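/- Let $V=\{0,\dots,n-1\}$ be a finite ground set and let $k\ge 1$. A function $f:(2^V)^k\to\mathbb{Q}$ is *multivariate submodular* if for all tuples $(S_1,\dots,S_k),(T_1,\dots,T_k)\in(2^V)^k$ $$f(S_1,\dots,S_k)+f(T_1,\dots,T_k)\ \ge\ f(S_1\cup T_1,\dots,S_k\cup T_k)+f(S_1\cap T_1,\dots,S_k\cap T_k),$$ and *monotone* if $f(S_1,\dots,S_k)\le f(T_1,\dots,T_k)$ whenever $S_i\subseteq T_i$ for all $i$. We write $S_1+\cdots+S_k=V$ if the sets $S_1,\dots,S_k$ (some of which may be empty) are pairwise disjoint and have union $V$. Functions are given by value oracles. The model of computation is the random access machine with integer arithmetic, oracle queries and logarithmic cost, that is, each operation is charged the bit length of the integers it handles. *Polynomial time* means: time bounded by a fixed polynomial in $n$, $k$ and $L$, where $L$ is any bound on the binary encoding lengths of the (rational) values of the given functions. 1. There is a polynomial time algorithm which, given $n$, $k$ and a value oracle of a nonnegative monotone multivariate submodular function $f:(2^V)^k\to\mathbb{Q}$, outputs a $k$-approximate solution of $$\min\ f(S_1,\dots,S_k)\quad\text{subject to}\quad S_1+\cdots+S_k=V,$$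 that is, sets with $S_1+\cdots+S_k=V$ and $f(S_1,\dots,S_k)\le k\cdot f(T_1,\dots,T_k)$ for all $T_1,\dots,T_k$ with $T_1+\cdots+T_k=V$. 2. There is a polynomial time $k$-approximation algorithm, in the same sense, for submodular facility location with $k$ facilities: given $n$, $k$ and value oracles of nonnegative monotone submodular functions $f_1,\dots,f_k:2^V\to\mathbb{Q}$ (where $V$ is the set of customers and $f_i(S)$ is the cost of serving the set $S$ of customers from facility $i$), it outputs sets with $S_1+\cdots+S_k=V$ and $\sum_{i=1}^k f_i(S_i)\le k\cdot\sum_{i=1}^k f_i(T_i)$ for all $T_1,\dots,T_k$ with $T_1+\cdots+T_k=V$. -/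

import Mathlib

/-! ## Multivariate submodular functions and allocations -/

namespace SubmodAlloc

/-- `f : 2^V → R` is submodular. -/
def IsSubmodular {V R : Type*} [DecidableEq V] [Add R] [LE R] (f : Finset V → R) : Prop :=
  ∀ S T : Finset V, f (S ∪ T) + f (S ∩ T) ≤ f S + f T

/-- `f : (2^V)^k → R` is multi-submodular (multivariate submodular); unions and intersections
of tuples are taken componentwise. -/
def IsMultiSubmodular {V R : Type*} [DecidableEq V] [Add R] [LE R] {k : ℕ}
    (f : (Fin k → Finset V) → R) : Prop :=
  ∀ S T : Fin k → Finset V,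
    f (fun i => S i ∪ T i) + f (fun i => S i ∩ T i) ≤ f S + f T

/-- `f : (2^V)^k → R` is monotone: it does not decrease when the sets of the tuple grow. -/
def IsMultiMonotone {V R : Type*} [LE R] {k : ℕ} (f : (Fin k → Finset V) → R) : Prop :=
  ∀ S T : Fin k → Finset V, (∀ i, S i ⊆ T i) → f S ≤ f T

/-- `S₁ + ⋯ + S_k = V`: the sets are pairwise disjoint (possibly empty) and cover `V`. -/
def IsAllocation {V : Type*} {k : ℕ} (S : Fin k → Finset V) : Prop :=
  (∀ i j, i ≠ j → Disjoint (S i) (S j)) ∧ ∀ v, ∃ i, v ∈ S i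

/-- `S` is an `α`-approximate solution of `min f(S₁, …, S_k)` subject to `S₁ + ⋯ + S_k = V`:
it is feasible and its cost is at most `α` times the cost of every feasible tuple. -/
def IsApproxMin {V : Type*} {k : ℕ} (α : ℚ) (f : (Fin k → Finset V) → ℚ)
    (S : Fin k → Finset V) : Prop :=
  IsAllocation S ∧ ∀ T : Fin k → Finset V, IsAllocation T → f S ≤ α * f T

/-! ## Random access machines with oracle, under the logarithmic cost criterion

Programs work on integer variables and an integer-addressed integer memory.  Every operation is
charged the bit length of the integers that it handles. -/

/-- Bit length of an integer (including one bit for the sign). -/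
def bitLen (z : ℤ) : ℕ := z.natAbs.size + 1

/-- Encoding length of a rational number: numerator and denominator in binary. -/
def encLen (q : ℚ) : ℕ := bitLen q.num + bitLen (q.den : ℤ)

/-- Expressions. -/
inductive Expr : Type
  | const (c : ℤ)
  | var (i : ℕ)
  | load (a : Expr)
  | add (a b : Expr)
  | sub (a b : Expr)
  | mul (a b : Expr)
  | div (a b : Expr)
  | lt (a b : Expr)

/-- Machine states: the values of the variables and the contents of the memory. -/
structure State : Type where
  var : ℕ → ℤ
  mem : ℤ → ℤ

/-- Value of an expression. Division is Euclidean (and gives `0` if the divisor is `0`);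
a comparison gives `1` or `0`. -/
def Expr.eval (s : State) : Expr → ℤ
  | .const c => c
  | .var i => s.var i
  | .load a => s.mem (a.eval s)
  | .add a b => a.eval s + b.eval s
  | .sub a b => a.eval s - b.eval s
  | .mul a b => a.eval s * b.eval s
  | .div a b => a.eval s / b.eval s
  | .lt a b => if a.eval s < b.eval s then 1 else 0

/-- Cost of evaluating an expression: the bit lengths of all values that occur. -/
def Expr.cost (s : State) : Expr → ℕ
  | .const c => bitLen c
  | .var i => bitLen (s.var i)
  | .load a => a.cost s + bitLen ((Expr.load a).eval s)
  | .add a b => a.cost s + b.cost s + bitLen ((Expr.add a b).eval s)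
  | .sub a b => a.cost s + b.cost s + bitLen ((Expr.sub a b).eval s)
  | .mul a b => a.cost s + b.cost s + bitLen ((Expr.mul a b).eval s)
  | .div a b => a.cost s + b.cost s + bitLen ((Expr.div a b).eval s)
  | .lt a b => a.cost s + b.cost s + bitLen ((Expr.lt a b).eval s)

/-- Programs. `query args x y` asks the oracle about the list of values of `args` and puts the
numerator and the denominator of the answer into the variables `x` and `y`. -/
inductive Prog : Type
  | skip
  | assign (x : ℕ) (e : Expr)
  | store (a e : Expr)
  | query (args : List Expr) (x y : ℕ)
  | seq (p q : Prog)
  | ite (b : Expr) (p q : Prog)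
  | while (b : Expr) (p : Prog)

/-- An oracle answers a list of integers with a rational number. -/
abbrev Oracle : Type := List ℤ → ℚ

/-- Assignment to a variable. -/
def State.setVar (s : State) (x : ℕ) (z : ℤ) : State :=
  { s with var := Function.update s.var x z }

/-- Writing to the memory. -/
def State.setMem (s : State) (a z : ℤ) : State :=
  { s with mem := Function.update s.mem a z }

/-- `Run O p s s' t`: started in state `s`, the program `p` with oracle `O` halts in state `s'`
after time `t`. -/
inductive Run (O : Oracle) : Prog → State → State → ℕ → Prop
  | skip (s : State) : Run O .skip s s 1
  | assign (s : State) (x : ℕ) (e : Expr) :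
      Run O (.assign x e) s (s.setVar x (e.eval s)) (1 + e.cost s)
  | store (s : State) (a e : Expr) :
      Run O (.store a e) s (s.setMem (a.eval s) (e.eval s)) (1 + a.cost s + e.cost s)
  | query (s : State) (args : List Expr) (x y : ℕ) (r : ℚ)
      (hr : r = O (args.map (Expr.eval s))) :
      Run O (.query args x y) s ((s.setVar x r.num).setVar y (r.den : ℤ))
        (1 + (args.map (Expr.cost s)).sum + encLen r)
  | seq {p q : Prog} {s s' s'' : State} {t t' : ℕ} :
      Run O p s s' t → Run O q s' s'' t' → Run O (.seq p q) s s'' (t + t')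
  | iteTrue {b : Expr} {p q : Prog} {s s' : State} {t : ℕ} :
      b.eval s ≠ 0 → Run O p s s' t → Run O (.ite b p q) s s' (1 + b.cost s + t)
  | iteFalse {b : Expr} {p q : Prog} {s s' : State} {t : ℕ} :
      b.eval s = 0 → Run O q s s' t → Run O (.ite b p q) s s' (1 + b.cost s + t)
  | whileTrue {b : Expr} {p : Prog} {s s' s'' : State} {t t' : ℕ} :
      b.eval s ≠ 0 → Run O p s s' t → Run O (.while b p) s' s'' t' →
      Run O (.while b p) s s'' (1 + b.cost s + t + t')
  | whileFalse {b : Expr} {p : Prog} {s : State} :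
      b.eval s = 0 → Run O (.while b p) s s (1 + b.cost s)

/-- Initial state: variable `0` holds `n`, variable `1` holds `k`, all the rest is `0`. -/
def initState (n k : ℕ) : State where
  var := fun i => if i = 0 then (n : ℤ) else if i = 1 then (k : ℤ) else 0
  mem := fun _ => 0

/-! ## Encodings and value oracles -/

/-- The subset of `V = {0, …, n-1}` whose characteristic vector is the binary expansion
of `q`. -/
def decodeSet (n : ℕ) (q : ℤ) : Finset (Fin n) :=
  Finset.univ.filter fun v => q.toNat.testBit v = true

/-- The tuple of `k` subsets of `V = {0, …, n-1}` whose characteristic vectors are the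
consecutive blocks of `n` bits in the binary expansion of `q`. -/
def decodeTuple (n k : ℕ) (q : ℤ) (i : Fin k) : Finset (Fin n) :=
  Finset.univ.filter fun v => q.toNat.testBit (i * n + v) = true

/-- The value oracle of `f : (2^V)^k → ℚ`: it is given an encoded tuple. -/
def tupleOracle {n k : ℕ} (f : (Fin k → Finset (Fin n)) → ℚ) : Oracle
  | [q] => f (decodeTuple n k q)
  | _ => 0

/-- The value oracles of `f₁, …, f_k : 2^V → ℚ`: it is given an index and an encoded set. -/
def facilityOracle {n k : ℕ} (f : Fin k → Finset (Fin n) → ℚ) : Oracle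
  | [i, q] => if h : 0 ≤ i ∧ i.toNat < k then f ⟨i.toNat, h.2⟩ (decodeSet n q) else 0
  | _ => 0

/-- With oracle `O` and input `(n, k)`, the program `P` halts within time `T`, and the tuple of
sets that variable `0` then encodes satisfies `good`. -/
def Computes (P : Prog) (O : Oracle) (n k T : ℕ) (good : (Fin k → Finset (Fin n)) → Prop) :
    Prop :=
  ∃ (s : State) (t : ℕ), Run O P (initState n k) s t ∧ t ≤ T ∧ good (decodeTuple n k (s.var 0))

end SubmodAlloc

open SubmodAlloc

/-! Approximation. A tuple is encoded as a set of numbers `e = i * n + v` below `N = n * k`. Then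
`F(A) = f(tuple of A) - f(∅, …, ∅)` is a normalized monotone submodular set function, and a feasible
tuple hits every residue class modulo `n`. A dual solution is a vector `y ≥ 0`, constant on the
classes, with `y(A) ≤ F(A)` for all `A`; hence `∑ v, y v` is a lower bound for the `F`-value of
every feasible tuple. The dual variables are raised one after the other, each until some set becomes
tight. By submodularity, unions of tight sets are tight (`DualState.step`), so the union `B` of the
sets found hits all classes and satisfies `F(B) = y(B) ≤ k * ∑ v, y v`. Keeping one element of `B`
per class makes the sets disjoint and, by monotonicity, costs nothing. The constant `f(∅, …, ∅)`
does no harm because it is nonnegative and `1 ≤ k` (`isApproxMin_of_dualState`).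

How far a variable can be raised is a minimum ratio problem. The discrete Newton method solves it in
`k` steps, because the multiplicity of the current class in the minimizer falls in each step
(`NewtonState.step`). Each step requires one submodular minimization.

Minimization. A preorder of implications "each minimizer containing `p` contains `q`" is extended
until it determines a minimizer. Let `η` be the largest increase of `g` when an element is added to
the elements strictly below it. If `η ≤ 0`, then the set of all elements not yet excluded is a
minimizer (`Implications.alive_min`). Otherwise a projected subgradient descent on the Lovász
extension, restricted to the closed sets above a pivot and scaled by `η`, has one of two outcomes.
It finds a further element of all minimizers that contain the pivot (`IsDescent.mem_of_lt`), or it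
shows that the closure of the pivot is optimal up to less than `η / 2`
(`IsDescent.lt_of_forall_le`). Descents from the bottom element and from the element of largest gain
always give a new implication (`Implications.deduce`), so `(N + 2) ^ 2` rounds suffice, whatever the
size of the values.

Machine. The algorithm is written in a language of arrays, bounded sums and loops of fixed lengths,
which is compiled to the machine with correctness and time bounds (`ACmd.run_comp`). The number of
operations is polynomial by construction. What needs an argument is that the numbers stay short: the
descent is clipped to a box, each deduction erases its intermediate results (`bdd_deduceCmd`), and
each change of the dual solution adds a bounded number of bits (`bdd_updateCmd`). -/

namespace SubmodAlloc
open Function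

/-! ## A small array language with bounded sums, and its compilation -/

/-- Binary operations of the machine. -/
inductive BinOp : Type
  | add | sub | mul | div | lt

/-- Value of a binary operation. -/
def BinOp.eval : BinOp → ℤ → ℤ → ℤ
  | .add, a, b => a + b
  | .sub, a, b => a - b
  | .mul, a, b => a * b
  | .div, a, b => a / b
  | .lt, a, b => if a < b then 1 else 0

/-- The machine expression of a binary operation. -/
def BinOp.toExpr : BinOp → Expr → Expr → Expr
  | .add, a, b => .add a b
  | .sub, a, b => .sub a b
  | .mul, a, b => .mul a b
  | .div, a, b => .div a b
  | .lt, a, b => .lt a b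

theorem BinOp.toExpr_eval (o : BinOp) (a b : Expr) (s : State) :
    (o.toExpr a b).eval s = o.eval (a.eval s) (b.eval s) := by
  cases o <;> rfl

theorem BinOp.toExpr_cost (o : BinOp) (a b : Expr) (s : State) :
    (o.toExpr a b).cost s = a.cost s + b.cost s + bitLen (o.eval (a.eval s) (b.eval s)) := by
  cases o <;> rfl

/-- Expressions of the array language: `fold o i j e` is the sum (or the product, if `o`) of `e`
over the values `0, …, sz j - 1` of the index `i`; `query den two a b` is the numerator or the
denominator of the oracle's answer to `[a, b]` or `[b]`. -/
inductive AExpr : Type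
  | const (c : ℤ)
  | sz (j : Fin 8)
  | var (x : Fin 8)
  | ix (i : ℕ)
  | arr (a : Fin 8) (e : AExpr)
  | bin (o : BinOp) (a b : AExpr)
  | fold (o : Bool) (i : ℕ) (j : Fin 8) (e : AExpr)
  | query (den two : Bool) (a b : AExpr)

/-- States of the array language: sizes (never changed), variables and arrays. -/
structure AState : Type where
  sz : Fin 8 → ℕ
  var : Fin 8 → ℤ
  arr : Fin 8 → ℤ → ℤ

/-- Value of an expression of the array language; `ρ` gives the values of the indices. -/
def AExpr.eval (O : Oracle) (h : AState) : (ℕ → ℤ) → AExpr → ℤ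
  | _, .const c => c
  | _, .sz j => h.sz j
  | _, .var x => h.var x
  | ρ, .ix i => ρ i
  | ρ, .arr a e => h.arr a (e.eval O h ρ)
  | ρ, .bin o a b => o.eval (a.eval O h ρ) (b.eval O h ρ)
  | ρ, .fold false i j e => ∑ l ∈ Finset.range (h.sz j), e.eval O h (update ρ i l)
  | ρ, .fold true i j e => ∏ l ∈ Finset.range (h.sz j), e.eval O h (update ρ i l)
  | ρ, .query den two a b =>
      let r := O (if two then [a.eval O h ρ, b.eval O h ρ] else [b.eval O h ρ])
      if den then (r.den : ℤ) else r.num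

/-- Counting loop: the counter is variable `d`, the bound is variable `b`. -/
def forLoop (d b : ℕ) (body : Prog) : Prog :=
  .seq (.assign d (.const 0))
    (.while (.lt (.var d) (.var b))
      (.seq body (.assign d (.add (.var d) (.const 1)))))

/-- Compilation of an expression: the value is computed into variable `d`, and only variables from
`d` on are used; index `i` is kept in variable `σ i`. -/
def AExpr.comp : (ℕ → ℕ) → ℕ → AExpr → Prog
  | _, d, .const c => .assign d (.const c)
  | _, d, .sz j => .assign d (.var (j + 1))
  | _, d, .var x => .assign d (.var (x + 9))
  | σ, d, .ix i => .assign d (.var (σ i))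
  | σ, d, .arr a e => .seq (e.comp σ d)
      (.assign d (.load (.add (.mul (.const 16) (.var d)) (.const (a : ℕ)))))
  | σ, d, .bin o a b => .seq (a.comp σ d) (.seq (b.comp σ (d + 1))
      (.assign d (o.toExpr (.var d) (.var (d + 1)))))
  | σ, d, .fold o i j e => .seq (.assign d (.const (if o then 1 else 0)))
      (forLoop (d + 1) (j + 1) (.seq (e.comp (update σ i (d + 1)) (d + 2))
        (.assign d ((if o then BinOp.mul else BinOp.add).toExpr (.var d) (.var (d + 2))))))
  | σ, d, .query den two a b => .seq (a.comp σ d) (.seq (b.comp σ (d + 1))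
      (.query (if two then [.var d, .var (d + 1)] else [.var (d + 1)])
        (if den then d + 1 else d) (if den then d else d + 1)))

/-- The machine state `s` represents the state `h` of the array language. -/
structure Rep (h : AState) (s : State) : Prop where
  sz : ∀ j : Fin 8, s.var (j + 1) = h.sz j
  var : ∀ x : Fin 8, s.var (x + 9) = h.var x
  arr : ∀ (a : Fin 8) (i : ℤ), s.mem (16 * i + (a : ℕ)) = h.arr a i
  zero : s.var 17 = 0

/-- Variables from `18` on and addresses congruent to `15` modulo `16` lie outside of the
represented part of a machine state; they serve as temporaries and as scratch memory. -/
theorem Rep.congr {h : AState} {s s' : State} (hr : Rep h s)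
    (hv : ∀ x < 18, s'.var x = s.var x)
    (hm : ∀ (a : Fin 8) (i : ℤ), s'.mem (16 * i + (a : ℕ)) = s.mem (16 * i + (a : ℕ))) :
    Rep h s' where
  sz j := by rw [hv _ (by omega), hr.sz]
  var j := by rw [hv _ (by omega), hr.var]
  arr a i := by rw [hm, hr.arr]
  zero := by rw [hv _ (by omega), hr.zero]

/-- All sizes are at most `m`, all variables and array entries have at most `m` bits. -/
structure Bdd (m : ℕ) (h : AState) : Prop where
  sz : ∀ j, h.sz j ≤ m
  var : ∀ x, |h.var x| ≤ 2 ^ m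
  arr : ∀ a i, |h.arr a i| ≤ 2 ^ m

theorem Bdd.mono {m m' : ℕ} {h : AState} (hb : Bdd m h) (hm : m ≤ m') : Bdd m' h where
  sz j := (hb.sz j).trans hm
  var x := (hb.var x).trans (pow_le_pow_right₀ (by norm_num) hm)
  arr a i := (hb.arr a i).trans (pow_le_pow_right₀ (by norm_num) hm)

/-- Bound on the bit lengths of the values of an expression. -/
def AExpr.bits : AExpr → ℕ → ℕ
  | .const c, _ => c.natAbs
  | .sz _, m => m
  | .var _, m => m
  | .ix _, m => m
  | .arr _ _, m => m
  | .bin _ a b, m => a.bits m + b.bits m + 1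
  | .fold _ _ _ e, m => (m + 1) * (e.bits m + 1)
  | .query _ _ _ _, m => m

/-- Bound on the time for computing an expression. -/
def AExpr.time : AExpr → ℕ → ℕ
  | .const c, _ => c.natAbs + 3
  | .sz _, m => m + 3
  | .var _, m => m + 3
  | .ix _, m => m + 3
  | .arr _ e, m => e.time m + 3 * e.bits m + m + 40
  | .bin _ a b, m => a.time m + b.time m + 2 * a.bits m + 2 * b.bits m + 10
  | .fold _ _ _ e, m =>
      4 + (m + 1) * (e.time m + (2 * ((m + 1) * (e.bits m + 1)) + e.bits m + 7) + 4 * m + 22)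
  | .query _ _ a b, m => a.time m + b.time m + a.bits m + b.bits m + m + 5

/-- The number `2 ^ c` itself has `c + 1` binary digits, and the sign costs one more bit. -/
theorem bitLen_le_of_abs_le {z : ℤ} {c : ℕ} (h : |z| ≤ 2 ^ c) : bitLen z ≤ c + 2 := by
  unfold bitLen
  have : z.natAbs < 2 ^ (c + 1) := by
    have h1 : (z.natAbs : ℤ) ≤ 2 ^ c := by rwa [Int.natCast_natAbs]
    have h2 : z.natAbs ≤ 2 ^ c := by exact_mod_cast h1
    have : 2 ^ c < 2 ^ (c + 1) := Nat.pow_lt_pow_right (by norm_num) (by omega)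
    omega
  have := Nat.size_le.2 this
  omega

theorem abs_le_two_pow_of_le {z : ℤ} {c c' : ℕ} (h : |z| ≤ 2 ^ c) (hc : c ≤ c') : |z| ≤ 2 ^ c' :=
  h.trans (pow_le_pow_right₀ (by norm_num) hc)

theorem abs_natCast_le_two_pow {n m : ℕ} (h : n ≤ m) : |(n : ℤ)| ≤ 2 ^ m := by
  rw [abs_of_nonneg (by positivity)]
  exact_mod_cast h.trans (Nat.lt_two_pow_self).le

theorem abs_le_two_pow_of_bitLen_le {z : ℤ} {m : ℕ} (h : bitLen z ≤ m) : |z| ≤ 2 ^ m := by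
  have h1 : z.natAbs < 2 ^ m := by
    have := Nat.size_le.1 (le_refl z.natAbs.size)
    exact this.trans_le (Nat.pow_le_pow_right (by norm_num) (by unfold bitLen at h; omega))
  rw [← Int.natCast_natAbs]
  exact_mod_cast h1.le

theorem bitLen_natCast_le {n m : ℕ} (h : n ≤ m) : bitLen (n : ℤ) ≤ m + 2 :=
  bitLen_le_of_abs_le (abs_natCast_le_two_pow h)

/-- One exponent serves all operations: a product needs `c + d`, and a sum or difference of two
terms that are at most `2 ^ (c + d)` needs one more. -/
theorem BinOp.abs_eval_le (o : BinOp) {a b : ℤ} {c d : ℕ} (ha : |a| ≤ 2 ^ c) (hb : |b| ≤ 2 ^ d) :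
    |o.eval a b| ≤ 2 ^ (c + d + 1) := by
  have h1 : (2 : ℤ) ^ c ≤ 2 ^ (c + d) := pow_le_pow_right₀ (by norm_num) (by omega)
  have h2 : (2 : ℤ) ^ d ≤ 2 ^ (c + d) := pow_le_pow_right₀ (by norm_num) (by omega)
  have h3 : (1 : ℤ) ≤ 2 ^ (c + d) := one_le_pow₀ (by norm_num)
  have h4 : (2 : ℤ) ^ (c + d + 1) = 2 * 2 ^ (c + d) := by ring
  have h5 : (2 : ℤ) ^ (c + d) = 2 ^ c * 2 ^ d := by ring
  rw [h4]
  cases o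
  · exact (abs_add_le _ _).trans (by linarith)
  · exact (abs_sub _ _).trans (by linarith)
  · simp only [BinOp.eval, abs_mul]
    have := mul_le_mul ha hb (abs_nonneg _) (by positivity)
    linarith
  · have : |a / b| ≤ |a| := by
      rw [← Int.natCast_natAbs, ← Int.natCast_natAbs]
      exact_mod_cast Int.natAbs_ediv_le_natAbs a b
    exact this.trans (by linarith)
  · simp only [BinOp.eval]
    split_ifs
    · simp only [abs_one]; linarith
    · simp only [abs_zero]; linarith

/-- The exponent is chosen so that it also works for products, since `AExpr.bits` does not
distinguish the two kinds of folds. -/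
theorem abs_sum_le_two_pow {M m c : ℕ} (hM : M ≤ m) (f : ℕ → ℤ) (hf : ∀ l < M, |f l| ≤ 2 ^ c) :
    |∑ l ∈ Finset.range M, f l| ≤ 2 ^ ((m + 1) * (c + 1)) := by
  have h1 : |∑ l ∈ Finset.range M, f l| ≤ M * 2 ^ c := by
    refine (Finset.abs_sum_le_sum_abs _ _).trans ?_
    refine (Finset.sum_le_sum fun l hl => hf l (Finset.mem_range.1 hl)).trans ?_
    simp
  have h2 : (M : ℤ) ≤ 2 ^ m := by exact_mod_cast hM.trans (Nat.lt_two_pow_self).le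
  calc _ ≤ (M : ℤ) * 2 ^ c := h1
    _ ≤ 2 ^ m * 2 ^ c := by gcongr
    _ = 2 ^ (m + c) := by ring
    _ ≤ _ := pow_le_pow_right₀ (by norm_num) (by nlinarith)

theorem abs_prod_le_two_pow {M m c : ℕ} (hM : M ≤ m) (f : ℕ → ℤ) (hf : ∀ l < M, |f l| ≤ 2 ^ c) :
    |∏ l ∈ Finset.range M, f l| ≤ 2 ^ ((m + 1) * (c + 1)) := by
  rw [Finset.abs_prod]
  calc _ ≤ ∏ l ∈ Finset.range M, (2 : ℤ) ^ c :=
        Finset.prod_le_prod (fun _ _ => abs_nonneg _) fun l hl => hf l (Finset.mem_range.1 hl)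
    _ = 2 ^ (c * M) := by simp [pow_mul]
    _ ≤ _ := pow_le_pow_right₀ (by norm_num) (by nlinarith)

theorem update_abs_le {m M l i : ℕ} {ρ : ℕ → ℤ} (hρ : ∀ i, |ρ i| ≤ 2 ^ m) (hM : M ≤ m)
    (hl : l < M) : ∀ i', |update ρ i (l : ℤ) i'| ≤ 2 ^ m := by
  intro i'
  by_cases h : i' = i
  · subst h; simpa using abs_natCast_le_two_pow (by omega : l ≤ m)
  · simpa [h] using hρ i'

theorem AExpr.abs_eval_le {O : Oracle} {h : AState} {m : ℕ} (hO : ∀ q, encLen (O q) ≤ m)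
    (hb : Bdd m h) : ∀ (e : AExpr) (ρ : ℕ → ℤ), (∀ i, |ρ i| ≤ 2 ^ m) →
      |e.eval O h ρ| ≤ 2 ^ e.bits m := by
  intro e
  induction e with
  | const c =>
    intro ρ _
    simp only [AExpr.eval, AExpr.bits]
    rw [← Int.natCast_natAbs]
    exact_mod_cast (Nat.lt_two_pow_self).le
  | sz j => intro ρ _; exact abs_natCast_le_two_pow (hb.sz j)
  | var x => intro ρ _; exact hb.var x
  | ix i => intro ρ hρ; exact hρ i
  | arr a e _ => intro ρ _; exact hb.arr a _
  | bin o a b iha ihb => intro ρ hρ; exact o.abs_eval_le (iha ρ hρ) (ihb ρ hρ)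
  | fold o i j e ih =>
    intro ρ hρ
    cases o
    · exact abs_sum_le_two_pow (hb.sz j) _ fun l hl => ih _ (update_abs_le hρ (hb.sz j) hl)
    · exact abs_prod_le_two_pow (hb.sz j) _ fun l hl => ih _ (update_abs_le hρ (hb.sz j) hl)
  | query den two a b _ _ =>
    intro ρ hρ
    simp only [AExpr.eval, AExpr.bits]
    generalize O _ = r, hO (if two then [a.eval O h ρ, b.eval O h ρ] else [b.eval O h ρ]) = hr
    unfold encLen at hr
    split_ifs
    · exact abs_le_two_pow_of_bitLen_le (by omega)
    · exact abs_le_two_pow_of_bitLen_le (by omega)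

/-- A Hoare rule with time bound. The invariant for `j + 1` is required only after the counter has
been increased, because the increment is not part of the body. -/
theorem run_forLoop {O : Oracle} {d b M m τ : ℕ} {body : Prog} (I : ℕ → State → Prop)
    (hM : M ≤ m) (hdb : b ≠ d)
    (hstep : ∀ j s, j < M → I j s → s.var d = j → s.var b = M →
      ∃ s' t, Run O body s s' t ∧ t ≤ τ ∧ s'.var d = j ∧ s'.var b = M ∧
        I (j + 1) (s'.setVar d (j + 1)))
    (s : State) (hb : s.var b = M) (h0 : I 0 (s.setVar d 0)) :
    ∃ s' t, Run O (forLoop d b body) s s' t ∧ t ≤ (m + 1) * (τ + 4 * m + 22) ∧ I M s' := by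
  have bit0 : bitLen 0 = 1 := by simp [bitLen]
  have bit1 : bitLen 1 = 2 := by simp [bitLen]
  have key : ∀ r j s, j + r = M → I j s → s.var d = j → s.var b = M →
      ∃ s' t, Run O (.while (.lt (.var d) (.var b))
        (.seq body (.assign d (.add (.var d) (.const 1))))) s s' t ∧
        t ≤ (r + 1) * (τ + 4 * m + 20) ∧ I M s' := by
    intro r
    -- The induction is on the number `r` of remaining passes, not on the counter.
    induction r with
    | zero =>
      intro j s hj hI hd hb
      refine ⟨s, _, Run.whileFalse ?_, ?_, ?_⟩
      · simp [Expr.eval, hd, hb]; omega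
      · have h1 : bitLen (s.var d) ≤ m + 2 := by rw [hd]; exact bitLen_natCast_le (by omega)
        have h2 : bitLen (s.var b) ≤ m + 2 := by rw [hb]; exact bitLen_natCast_le (by omega)
        have h3 : ¬ s.var d < s.var b := by rw [hd, hb]; omega
        have h4 : Expr.eval s (.lt (.var d) (.var b)) = 0 := if_neg h3
        simp only [Expr.cost, h4, bit0]
        omega
      · have : j = M := by omega
        exact this ▸ hI
    | succ r ih =>
      intro j s hj hI hd hb
      obtain ⟨s1, t1, hr1, ht1, hd1, hb1, hI1⟩ := hstep j s (by omega) hI hd hb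
      obtain ⟨s2, t2, hr2, ht2, hI2⟩ := ih (j + 1) (s1.setVar d (j + 1)) (by omega) hI1
        (by simp [State.setVar]) (by simp [State.setVar, hdb, hb1])
      have h3 : s.var d < s.var b := by rw [hd, hb]; omega
      have h4 : Expr.eval s1 (.add (.var d) (.const 1)) = (j : ℤ) + 1 := by
        simp [Expr.eval, hd1]
      rw [← h4] at hr2
      refine ⟨s2, _, Run.whileTrue ?_ (Run.seq hr1 (Run.assign _ _ _)) hr2, ?_, hI2⟩
      · simp [Expr.eval, h3]
      · have h1 : bitLen (s.var d) ≤ m + 2 := by rw [hd]; exact bitLen_natCast_le (by omega)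
        have h2 : bitLen (s.var b) ≤ m + 2 := by rw [hb]; exact bitLen_natCast_le (by omega)
        have h5 : bitLen (s1.var d) ≤ m + 2 := by rw [hd1]; exact bitLen_natCast_le (by omega)
        have h6 : bitLen ((j : ℤ) + 1) ≤ m + 2 := by
          exact_mod_cast bitLen_natCast_le (n := j + 1) (by omega)
        have h7 : Expr.eval s (.lt (.var d) (.var b)) = 1 := if_pos h3
        simp only [Expr.cost, h4, h7, bit1]
        have : (r + 1 + 1) * (τ + 4 * m + 20) =
          (r + 1) * (τ + 4 * m + 20) + (τ + 4 * m + 20) := by ring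
        omega
  obtain ⟨s', t, hr, ht, hI⟩ := key M 0 (s.setVar d 0) (by omega) h0 (by simp [State.setVar])
    (by simp [State.setVar, hdb, hb])
  refine ⟨s', _, Run.seq (Run.assign _ _ _) hr, ?_, hI⟩
  simp only [Expr.cost, bit0]
  have h1 : (M + 1) * (τ + 4 * m + 20) ≤ (m + 1) * (τ + 4 * m + 20) := by gcongr
  have : (m + 1) * (τ + 4 * m + 22) = (m + 1) * (τ + 4 * m + 20) + 2 * (m + 1) := by ring
  omega

theorem Rep.setVar {h : AState} {s : State} {d : ℕ} (hr : Rep h s) (hd : 18 ≤ d) (z : ℤ) :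
    Rep h (s.setVar d z) :=
  hr.congr (fun x hx => by simp [State.setVar, show x ≠ d by omega]) fun _ _ => rfl

theorem update_index {s : State} {σ : ℕ → ℕ} {ρ : ℕ → ℤ} {d i j : ℕ}
    (hρ : ∀ i, s.var (σ i) = ρ i) (hj : s.var d = j) (i' : ℕ) :
    s.var (update σ i d i') = update ρ i (j : ℤ) i' := by
  by_cases h : i' = i
  · subst h; simpa using hj
  · simpa [h] using hρ i'

theorem AExpr.eval_fold (O : Oracle) (h : AState) (ρ : ℕ → ℤ) (o : Bool) (i : ℕ) (j : Fin 8)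
    (e : AExpr) : (AExpr.fold o i j e).eval O h ρ =
      if o then ∏ l ∈ Finset.range (h.sz j), e.eval O h (update ρ i l)
      else ∑ l ∈ Finset.range (h.sz j), e.eval O h (update ρ i l) := by
  cases o <;> simp [AExpr.eval]

/-- Variables form a stack: code compiled at `d` writes only to variables from `d` on and never to
memory. Hence a first operand kept in `d` survives while the second one is computed into `d + 1`,
and the variables `σ i < d` of the indices survive as well. -/
theorem AExpr.run_comp {O : Oracle} {h : AState} {m : ℕ} (hO : ∀ q, encLen (O q) ≤ m)
    (hb : Bdd m h) : ∀ (e : AExpr) (σ : ℕ → ℕ) (ρ : ℕ → ℤ) (d : ℕ) (s : State), 18 ≤ d →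
      (∀ i, σ i < d) → (∀ i, s.var (σ i) = ρ i) → (∀ i, |ρ i| ≤ 2 ^ m) → Rep h s →
      ∃ s' t, Run O (e.comp σ d) s s' t ∧ t ≤ e.time m ∧ s'.mem = s.mem ∧
        (∀ x < d, s'.var x = s.var x) ∧ s'.var d = e.eval O h ρ := by
  intro e
  induction e with
  | const c =>
    intro σ ρ d s hd hσ hρ hm hr
    refine ⟨_, _, Run.assign _ _ _, ?_, rfl, ?_, ?_⟩
    · have := bitLen_le_of_abs_le (AExpr.abs_eval_le hO hb (.const c) ρ hm)
      simp only [AExpr.bits, AExpr.eval] at this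
      simp only [Expr.cost, AExpr.time]
      omega
    · intro x hx; simp [State.setVar, hx.ne]
    · simp [State.setVar, Expr.eval, AExpr.eval]
  | sz j =>
    intro σ ρ d s hd hσ hρ hm hr
    refine ⟨_, _, Run.assign _ _ _, ?_, rfl, ?_, ?_⟩
    · have := bitLen_le_of_abs_le (AExpr.abs_eval_le hO hb (.sz j) ρ hm)
      simp only [AExpr.bits, AExpr.eval] at this
      simp only [Expr.cost, AExpr.time, hr.sz]
      omega
    · intro x hx; simp [State.setVar, hx.ne]
    · simp [State.setVar, Expr.eval, AExpr.eval, hr.sz]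
  | var j =>
    intro σ ρ d s hd hσ hρ hm hr
    refine ⟨_, _, Run.assign _ _ _, ?_, rfl, ?_, ?_⟩
    · have := bitLen_le_of_abs_le (AExpr.abs_eval_le hO hb (.var j) ρ hm)
      simp only [AExpr.bits, AExpr.eval] at this
      simp only [Expr.cost, AExpr.time, hr.var]
      omega
    · intro x hx; simp [State.setVar, hx.ne]
    · simp [State.setVar, Expr.eval, AExpr.eval, hr.var]
  | ix i =>
    intro σ ρ d s hd hσ hρ hm hr
    refine ⟨_, _, Run.assign _ _ _, ?_, rfl, ?_, ?_⟩
    · have := bitLen_le_of_abs_le (AExpr.abs_eval_le hO hb (.ix i) ρ hm)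
      simp only [AExpr.bits, AExpr.eval] at this
      simp only [Expr.cost, AExpr.time, hρ]
      omega
    · intro x hx; simp [State.setVar, hx.ne]
    · simp [State.setVar, Expr.eval, AExpr.eval, hρ]
  | arr a e ih =>
    intro σ ρ d s hd hσ hρ hm hr
    obtain ⟨s1, t1, hr1, ht1, hm1, hv1, he1⟩ := ih σ ρ d s hd hσ hρ hm hr
    refine ⟨_, _, Run.seq hr1 (Run.assign _ _ _), ?_, hm1, ?_, ?_⟩
    · have hv := AExpr.abs_eval_le hO hb e ρ hm
      have h0 := bitLen_le_of_abs_le hv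
      have ha := bitLen_le_of_abs_le (hb.arr a (e.eval O h ρ))
      have hld : s1.mem (16 * s1.var d + (a : ℕ)) = h.arr a (e.eval O h ρ) := by
        rw [hm1, he1, hr.arr]
      have h16 : bitLen 16 = 6 := by decide
      have hca : bitLen ((a : ℕ) : ℤ) ≤ 8 + 2 := bitLen_natCast_le (by omega)
      have hp : (1 : ℤ) ≤ 2 ^ e.bits m := one_le_pow₀ (by norm_num)
      have hmul : bitLen (16 * e.eval O h ρ) ≤ e.bits m + 4 + 2 := by
        apply bitLen_le_of_abs_le
        rw [abs_mul, pow_add]; simp; linarith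
      have hadd : bitLen (16 * e.eval O h ρ + (a : ℕ)) ≤ e.bits m + 5 + 2 := by
        apply bitLen_le_of_abs_le
        refine (abs_add_le _ _).trans ?_
        rw [abs_mul, pow_add]; simp
        have : ((a : ℕ) : ℤ) ≤ 8 := by omega
        linarith
      simp only [Expr.cost, Expr.eval, AExpr.time, hld, h16]
      rw [he1]
      omega
    · intro x hx; simp [State.setVar, hx.ne, hv1 x hx]
    · simp [State.setVar, Expr.eval, AExpr.eval, hm1, he1, hr.arr]
  | bin o a b iha ihb =>
    intro σ ρ d s hd hσ hρ hm hr
    obtain ⟨s1, t1, hr1, ht1, hm1, hv1, he1⟩ := iha σ ρ d s hd hσ hρ hm hr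
    obtain ⟨s2, t2, hr2, ht2, hm2, hv2, he2⟩ := ihb σ ρ (d + 1) s1 (by omega)
      (fun i => (hσ i).trans (by omega)) (fun i => by rw [hv1 _ (hσ i), hρ]) hm
      (hr.congr (fun x hx => hv1 x (by omega)) fun _ _ => by rw [hm1])
    have h0 := AExpr.abs_eval_le hO hb a ρ hm
    have h1 := AExpr.abs_eval_le hO hb b ρ hm
    have h2 := bitLen_le_of_abs_le (o.abs_eval_le h0 h1)
    have h0 := bitLen_le_of_abs_le h0
    have h1 := bitLen_le_of_abs_le h1
    have hd2 : s2.var d = a.eval O h ρ := by rw [hv2 _ (by omega), he1]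
    refine ⟨_, _, Run.seq hr1 (Run.seq hr2 (Run.assign _ _ _)), ?_, by simp [State.setVar, hm2, hm1],
      ?_, ?_⟩
    · simp only [BinOp.toExpr_cost, Expr.cost, Expr.eval, AExpr.time, hd2, he2]
      omega
    · intro x hx; simp [State.setVar, hx.ne, hv2 x (by omega), hv1 x hx]
    · simp [State.setVar, BinOp.toExpr_eval, Expr.eval, AExpr.eval, hd2, he2]
  | fold o i j e ih =>
    intro σ ρ d s hd hσ hρ hm hr
    set f : ℕ → ℤ := fun l => e.eval O h (update ρ i l) with hf
    set acc : ℕ → ℤ := fun r => if o then ∏ l ∈ Finset.range r, f l else ∑ l ∈ Finset.range r, f l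
      with hacc
    have hfb : ∀ l < h.sz j, |f l| ≤ 2 ^ e.bits m := fun l hl =>
      AExpr.abs_eval_le hO hb e _ (update_abs_le hm (hb.sz j) hl)
    have hab : ∀ r ≤ h.sz j, |acc r| ≤ 2 ^ ((m + 1) * (e.bits m + 1)) := by
      intro r hr
      cases o
      · simpa [hacc] using abs_sum_le_two_pow (hr.trans (hb.sz j)) f fun l hl =>
          hfb l (hl.trans_le hr)
      · simpa [hacc] using abs_prod_le_two_pow (hr.trans (hb.sz j)) f fun l hl =>
          hfb l (hl.trans_le hr)
    have hinit : bitLen (if o then 1 else 0) ≤ 2 := by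
      cases o <;> simp [bitLen]
    have hop : ∀ r, (if o then BinOp.mul else BinOp.add).eval (acc r) (f r) = acc (r + 1) := by
      intro r
      cases o
      · simp [hacc, BinOp.eval, Finset.sum_range_succ]
      · simp [hacc, BinOp.eval, Finset.prod_range_succ]
    -- The accumulator is in `d`, the counter in `d + 1`, the current value in `d + 2`. The
    -- invariant says that the accumulator holds the sum or product of the first `r` values.
    obtain ⟨s', t, hr', ht, hI⟩ := run_forLoop (O := O) (d := d + 1) (b := j + 1) (M := h.sz j)
      (m := m) (τ := e.time m + (2 * ((m + 1) * (e.bits m + 1)) + e.bits m + 7))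
      (body := .seq (e.comp (update σ i (d + 1)) (d + 2))
        (.assign d ((if o then BinOp.mul else BinOp.add).toExpr (.var d) (.var (d + 2)))))
      (fun r s' => s'.mem = s.mem ∧ (∀ x < d, s'.var x = s.var x) ∧ s'.var d = acc r)
      (hb.sz j) (by omega)
      (by
        rintro r s1 hrj ⟨hm1, hv1, hd1⟩ hrv hbv
        obtain ⟨s2, t2, hr2, ht2, hm2, hv2, he2⟩ := ih (update σ i (d + 1)) (update ρ i r) (d + 2) s1
          (by omega)
          (fun i' => by
            by_cases h : i' = i
            · subst h; simp
            · simpa [h] using (hσ i').trans (by omega))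
          (update_index (fun i' => by rw [hv1 _ (hσ i'), hρ]) hrv)
          (update_abs_le hm (hb.sz j) hrj)
          (hr.congr (fun x hx => hv1 x (by omega)) fun _ _ => by rw [hm1])
        have hd2 : s2.var d = acc r := by rw [hv2 _ (by omega), hd1]
        refine ⟨_, _, Run.seq hr2 (Run.assign _ _ _), ?_, ?_, ?_, ?_, ?_, ?_⟩
        · have h1 := bitLen_le_of_abs_le (hab r hrj.le)
          have h2 := bitLen_le_of_abs_le (hab (r + 1) hrj)
          have h3 := bitLen_le_of_abs_le (hfb r hrj)
          simp only [BinOp.toExpr_cost, Expr.cost, Expr.eval, hd2, he2]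
          rw [hop r]
          change bitLen (e.eval O h (update ρ i r)) ≤ _ at h3
          omega
        · simp [State.setVar, hv2 (d + 1) (by omega), hrv]
        · have : (j : ℕ) + 1 ≠ d := by omega
          simp [State.setVar, this, hv2 (j + 1) (by omega), hbv]
        · simp [State.setVar, hm2, hm1]
        · intro x hx
          simp [State.setVar, hx.ne, show x ≠ d + 1 by omega, hv2 x (by omega), hv1 x hx]
        · simp only [State.setVar, BinOp.toExpr_eval, Expr.eval, hd2, he2]
          simpa using hop r)
      (s.setVar d (if o then 1 else 0))
      (by
        have : (j : ℕ) + 1 ≠ d := by omega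
        simp [State.setVar, this, hr.sz])
      (by
        refine ⟨rfl, fun x hx => by simp [State.setVar, hx.ne, show x ≠ d + 1 by omega], ?_⟩
        cases o <;> simp [State.setVar, hacc])
    refine ⟨s', _, Run.seq (Run.assign _ _ _) hr', ?_, hI.1, hI.2.1, ?_⟩
    · simp only [Expr.cost, AExpr.time]
      omega
    · rw [hI.2.2, AExpr.eval_fold]
  | query den two a b iha ihb =>
    intro σ ρ d s hd hσ hρ hm hr
    obtain ⟨s1, t1, hr1, ht1, hm1, hv1, he1⟩ := iha σ ρ d s hd hσ hρ hm hr
    obtain ⟨s2, t2, hr2, ht2, hm2, hv2, he2⟩ := ihb σ ρ (d + 1) s1 (by omega)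
      (fun i => (hσ i).trans (by omega)) (fun i => by rw [hv1 _ (hσ i), hρ]) hm
      (hr.congr (fun x hx => hv1 x (by omega)) fun _ _ => by rw [hm1])
    have h0 := bitLen_le_of_abs_le (AExpr.abs_eval_le hO hb a ρ hm)
    have h1 := bitLen_le_of_abs_le (AExpr.abs_eval_le hO hb b ρ hm)
    have hd2 : s2.var d = a.eval O h ρ := by rw [hv2 _ (by omega), he1]
    refine ⟨_, _, Run.seq hr1 (Run.seq hr2 (Run.query _ _ _ _ _ rfl)), ?_, ?_, ?_, ?_⟩
    · have h2 := hO (List.map (Expr.eval s2)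
        (if two then [.var d, .var (d + 1)] else [.var (d + 1)]))
      have h3 : (List.map (Expr.cost s2)
          (if two then [.var d, .var (d + 1)] else [.var (d + 1)])).sum ≤
          a.bits m + b.bits m + 4 := by
        cases two <;> simp [Expr.cost, hd2, he2] <;> omega
      simp only [AExpr.time]
      omega
    · simp [State.setVar, hm2, hm1]
    · intro x hx
      cases den <;>
      simp [State.setVar, hx.ne, show x ≠ d + 1 by omega, hv2 x (by omega), hv1 x hx]
    · have : List.map (Expr.eval s2) (if two then [.var d, .var (d + 1)] else [.var (d + 1)]) =
          if two then [a.eval O h ρ, b.eval O h ρ] else [b.eval O h ρ] := by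
        cases two <;> simp [Expr.eval, hd2, he2]
      rw [this]
      cases den <;> simp [State.setVar, AExpr.eval]

end SubmodAlloc

/-! ### Commands of the array language: meaning, compilation, running time. -/

namespace SubmodAlloc
open Function

/-- Commands of the array language. `tab a j e` replaces the entries `0, …, sz j - 1` of the array
`a` simultaneously by the values of `e`, in which index `0` is the position; `loop j c` repeats `c`
for `sz j` times. -/
inductive ACmd : Type
  | assign (x : Fin 8) (e : AExpr)
  | tab (a : Fin 8) (j : Fin 8) (e : AExpr)
  | seq (c c' : ACmd)
  | loop (j : Fin 8) (c : ACmd)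

/-- Assignment to a variable. -/
def AState.setVar (h : AState) (x : Fin 8) (z : ℤ) : AState :=
  { h with var := update h.var x z }

/-- Replacing the first `m` entries of an array. -/
def AState.setArr (h : AState) (a : Fin 8) (m : ℕ) (f : ℤ → ℤ) : AState :=
  { h with arr := update h.arr a fun i => if 0 ≤ i ∧ i < m then f i else h.arr a i }

/-- Values of the indices at the outermost level. -/
def noIndex : ℕ → ℤ := fun _ => 0

/-- Meaning of a command. -/
def ACmd.den (O : Oracle) : ACmd → AState → AState
  | .assign x e, h => h.setVar x (e.eval O h noIndex)
  | .tab a j e, h => h.setArr a (h.sz j) fun i => e.eval O h (update noIndex 0 i)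
  | .seq c c', h => c'.den O (c.den O h)
  | .loop j c, h => (c.den O)^[h.sz j] h

/-- Compilation of a command; variables from `d` on are used for the counters and temporaries. -/
def ACmd.comp : ℕ → ACmd → Prog
  | d, .assign x e => .seq (e.comp (fun _ => 17) d) (.assign (x + 9) (.var d))
  | d, .tab a j e => .seq
      (forLoop d (j + 1) (.seq (e.comp (update (fun _ => 17) 0 d) (d + 1))
        (.store (.add (.mul (.const 16) (.var d)) (.const 15)) (.var (d + 1)))))
      (forLoop d (j + 1) (.store (.add (.mul (.const 16) (.var d)) (.const (a : ℕ)))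
        (.load (.add (.mul (.const 16) (.var d)) (.const 15)))))
  | d, .seq c c' => .seq (c.comp d) (c'.comp d)
  | d, .loop j c => forLoop d (j + 1) (c.comp (d + 1))

/-- All states at the beginning and at the end of the passes through the loops are bounded. -/
def ACmd.Good (O : Oracle) (m : ℕ) : ACmd → AState → Prop
  | .assign _ _, _ => True
  | .tab _ _ _, _ => True
  | .seq c c', h => c.Good O m h ∧ c'.Good O m (c.den O h)
  | .loop j c, h => ∀ i ≤ h.sz j, Bdd m ((c.den O)^[i] h) ∧
      (i < h.sz j → c.Good O m ((c.den O)^[i] h))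

/-- Bound on the values after a command. -/
def ACmd.growth : ACmd → ℕ → ℕ
  | .assign _ e, m => m + e.bits m
  | .tab _ _ e, m => m + e.bits m
  | .seq c c', m => c'.growth (c.growth m)
  | .loop _ _, m => m

/-- Bound on the time of a command. -/
def ACmd.time : ACmd → ℕ → ℕ
  | .assign _ e, m => e.time m + e.bits m + 5
  | .tab _ _ e, m => (m + 1) * (e.time m + 3 * m + e.bits m + 40 + 4 * m + 22) +
      (m + 1) * (6 * m + e.bits m + 80 + 4 * m + 22)
  | .seq c c', m => c.time m + c'.time (c.growth m)
  | .loop _ c, m => (m + 1) * (c.time m + 4 * m + 22)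

theorem ACmd.le_growth : ∀ (c : ACmd) (m : ℕ), m ≤ c.growth m := by
  intro c
  induction c with
  | assign => intro m; simp [ACmd.growth]
  | tab => intro m; simp [ACmd.growth]
  | seq c c' ih ih' => intro m; exact (ih m).trans (ih' _)
  | loop => intro m; simp [ACmd.growth]

theorem ACmd.Good.mono {O : Oracle} {m m' : ℕ} (hm : m ≤ m') : ∀ {c : ACmd} {h : AState},
    c.Good O m h → c.Good O m' h := by
  intro c
  induction c with
  | assign => intros; trivial
  | tab => intros; trivial
  | seq c c' ih ih' => intro h hg; exact ⟨ih hg.1, ih' hg.2⟩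
  | loop j c ih => intro h hg i hi; exact ⟨(hg i hi).1.mono hm, fun hlt => ih ((hg i hi).2 hlt)⟩

theorem ACmd.den_sz (O : Oracle) : ∀ (c : ACmd) (h : AState), (c.den O h).sz = h.sz := by
  intro c
  induction c with
  | assign => intro h; rfl
  | tab => intro h; rfl
  | seq c c' ih ih' => intro h; simp only [ACmd.den]; rw [ih', ih]
  | loop j c ih =>
    intro h
    simp only [ACmd.den]
    generalize h.sz j = r
    induction r with
    | zero => rfl
    | succ r ihr => rw [iterate_succ_apply', ih, ihr]

theorem ACmd.iterate_den_sz (O : Oracle) (c : ACmd) (h : AState) (r : ℕ) :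
    ((c.den O)^[r] h).sz = h.sz := by
  induction r with
  | zero => rfl
  | succ r ih => rw [iterate_succ_apply', ACmd.den_sz, ih]

theorem abs_noIndex_le (m : ℕ) (i : ℕ) : |noIndex i| ≤ 2 ^ m := by
  simp [noIndex]

/-- The values after a command are bounded. -/
theorem ACmd.bdd_den {O : Oracle} : ∀ (c : ACmd) (m : ℕ) (h : AState),
    (∀ q, encLen (O q) ≤ m) → Bdd m h → c.Good O m h → Bdd (c.growth m) (c.den O h) := by
  intro c
  induction c with
  | assign x e =>
    intro m h hO hb _
    have he := AExpr.abs_eval_le hO hb e noIndex (abs_noIndex_le m)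
    have hb' := hb.mono (show m ≤ m + e.bits m by omega)
    refine ⟨hb'.sz, fun x' => ?_, hb'.arr⟩
    simp only [ACmd.den, AState.setVar]
    by_cases hx : x' = x
    · subst hx; simpa using abs_le_two_pow_of_le he (by simp [ACmd.growth])
    · simpa [hx, ACmd.growth] using hb'.var x'
  | tab a j e =>
    intro m h hO hb _
    have hb' := hb.mono (show m ≤ m + e.bits m by omega)
    refine ⟨hb'.sz, hb'.var, fun b i => ?_⟩
    simp only [ACmd.den, AState.setArr]
    by_cases hab : b = a
    · subst hab
      rw [update_self]
      split_ifs with hi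
      · lift i to ℕ using hi.1
        exact abs_le_two_pow_of_le (AExpr.abs_eval_le hO hb e _
          (update_abs_le (abs_noIndex_le m) (hb.sz j) (by omega))) (by simp [ACmd.growth])
      · exact hb'.arr b i
    · simpa [hab, ACmd.growth] using hb'.arr b i
  | seq c c' ih ih' =>
    intro m h hO hb hg
    exact ih' (c.growth m) (c.den O h) (fun q => (hO q).trans (c.le_growth m)) (ih m h hO hb hg.1)
      (hg.2.mono (c.le_growth m))
  | loop j c ih => intro m h hO hb hg; exact (hg _ le_rfl).1

/-- The command `c` is compiled correctly and its time bound holds. -/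
theorem ACmd.run_comp {O : Oracle} : ∀ (c : ACmd) (d m : ℕ) (h : AState) (s : State), 18 ≤ d →
    (∀ q, encLen (O q) ≤ m) → Bdd m h → c.Good O m h → Rep h s →
    ∃ s' t, Run O (c.comp d) s s' t ∧ t ≤ c.time m ∧ Rep (c.den O h) s' ∧
      (∀ x, 18 ≤ x → x < d → s'.var x = s.var x) := by
  intro c
  induction c with
  | assign x e =>
    intro d m h s hd hO hb _ hr
    have he := AExpr.abs_eval_le hO hb e noIndex (abs_noIndex_le m)
    obtain ⟨s1, t1, hr1, ht1, hm1, hv1, he1⟩ := AExpr.run_comp hO hb e (fun _ => 17) noIndex d s hd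
      (fun _ => by omega) (fun _ => hr.zero) (abs_noIndex_le m) hr
    refine ⟨_, _, Run.seq hr1 (Run.assign _ _ _), ?_, ⟨?_, ?_, ?_, ?_⟩, ?_⟩
    · have := bitLen_le_of_abs_le he
      simp only [Expr.cost, he1, ACmd.time]
      omega
    · intro j
      have : (j : ℕ) + 1 ≠ x + 9 := by omega
      change update s1.var ((x : ℕ) + 9) _ ((j : ℕ) + 1) = _
      rw [update_of_ne this, hv1 _ (by omega), hr.sz]
      rfl
    · intro y
      by_cases hy : y = x
      · subst hy
        simp [State.setVar, ACmd.den, AState.setVar, Expr.eval, he1]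
      · have : (y : ℕ) + 9 ≠ x + 9 := by omega
        change update s1.var ((x : ℕ) + 9) _ ((y : ℕ) + 9) = update h.var x _ y
        rw [update_of_ne this, update_of_ne hy, hv1 _ (by omega), hr.var]
    · intro a i
      simp [State.setVar, ACmd.den, AState.setVar, hm1, hr.arr]
    · simp [State.setVar, show 17 ≠ (x : ℕ) + 9 by omega, hv1 17 (by omega), hr.zero]
    · intro y hy hyd
      simp [State.setVar, show y ≠ (x : ℕ) + 9 by omega, hv1 y hyd]
  | tab a j e =>
    intro d m h s hd hO hb _ hr
    have hidx : ∀ l < h.sz j, ∀ i', |update noIndex 0 (l : ℤ) i'| ≤ 2 ^ m := fun l hl =>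
      update_abs_le (abs_noIndex_le m) (hb.sz j) hl
    have he : ∀ l < h.sz j, |e.eval O h (update noIndex 0 (l : ℤ))| ≤ 2 ^ e.bits m := fun l hl =>
      AExpr.abs_eval_le hO hb e _ (hidx l hl)
    have hadr : ∀ l < h.sz j, bitLen (l : ℤ) ≤ m + 2 ∧ bitLen (16 * (l : ℤ)) ≤ m + 6 ∧
        bitLen (16 * (l : ℤ) + 15) ≤ m + 7 ∧ bitLen (16 * (l : ℤ) + (a : ℕ)) ≤ m + 7 := by
      intro l hl
      have h1 : |(l : ℤ)| ≤ 2 ^ m := abs_natCast_le_two_pow (hl.le.trans (hb.sz j))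
      have hp : (1 : ℤ) ≤ 2 ^ m := one_le_pow₀ (by norm_num)
      have h1' := abs_of_nonneg (show (0 : ℤ) ≤ l by positivity)
      refine ⟨bitLen_le_of_abs_le h1, bitLen_le_of_abs_le (c := m + 4) ?_,
        bitLen_le_of_abs_le (c := m + 5) ?_, bitLen_le_of_abs_le (c := m + 5) ?_⟩ <;>
      rw [abs_of_nonneg (by positivity), pow_add] <;> norm_num <;> omega
    have h16 : bitLen 16 = 6 := by decide
    have h15 : bitLen 15 = 5 := by decide
    have hca : bitLen ((a : ℕ) : ℤ) ≤ 8 + 2 := bitLen_natCast_le (by omega)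
    -- The replacement has to be simultaneous, while `e` may read the array `a`. Therefore the new
    -- values first go to the scratch addresses `16 * l + 15`.
    obtain ⟨s1, t1, hr1, ht1, ⟨hv1, hm1, hc1⟩⟩ := run_forLoop (O := O) (d := d) (b := j + 1)
      (M := h.sz j) (m := m) (τ := e.time m + 3 * m + e.bits m + 40)
      (body := .seq (e.comp (update (fun _ => 17) 0 d) (d + 1))
        (.store (.add (.mul (.const 16) (.var d)) (.const 15)) (.var (d + 1))))
      (fun r s' => (∀ x < d, s'.var x = s.var x) ∧
        (∀ (a : Fin 8) (i : ℤ), s'.mem (16 * i + (a : ℕ)) = s.mem (16 * i + (a : ℕ))) ∧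
        ∀ l < r, s'.mem (16 * (l : ℤ) + 15) = e.eval O h (update noIndex 0 (l : ℤ)))
      (hb.sz j) (by omega)
      (by
        rintro r s1 hrj ⟨hv1, hm1, hc1⟩ hd1 hb1
        obtain ⟨s2, t2, hr2, ht2, hm2, hv2, he2⟩ := AExpr.run_comp hO hb e
          (update (fun _ => 17) 0 d) (update noIndex 0 (r : ℤ)) (d + 1) s1 (by omega)
          (fun i => by
            by_cases hi : i = 0
            · subst hi; simp
            · simp [hi]; omega)
          (update_index (fun i => by rw [hv1 17 (by omega), hr.zero]; rfl) hd1) (hidx r hrj)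
          (hr.congr (fun x hx => hv1 x (by omega)) hm1)
        have hd2 : s2.var d = r := by rw [hv2 d (by omega), hd1]
        refine ⟨_, _, Run.seq hr2 (Run.store _ _ _), ?_, hd2, ?_, ?_, ?_, ?_⟩
        · have h1 := hadr r hrj
          have h2 := bitLen_le_of_abs_le (he r hrj)
          simp only [Expr.cost, Expr.eval, he2, hd2, h16, h15]
          omega
        · exact (hv2 _ (by omega)).trans hb1
        · intro x hx
          simp [State.setVar, State.setMem, hx.ne, hv2 x (by omega), hv1 x hx]
        · intro a i
          have : 16 * i + ((a : ℕ) : ℤ) ≠ 16 * (r : ℤ) + 15 := by omega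
          simp [State.setVar, State.setMem, Expr.eval, hd2, this, hm2, hm1]
        · intro l hl
          by_cases hlr : l = r
          · subst hlr
            simp [State.setVar, State.setMem, Expr.eval, hd2, he2]
          · have : 16 * (l : ℤ) + 15 ≠ 16 * (r : ℤ) + 15 := by omega
            simp [State.setVar, State.setMem, Expr.eval, hd2, hlr, hm2, hc1 l (by omega)])
      s (hr.sz j)
      ⟨fun x hx => by simp [State.setVar, hx.ne], fun _ _ => rfl, fun l hl => by omega⟩
    -- The second loop copies the scratch values; after `r` passes exactly the first `r` entries of
    -- `a` are new.
    obtain ⟨s2, t2, hr2, ht2, ⟨hv2, hm2, hc2⟩⟩ := run_forLoop (O := O) (d := d) (b := j + 1)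
      (M := h.sz j) (m := m) (τ := 6 * m + e.bits m + 80)
      (body := .store (.add (.mul (.const 16) (.var d)) (.const (a : ℕ)))
        (.load (.add (.mul (.const 16) (.var d)) (.const 15))))
      (fun r s' => (∀ x < d, s'.var x = s.var x) ∧
        (∀ (b : Fin 8) (i : ℤ), s'.mem (16 * i + (b : ℕ)) =
          if b = a ∧ 0 ≤ i ∧ i < r then e.eval O h (update noIndex 0 i) else h.arr b i) ∧
        ∀ l < h.sz j, s'.mem (16 * (l : ℤ) + 15) = e.eval O h (update noIndex 0 (l : ℤ)))
      (hb.sz j) (by omega)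
      (by
        rintro r s2 hrj ⟨hv2, hm2, hc2⟩ hd2 hb2
        refine ⟨_, _, Run.store _ _ _, ?_, hd2, hb2, ?_, ?_, ?_⟩
        · have h1 := hadr r hrj
          have h2 := bitLen_le_of_abs_le (he r hrj)
          simp only [Expr.cost, Expr.eval, hd2, h16, h15, hc2 r hrj]
          omega
        · intro x hx
          simp [State.setVar, State.setMem, hx.ne, hv2 x hx]
        · intro b i
          by_cases hbi : b = a ∧ i = r
          · obtain ⟨rfl, rfl⟩ := hbi
            simp [State.setVar, State.setMem, Expr.eval, hd2, hc2 r hrj]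
          -- Array numbers are less than `16`, so equal addresses would force equal arrays and equal
          -- positions.
          · have h1 : 16 * i + ((b : ℕ) : ℤ) ≠ 16 * (r : ℤ) + (a : ℕ) := by
              intro h1
              exact hbi ⟨by omega, by omega⟩
            simp only [State.setVar, State.setMem, Expr.eval, hd2]
            rw [update_of_ne h1, hm2]
            have h2 : (b = a ∧ 0 ≤ i ∧ i < (r : ℤ)) ↔
                (b = a ∧ 0 ≤ i ∧ i < ((r + 1 : ℕ) : ℤ)) := by
              constructor
              · rintro ⟨h1, h2, h3⟩; exact ⟨h1, h2, by omega⟩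
              · rintro ⟨h1, h2, h3⟩
                have : i ≠ r := fun h => hbi ⟨h1, h⟩
                exact ⟨h1, h2, by omega⟩
            simp only [h2]
        · intro l hl
          have : 16 * (l : ℤ) + 15 ≠ 16 * (r : ℤ) + (a : ℕ) := by omega
          simp [State.setVar, State.setMem, Expr.eval, hd2, this, hc2 l hl])
      s1 (by rw [hv1 _ (by omega), hr.sz])
      ⟨fun x hx => by simp [State.setVar, hx.ne, hv1 x hx],
        fun b i => by
          have : ¬ (0 ≤ i ∧ i < 0) := by omega
          simp [State.setVar, hm1, hr.arr, this], hc1⟩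
    refine ⟨s2, _, Run.seq hr1 hr2, ?_, ⟨?_, ?_, ?_, ?_⟩, ?_⟩
    · simp only [ACmd.time]; omega
    · intro i; rw [hv2 _ (by omega), hr.sz]; rfl
    · intro i; rw [hv2 _ (by omega), hr.var]; rfl
    · intro b i
      rw [hm2]
      simp only [ACmd.den, AState.setArr]
      by_cases hba : b = a
      · subst hba; simp
      · simp [hba]
    · rw [hv2 _ (by omega), hr.zero]
    · intro x _ hx; exact hv2 x hx
  | seq c c' ih ih' =>
    intro d m h s hd hO hb hg hr
    have hb1 := c.bdd_den m h hO hb hg.1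
    obtain ⟨s1, t1, hr1, ht1, hrep1, hv1⟩ := ih d m h s hd hO hb hg.1 hr
    obtain ⟨s2, t2, hr2, ht2, hrep2, hv2⟩ := ih' d (c.growth m) (c.den O h) s1 hd
      (fun q => (hO q).trans (c.le_growth m)) hb1 (hg.2.mono (c.le_growth m)) hrep1
    exact ⟨s2, _, Run.seq hr1 hr2, by simp only [ACmd.time]; omega, hrep2,
      fun x hx hxd => by rw [hv2 x hx hxd, hv1 x hx hxd]⟩
  | loop j c ih =>
    intro d m h s hd hO hb hg hr
    obtain ⟨s1, t1, hr1, ht1, hrep1, hv1⟩ := run_forLoop (O := O) (d := d) (b := j + 1)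
      (M := h.sz j) (m := m) (τ := c.time m) (body := c.comp (d + 1))
      (fun r s' => Rep ((c.den O)^[r] h) s' ∧ (∀ x, 18 ≤ x → x < d → s'.var x = s.var x))
      (hb.sz j) (by omega)
      (by
        rintro r s1 hrj ⟨hrep1, hv1⟩ hd1 hb1
        obtain ⟨s2, t2, hr2, ht2, hrep2, hv2⟩ := ih (d + 1) m _ s1 (by omega) hO (hg r hrj.le).1
          ((hg r hrj.le).2 hrj) hrep1
        refine ⟨s2, t2, hr2, ht2, ?_, ?_, ?_, ?_⟩
        · rw [hv2 d hd (by omega), hd1]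
        · rw [hrep2.sz, ACmd.den_sz, ACmd.iterate_den_sz]
        · rw [iterate_succ_apply']
          exact hrep2.setVar hd _
        · intro x hx hxd
          simp [State.setVar, hxd.ne, hv2 x hx (by omega), hv1 x hx hxd])
      s (hr.sz j)
      ⟨hr.setVar hd _, fun x _ hxd => by simp [State.setVar, hxd.ne]⟩
    exact ⟨s1, t1, hr1, by simp only [ACmd.time]; omega, hrep1, hv1⟩

/-! ### Polynomial bounds -/

/-- Functions bounded by a polynomial. -/
def PolyBounded (φ : ℕ → ℕ) : Prop := ∃ p : Polynomial ℕ, ∀ m, φ m ≤ p.eval m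

theorem eval_mono (p : Polynomial ℕ) : Monotone fun m => p.eval m := by
  intro a b hab
  induction p using Polynomial.induction_on' with
  | add p q hp hq => simpa using add_le_add hp hq
  | monomial n c => simp only [Polynomial.eval_monomial]; gcongr

namespace PolyBounded

variable {φ ψ : ℕ → ℕ}

theorem const (c : ℕ) : PolyBounded fun _ => c := ⟨Polynomial.C c, by simp⟩

theorem id : PolyBounded fun m => m := ⟨Polynomial.X, by simp⟩

theorem add (h : PolyBounded φ) (h' : PolyBounded ψ) : PolyBounded fun m => φ m + ψ m := by
  obtain ⟨p, hp⟩ := h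
  obtain ⟨q, hq⟩ := h'
  exact ⟨p + q, fun m => by simpa using add_le_add (hp m) (hq m)⟩

theorem mul (h : PolyBounded φ) (h' : PolyBounded ψ) : PolyBounded fun m => φ m * ψ m := by
  obtain ⟨p, hp⟩ := h
  obtain ⟨q, hq⟩ := h'
  exact ⟨p * q, fun m => by simpa using Nat.mul_le_mul (hp m) (hq m)⟩

theorem comp (h : PolyBounded φ) (h' : PolyBounded ψ) : PolyBounded fun m => φ (ψ m) := by
  obtain ⟨p, hp⟩ := h
  obtain ⟨q, hq⟩ := h'
  exact ⟨p.comp q, fun m => by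
    simpa [Polynomial.eval_comp] using (hp _).trans (eval_mono p (hq m))⟩

theorem pow (h : PolyBounded φ) (r : ℕ) : PolyBounded fun m => φ m ^ r := by
  induction r with
  | zero => simpa using const 1
  | succ r ih => simpa only [pow_succ] using ih.mul h

end PolyBounded

/-- The expression is fixed, so its nesting depth affects only the degree and the coefficients of
the polynomial. -/
theorem AExpr.polyBounded_bits : ∀ e : AExpr, PolyBounded e.bits := by
  intro e
  induction e with
  | const c => exact .const _
  | sz | var | ix | arr | query => exact .id
  | bin o a b iha ihb => exact (iha.add ihb).add (.const 1)
  | fold o i j e ih => exact (PolyBounded.id.add (.const 1)).mul (ih.add (.const 1))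

theorem AExpr.polyBounded_time : ∀ e : AExpr, PolyBounded e.time := by
  intro e
  induction e with
  | const c => exact .const _
  | sz | var | ix => exact PolyBounded.id.add (.const 3)
  | arr a e ih =>
    exact ((ih.add ((PolyBounded.const 3).mul e.polyBounded_bits)).add .id).add (.const 40)
  | query den two a b iha ihb =>
    exact ((((iha.add ihb).add a.polyBounded_bits).add b.polyBounded_bits).add .id).add (.const 5)
  | bin o a b iha ihb =>
    exact (((iha.add ihb).add ((PolyBounded.const 2).mul a.polyBounded_bits)).add
      ((PolyBounded.const 2).mul b.polyBounded_bits)).add (.const 10)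
  | fold o i j e ih =>
    have h1 : PolyBounded fun m => m + 1 := PolyBounded.id.add (.const 1)
    have hb := e.polyBounded_bits
    exact (PolyBounded.const 4).add (h1.mul (((ih.add ((((PolyBounded.const 2).mul
      (h1.mul (hb.add (.const 1)))).add hb).add (.const 7))).add
      ((PolyBounded.const 4).mul .id)).add (.const 22)))

theorem ACmd.polyBounded_growth : ∀ c : ACmd, PolyBounded c.growth := by
  intro c
  induction c with
  | assign x e => exact PolyBounded.id.add e.polyBounded_bits
  | tab a j e => exact PolyBounded.id.add e.polyBounded_bits
  | seq c c' ih ih' => exact ih'.comp ih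
  | loop => exact .id

theorem ACmd.polyBounded_time : ∀ c : ACmd, PolyBounded c.time := by
  intro c
  have h1 : PolyBounded fun m => m + 1 := PolyBounded.id.add (.const 1)
  have h4 : PolyBounded fun m => 4 * m := (PolyBounded.const 4).mul .id
  induction c with
  | assign x e => exact (e.polyBounded_time.add e.polyBounded_bits).add (.const 5)
  | tab a j e =>
    exact (h1.mul (((((e.polyBounded_time.add ((PolyBounded.const 3).mul .id)).add
      e.polyBounded_bits).add (.const 40)).add h4).add (.const 22))).add
      (h1.mul (((((((PolyBounded.const 6).mul .id)).add
      e.polyBounded_bits).add (.const 80)).add h4).add (.const 22)))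
  | seq c c' ih ih' => exact ih.add (ih'.comp c.polyBounded_growth)
  | loop j c ih => exact h1.mul ((ih.add h4).add (.const 22))

end SubmodAlloc

namespace SubmodAlloc
open Finset

/-! ## Greedy vectors of a submodular function over the closed sets of a preorder -/

open Classical in
/-- The elements of `{0, …, W - 1}` that are implied by `p`. -/
noncomputable def row (W : ℕ) (R : ℕ → ℕ → Prop) (p : ℕ) : Finset ℕ := (range W).filter (R p)

open Classical in
/-- The elements that are implied by `p` and do not imply `p`. -/
noncomputable def lowerRow (W : ℕ) (R : ℕ → ℕ → Prop) (p : ℕ) : Finset ℕ :=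
  (range W).filter fun q => R p q ∧ ¬ R q p

/-- The elements that are implied by some element of `J`. -/
noncomputable def rows (W : ℕ) (R : ℕ → ℕ → Prop) (J : Finset ℕ) : Finset ℕ := J.biUnion (row W R)

/-- `X` contains with each element all those implied by it. -/
def IsClosedSet (W : ℕ) (R : ℕ → ℕ → Prop) (X : Finset ℕ) : Prop :=
  ∀ p ∈ X, ∀ q < W, R p q → q ∈ X

/-- `R` is a preorder on `{0, …, W - 1}`. -/
structure IsPre (W : ℕ) (R : ℕ → ℕ → Prop) : Prop where
  refl : ∀ p < W, R p p
  trans : ∀ p < W, ∀ q < W, ∀ r < W, R p q → R q r → R p r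

variable {W : ℕ} {R : ℕ → ℕ → Prop} {g : Finset ℕ → ℚ} {K J : Finset ℕ} {key : ℕ → ℤ}

theorem mem_row {p q : ℕ} : q ∈ row W R p ↔ q < W ∧ R p q := by simp [row]

theorem mem_lowerRow {p q : ℕ} : q ∈ lowerRow W R p ↔ q < W ∧ R p q ∧ ¬ R q p := by
  simp [lowerRow]

theorem mem_rows {q : ℕ} : q ∈ rows W R J ↔ ∃ p ∈ J, q < W ∧ R p q := by
  simp [rows, mem_row]

theorem IsPre.isClosedSet_rows (hR : IsPre W R) (hJ : J ⊆ range W) :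
    IsClosedSet W R (rows W R J) := by
  intro p hp q hq hpq
  obtain ⟨r, hr, hpW, hrp⟩ := mem_rows.1 hp
  exact mem_rows.2 ⟨r, hr, hq, hR.trans r (by simpa using hJ hr) p hpW q hq hrp hpq⟩

theorem IsPre.isClosedSet_row (hR : IsPre W R) {p : ℕ} (hp : p < W) :
    IsClosedSet W R (row W R p) := by
  intro q hq r hr hqr
  obtain ⟨hqW, hpq⟩ := mem_row.1 hq
  exact mem_row.2 ⟨hr, hR.trans p hp q hqW r hr hpq hqr⟩

theorem IsPre.isClosedSet_lowerRow (hR : IsPre W R) {p : ℕ} (hp : p < W) :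
    IsClosedSet W R (lowerRow W R p) := by
  intro q hq r hr hqr
  obtain ⟨hqW, hpq, hqp⟩ := mem_lowerRow.1 hq
  exact mem_lowerRow.2 ⟨hr, hR.trans p hp q hqW r hr hpq hqr,
    fun h => hqp (hR.trans q hqW r hr p hp hqr h)⟩

theorem IsClosedSet.union {X Y : Finset ℕ} (hX : IsClosedSet W R X) (hY : IsClosedSet W R Y) :
    IsClosedSet W R (X ∪ Y) := by
  intro p hp q hq hpq
  rcases mem_union.1 hp with h | h
  · exact mem_union_left _ (hX p h q hq hpq)
  · exact mem_union_right _ (hY p h q hq hpq)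

/-- The set in front of `w` when the elements of `J` are inserted in order of decreasing key, each
with all elements that it implies, starting from `K`. -/
noncomputable def prefixSet (W : ℕ) (R : ℕ → ℕ → Prop) (K J : Finset ℕ) (key : ℕ → ℤ) (w : ℕ) :
    Finset ℕ :=
  K ∪ rows W R (J.filter fun p => key w < key p)

/-- The greedy vector. -/
noncomputable def greedy (W : ℕ) (R : ℕ → ℕ → Prop) (g : Finset ℕ → ℚ) (K J : Finset ℕ)
    (key : ℕ → ℤ) (w : ℕ) : ℚ :=
  g (prefixSet W R K J key w ∪ row W R w) - g (prefixSet W R K J key w)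

/-- The elements of `J` are to be added to the closed set `K`, in an order that is consistent
with the preorder `R`. -/
structure IsConsistent (W : ℕ) (R : ℕ → ℕ → Prop) (K J : Finset ℕ) (key : ℕ → ℤ) : Prop where
  pre : IsPre W R
  closed : IsClosedSet W R K
  subset : J ⊆ range W
  row_subset : ∀ p ∈ J, row W R p ⊆ K ∪ J
  inj : ∀ p ∈ J, ∀ q ∈ J, key p = key q → p = q
  lt : ∀ p ∈ J, ∀ q ∈ J, R p q → ¬ R q p → key p < key q

theorem IsConsistent.lt_W (hc : IsConsistent W R K J key) {p : ℕ} (hp : p ∈ J) : p < W := by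
  simpa using hc.subset hp

theorem IsConsistent.rows_subset (hc : IsConsistent W R K J key) : rows W R J ⊆ K ∪ J := by
  intro q hq
  obtain ⟨p, hp, hqW, hpq⟩ := mem_rows.1 hq
  exact hc.row_subset p hp (mem_row.2 ⟨hqW, hpq⟩)

theorem IsConsistent.subset_rows (hc : IsConsistent W R K J key) {U : Finset ℕ} (hU : U ⊆ J) :
    U ⊆ rows W R U :=
  fun p hp => mem_rows.2 ⟨p, hp, hc.lt_W (hU hp), hc.pre.refl p (hc.lt_W (hU hp))⟩

theorem IsConsistent.union_rows (hc : IsConsistent W R K J key) : K ∪ rows W R J = K ∪ J := by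
  apply Subset.antisymm
  · exact union_subset subset_union_left hc.rows_subset
  · exact union_subset_union_right (hc.subset_rows Subset.rfl)

/-- Edmonds' greedy argument, by induction over the initial segments `U` of the order of insertion.
Both sums grow by the greedy value of the last element `w`, inserted behind a set `B`. If `w ∈ X`,
diminishing returns bound this value by the increase of `g` on the traces in `X`. If `w ∉ X`, the
trace in `X` does not change at all: an element of `X` implied by `w` cannot imply `w`, so it has
been inserted before. -/
theorem IsConsistent.sum_greedy (hc : IsConsistent W R K J key) (hg : IsSubmodular g)
    {X : Finset ℕ} (hX : IsClosedSet W R X) (hKX : K ⊆ X) :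
    ∀ (r : ℕ) (U : Finset ℕ), U.card = r → U ⊆ J →
      (∀ p ∈ U, ∀ q ∈ J, key p < key q → q ∈ U) →
      ∑ w ∈ U, greedy W R g K J key w = g (K ∪ rows W R U) - g K ∧
      ∑ w ∈ U.filter (· ∈ X), greedy W R g K J key w ≤ g ((K ∪ rows W R U) ∩ X) - g K := by
  intro r
  induction r with
  | zero =>
    intro U hU _ _
    rw [card_eq_zero.1 hU]
    simp [rows, inter_eq_left.2 hKX]
  | succ r ih =>
    intro U hU hUJ hup
    -- Elements are inserted by decreasing key, so `w` is the last one of `U`, and the remaining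
    -- ones are those in front of it.
    obtain ⟨w, hw, hmin⟩ := exists_min_image U key (card_pos.1 (by omega))
    have hfil : J.filter (fun p => key w < key p) = U.erase w := by
      ext p
      simp only [mem_filter, mem_erase]
      constructor
      · rintro ⟨hp, hlt⟩
        exact ⟨fun h => by simp [h] at hlt, hup w hw p hp hlt⟩
      · rintro ⟨hne, hp⟩
        refine ⟨hUJ hp, lt_of_le_of_ne (hmin p hp) fun h => hne ?_⟩
        exact (hc.inj w (hUJ hw) p (hUJ hp) h).symm
    obtain ⟨ih1, ih2⟩ := ih (U.erase w) (by rw [card_erase_of_mem hw]; omega)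
      ((erase_subset _ _).trans hUJ)
      (by
        rw [← hfil]
        intro p hp q hq hpq
        exact mem_filter.2 ⟨hq, (mem_filter.1 hp).2.trans hpq⟩)
    set B := K ∪ rows W R (U.erase w) with hB
    have hpre : prefixSet W R K J key w = B := by rw [prefixSet, hfil]
    have hrows : K ∪ rows W R U = B ∪ row W R w := by
      rw [hB, union_assoc, ← insert_erase hw]
      simp [rows, biUnion_insert, union_comm]
    have hgw : greedy W R g K J key w = g (B ∪ row W R w) - g B := by rw [greedy, hpre]
    constructor
    · rw [← add_sum_erase U _ hw, ih1, hrows, hgw]; ring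
    · rw [hrows]
      by_cases hwX : w ∈ X
      · have hrow : row W R w ⊆ X := fun q hq =>
          hX w hwX q (mem_row.1 hq).1 (mem_row.1 hq).2
        have h1 : U.filter (· ∈ X) = insert w ((U.erase w).filter (· ∈ X)) := by
          conv_lhs => rw [← insert_erase hw, filter_insert, if_pos hwX]
        rw [h1, sum_insert (by simp), hgw]
        -- The second set has union `B ∪ row w` and intersection `B ∩ X` with `B`, so this is the
        -- comparison of the two marginal values.
        have h2 := hg B ((B ∪ row W R w) ∩ X)
        have h3 : B ∪ (B ∪ row W R w) ∩ X = B ∪ row W R w := by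
          ext q
          have := @hrow q
          simp only [mem_union, mem_inter]; tauto
        have h4 : B ∩ ((B ∪ row W R w) ∩ X) = B ∩ X := by
          ext q; simp only [mem_union, mem_inter]; tauto
        rw [h3, h4] at h2
        linarith
      · have h1 : U.filter (· ∈ X) = (U.erase w).filter (· ∈ X) := by
          ext q
          simp only [mem_filter, mem_erase]
          constructor
          · rintro ⟨h, h'⟩; exact ⟨⟨fun hq => hwX (hq ▸ h'), h⟩, h'⟩
          · rintro ⟨⟨_, h⟩, h'⟩; exact ⟨h, h'⟩
        have h2 : (B ∪ row W R w) ∩ X = B ∩ X := by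
          ext q
          simp only [mem_union, mem_inter]
          constructor
          · rintro ⟨h | h, hqX⟩
            · exact ⟨h, hqX⟩
            · refine ⟨?_, hqX⟩
              obtain ⟨hqW, hwq⟩ := mem_row.1 h
              rcases mem_union.1 (hc.row_subset w (hUJ hw) h) with hq | hq
              · exact mem_union_left _ hq
              -- Since `X` is closed and `w ∉ X`, the element `q ∈ X` does not imply `w`, and
              -- consistency gives it the larger key.
              · have hlt := hc.lt w (hUJ hw) q hq hwq
                  fun hqw => hwX (hX q hqX w (hc.lt_W (hUJ hw)) hqw)
                refine mem_union_right _ (mem_rows.2 ⟨q, ?_, hqW, hc.pre.refl q hqW⟩)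
                rw [← hfil]
                exact mem_filter.2 ⟨hq, hlt⟩
          · rintro ⟨h, hqX⟩; exact ⟨Or.inl h, hqX⟩
        rw [h1, h2]
        exact ih2

theorem IsConsistent.sum_greedy_upset (hc : IsConsistent W R K J key) (hg : IsSubmodular g)
    {U : Finset ℕ} (hU : U ⊆ J) (hup : ∀ p ∈ U, ∀ q ∈ J, key p < key q → q ∈ U) :
    ∑ w ∈ U, greedy W R g K J key w = g (K ∪ rows W R U) - g K :=
  (hc.sum_greedy hg hc.closed Subset.rfl _ U rfl hU hup).1

theorem IsConsistent.sum_greedy_le (hc : IsConsistent W R K J key) (hg : IsSubmodular g)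
    {X : Finset ℕ} (hX : IsClosedSet W R X) (hKX : K ⊆ X) (hXJ : X ⊆ K ∪ J) :
    ∑ w ∈ J.filter (· ∈ X), greedy W R g K J key w ≤ g X - g K := by
  have h := (hc.sum_greedy hg hX hKX _ J rfl Subset.rfl fun _ _ q hq _ => hq).2
  rwa [hc.union_rows, inter_eq_right.2 hXJ] at h

theorem IsConsistent.sum_greedy_eq (hc : IsConsistent W R K J key) (hg : IsSubmodular g) :
    ∑ w ∈ J, greedy W R g K J key w = g (K ∪ J) - g K := by
  rw [hc.sum_greedy_upset hg Subset.rfl fun _ _ q hq _ => hq, hc.union_rows]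

/-- If `w` is already in the set `B` in front of it, the greedy value is `0`. Otherwise consistency
gives `row w ∩ B = lowerRow w`, and by diminishing returns adding `w` to `B` gains at most as much
as adding it to the elements strictly below it. -/
theorem IsConsistent.greedy_le (hc : IsConsistent W R K J key) (hg : IsSubmodular g) {η : ℚ}
    (hη : 0 ≤ η) (hle : ∀ p ∈ J, g (row W R p) - g (lowerRow W R p) ≤ η) {w : ℕ} (hw : w ∈ J) :
    greedy W R g K J key w ≤ η := by
  set B := prefixSet W R K J key w with hB
  have hBc : IsClosedSet W R B :=
    hc.closed.union (hc.pre.isClosedSet_rows ((filter_subset _ _).trans hc.subset))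
  by_cases hwB : w ∈ B
  · have : B ∪ row W R w = B := union_eq_left.2 fun q hq =>
      hBc w hwB q (mem_row.1 hq).1 (mem_row.1 hq).2
    rw [greedy, ← hB, this]; simpa using hη
  · have h := hg (row W R w) B
    have h1 : row W R w ∩ B = lowerRow W R w := by
      ext q
      rw [mem_inter, mem_lowerRow, mem_row]
      constructor
      · rintro ⟨⟨hqW, hwq⟩, hqB⟩
        exact ⟨hqW, hwq, fun h => hwB (hBc q hqB w (hc.lt_W hw) h)⟩
      · rintro ⟨hqW, hwq, hqw⟩
        refine ⟨⟨hqW, hwq⟩, ?_⟩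
        rcases mem_union.1 (hc.row_subset w hw (mem_row.2 ⟨hqW, hwq⟩)) with hq | hq
        · exact mem_union_left _ hq
        · exact mem_union_right _ (mem_rows.2 ⟨q, mem_filter.2 ⟨hq, hc.lt w hw q hq hwq hqw⟩,
            hqW, hc.pre.refl q hqW⟩)
    rw [h1, union_comm] at h
    have := hle w hw
    rw [greedy, ← hB]
    linarith

/-- The loss vector: positive parts of the rounded greedy vector `β` are moved along `u`. -/
def loss (J : Finset ℕ) (u : ℕ → ℕ) (β : ℕ → ℤ) (p : ℕ) : ℤ :=
  ∑ w ∈ J.filter (fun w => u w = p), max (β w) 0 + min (β p) 0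

/-- The elements of `J` are ordered according to the values `x (u w)`, where `u w` has the largest
value among the elements that imply `w`. -/
structure IsPull (R : ℕ → ℕ → Prop) (J : Finset ℕ) (key : ℕ → ℤ) (u : ℕ → ℕ) (x : ℕ → ℤ) :
    Prop where
  mem : ∀ w ∈ J, u w ∈ J
  rel : ∀ w ∈ J, R (u w) w
  le : ∀ w ∈ J, x w ≤ x (u w)
  mono : ∀ w ∈ J, ∀ w' ∈ J, key w < key w' → x (u w) ≤ x (u w')

variable {u : ℕ → ℕ} {x : ℕ → ℤ} {c : ℚ}

/-- The mass that arrives at `p ∈ X` comes from elements implied by `p`, which lie in `X` too. So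
moving positive parts along `u` does not increase the sum over a closed set, nor does rounding down,
and the greedy bound applies. -/
theorem IsConsistent.sum_loss_le (hc : IsConsistent W R K J key) (hg : IsSubmodular g)
    (hu : IsPull R J key u x) (hc0 : 0 ≤ c) {X : Finset ℕ} (hX : IsClosedSet W R X) (hKX : K ⊆ X)
    (hXJ : X ⊆ K ∪ J) :
    ((∑ p ∈ J.filter (· ∈ X), loss J u (fun w => ⌊c * greedy W R g K J key w⌋) p : ℤ) : ℚ) ≤
      c * (g X - g K) := by
  set β : ℕ → ℤ := fun w => ⌊c * greedy W R g K J key w⌋ with hβ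
  have h1 : ∑ p ∈ J.filter (· ∈ X), ∑ w ∈ J.filter (fun w => u w = p), max (β w) 0 ≤
      ∑ w ∈ J.filter (· ∈ X), max (β w) 0 := by
    have : ∀ p ∈ J.filter (· ∈ X), ∑ w ∈ J.filter (fun w => u w = p), max (β w) 0 =
        ∑ w ∈ (J.filter (· ∈ X)).filter (fun w => u w = p), max (β w) 0 := by
      intro p hp
      refine sum_congr ?_ fun _ _ => rfl
      ext w
      simp only [mem_filter] at hp ⊢
      constructor
      · rintro ⟨hw, huw⟩
        exact ⟨⟨hw, hX p hp.2 w (hc.lt_W hw) (huw ▸ hu.rel w hw)⟩, huw⟩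
      · rintro ⟨⟨hw, _⟩, huw⟩; exact ⟨hw, huw⟩
    rw [sum_congr rfl this]
    exact sum_fiberwise_le_sum_of_sum_fiber_nonneg fun p _ =>
      sum_nonneg fun w _ => le_max_right _ _
  have h2 : ∑ p ∈ J.filter (· ∈ X), loss J u β p ≤ ∑ w ∈ J.filter (· ∈ X), β w := by
    calc _ = ∑ p ∈ J.filter (· ∈ X), ∑ w ∈ J.filter (fun w => u w = p), max (β w) 0 +
          ∑ p ∈ J.filter (· ∈ X), min (β p) 0 := sum_add_distrib
      _ ≤ ∑ w ∈ J.filter (· ∈ X), max (β w) 0 + ∑ p ∈ J.filter (· ∈ X), min (β p) 0 := by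
          gcongr
      _ = _ := by
          rw [← sum_add_distrib]
          refine sum_congr rfl fun w _ => ?_
          rw [max_add_min, add_zero]
  have h3 : ((∑ w ∈ J.filter (· ∈ X), β w : ℤ) : ℚ) ≤
      ∑ w ∈ J.filter (· ∈ X), c * greedy W R g K J key w := by
    push_cast
    exact sum_le_sum fun w _ => Int.floor_le _
  rw [← mul_sum] at h3
  have h4 := mul_le_mul_of_nonneg_left (hc.sum_greedy_le hg hX hKX hXJ) hc0
  have h2' : ((∑ p ∈ J.filter (· ∈ X), loss J u β p : ℤ) : ℚ) ≤
    ((∑ w ∈ J.filter (· ∈ X), β w : ℤ) : ℚ) := by exact_mod_cast h2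
  linarith

/-- Double counting: each positive part is charged at its destination `u w`, each negative part at
`w`. -/
theorem sum_loss_mul (hu : IsPull R J key u x) (β : ℕ → ℤ) (y : ℕ → ℤ) :
    ∑ p ∈ J, loss J u β p * y p = ∑ w ∈ J, (max (β w) 0 * y (u w) + min (β w) 0 * y w) := by
  have : ∀ p ∈ J, loss J u β p * y p =
      ∑ w ∈ J.filter (fun w => u w = p), max (β w) 0 * y (u w) + min (β p) 0 * y p := by
    intro p _
    rw [loss, add_mul, sum_mul]
    congr 1
    refine sum_congr rfl fun w hw => ?_
    rw [(mem_filter.1 hw).2]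
  rw [sum_congr rfl this, sum_add_distrib, sum_add_distrib]
  congr 1
  exact sum_fiberwise_of_maps_to hu.mem _

/-- This is the layer formula of the Lovász extension. The integer `x (u w)` counts the thresholds
`θ` below it, and each level set `θ < x (u w)` is an initial segment of the order, on which the
greedy values add up to the difference of `g` at a closed set and at `K`. -/
theorem IsConsistent.le_sum_greedy_mul (hc : IsConsistent W R K J key) (hg : IsSubmodular g)
    (hu : IsPull R J key u x) {Q : ℕ} (hx : ∀ p ∈ J, 0 ≤ x p ∧ x p ≤ Q) {μ : ℚ}
    (hμ : ∀ X, IsClosedSet W R X → K ⊆ X → X ⊆ K ∪ J → μ ≤ g X - g K) :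
    Q * μ ≤ ∑ w ∈ J, greedy W R g K J key w * x (u w) := by
  have h1 : ∀ w ∈ J, ((x (u w) : ℤ) : ℚ) = ∑ θ ∈ range Q, if (θ : ℤ) < x (u w) then 1 else 0 := by
    intro w hw
    obtain ⟨h0, hQ⟩ := hx _ (hu.mem w hw)
    lift x (u w) to ℕ using h0 with y hy
    have : (range Q).filter (fun θ : ℕ => (θ : ℤ) < y) = range y := by
      ext θ; simp only [mem_filter, mem_range]; omega
    rw [← sum_filter, this]
    simp
  have h2 : ∑ w ∈ J, greedy W R g K J key w * x (u w) =
      ∑ θ ∈ range Q, ∑ w ∈ J.filter (fun w => (θ : ℤ) < x (u w)), greedy W R g K J key w := by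
    simp_rw [sum_filter]
    rw [sum_comm]
    refine sum_congr rfl fun w hw => ?_
    rw [h1 w hw, mul_sum]
    simp
  rw [h2]
  have h3 : ∀ θ ∈ range Q,
      μ ≤ ∑ w ∈ J.filter (fun w => (θ : ℤ) < x (u w)), greedy W R g K J key w := by
    intro θ _
    have hsub : J.filter (fun w => (θ : ℤ) < x (u w)) ⊆ J := filter_subset _ _
    rw [hc.sum_greedy_upset hg hsub]
    · refine hμ _ (hc.closed.union (hc.pre.isClosedSet_rows (hsub.trans hc.subset)))
        subset_union_left (union_subset subset_union_left ?_)
      exact (biUnion_subset_biUnion_of_subset_left _ hsub).trans hc.rows_subset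
    · intro p hp q hq hpq
      have hp' := mem_filter.1 hp
      exact mem_filter.2 ⟨hq, hp'.2.trans_le (hu.mono p hp'.1 q hq hpq)⟩
  calc Q * μ = ∑ θ ∈ range Q, μ := by simp
    _ ≤ _ := sum_le_sum h3

/-- Since `x w ≤ x (u w)`, leaving the negative part of `β w` at `w` can only increase the product,
compared with evaluating everything at `u w`. Rounding loses at most `1` per element, which is
multiplied by at most `Q`. -/
theorem IsConsistent.le_sum_loss_mul (hc : IsConsistent W R K J key) (hg : IsSubmodular g)
    (hu : IsPull R J key u x) (hc0 : 0 ≤ c) {Q : ℕ} (hx : ∀ p ∈ J, 0 ≤ x p ∧ x p ≤ Q) {μ : ℚ}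
    (hμ : ∀ X, IsClosedSet W R X → K ⊆ X → X ⊆ K ∪ J → μ ≤ g X - g K) :
    Q * c * μ - W * Q ≤
      ((∑ p ∈ J, loss J u (fun w => ⌊c * greedy W R g K J key w⌋) p * x p : ℤ) : ℚ) := by
  rw [sum_loss_mul hu]
  set β : ℕ → ℤ := fun w => ⌊c * greedy W R g K J key w⌋ with hβ
  have h1 : ∀ w ∈ J, c * (greedy W R g K J key w * x (u w)) - Q ≤
      ((max (β w) 0 * x (u w) + min (β w) 0 * x w : ℤ) : ℚ) := by
    intro w hw
    obtain ⟨h0, hQ⟩ := hx _ (hu.mem w hw)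
    have h2 : β w * x (u w) ≤ max (β w) 0 * x (u w) + min (β w) 0 * x w := by
      have h3 : min (β w) 0 * x (u w) ≤ min (β w) 0 * x w :=
        mul_le_mul_of_nonpos_left (hu.le w hw) (min_le_right _ _)
      have h4 : β w = max (β w) 0 + min (β w) 0 := by rw [max_add_min, add_zero]
      calc β w * x (u w) = max (β w) 0 * x (u w) + min (β w) 0 * x (u w) := by
            rw [← add_mul, ← h4]
        _ ≤ _ := by linarith
    have h5 : ((β w * x (u w) : ℤ) : ℚ) ≤
      ((max (β w) 0 * x (u w) + min (β w) 0 * x w : ℤ) : ℚ) := by exact_mod_cast h2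
    refine le_trans ?_ h5
    push_cast
    have h6 : c * greedy W R g K J key w - 1 ≤ (β w : ℚ) := (Int.sub_one_lt_floor _).le
    have h0' : (0 : ℚ) ≤ x (u w) := by exact_mod_cast h0
    have hQ' : (x (u w) : ℚ) ≤ Q := by exact_mod_cast hQ
    nlinarith
  have h2 := sum_le_sum h1
  have h3 := mul_le_mul_of_nonneg_left (hc.le_sum_greedy_mul hg hu hx hμ) hc0
  have h4 : ((J.card : ℕ) : ℚ) ≤ W := by
    have := card_le_card hc.subset
    rw [card_range] at this
    exact_mod_cast this
  have h5 : (J.card : ℚ) * Q ≤ W * Q := by gcongr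
  rw [sum_sub_distrib, ← mul_sum, sum_const, nsmul_eq_mul] at h2
  push_cast at h2 ⊢
  linarith

/-- After scaling by `H / η` each greedy value is at most `H`; at most `W` positive parts are
collected in `p`, and the negative part only helps. -/
theorem IsConsistent.loss_le (hc : IsConsistent W R K J key) (hg : IsSubmodular g)
    {η : ℚ} (hη : 0 < η) {H : ℕ} (hle : ∀ p ∈ J, g (row W R p) - g (lowerRow W R p) ≤ η) (p : ℕ) :
    loss J u (fun w => ⌊(H : ℚ) / η * greedy W R g K J key w⌋) p ≤ W * H := by
  have hup : ∀ w ∈ J, ⌊(H : ℚ) / η * greedy W R g K J key w⌋ ≤ H := by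
    intro w hw
    have h1 : (H : ℚ) / η * greedy W R g K J key w ≤ H := by
      calc (H : ℚ) / η * greedy W R g K J key w ≤ H / η * η := by
            apply mul_le_mul_of_nonneg_left (hc.greedy_le hg hη.le hle hw); positivity
        _ = H := by field_simp
    have : (⌊(H : ℚ) / η * greedy W R g K J key w⌋ : ℚ) ≤ ((H : ℤ) : ℚ) := by
      push_cast; exact (Int.floor_le _).trans h1
    exact_mod_cast this
  have hpos : ∑ w ∈ J.filter (fun w => u w = p),
      max ⌊(H : ℚ) / η * greedy W R g K J key w⌋ 0 ≤ W * H := by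
    calc _ ≤ ∑ w ∈ J.filter (fun w => u w = p), (H : ℤ) :=
          sum_le_sum fun w hw => max_le (hup w (mem_filter.1 hw).1) (by positivity)
      _ = ((J.filter (fun w => u w = p)).card : ℤ) * H := by simp
      _ ≤ _ := by
        gcongr
        have hcard : J.card ≤ W := by simpa using card_le_card hc.subset
        exact_mod_cast (card_filter_le _ _).trans hcard
  rw [loss]
  linarith [min_le_right ⌊(H : ℚ) / η * greedy W R g K J key p⌋ 0]

/-- The loss vector is bounded if the values of `g` on `K` and on `K ∪ J` are not too far apart. -/
theorem IsConsistent.abs_loss_le (hc : IsConsistent W R K J key) (hg : IsSubmodular g)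
    {η : ℚ} (hη : 0 < η) {H : ℕ} (hH : 1 ≤ H) (hW : 2 ≤ W)
    (hle : ∀ p ∈ J, g (row W R p) - g (lowerRow W R p) ≤ η)
    (hgap : g K - g (K ∪ J) ≤ 2 * (W : ℚ) ^ 3 * η) {p : ℕ} (hp : p ∈ J) :
    |loss J u (fun w => ⌊(H : ℚ) / η * greedy W R g K J key w⌋) p| ≤ 3 * W ^ 3 * H := by
  set b := greedy W R g K J key with hb
  set β : ℕ → ℤ := fun w => ⌊(H : ℚ) / η * b w⌋ with hβ
  have hcard : J.card ≤ W := by simpa using card_le_card hc.subset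
  have hup : ∀ w ∈ J, b w ≤ η := fun w hw => hc.greedy_le hg hη.le hle hw
  -- The other entries are at most `η` each while the total is at least `-2 * W ^ 3 * η`, so a
  -- single entry cannot be very negative.
  have hlow : -(2 * (W : ℚ) ^ 3 + W) * η ≤ b p := by
    have h1 := hc.sum_greedy_eq hg
    rw [← add_sum_erase J _ hp] at h1
    have h2 : ∑ w ∈ J.erase p, b w ≤ W * η := by
      calc _ ≤ ∑ w ∈ J.erase p, η := sum_le_sum fun w hw => hup w (mem_of_mem_erase hw)
        _ = ((J.erase p).card : ℚ) * η := by simp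
        _ ≤ _ := by
          gcongr
          exact (card_erase_le).trans hcard
    have h3 : b p + ∑ w ∈ J.erase p, b w = g (K ∪ J) - g K := h1
    nlinarith
  have hWq : (W : ℤ) + 1 ≤ W ^ 3 := by
    have h1 : (2 : ℤ) ≤ W := by exact_mod_cast hW
    nlinarith [mul_nonneg (sub_nonneg.2 h1) (sub_nonneg.2 h1), sq_nonneg (W : ℤ)]
  have hHz : (1 : ℤ) ≤ H := by exact_mod_cast hH
  have hβlow : -(3 * (W : ℤ) ^ 3 * H) ≤ β p := by
    have h1 : -(2 * (W : ℚ) ^ 3 + W) * H ≤ H / η * b p := by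
      calc -(2 * (W : ℚ) ^ 3 + W) * H = H / η * (-(2 * (W : ℚ) ^ 3 + W) * η) := by field_simp
        _ ≤ _ := by apply mul_le_mul_of_nonneg_left hlow; positivity
    have h2 : ((-(2 * (W : ℤ) ^ 3 + W) * H : ℤ) : ℚ) ≤ H / η * b p := by push_cast; exact h1
    have h3 := Int.le_floor.2 h2
    have h4 : -(2 * (W : ℤ) ^ 3 + W) * H ≤ β p := h3
    nlinarith
  have hup' := hc.loss_le (u := u) (H := H) hg hη hle p
  have hpos0 : 0 ≤ ∑ w ∈ J.filter (fun w => u w = p), max (β w) 0 :=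
    sum_nonneg fun w _ => le_max_right _ _
  have hmin : -(3 * (W : ℤ) ^ 3 * H) ≤ min (β p) 0 := le_min hβlow (by
    have : (0 : ℤ) ≤ 3 * W ^ 3 * H := by positivity
    linarith)
  have hfin : (W : ℤ) * H ≤ 3 * W ^ 3 * H := by nlinarith [sq_nonneg (W : ℤ)]
  rw [abs_le]
  refine ⟨?_, hup'.trans hfin⟩
  rw [loss]
  linarith

end SubmodAlloc

namespace SubmodAlloc
open Finset

/-! ## Projected subgradient descent in integers -/

/-- The usual potential argument for online gradient descent, for a single coordinate: the squared
distance to a fixed comparison point `z` of the interval pays for the difference of the losses up to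
`G ^ 2` per step. The box is a product of intervals, so `z` may be chosen in hindsight for each
coordinate separately. -/
theorem regret_le {Q T : ℕ} {G : ℤ} {x s l : ℕ → ℤ} (hx0 : x 0 = 0) (hs0 : s 0 = 0)
    (hs : ∀ t < T, s (t + 1) = s t + l t) (hx : ∀ t < T, x (t + 1) = max 0 (min (Q : ℤ) (x t - l t)))
    (hl : ∀ t < T, |l t| ≤ G) :
    2 * ∑ t ∈ range T, l t * x t ≤ 2 * Q * min (s T) 0 + Q ^ 2 + T * G ^ 2 := by
  have key : ∀ z : ℤ, 0 ≤ z → z ≤ Q → ∀ t ≤ T,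
      2 * ∑ i ∈ range t, l i * x i - 2 * z * s t ≤ z ^ 2 - (x t - z) ^ 2 + t * G ^ 2 := by
    intro z hz0 hzQ t
    induction t with
    | zero => intro _; simp [hx0, hs0]
    | succ t ih =>
      intro ht
      have h1 := ih (by omega)
      -- Projection to an interval that contains `z` does not increase the distance from `z`.
      have h2 : (x (t + 1) - z) ^ 2 ≤ (x t - l t - z) ^ 2 := by
        rw [hx t (by omega)]
        apply sq_le_sq.2
        rcases le_total 0 (x t - l t) with h | h
        · rcases le_total (Q : ℤ) (x t - l t) with h' | h'
          · rw [min_eq_left h', max_eq_right (by positivity), abs_of_nonneg (by linarith),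
              abs_of_nonneg (by linarith)]
            linarith
          · rw [min_eq_right h', max_eq_right h]
        · rw [max_eq_left (min_le_of_right_le h), abs_of_nonpos (by linarith),
            abs_of_nonpos (by linarith)]
          linarith
      have h3 : (l t) ^ 2 ≤ G ^ 2 := by
        rw [← sq_abs (l t)]
        exact pow_le_pow_left₀ (abs_nonneg _) (hl t (by omega)) 2
      rw [sum_range_succ, hs t (by omega)]
      push_cast
      nlinarith
  -- The best comparison point is the right end `Q` if the total loss is negative, and `0`
  -- otherwise; this produces the minimum with `0`.
  rcases le_total (s T) 0 with h | h
  · have := key Q (by positivity) le_rfl T le_rfl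
    rw [min_eq_left h]
    nlinarith [sq_nonneg (x T - Q)]
  · have := key 0 le_rfl (by positivity) T le_rfl
    rw [min_eq_right h]
    nlinarith [sq_nonneg (x T), sq_nonneg (Q : ℤ)]

variable {W : ℕ} {R : ℕ → ℕ → Prop} {g : Finset ℕ → ℚ} {K J : Finset ℕ}

/-- Number of steps of the descent, which is also the size of its domain. -/
def descentSteps (W : ℕ) : ℕ := (48 * W ^ 5) ^ 2

/-- `x` and `s` are the iterates and the sums of the loss vectors of the projected subgradient
descent that uses greedy vectors scaled by `16 W ^ 2 / η`. -/
structure IsDescent (W : ℕ) (R : ℕ → ℕ → Prop) (g : Finset ℕ → ℚ) (K J : Finset ℕ) (η : ℚ)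
    (key : ℕ → ℕ → ℤ) (u : ℕ → ℕ → ℕ) (x s : ℕ → ℕ → ℤ) : Prop where
  consistent : ∀ t < descentSteps W, IsConsistent W R K J (key t)
  pull : ∀ t < descentSteps W, IsPull R J (key t) (u t) (x t)
  x_zero : ∀ p ∈ J, x 0 p = 0
  s_zero : ∀ p ∈ J, s 0 p = 0
  s_succ : ∀ t < descentSteps W, ∀ p ∈ J, s (t + 1) p = s t p +
    loss J (u t) (fun w => ⌊((16 * W ^ 2 : ℕ) : ℚ) / η * greedy W R g K J (key t) w⌋) p
  x_succ : ∀ t < descentSteps W, ∀ p ∈ J, x (t + 1) p = max 0 (min (descentSteps W : ℤ) (x t p -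
    loss J (u t) (fun w => ⌊((16 * W ^ 2 : ℕ) : ℚ) / η * greedy W R g K J (key t) w⌋) p))

/-- The hypotheses on the function and the scale. -/
structure IsScale (W : ℕ) (R : ℕ → ℕ → Prop) (g : Finset ℕ → ℚ) (J : Finset ℕ) (η : ℚ) :
    Prop where
  submodular : IsSubmodular g
  two_le : 2 ≤ W
  pos : 0 < η
  le : ∀ p ∈ J, g (row W R p) - g (lowerRow W R p) ≤ η

variable {η : ℚ} {key : ℕ → ℕ → ℤ} {u : ℕ → ℕ → ℕ} {x s : ℕ → ℕ → ℤ}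

theorem descentSteps_pos (hW : 2 ≤ W) : 0 < descentSteps W := by
  unfold descentSteps; positivity

namespace IsDescent

theorem s_eq_sum (hd : IsDescent W R g K J η key u x s) {p : ℕ} (hp : p ∈ J) :
    s (descentSteps W) p = ∑ t ∈ range (descentSteps W),
      loss J (u t) (fun w => ⌊((16 * W ^ 2 : ℕ) : ℚ) / η * greedy W R g K J (key t) w⌋) p := by
  have : ∀ T ≤ descentSteps W, s T p = ∑ t ∈ range T,
      loss J (u t) (fun w => ⌊((16 * W ^ 2 : ℕ) : ℚ) / η * greedy W R g K J (key t) w⌋) p := by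
    intro T
    induction T with
    | zero => intro _; simpa using hd.s_zero p hp
    | succ T ih => intro hT; rw [hd.s_succ T (by omega) p hp, ih (by omega), sum_range_succ]
  exact this _ le_rfl

theorem x_mem (hd : IsDescent W R g K J η key u x s) : ∀ t ≤ descentSteps W, ∀ p ∈ J,
    0 ≤ x t p ∧ x t p ≤ descentSteps W := by
  intro t
  cases t with
  | zero => intro _ p hp; rw [hd.x_zero p hp]; simp
  | succ t =>
    intro ht p hp
    rw [hd.x_succ t (by omega) p hp]
    exact ⟨le_max_left _ _, max_le (by positivity) (min_le_left _ _)⟩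

/-- On closed sets, the average of the loss vectors satisfies the same upper bounds as each of them,
so it is a dual certificate for the minimum of `g`. -/
theorem sum_s_le (hd : IsDescent W R g K J η key u x s) (hs : IsScale W R g J η) {X : Finset ℕ}
    (hX : IsClosedSet W R X) (hKX : K ⊆ X) (hXJ : X ⊆ K ∪ J) :
    ((∑ p ∈ J.filter (· ∈ X), s (descentSteps W) p : ℤ) : ℚ) ≤
      descentSteps W * (((16 * W ^ 2 : ℕ) : ℚ) / η * (g X - g K)) := by
  have hη := hs.pos
  have h1 : ∑ p ∈ J.filter (· ∈ X), s (descentSteps W) p =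
      ∑ t ∈ range (descentSteps W), ∑ p ∈ J.filter (· ∈ X), loss J (u t)
        (fun w => ⌊((16 * W ^ 2 : ℕ) : ℚ) / η * greedy W R g K J (key t) w⌋) p := by
    rw [sum_comm]
    exact sum_congr rfl fun p hp => hd.s_eq_sum (mem_filter.1 hp).1
  rw [h1, Int.cast_sum]
  calc _ ≤ ∑ t ∈ range (descentSteps W), ((16 * W ^ 2 : ℕ) : ℚ) / η * (g X - g K) := by
        refine sum_le_sum fun t ht => ?_
        have ht := mem_range.1 ht
        exact (hd.consistent t ht).sum_loss_le hs.submodular (hd.pull t ht) (by positivity)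
          hX hKX hXJ
    _ = _ := by simp

/-- Approximate strong duality: the sum of the negative parts of the certificate comes close to the
scaled minimum. The losses along the iterates are estimated from below through the Lovász extension
and from above by the regret bound; after division by the number of steps `T`, each estimate
contributes an error of `W * T`. -/
theorem le_sum_min (hd : IsDescent W R g K J η key u x s) (hs : IsScale W R g J η)
    (hgap : g K - g (K ∪ J) ≤ 2 * (W : ℚ) ^ 3 * η) {μ : ℚ}
    (hμ : ∀ X, IsClosedSet W R X → K ⊆ X → X ⊆ K ∪ J → μ ≤ g X - g K) :
    descentSteps W * (((16 * W ^ 2 : ℕ) : ℚ) / η * μ) - 2 * W * descentSteps W ≤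
      ((∑ p ∈ J, min (s (descentSteps W) p) 0 : ℤ) : ℚ) := by
  have hη := hs.pos
  have hT0 := descentSteps_pos hs.two_le
  set T := descentSteps W with hT
  set c : ℚ := ((16 * W ^ 2 : ℕ) : ℚ) / η with hcdef
  have hc0 : 0 ≤ c := by positivity
  set l : ℕ → ℕ → ℤ := fun t p => loss J (u t) (fun w => ⌊c * greedy W R g K J (key t) w⌋) p
    with hl
  have hW2 := hs.two_le
  -- The losses are at most `3 * W ^ 3 * (16 * W ^ 2) = 48 * W ^ 5`. The number of steps and the
  -- side of the box are both the square of this, so that the error terms `Q ^ 2` and `T * G ^ 2` of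
  -- the regret bound both equal `T ^ 2`.
  have hG : ((48 * W ^ 5 : ℕ) : ℤ) ^ 2 = T := by rw [hT, descentSteps]; push_cast; ring
  have h1 : ∀ p ∈ J, 2 * ∑ t ∈ range T, l t p * x t p ≤ 2 * T * min (s T p) 0 + 2 * T ^ 2 := by
    intro p hp
    have := regret_le (Q := T) (T := T) (G := (48 * W ^ 5 : ℕ)) (x := fun t => x t p)
      (s := fun t => s t p) (l := fun t => l t p) (hd.x_zero p hp) (hd.s_zero p hp)
      (fun t ht => hd.s_succ t ht p hp) (fun t ht => hd.x_succ t ht p hp)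
      (fun t ht => by
        have := (hd.consistent t ht).abs_loss_le (u := u t) hs.submodular hη
          (H := 16 * W ^ 2) (Nat.succ_le_of_lt (by positivity)) hs.two_le hs.le hgap hp
        refine this.trans (le_of_eq ?_)
        push_cast; ring)
    rw [hG] at this
    linarith
  have h2 := sum_le_sum h1
  have h3 : T * (T * c * μ - W * T) ≤ ((∑ p ∈ J, ∑ t ∈ range T, l t p * x t p : ℤ) : ℚ) := by
    rw [sum_comm, Int.cast_sum]
    calc _ = ∑ t ∈ range T, (T * c * μ - W * T) := by simp; ring
      _ ≤ _ := sum_le_sum fun t ht => by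
        have ht := mem_range.1 ht
        exact (hd.consistent t ht).le_sum_loss_mul hs.submodular (hd.pull t ht) hc0
          (hd.x_mem t ht.le) hμ
  rw [← mul_sum, sum_add_distrib, ← mul_sum, sum_const, nsmul_eq_mul] at h2
  have hcard : (J.card : ℤ) ≤ W := by
    have hT' : 0 < descentSteps W := hT0
    have := card_le_card (hd.consistent 0 hT').subset
    rw [card_range] at this
    exact_mod_cast this
  have h4 : (J.card : ℤ) * (2 * T ^ 2) ≤ W * (2 * T ^ 2) := by gcongr
  have h5 : ∑ p ∈ J, ∑ t ∈ range T, l t p * x t p ≤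
    T * ∑ p ∈ J, min (s T p) 0 + W * T ^ 2 := by linarith
  have h6 : ((∑ p ∈ J, ∑ t ∈ range T, l t p * x t p : ℤ) : ℚ) ≤
    T * ((∑ p ∈ J, min (s T p) 0 : ℤ) : ℚ) + W * T ^ 2 := by exact_mod_cast h5
  have hTq : (0 : ℚ) < T := by exact_mod_cast hT0
  have h7 : (T : ℚ) * (T * (c * μ) - 2 * W * T) ≤ T * ((∑ p ∈ J, min (s T p) 0 : ℤ) : ℚ) := by
    nlinarith
  exact le_of_mul_le_mul_left h7 hTq

theorem sum_s_le_card (hd : IsDescent W R g K J η key u x s) (hs : IsScale W R g J η) {p : ℕ}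
    (hp : p ∈ J) : s (descentSteps W) p ≤ descentSteps W * (W * (16 * W ^ 2 : ℕ)) := by
  have hη := hs.pos
  rw [hd.s_eq_sum hp]
  calc _ ≤ ∑ t ∈ range (descentSteps W), ((W : ℤ) * (16 * W ^ 2 : ℕ)) := by
        refine sum_le_sum fun t ht => ?_
        have ht := mem_range.1 ht
        exact (hd.consistent t ht).loss_le hs.submodular hη hs.le p
    _ = _ := by simp

/-- Over all of `J` the transport along `u` preserves the total, so only the rounding is lost, at
most `W` per step. -/
theorem le_sum_s (hd : IsDescent W R g K J η key u x s) (hs : IsScale W R g J η) :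
    descentSteps W * (((16 * W ^ 2 : ℕ) : ℚ) / η * (g (K ∪ J) - g K)) - descentSteps W * W ≤
      ((∑ p ∈ J, s (descentSteps W) p : ℤ) : ℚ) := by
  have h1 : ∑ p ∈ J, s (descentSteps W) p =
      ∑ t ∈ range (descentSteps W), ∑ p ∈ J, loss J (u t)
        (fun w => ⌊((16 * W ^ 2 : ℕ) : ℚ) / η * greedy W R g K J (key t) w⌋) p := by
    rw [sum_comm]
    exact sum_congr rfl fun p hp => hd.s_eq_sum hp
  rw [h1, Int.cast_sum]
  calc _ = ∑ t ∈ range (descentSteps W), (((16 * W ^ 2 : ℕ) : ℚ) / η * (g (K ∪ J) - g K) - W) := by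
        simp
    _ ≤ _ := sum_le_sum fun t ht => by
      have ht := mem_range.1 ht
      have hc := hd.consistent t ht
      have h2 := sum_loss_mul (hd.pull t ht)
        (fun w => ⌊((16 * W ^ 2 : ℕ) : ℚ) / η * greedy W R g K J (key t) w⌋) (fun _ => 1)
      simp only [mul_one, max_add_min, add_zero] at h2
      rw [h2, Int.cast_sum]
      have h3 : ∑ w ∈ J, (((16 * W ^ 2 : ℕ) : ℚ) / η * greedy W R g K J (key t) w - 1) ≤
          ∑ w ∈ J, ((⌊((16 * W ^ 2 : ℕ) : ℚ) / η * greedy W R g K J (key t) w⌋ : ℤ) : ℚ) :=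
        sum_le_sum fun w _ => (Int.sub_one_lt_floor _).le
      rw [sum_sub_distrib, ← mul_sum, hc.sum_greedy_eq hs.submodular] at h3
      have h4 : ((J.card : ℕ) : ℚ) ≤ W := by
        have := card_le_card hc.subset
        rw [card_range] at this
        exact_mod_cast this
      simp only [sum_const, nsmul_eq_mul, mul_one] at h3
      linarith

/-- An element with a very negative sum is contained in all minimizers. -/
theorem mem_of_lt (hd : IsDescent W R g K J η key u x s) (hs : IsScale W R g J η) {w : ℕ}
    (hw : w ∈ J) (hmin : ∀ p ∈ J, s (descentSteps W) w ≤ s (descentSteps W) p)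
    (hlt : s (descentSteps W) w < -(4 * W * descentSteps W)) {X : Finset ℕ}
    (hX : IsClosedSet W R X) (hKX : K ⊆ X) (hXJ : X ⊆ K ∪ J)
    (hXmin : ∀ Y, IsClosedSet W R Y → K ⊆ Y → Y ⊆ K ∪ J → g X ≤ g Y) : w ∈ X := by
  by_contra hwX
  have hη := hs.pos
  have hT0 := descentSteps_pos hs.two_le
  have h1 := hd.sum_s_le hs hX hKX hXJ
  have hc := hd.consistent 0 hT0
  have hcard : J.card ≤ W := by simpa using card_le_card hc.subset
  have hW2 : (2 : ℚ) ≤ W := by exact_mod_cast hs.two_le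
  have h3 := hd.le_sum_s hs
  have h4 := fun p hp => hd.sum_s_le_card hs (p := p) hp
  have h5 := hd.sum_s_le hs (X := K ∪ J) (by
    rw [← hc.union_rows]; exact hc.closed.union (hc.pre.isClosedSet_rows hc.subset))
    subset_union_left Subset.rfl
  have h6 := fun hgap => hd.le_sum_min hs hgap (μ := g X - g K) fun Y hY hKY hYJ => by
    linarith [hXmin Y hY hKY hYJ]
  have hXKJ := hXmin (K ∪ J) (by
    rw [← hc.union_rows]; exact hc.closed.union (hc.pre.isClosedSet_rows hc.subset))
    subset_union_left Subset.rfl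
  generalize hT : descentSteps W = T at *
  have hTq : (0 : ℚ) < T := by exact_mod_cast hT0
  rcases le_or_gt (g K - g (K ∪ J)) (2 * (W : ℚ) ^ 3 * η) with hgap | hgap
  -- Moderate gap, so the regret bound is available. If `w` were missing from `X`, the negative
  -- parts would sum up to at most `s(X) + s w`, which is more than `4 * W * T` below the scaled
  -- minimum, against an admissible error of `2 * W * T`.
  · have h7 : ∑ p ∈ J, min (s T p) 0 ≤ ∑ p ∈ J.filter (· ∈ X), s T p + s T w := by
      rw [← sum_filter_add_sum_filter_not J (· ∈ X)]
      refine add_le_add (sum_le_sum fun p _ => min_le_left _ _) ?_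
      have hw' : w ∈ J.filter (fun p => ¬ p ∈ X) := mem_filter.2 ⟨hw, hwX⟩
      rw [← add_sum_erase _ _ hw']
      have : ∑ p ∈ (J.filter (fun p => ¬ p ∈ X)).erase w, min (s T p) 0 ≤ 0 :=
        sum_nonpos fun p _ => min_le_right _ _
      linarith [min_le_left (s T w) 0]
    have h8 : ((∑ p ∈ J, min (s T p) 0 : ℤ) : ℚ) ≤
      ((∑ p ∈ J.filter (· ∈ X), s T p : ℤ) : ℚ) + ((s T w : ℤ) : ℚ) := by exact_mod_cast h7
    have h9 : ((s T w : ℤ) : ℚ) < -(4 * W * T) := by exact_mod_cast hlt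
    have h10 := h6 hgap
    nlinarith
  -- Large gap: the losses may be too large for the regret bound, but totals suffice. As `g X ≤ g (K
  -- ∪ J)`, the sum over `X` is bounded above almost by the sum over `J`, so the elements outside of
  -- `X`, and with them `w`, cannot be very negative: `s w ≥ -T * W - 16 * T * W ^ 4`. But `s w` is
  -- minimal and the total is less than `-32 * T * W ^ 5`.
  · have h7 : ((∑ p ∈ J, s T p : ℤ) : ℚ) =
        ((∑ p ∈ J.filter (· ∈ X), s T p : ℤ) : ℚ) +
        ((∑ p ∈ J.filter (fun p => ¬ p ∈ X), s T p : ℤ) : ℚ) := by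
      rw [← sum_filter_add_sum_filter_not J (· ∈ X)]; push_cast; ring
    have hw' : w ∈ J.filter (fun p => ¬ p ∈ X) := mem_filter.2 ⟨hw, hwX⟩
    have h8 : ∑ p ∈ J.filter (fun p => ¬ p ∈ X), s T p ≤
        s T w + W * (T * (W * (16 * W ^ 2 : ℕ))) := by
      rw [← add_sum_erase _ _ hw']
      gcongr
      calc _ ≤ ∑ p ∈ (J.filter (fun p => ¬ p ∈ X)).erase w, ((T : ℤ) * (W * (16 * W ^ 2 : ℕ))) :=
            sum_le_sum fun p hp => h4 p (mem_filter.1 (mem_of_mem_erase hp)).1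
        _ = (((J.filter (fun p => ¬ p ∈ X)).erase w).card : ℤ) * (T * (W * (16 * W ^ 2 : ℕ))) := by
            simp
        _ ≤ _ := by
          gcongr
          exact_mod_cast card_erase_le.trans ((card_filter_le _ _).trans hcard)
    have h9 : W * s T w ≤ ∑ p ∈ J, s T p := by
      have h10 : (J.card : ℤ) * s T w ≤ ∑ p ∈ J, s T p := by
        have := sum_le_sum hmin
        simpa using this
      have h11 : s T w ≤ 0 := by
        have : (0 : ℤ) ≤ 4 * W * T := by positivity
        linarith
      have h12 : (J.card : ℤ) ≤ W := by exact_mod_cast hcard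
      nlinarith
    have h8' : ((∑ p ∈ J.filter (fun p => ¬ p ∈ X), s T p : ℤ) : ℚ) ≤
      ((s T w : ℤ) : ℚ) + W * (T * (W * (16 * W ^ 2))) := by exact_mod_cast h8
    have h9' : (W : ℚ) * ((s T w : ℤ) : ℚ) ≤ ((∑ p ∈ J, s T p : ℤ) : ℚ) := by exact_mod_cast h9
    have h5' : ((∑ p ∈ J, s T p : ℤ) : ℚ) ≤
        T * (((16 * W ^ 2 : ℕ) : ℚ) / η * (g (K ∪ J) - g K)) := by
      have : J.filter (· ∈ K ∪ J) = J := filter_true_of_mem fun p hp => mem_union_right _ hp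
      rwa [this] at h5
    have hmono : ((16 * W ^ 2 : ℕ) : ℚ) / η * (g X - g K) ≤
        ((16 * W ^ 2 : ℕ) : ℚ) / η * (g (K ∪ J) - g K) := by gcongr
    have hbig : ((16 * W ^ 2 : ℕ) : ℚ) / η * (g (K ∪ J) - g K) <
        -(16 * (W : ℚ) ^ 2 * (2 * W ^ 3)) := by
      have : ((16 * W ^ 2 : ℕ) : ℚ) / η * (-(2 * (W : ℚ) ^ 3 * η)) =
        -(16 * (W : ℚ) ^ 2 * (2 * W ^ 3)) := by push_cast; field_simp
      rw [← this]
      have hW0 : 0 < W := by have := hs.two_le; omega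
      apply mul_lt_mul_of_pos_left (by linarith); positivity
    generalize ((16 * W ^ 2 : ℕ) : ℚ) / η * (g (K ∪ J) - g K) = A at *
    generalize ((16 * W ^ 2 : ℕ) : ℚ) / η * (g X - g K) = A' at *
    generalize ((s T w : ℤ) : ℚ) = z at *
    have hAA : (T : ℚ) * A' ≤ T * A := by gcongr
    have h10 : -(T * W : ℚ) - W * (T * (W * (16 * W ^ 2))) ≤ z := by linarith
    have h11 : (T : ℚ) * A < T * -(16 * (W : ℚ) ^ 2 * (2 * W ^ 3)) :=
      mul_lt_mul_of_pos_left hbig hTq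
    have h12 : (W : ℚ) * (-(T * W : ℚ) - W * (T * (W * (16 * W ^ 2)))) ≤ W * z := by gcongr
    have h13 : (T : ℚ) * (W ^ 2) * (16 * W ^ 3 - 1) < 0 := by nlinarith
    have h14 : (1 : ℚ) ≤ W ^ 3 := one_le_pow₀ (by linarith)
    have h15 : 0 ≤ (T : ℚ) * (W ^ 2) * (16 * W ^ 3 - 1) := by
      apply mul_nonneg (by positivity); linarith
    linarith

/-- If there is no very negative sum, then `K` is almost a minimizer. -/
theorem lt_of_forall_le (hd : IsDescent W R g K J η key u x s) (hs : IsScale W R g J η)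
    (hge : ∀ w ∈ J, -(4 * W * descentSteps W) ≤ s (descentSteps W) w) {X : Finset ℕ}
    (hX : IsClosedSet W R X) (hKX : K ⊆ X) (hXJ : X ⊆ K ∪ J) : g K - η / 2 < g X := by
  have hη := hs.pos
  have hT0 := descentSteps_pos hs.two_le
  have h1 := hd.sum_s_le hs hX hKX hXJ
  have hcard : J.card ≤ W := by simpa using card_le_card (hd.consistent 0 hT0).subset
  have hW2 : (2 : ℚ) ≤ W := by exact_mod_cast hs.two_le
  generalize hT : descentSteps W = T at *
  have hTq : (0 : ℚ) < T := by exact_mod_cast hT0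
  have h2 : (W : ℤ) * -(4 * W * T) ≤ ∑ p ∈ J.filter (· ∈ X), s T p := by
    calc (W : ℤ) * -(4 * W * T) ≤ ((J.filter (· ∈ X)).card : ℤ) * -(4 * W * T) := by
          apply mul_le_mul_of_nonpos_right
          · exact_mod_cast (card_filter_le _ _).trans hcard
          · have : (0 : ℤ) ≤ 4 * W * T := by positivity
            linarith
      _ = ∑ p ∈ J.filter (· ∈ X), (-(4 * W * T) : ℤ) := by simp
      _ ≤ _ := sum_le_sum fun p hp => hge p (mem_filter.1 hp).1
  have h3 : (W : ℚ) * -(4 * W * T) ≤ ((∑ p ∈ J.filter (· ∈ X), s T p : ℤ) : ℚ) := by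
    exact_mod_cast h2
  -- After division this says `g X - g K ≥ -η / 4`, which is better than required.
  have h4 : (T : ℚ) * -(4 * W ^ 2) ≤ T * (((16 * W ^ 2 : ℕ) : ℚ) / η * (g X - g K)) := by
    linarith
  have h5 := le_of_mul_le_mul_left h4 hTq
  by_contra hcon
  have h6 : g X - g K ≤ -(η / 2) := by linarith
  have h7 : ((16 * W ^ 2 : ℕ) : ℚ) / η * (g X - g K) ≤ ((16 * W ^ 2 : ℕ) : ℚ) / η * -(η / 2) := by
    gcongr
  have h8 : ((16 * W ^ 2 : ℕ) : ℚ) / η * -(η / 2) = -(8 * W ^ 2) := by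
    push_cast; field_simp; norm_num
  nlinarith

end IsDescent

end SubmodAlloc

namespace SubmodAlloc
open Finset

/-! ## Submodular minimization by deducing implications -/

/-- `Y` minimizes `g` among the subsets of `{0, …, N - 1}`. -/
def IsMin (N : ℕ) (g : Finset ℕ → ℚ) (Y : Finset ℕ) : Prop :=
  Y ⊆ range N ∧ ∀ Z ⊆ range N, g Y ≤ g Z

/-- `R p q` is only allowed if each minimizer that contains `p` contains `q`. The number `N` stands
for an element of all sets, and `N + 1` for an element of no set. -/
structure Implications (N : ℕ) (g : Finset ℕ → ℚ) (R : ℕ → ℕ → Prop) : Prop where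
  pre : IsPre (N + 2) R
  bot : ∀ p < N + 2, R p N
  top : ∀ q < N + 2, R (N + 1) q
  sound : ∀ Y, IsMin N g Y → IsClosedSet (N + 2) R (insert N Y)

open Classical in
/-- The elements that are not known to be outside of all minimizers. -/
noncomputable def alive (N : ℕ) (R : ℕ → ℕ → Prop) : Finset ℕ :=
  (range (N + 2)).filter fun p => ¬ R p (N + 1)

/-- The increase of `g` when `p` is added to the elements that it implies. -/
noncomputable def gain (N : ℕ) (g : Finset ℕ → ℚ) (R : ℕ → ℕ → Prop) (p : ℕ) : ℚ :=
  g (row (N + 2) R p) - g (lowerRow (N + 2) R p)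

/-- Adding the implication `v → w` to the preorder `R`. -/
def addImp (R : ℕ → ℕ → Prop) (v w : ℕ) (p q : ℕ) : Prop := R p q ∨ (R p v ∧ R w q)

/-- The function `g` is submodular and ignores the elements outside of `{0, …, N - 1}`. -/
structure IsSub (N : ℕ) (g : Finset ℕ → ℚ) : Prop where
  submodular : IsSubmodular g
  inter : ∀ A, g (A ∩ range N) = g A

variable {N : ℕ} {g : Finset ℕ → ℚ} {R : ℕ → ℕ → Prop}

theorem mem_alive {p : ℕ} : p ∈ alive N R ↔ p < N + 2 ∧ ¬ R p (N + 1) := by simp [alive]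

theorem exists_isMin (N : ℕ) (g : Finset ℕ → ℚ) : ∃ Y, IsMin N g Y := by
  obtain ⟨Y, hY, h⟩ := exists_min_image (range N).powerset g ⟨∅, by simp⟩
  exact ⟨Y, mem_powerset.1 hY, fun Z hZ => h Z (mem_powerset.2 hZ)⟩

theorem IsMin.le (hg : IsSub N g) {Y : Finset ℕ} (hY : IsMin N g Y) (Z : Finset ℕ) :
    g Y ≤ g Z := by
  rw [← hg.inter Z]; exact hY.2 _ inter_subset_right

theorem IsSub.insert_eq (hg : IsSub N g) (Y : Finset ℕ) : g (insert N Y) = g Y := by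
  rw [← hg.inter, ← hg.inter Y, insert_inter_of_notMem (by simp)]

/-- `r` is the outcome of a search for an element that is contained in all minimizing closed sets
containing `v`: it is the successor of such an element, or `0` if the search failed, and then the
elements implied by `v` almost form a minimizer. -/
def IsOutcome (N : ℕ) (g : Finset ℕ → ℚ) (R : ℕ → ℕ → Prop) (η : ℚ)
    (v r : ℕ) : Prop :=
  (r = 0 ∧ ∀ X, IsClosedSet (N + 2) R X → row (N + 2) R v ⊆ X → X ⊆ alive N R →
    g (row (N + 2) R v) - η / 2 < g X) ∨
  (∃ w, r = w + 1 ∧ w ∈ alive N R ∧ w ∉ row (N + 2) R v ∧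
    ∀ X, IsClosedSet (N + 2) R X → row (N + 2) R v ⊆ X → X ⊆ alive N R →
      (∀ Y, IsClosedSet (N + 2) R Y → row (N + 2) R v ⊆ Y → Y ⊆ alive N R → g X ≤ g Y) → w ∈ X)

namespace Implications

theorem not_bot_top (h : Implications N g R) : ¬ R N (N + 1) := by
  intro hR
  obtain ⟨Y, hY⟩ := exists_isMin N g
  have := h.sound Y hY N (mem_insert_self _ _) (N + 1) (by omega) hR
  rcases mem_insert.1 this with h | h
  · omega
  · have := mem_range.1 (hY.1 h); omega

theorem insert_subset_alive (h : Implications N g R) {Y : Finset ℕ} (hY : IsMin N g Y) :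
    insert N Y ⊆ alive N R := by
  intro p hp
  have hpW : p < N + 2 := by
    rcases mem_insert.1 hp with h | h
    · omega
    · have := mem_range.1 (hY.1 h); omega
  refine mem_alive.2 ⟨hpW, fun hR => ?_⟩
  have := h.sound Y hY p hp (N + 1) (by omega) hR
  rcases mem_insert.1 this with h | h
  · omega
  · have := mem_range.1 (hY.1 h); omega

theorem isClosedSet_alive (h : Implications N g R) : IsClosedSet (N + 2) R (alive N R) := by
  intro p hp q hq hpq
  obtain ⟨hpW, hp⟩ := mem_alive.1 hp
  exact mem_alive.2 ⟨hq, fun hqt => hp (h.pre.trans p hpW q hq (N + 1) (by omega) hpq hqt)⟩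

theorem row_subset_alive (h : Implications N g R) {p : ℕ} (hp : p ∈ alive N R) :
    row (N + 2) R p ⊆ alive N R := fun q hq =>
  h.isClosedSet_alive p hp q (mem_row.1 hq).1 (mem_row.1 hq).2

/-- The composition of two pairs of which at least one is new is again a pair of the extended
relation, so no further transitive closure is needed. -/
theorem addImp (h : Implications N g R) {v w : ℕ} (hv : v < N + 2) (hw : w < N + 2)
    (hvw : ∀ Y, IsMin N g Y → v ∈ insert N Y → w ∈ insert N Y) :
    Implications N g (addImp R v w) where
  pre := by
    refine ⟨fun p hp => Or.inl (h.pre.refl p hp), ?_⟩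
    rintro p hp q hq r hr (h1 | ⟨h1, h2⟩) (h3 | ⟨h3, h4⟩)
    · exact Or.inl (h.pre.trans p hp q hq r hr h1 h3)
    · exact Or.inr ⟨h.pre.trans p hp q hq v hv h1 h3, h4⟩
    · exact Or.inr ⟨h1, h.pre.trans w hw q hq r hr h2 h3⟩
    · exact Or.inr ⟨h1, h4⟩
  bot p hp := Or.inl (h.bot p hp)
  top q hq := Or.inl (h.top q hq)
  sound := by
    rintro Y hY p hp q hq (h1 | ⟨h1, h2⟩)
    · exact h.sound Y hY p hp q hq h1
    · exact h.sound Y hY w (hvw Y hY (h.sound Y hY p hp v hv h1)) q hq h2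

/-- If no gain is positive, then the elements that are alive form a minimizer. -/
theorem alive_min (h : Implications N g R) (hg : IsSub N g)
    (hgain : ∀ p ∈ alive N R, ¬ R N p → gain N g R p ≤ 0) (Z : Finset ℕ) :
    g (alive N R) ≤ g Z := by
  classical
  -- A minimizer of largest cardinality is shown to consist of all elements that are alive.
  obtain ⟨Y, hY, hmax⟩ := exists_max_image ((range N).powerset.filter (IsMin N g)) card (by
    obtain ⟨Y, hY⟩ := exists_isMin N g
    exact ⟨Y, mem_filter.2 ⟨mem_powerset.2 hY.1, hY⟩⟩)
  have hY := (mem_filter.1 hY).2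
  have hYa := h.insert_subset_alive hY
  by_cases heq : insert N Y = alive N R
  · rw [← heq, hg.insert_eq]; exact hY.le hg Z
  · exfalso
    -- By the choice of `p`, all elements strictly below it belong to the minimizer, so `row p`
    -- meets it exactly in `lowerRow p`.
    obtain ⟨p, hp, hpmin⟩ := exists_min_image (alive N R \ insert N Y)
      (fun p => (row (N + 2) R p).card) (by
        rw [sdiff_nonempty]
        exact fun hsub => heq (Subset.antisymm hYa hsub))
    obtain ⟨hpa, hpY⟩ := mem_sdiff.1 hp
    obtain ⟨hpW, hpt⟩ := mem_alive.1 hpa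
    have hcl := h.sound Y hY
    have hbot : ¬ R N p := fun hR => hpY (hcl N (mem_insert_self _ _) p hpW hR)
    have h1 : row (N + 2) R p ∩ insert N Y = lowerRow (N + 2) R p := by
      ext q
      rw [mem_inter, mem_lowerRow, mem_row]
      constructor
      · rintro ⟨⟨hqW, hpq⟩, hq⟩
        exact ⟨hqW, hpq, fun hqp => hpY (hcl q hq p hpW hqp)⟩
      · rintro ⟨hqW, hpq, hqp⟩
        refine ⟨⟨hqW, hpq⟩, ?_⟩
        by_contra hqY
        have hqa := h.row_subset_alive hpa (mem_row.2 ⟨hqW, hpq⟩)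
        have := hpmin q (mem_sdiff.2 ⟨hqa, hqY⟩)
        have hlt : (row (N + 2) R q).card < (row (N + 2) R p).card := by
          apply card_lt_card
          refine ⟨fun r hr => ?_, fun hsub => ?_⟩
          · obtain ⟨hrW, hqr⟩ := mem_row.1 hr
            exact mem_row.2 ⟨hrW, h.pre.trans p hpW q hqW r hrW hpq hqr⟩
          · exact hqp (mem_row.1 (hsub (mem_row.2 ⟨hpW, h.pre.refl p hpW⟩))).2
        omega
    have h2 := hg.submodular (row (N + 2) R p) (insert N Y)
    have h3 := hgain p hpa hbot
    rw [gain] at h3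
    rw [h1, hg.insert_eq] at h2
    set X := row (N + 2) R p ∪ insert N Y with hX
    -- As the gain of `p` is not positive, submodularity shows that adding `row p` keeps the set
    -- optimal; this contradicts the maximality of `Y`.
    have hXmin : IsMin N g (X ∩ range N) := by
      refine ⟨inter_subset_right, fun Z hZ => ?_⟩
      rw [hg.inter]
      have := hY.2 Z hZ
      linarith
    have hle := hmax (X ∩ range N)
      (mem_filter.2 ⟨mem_powerset.2 inter_subset_right, hXmin⟩)
    have hpN : p < N := by
      have : p ≠ N := fun h => hpY (h ▸ mem_insert_self _ _)
      have : p ≠ N + 1 := fun h' => hpt (h' ▸ h.pre.refl p hpW)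
      omega
    have hlt : Y.card < (X ∩ range N).card := by
      apply card_lt_card
      refine ⟨fun q hq => mem_inter.2 ⟨mem_union_right _ (mem_insert_of_mem hq), hY.1 hq⟩,
        fun hsub => hpY (mem_insert_of_mem (hsub (mem_inter.2
          ⟨mem_union_left _ (mem_row.2 ⟨hpW, h.pre.refl p hpW⟩), mem_range.2 hpN⟩)))⟩
    omega

theorem mem_of_isOutcome (h : Implications N g R) (hg : IsSub N g) {v w : ℕ} {η : ℚ}
    (ho : IsOutcome N g R η v (w + 1)) {Y : Finset ℕ} (hY : IsMin N g Y)
    (hv : v ∈ insert N Y) : w ∈ insert N Y := by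
  rcases ho with ⟨h0, _⟩ | ⟨w', hw', _, _, ho⟩
  · omega
  · obtain rfl : w = w' := by omega
    have hcl := h.sound Y hY
    refine ho _ hcl (fun q hq => hcl v hv q (mem_row.1 hq).1 (mem_row.1 hq).2)
      (h.insert_subset_alive hY) fun Z _ _ _ => ?_
    rw [hg.insert_eq]; exact hY.le hg Z

/-- Let `η` be the gain of `v`. For a minimizer `Y` containing `v`, the failed search above `v`
gives `g Y > g (row v) - η / 2 = g (lowerRow v) + η / 2`. The failed search above the bottom
element, applied to the closed set `lowerRow v`, gives `g (lowerRow v) > g (row N) - η / 2`.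
Together `g Y > g (row N)`, which is impossible. -/
theorem not_mem_of_isOutcome (h : Implications N g R) (hg : IsSub N g) {v : ℕ}
    (hv : v ∈ alive N R) (hNv : ¬ R N v)
    (h0 : IsOutcome N g R (gain N g R v) N 0) (h1 : IsOutcome N g R (gain N g R v) v 0)
    {Y : Finset ℕ} (hY : IsMin N g Y) : v ∉ insert N Y := by
  intro hvY
  obtain ⟨hvW, hvt⟩ := mem_alive.1 hv
  rcases h0 with ⟨_, h0⟩ | ⟨w, hw, _⟩
  swap; · omega
  rcases h1 with ⟨_, h1⟩ | ⟨w, hw, _⟩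
  swap; · omega
  have hcl := h.sound Y hY
  have h2 := h1 _ hcl (fun q hq => hcl v hvY q (mem_row.1 hq).1 (mem_row.1 hq).2)
      (h.insert_subset_alive hY)
  rw [hg.insert_eq] at h2
  have h3 := h0 _ (h.pre.isClosedSet_lowerRow hvW) (fun q hq => by
      obtain ⟨hqW, hNq⟩ := mem_row.1 hq
      exact mem_lowerRow.2 ⟨hqW, h.pre.trans v hvW N (by omega) q hqW (h.bot v hvW) hNq,
        fun hqv => hNv (h.pre.trans N (by omega) q hqW v hvW hNq hqv)⟩)
    (fun q hq => h.row_subset_alive hv (mem_row.2 ⟨(mem_lowerRow.1 hq).1, (mem_lowerRow.1 hq).2.1⟩))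
  have h4 := hY.le hg (row (N + 2) R N)
  have h5 : gain N g R v = g (row (N + 2) R v) - g (lowerRow (N + 2) R v) := rfl
  linarith

theorem isConsistent (h : Implications N g R) {v : ℕ} (hv : v ∈ alive N R) {key : ℕ → ℤ}
    (hinj : ∀ p ∈ alive N R \ row (N + 2) R v, ∀ q ∈ alive N R \ row (N + 2) R v,
      key p = key q → p = q)
    (hlt : ∀ p ∈ alive N R \ row (N + 2) R v, ∀ q ∈ alive N R \ row (N + 2) R v,
      R p q → ¬ R q p → key p < key q) :
    IsConsistent (N + 2) R (row (N + 2) R v) (alive N R \ row (N + 2) R v) key where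
  pre := h.pre
  closed := h.pre.isClosedSet_row (mem_alive.1 hv).1
  subset p hp := mem_range.2 (mem_alive.1 (mem_sdiff.1 hp).1).1
  row_subset p hp := by
    rw [union_sdiff_of_subset (h.row_subset_alive hv)]
    exact h.row_subset_alive (mem_sdiff.1 hp).1
  inj := hinj
  lt := hlt

end Implications

/-- The number of pairs in the preorder. -/
noncomputable def relCard (N : ℕ) (R : ℕ → ℕ → Prop) : ℕ :=
  ∑ p ∈ range (N + 2), (row (N + 2) R p).card

theorem relCard_lt_addImp {v w : ℕ} (hR : IsPre (N + 2) R) (hv : v < N + 2) (hw : w < N + 2)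
    (hvw : ¬ R v w) : relCard N R < relCard N (addImp R v w) := by
  have hsub : ∀ p, row (N + 2) R p ⊆ row (N + 2) (addImp R v w) p := fun p q hq =>
    mem_row.2 ⟨(mem_row.1 hq).1, Or.inl (mem_row.1 hq).2⟩
  refine sum_lt_sum (fun p _ => card_le_card (hsub p)) ⟨v, mem_range.2 hv, card_lt_card ?_⟩
  refine ⟨hsub v, fun hsub' => hvw (mem_row.1 (hsub' (mem_row.2 ⟨hw, Or.inr ⟨?_, ?_⟩⟩))).2⟩
  · exact hR.refl v hv
  · exact hR.refl w hw

/-- As long as `v` is alive, the pair `(v, N + 1)` is missing. This bounds the number of deductions.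
-/
theorem relCard_lt {v : ℕ} (hv : v ∈ alive N R) : relCard N R < (N + 2) ^ 2 := by
  obtain ⟨hvW, hvt⟩ := mem_alive.1 hv
  calc relCard N R < ∑ p ∈ range (N + 2), (N + 2) := by
        refine sum_lt_sum (fun p _ => ?_) ⟨v, mem_range.2 hvW, ?_⟩
        · have : row (N + 2) R p ⊆ range (N + 2) := fun q hq => mem_range.2 (mem_row.1 hq).1
          simpa using card_le_card this
        · have : row (N + 2) R v ⊂ range (N + 2) := by
            refine ⟨fun q hq => mem_range.2 (mem_row.1 hq).1, fun hsub => hvt ?_⟩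
            exact (mem_row.1 (hsub (mem_range.2 (by omega : N + 1 < N + 2)))).2
          simpa using card_lt_card this
    _ = _ := by simp; ring

open Classical in
/-- The implication that is deduced from the outcomes of the two searches. -/
noncomputable def deduced (N v r r' : ℕ) : ℕ × ℕ :=
  if 0 < r then (N, r - 1) else if 0 < r' then (v, r' - 1) else (v, N + 1)

/-- Progress in all cases: a successful search yields a pair that is new because its target is not
in the row of the pivot; two failed searches exclude `v` from all minimizers, which is recorded as
`v → N + 1`. -/
theorem Implications.deduce (h : Implications N g R) (hg : IsSub N g) {v r r' : ℕ}
    (hv : v ∈ alive N R) (hNv : ¬ R N v)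
    (hr : IsOutcome N g R (gain N g R v) N r) (hr' : IsOutcome N g R (gain N g R v) v r') :
    Implications N g (SubmodAlloc.addImp R (deduced N v r r').1 (deduced N v r r').2) ∧
    relCard N R < relCard N (SubmodAlloc.addImp R (deduced N v r r').1 (deduced N v r r').2) := by
  obtain ⟨hvW, hvt⟩ := mem_alive.1 hv
  unfold deduced
  rcases Nat.eq_zero_or_pos r with h0 | h0
  · subst h0
    rcases Nat.eq_zero_or_pos r' with h1 | h1
    · subst h1
      simp only [lt_irrefl, if_false]
      exact ⟨h.addImp hvW (by omega) fun Y hY hvY =>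
        absurd hvY (h.not_mem_of_isOutcome hg hv hNv hr hr' hY),
        relCard_lt_addImp h.pre hvW (by omega) hvt⟩
    · obtain ⟨w, rfl⟩ : ∃ w, r' = w + 1 := ⟨r' - 1, by omega⟩
      simp only [lt_irrefl, if_false, h1, if_true, Nat.add_sub_cancel]
      rcases id hr' with ⟨h2, _⟩ | ⟨w', hw', hwa, hwr, _⟩
      · omega
      obtain rfl : w = w' := by omega
      have hwW := (mem_alive.1 hwa).1
      exact ⟨h.addImp hvW hwW fun Y hY hvY => h.mem_of_isOutcome hg hr' hY hvY,
        relCard_lt_addImp h.pre hvW hwW fun hR => hwr (mem_row.2 ⟨hwW, hR⟩)⟩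
  · obtain ⟨w, rfl⟩ : ∃ w, r = w + 1 := ⟨r - 1, by omega⟩
    simp only [h0, if_true, Nat.add_sub_cancel]
    rcases id hr with ⟨h2, _⟩ | ⟨w', hw', hwa, hwr, _⟩
    · omega
    obtain rfl : w = w' := by omega
    have hwW := (mem_alive.1 hwa).1
    exact ⟨h.addImp (by omega) hwW fun Y hY hvY => h.mem_of_isOutcome hg hr hY hvY,
      relCard_lt_addImp h.pre (by omega) hwW fun hR => hwr (mem_row.2 ⟨hwW, hR⟩)⟩

/-- No implication can be deduced, because no gain is positive. -/
def IsFinal (N : ℕ) (g : Finset ℕ → ℚ) (R : ℕ → ℕ → Prop) : Prop :=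
  ∀ p ∈ alive N R, ¬ R N p → gain N g R p ≤ 0

/-- The trivial implications. -/
def trivialImp (N p q : ℕ) : Prop := p = q ∨ q = N ∨ p = N + 1

theorem implications_trivialImp (N : ℕ) (g : Finset ℕ → ℚ) :
    Implications N g (trivialImp N) where
  pre := ⟨fun p _ => Or.inl rfl, by
    rintro p _ q _ r _ (rfl | rfl | rfl) (rfl | rfl | h)
    · exact Or.inl rfl
    · exact Or.inr (Or.inl rfl)
    · exact Or.inr (Or.inr h)
    · exact Or.inr (Or.inl rfl)
    · exact Or.inr (Or.inl rfl)
    · omega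
    · exact Or.inr (Or.inr rfl)
    · exact Or.inr (Or.inr rfl)
    · exact Or.inr (Or.inr rfl)⟩
  bot p _ := Or.inr (Or.inl rfl)
  top p _ := Or.inr (Or.inr rfl)
  sound := by
    rintro Y hY p hp q _ (rfl | rfl | rfl)
    · exact hp
    · exact mem_insert_self _ _
    · rcases mem_insert.1 hp with h | h
      · omega
      · have := mem_range.1 (hY.1 h); omega

end SubmodAlloc

namespace SubmodAlloc
open Finset

/-! ## The dual ascent -/

/-- One variable of the dual solution has been raised to `h A / m A`, and `j` steps of the discrete
Newton method have been made. -/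
structure NewtonState (N : ℕ) (h : Finset ℕ → ℚ) (m : Finset ℕ → ℕ) (k j : ℕ) (A : Finset ℕ) :
    Prop where
  subset : A ⊆ range N
  pos : 0 < m A
  bound : ∀ C, IsMin N (fun Z => h Z - h A / m A * m Z) C → h C - h A / m A * m C < 0 →
    m C + j ≤ k

/-- Let `C` be a minimizer for the ratio `a` of `A` with negative value, so that its own ratio `a'`
is less than `a`, and let `D` be a minimizer with negative value for `a'`. Subtracting the
optimality of `C` at `a` from the negativity of `D` at `a'` leaves `(a - a') * (m D - m C) < 0`.
Hence `m` strictly decreases, and at most `k` improvements are possible. -/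
theorem NewtonState.step {N : ℕ} {h : Finset ℕ → ℚ} {m : Finset ℕ → ℕ} {k j : ℕ} {A C : Finset ℕ}
    (hs : NewtonState N h m k j A) (h0 : ∀ Z ⊆ range N, 0 ≤ h Z)
    (hC : IsMin N (fun Z => h Z - h A / m A * m Z) C) :
    NewtonState N h m k (j + 1) (if h C - h A / m A * m C < 0 then C else A) := by
  split_ifs with hneg
  · have hmA : (0 : ℚ) < m A := by exact_mod_cast hs.pos
    have hmC : 0 < m C := by
      rcases Nat.eq_zero_or_pos (m C) with h1 | h1
      · have := h0 C hC.1
        rw [h1] at hneg; simp at hneg; linarith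
      · exact h1
    have hmC' : (0 : ℚ) < m C := by exact_mod_cast hmC
    refine ⟨hC.1, hmC, fun D hD hDneg => ?_⟩
    have h1 := hs.bound C hC hneg
    have h2 := hC.2 D hD.1
    simp only at h2
    have h3 : h C = h C / m C * m C := by field_simp
    have h4 : h C / m C < h A / m A := by rw [div_lt_iff₀ hmC']; linarith
    have h5 : (h A / m A - h C / m C) * (m D - m C) < 0 := by nlinarith
    have h6 : (m D : ℚ) < m C := by
      by_contra hcon
      have : 0 ≤ (h A / m A - h C / m C) * ((m D : ℚ) - m C) :=
        mul_nonneg (by linarith) (by linarith)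
      linarith
    have h7 : m D < m C := by exact_mod_cast h6
    omega
  · refine ⟨hs.subset, hs.pos, fun D hD hDneg => ?_⟩
    have h2 := hC.2 D hD.1
    simp only at h2
    linarith

/-- After `k` steps a negative minimizer would have multiplicity `0`, and then its value is `h C ≥
0`. -/
theorem NewtonState.nonneg {N : ℕ} {h : Finset ℕ → ℚ} {m : Finset ℕ → ℕ} {k : ℕ} {A : Finset ℕ}
    (hs : NewtonState N h m k k A) (h0 : ∀ Z ⊆ range N, 0 ≤ h Z) {Z : Finset ℕ}
    (hZ : Z ⊆ range N) : 0 ≤ h Z - h A / m A * m Z := by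
  by_contra hneg
  obtain ⟨C, hC⟩ := exists_isMin N (fun Z => h Z - h A / m A * m Z)
  have h1 : h C - h A / m A * m C < 0 := (hC.2 Z hZ).trans_lt (not_le.1 hneg)
  have h2 := hs.bound C hC h1
  have h3 : m C = 0 := by omega
  rw [h3] at h1
  have := h0 C hC.1
  simp at h1; linarith

/-- A normalized monotone submodular function that ignores the elements outside of
`{0, …, N - 1}`. -/
structure IsPolymatroid (N : ℕ) (F : Finset ℕ → ℚ) : Prop where
  submodular : IsSubmodular F
  inter : ∀ A, F (A ∩ range N) = F A
  mono : ∀ A B, A ⊆ B → F A ≤ F B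
  empty : F ∅ = 0

/-- The reduced function for the dual solution `y`. -/
def reduced (N : ℕ) (F : Finset ℕ → ℚ) (y : ℕ → ℚ) (A : Finset ℕ) : ℚ :=
  F A - ∑ e ∈ A ∩ range N, y e

theorem IsPolymatroid.isSub_reduced {N : ℕ} {F : Finset ℕ → ℚ} (hF : IsPolymatroid N F)
    (y : ℕ → ℚ) : IsSub N (reduced N F y) where
  submodular S T := by
    have h1 := hF.submodular S T
    have h2 := sum_union_inter (s₁ := S ∩ range N) (s₂ := T ∩ range N) (f := y)
    rw [← union_inter_distrib_right, ← inter_inter_distrib_right] at h2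
    unfold reduced
    linarith
  inter A := by
    unfold reduced
    rw [hF.inter, inter_assoc, inter_self]

/-- The reduced function without the elements congruent to `v`. -/
def reducedWithout (n : ℕ) (F : Finset ℕ → ℚ) (y : ℕ → ℚ) (v : ℕ) (A : Finset ℕ) : ℚ :=
  F A - ∑ e ∈ A.filter (fun e => ¬ e % n = v), y e

/-- The number of elements congruent to `v`. -/
def multiplicity (n v : ℕ) (A : Finset ℕ) : ℕ := (A.filter fun e => e % n = v).card

/-- Changing the dual variable of `v` to `a`. -/
def raise (n v : ℕ) (a : ℚ) (y : ℕ → ℚ) (e : ℕ) : ℚ := if e % n = v then a else y e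

theorem sum_raise (n v : ℕ) (a : ℚ) (y : ℕ → ℚ) (A : Finset ℕ) :
    ∑ e ∈ A, raise n v a y e =
      a * multiplicity n v A + ∑ e ∈ A.filter (fun e => ¬ e % n = v), y e := by
  unfold raise multiplicity
  rw [sum_ite, sum_const, nsmul_eq_mul]; ring

theorem reduced_raise {N n v : ℕ} {F : Finset ℕ → ℚ} {a : ℚ} {y : ℕ → ℚ} {A : Finset ℕ}
    (hA : A ⊆ range N) : reduced N F (raise n v a y) A =
      reducedWithout n F y v A - a * multiplicity n v A := by
  rw [reduced, inter_eq_left.2 hA, sum_raise, reducedWithout]; ring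

/-- The dual solution `y` after the treatment of the elements `0, …, v - 1`, and a tight set `B`
that covers them. -/
structure DualState (n N : ℕ) (F : Finset ℕ → ℚ) (v : ℕ) (y : ℕ → ℚ) (B : Finset ℕ) : Prop where
  zero : ∀ e < N, v ≤ e % n → y e = 0
  congr : ∀ e < N, ∀ e' < N, e % n = e' % n → y e = y e'
  nonneg : ∀ e < N, 0 ≤ y e
  feasible : ∀ A ⊆ range N, ∑ e ∈ A, y e ≤ F A
  subset : B ⊆ range N
  tight : ∑ e ∈ B, y e = F B
  cover : ∀ w < v, ∃ e ∈ B, e % n = w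

theorem dualState_zero {n N : ℕ} {F : Finset ℕ → ℚ} (hF : IsPolymatroid N F) :
    DualState n N F 0 (fun _ => 0) ∅ where
  zero _ _ _ := rfl
  congr _ _ _ _ _ := rfl
  nonneg _ _ := le_rfl
  feasible A _ := by simpa [hF.empty] using hF.mono ∅ A (empty_subset A)
  subset := empty_subset _
  tight := by simp [hF.empty]
  cover w hw := by omega

theorem DualState.reducedWithout_nonneg {n N v : ℕ} {F : Finset ℕ → ℚ} {y : ℕ → ℚ} {B : Finset ℕ}
    (hd : DualState n N F v y B) {Z : Finset ℕ} (hZ : Z ⊆ range N) :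
    0 ≤ reducedWithout n F y v Z := by
  have h1 := hd.feasible Z hZ
  have h2 := sum_filter_add_sum_filter_not Z (fun e => e % n = v) y
  have h3 : 0 ≤ ∑ e ∈ Z.filter (fun e => e % n = v), y e :=
    sum_nonneg fun e he => hd.nonneg e (mem_range.1 (hZ (mem_filter.1 he).1))
  unfold reducedWithout
  linarith

/-- The Newton method ends with the largest feasible value `a` of the dual variable, at which `A` is
tight. Before that the variable was `0`, so no entry of `y` decreases, and the tight sets `B` and
`A` can be uncrossed. -/
theorem DualState.step {n N k v : ℕ} {F : Finset ℕ → ℚ} {y : ℕ → ℚ} {A B : Finset ℕ}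
    (hF : IsPolymatroid N F) (hd : DualState n N F v y B)
    (hA : NewtonState N (reducedWithout n F y v) (multiplicity n v) k k A) :
    DualState n N F (v + 1)
      (raise n v (reducedWithout n F y v A / multiplicity n v A) y) (B ∪ A) := by
  have hmA : (0 : ℚ) < multiplicity n v A := by exact_mod_cast hA.pos
  set a := reducedWithout n F y v A / multiplicity n v A with ha
  have ha0 : 0 ≤ a := div_nonneg (hd.reducedWithout_nonneg hA.subset) hmA.le
  have hfeas : ∀ Z ⊆ range N, ∑ e ∈ Z, raise n v a y e ≤ F Z := by
    intro Z hZ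
    have := hA.nonneg (fun Z hZ => hd.reducedWithout_nonneg hZ) hZ
    rw [← ha, ← reduced_raise hZ, reduced, inter_eq_left.2 hZ] at this
    linarith
  have hle : ∀ e < N, y e ≤ raise n v a y e := by
    intro e he
    unfold raise
    split_ifs with h
    · rw [hd.zero e he h.ge]; exact ha0
    · exact le_rfl
  have hBA : B ∪ A ⊆ range N := union_subset hd.subset hA.subset
  refine ⟨?_, ?_, fun e he => (hd.nonneg e he).trans (hle e he), hfeas, hBA, ?_, ?_⟩
  · intro e he hve
    rw [raise, if_neg (by omega), hd.zero e he (by omega)]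
  · intro e he e' he' hee
    unfold raise
    rw [hee, hd.congr e he e' he' hee]
  -- The old set stays tight: its `y`-value cannot decrease, and feasibility prevents it from
  -- exceeding `F B`.
  · have h1 : F B ≤ ∑ e ∈ B, raise n v a y e := by
      rw [← hd.tight]
      exact sum_le_sum fun e he => hle e (mem_range.1 (hd.subset he))
    have h2 : F A = ∑ e ∈ A, raise n v a y e := by
      have h3 : reduced N F (raise n v a y) A = 0 := by
        rw [reduced_raise hA.subset, ha]; field_simp; ring
      rw [reduced, inter_eq_left.2 hA.subset] at h3
      linarith
    have h3 := hF.submodular B A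
    have h4 := hfeas (B ∩ A) (inter_subset_left.trans hd.subset)
    have h5 := hfeas (B ∪ A) hBA
    have h6 := sum_union_inter (s₁ := B) (s₂ := A) (f := raise n v a y)
    linarith
  · intro w hw
    rcases Nat.lt_succ_iff_lt_or_eq.1 hw with hw | rfl
    · obtain ⟨e, he, hew⟩ := hd.cover w hw
      exact ⟨e, mem_union_left _ he, hew⟩
    · obtain ⟨e, he⟩ := card_pos.1 hA.pos
      exact ⟨e, mem_union_right _ (mem_filter.1 he).1, (mem_filter.1 he).2⟩

theorem multiplicity_le {n k v : ℕ} {C : Finset ℕ} (hC : C ⊆ range (n * k)) :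
    multiplicity n v C ≤ k := by
  have : C.filter (fun e => e % n = v) ⊆ (range k).image (fun i => i * n + v) := by
    intro e he
    obtain ⟨heC, hev⟩ := mem_filter.1 he
    refine mem_image.2 ⟨e / n, mem_range.2 ?_, ?_⟩
    · exact Nat.div_lt_of_lt_mul (mem_range.1 (hC heC))
    · rw [← hev, mul_comm]; exact Nat.div_add_mod e n
  exact (card_le_card this).trans (card_image_le.trans (by simp))

theorem newtonState_zero {n k v : ℕ} (h : Finset ℕ → ℚ) (hk : 1 ≤ k) (hv : v < n) :
    NewtonState (n * k) h (multiplicity n v) k 0 (range (n * k)) := by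
  refine ⟨Subset.rfl, card_pos.2 ⟨v, mem_filter.2 ⟨mem_range.2 ?_, Nat.mod_eq_of_lt hv⟩⟩,
    fun C hC _ => by simpa using multiplicity_le hC.1⟩
  nlinarith

/-! ## Tuples of sets and sets of numbers -/

/-- The tuple of sets that is represented by a set of numbers. -/
def tupleOf (n k : ℕ) (A : Finset ℕ) (i : Fin k) : Finset (Fin n) :=
  univ.filter fun v => (i : ℕ) * n + v ∈ A

/-- The set of numbers that represents a tuple of sets. -/
def ofTuple {n k : ℕ} (T : Fin k → Finset (Fin n)) : Finset ℕ :=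
  univ.biUnion fun i => (T i).image fun v : Fin n => (i : ℕ) * n + (v : ℕ)

/-- The normalization of a function of tuples, as a function of sets of numbers. -/
def normalized {n k : ℕ} (f : (Fin k → Finset (Fin n)) → ℚ) (A : Finset ℕ) : ℚ :=
  f (tupleOf n k A) - f fun _ => ∅

theorem mem_tupleOf {n k : ℕ} {A : Finset ℕ} {i : Fin k} {v : Fin n} :
    v ∈ tupleOf n k A i ↔ (i : ℕ) * n + v ∈ A := by simp [tupleOf]

theorem index_lt {n k : ℕ} (i : Fin k) (v : Fin n) : (i : ℕ) * n + v < n * k := by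
  have h1 := i.2
  have h2 := v.2
  nlinarith

theorem index_mod {n : ℕ} (i : ℕ) (v : Fin n) : (i * n + (v : ℕ)) % n = v := by
  rw [Nat.add_comm, Nat.add_mul_mod_self_right, Nat.mod_eq_of_lt v.2]

theorem index_div {n : ℕ} (i : ℕ) (v : Fin n) : (i * n + (v : ℕ)) / n = i := by
  have h : 0 < n := v.pos
  rw [Nat.add_comm, Nat.add_mul_div_right _ _ h, Nat.div_eq_of_lt v.2, Nat.zero_add]

theorem tupleOf_ofTuple {n k : ℕ} (T : Fin k → Finset (Fin n)) :
    tupleOf n k (ofTuple T) = T := by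
  ext i v
  rw [mem_tupleOf]
  simp only [ofTuple, mem_biUnion, mem_univ, true_and, mem_image]
  constructor
  · rintro ⟨j, w, hw, h⟩
    have h1 := congrArg (· % n) h
    have h2 := congrArg (· / n) h
    simp only [index_mod, index_div] at h1 h2
    rw [← Fin.ext h1, ← Fin.ext h2]; exact hw
  · intro h; exact ⟨i, v, h, rfl⟩

theorem ofTuple_subset {n k : ℕ} (T : Fin k → Finset (Fin n)) : ofTuple T ⊆ range (n * k) := by
  intro e he
  simp only [ofTuple, mem_biUnion, mem_univ, true_and, mem_image] at he
  obtain ⟨i, v, _, rfl⟩ := he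
  exact mem_range.2 (index_lt i v)

theorem isPolymatroid_normalized {n k : ℕ} {f : (Fin k → Finset (Fin n)) → ℚ}
    (hm : IsMultiMonotone f) (hs : IsMultiSubmodular f) :
    IsPolymatroid (n * k) (normalized f) where
  submodular S T := by
    have h := hs (tupleOf n k S) (tupleOf n k T)
    have h1 : (fun i => tupleOf n k S i ∪ tupleOf n k T i) = tupleOf n k (S ∪ T) := by
      ext i v; simp [mem_tupleOf]
    have h2 : (fun i => tupleOf n k S i ∩ tupleOf n k T i) = tupleOf n k (S ∩ T) := by
      ext i v; simp [mem_tupleOf]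
    rw [h1, h2] at h
    unfold normalized
    linarith
  inter A := by
    have : tupleOf n k (A ∩ range (n * k)) = tupleOf n k A := by
      ext i v; simp [mem_tupleOf, index_lt i v]
    rw [normalized, this, normalized]
  mono A B hAB := by
    have := hm (tupleOf n k A) (tupleOf n k B) fun i v hv =>
      mem_tupleOf.2 (hAB (mem_tupleOf.1 hv))
    unfold normalized
    linarith
  empty := by
    have : tupleOf n k ∅ = fun _ => ∅ := by ext i v; simp [mem_tupleOf]
    rw [normalized, this, sub_self]

/-- The least representatives of the classes modulo `n` in `B`. -/
def leastReps (n : ℕ) (B : Finset ℕ) : Finset ℕ :=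
  B.filter fun e => ∀ e' < e, e' ∈ B → ¬ e' % n = e % n

theorem isAllocation_leastReps {n k : ℕ} {B : Finset ℕ} (hB : B ⊆ range (n * k))
    (hcover : ∀ w < n, ∃ e ∈ B, e % n = w) : IsAllocation (tupleOf n k (leastReps n B)) := by
  constructor
  · intro i j hij
    rw [disjoint_left]
    intro v hi hj
    obtain ⟨hi1, hi2⟩ := mem_filter.1 (mem_tupleOf.1 hi)
    obtain ⟨hj1, hj2⟩ := mem_filter.1 (mem_tupleOf.1 hj)
    have hne : (i : ℕ) ≠ j := fun h => hij (Fin.ext h)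
    have hv := v.pos
    rcases lt_or_gt_of_ne hne with h | h
    · exact hj2 _ (by nlinarith) hi1 (by rw [index_mod, index_mod])
    · exact hi2 _ (by nlinarith) hj1 (by rw [index_mod, index_mod])
  · intro v
    have hne : (B.filter fun e => e % n = v).Nonempty := by
      obtain ⟨e, he, hev⟩ := hcover v v.2
      exact ⟨e, mem_filter.2 ⟨he, hev⟩⟩
    set e := (B.filter fun e => e % n = v).min' hne with he
    obtain ⟨heB, hev⟩ := mem_filter.1 (min'_mem _ hne)
    have hlt := mem_range.1 (hB heB)
    refine ⟨⟨e / n, Nat.div_lt_of_lt_mul hlt⟩, mem_tupleOf.2 ?_⟩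
    have : e / n * n + (v : ℕ) = e := by
      rw [← hev, ← he, mul_comm]; exact Nat.div_add_mod e n
    simp only [this]
    refine mem_filter.2 ⟨heB, fun e' he' he'B hmod => ?_⟩
    have := min'_le (B.filter fun e => e % n = v) e' (mem_filter.2 ⟨he'B, hmod.trans hev⟩)
    rw [← he] at this
    omega

/-- The tight set gives an approximate solution. -/
theorem isApproxMin_of_dualState {n k : ℕ} {f : (Fin k → Finset (Fin n)) → ℚ} (hk : 1 ≤ k)
    (h0 : ∀ S, 0 ≤ f S) (hm : IsMultiMonotone f) {y : ℕ → ℚ} {B : Finset ℕ}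
    (hd : DualState n (n * k) (normalized f) n y B) :
    IsApproxMin (k : ℚ) f (tupleOf n k (leastReps n B)) := by
  refine ⟨isAllocation_leastReps hd.subset hd.cover, fun T hT => ?_⟩
  have h1 : f (tupleOf n k (leastReps n B)) ≤ f (tupleOf n k B) :=
    hm _ _ fun i v hv => mem_tupleOf.2 (mem_filter.1 (mem_tupleOf.1 hv)).1
  -- Each class modulo `n` has at most `k` elements, one for every index of the tuple. This is the
  -- only place where the factor `k` is lost.
  have h2 : ∑ e ∈ B, y e ≤ k * ∑ v ∈ range n, y v := by
    calc _ ≤ ∑ e ∈ range (n * k), y e :=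
          sum_le_sum_of_subset_of_nonneg hd.subset fun e he _ => hd.nonneg e (mem_range.1 he)
      _ = ∑ e ∈ range (n * k), y (e % n) := by
          refine sum_congr rfl fun e he => ?_
          have hlt := mem_range.1 he
          have hmod := Nat.mod_le e n
          exact hd.congr e hlt (e % n) (by omega) (Nat.mod_mod e n).symm
      _ = ∑ v ∈ range n, ∑ e ∈ (range (n * k)).filter (fun e => e % n = v), y (e % n) := by
          refine (sum_fiberwise_of_maps_to (fun e he => ?_) _).symm
          have hlt := mem_range.1 he
          exact mem_range.2 (Nat.mod_lt _ (Nat.pos_of_ne_zero fun h => by simp [h] at hlt))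
      _ ≤ ∑ v ∈ range n, k * y v := by
          refine sum_le_sum fun v hv => ?_
          have hv := mem_range.1 hv
          have hyv : 0 ≤ y v := hd.nonneg v (by nlinarith)
          have hcongr : ∑ e ∈ (range (n * k)).filter (fun e => e % n = v), y (e % n) =
              ∑ e ∈ (range (n * k)).filter (fun e => e % n = v), y v :=
            sum_congr rfl fun e he => by rw [(mem_filter.1 he).2]
          rw [hcongr, sum_const, nsmul_eq_mul]
          have : multiplicity n v (range (n * k)) ≤ k := multiplicity_le Subset.rfl
          have : ((multiplicity n v (range (n * k)) : ℕ) : ℚ) ≤ k := by exact_mod_cast this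
          exact mul_le_mul_of_nonneg_right this hyv
      _ = _ := by rw [mul_sum]
  -- Weak duality: an allocation contains a representative of every class, and representatives of
  -- different classes are different.
  have h3 : ∑ v ∈ range n, y v ≤ ∑ e ∈ ofTuple T, y e := by
    have hex : ∀ v : Fin n, ∃ i : Fin k, v ∈ T i := hT.2
    choose i hi using hex
    have hinj : Set.InjOn (fun v : Fin n => (i v : ℕ) * n + v) (univ : Finset (Fin n)) := by
      intro v _ w _ h
      have := congrArg (· % n) h
      simp only [index_mod] at this
      exact Fin.ext this
    calc ∑ v ∈ range n, y v = ∑ v : Fin n, y v := (Fin.sum_univ_eq_sum_range y n).symm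
      _ = ∑ v : Fin n, y ((i v : ℕ) * n + v) := by
          refine sum_congr rfl fun v _ => ?_
          have h1 := v.2
          refine hd.congr v (by nlinarith) _ (index_lt _ _) ?_
          rw [index_mod, Nat.mod_eq_of_lt v.2]
      _ = ∑ e ∈ (univ : Finset (Fin n)).image (fun v => (i v : ℕ) * n + v), y e :=
          (sum_image hinj).symm
      _ ≤ _ := by
          refine sum_le_sum_of_subset_of_nonneg (fun e he => ?_) fun e he _ =>
            hd.nonneg e (mem_range.1 (ofTuple_subset T he))
          obtain ⟨v, _, rfl⟩ := mem_image.1 he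
          exact mem_biUnion.2 ⟨i v, mem_univ _, mem_image.2 ⟨v, hi v, rfl⟩⟩
  have h4 := hd.feasible (ofTuple T) (ofTuple_subset T)
  have h5 := hd.tight
  rw [normalized, tupleOf_ofTuple] at h4
  rw [normalized] at h5
  -- Undoing the normalization: `f(B) ≤ k * (f(T) - f(∅)) + f(∅) ≤ k * f(T)`.
  have hk' : (1 : ℚ) ≤ k := by exact_mod_cast hk
  have h6 := h0 fun _ => ∅
  nlinarith

end SubmodAlloc

namespace SubmodAlloc
open Finset Function

/-! ## Derived expressions -/

open Classical in
/-- Truth values as integers. -/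
noncomputable def bi (P : Prop) : ℤ := if P then 1 else 0

theorem bi_pos {P : Prop} (h : P) : bi P = 1 := by simp [bi, h]

theorem bi_neg {P : Prop} (h : ¬ P) : bi P = 0 := by simp [bi, h]

theorem bi_congr {P Q : Prop} (h : P ↔ Q) : bi P = bi Q := by rw [propext h]

theorem bi_mul (P Q : Prop) : bi P * bi Q = bi (P ∧ Q) := by
  by_cases hP : P <;> by_cases hQ : Q <;> simp [bi, hP, hQ]

theorem one_sub_bi (P : Prop) : 1 - bi P = bi (¬ P) := by
  by_cases hP : P <;> simp [bi, hP]

theorem bi_nonneg (P : Prop) : 0 ≤ bi P := by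
  by_cases hP : P <;> simp [bi, hP]

theorem bi_le_one (P : Prop) : bi P ≤ 1 := by
  by_cases hP : P <;> simp [bi, hP]

/-- Expressions have no search operator; a uniquely determined element is found by a sum in which
only its term survives. -/
theorem sum_bi_mul_of_unique {M : ℕ} {P : ℕ → Prop} {f : ℕ → ℤ} {w : ℕ} (hw : w < M)
    (hP : ∀ l < M, P l ↔ l = w) : ∑ l ∈ range M, bi (P l) * f l = f w := by
  rw [sum_eq_single w]
  · rw [bi_pos ((hP w hw).2 rfl), one_mul]
  · intro l hl hne
    rw [bi_neg fun h => hne ((hP l (mem_range.1 hl)).1 h), zero_mul]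
  · intro h; exact absurd (mem_range.2 hw) h

namespace AExpr

/-- Negation of a truth value. -/
def eNot (a : AExpr) : AExpr := .bin .sub (.const 1) a

/-- Conjunction of truth values, and product. -/
def eMul (a b : AExpr) : AExpr := .bin .mul a b

/-- Sum. -/
def eAdd (a b : AExpr) : AExpr := .bin .add a b

/-- Difference. -/
def eSub (a b : AExpr) : AExpr := .bin .sub a b

/-- Quotient. -/
def eDiv (a b : AExpr) : AExpr := .bin .div a b

/-- Comparison. -/
def eLt (a b : AExpr) : AExpr := .bin .lt a b

/-- Disjunction of truth values. -/
def eOr (a b : AExpr) : AExpr := eLt (.const 0) (eAdd a b)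

/-- Sum over an index. -/
def eSum (i : ℕ) (j : Fin 8) (a : AExpr) : AExpr := .fold false i j a

/-- Existential quantification over an index. -/
def eEx (i : ℕ) (j : Fin 8) (a : AExpr) : AExpr := eLt (.const 0) (eSum i j a)

/-- Equality. -/
def eEq (a b : AExpr) : AExpr := eMul (eNot (eLt a b)) (eNot (eLt b a))

/-- Case distinction. -/
def eIf (c a b : AExpr) : AExpr := eAdd (eMul c a) (eMul (eNot c) b)

variable {O : Oracle} {h : AState} {ρ : ℕ → ℤ} {a b c : AExpr} {P Q : Prop}

@[simp] theorem eval_const (z : ℤ) : (const z).eval O h ρ = z := rfl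
@[simp] theorem eval_sz (j : Fin 8) : (sz j).eval O h ρ = h.sz j := rfl
@[simp] theorem eval_var (j : Fin 8) : (var j).eval O h ρ = h.var j := rfl
@[simp] theorem eval_ix (i : ℕ) : (ix i).eval O h ρ = ρ i := rfl
@[simp] theorem eval_arr (i : Fin 8) : (arr i a).eval O h ρ = h.arr i (a.eval O h ρ) := rfl
@[simp] theorem eval_eMul : (eMul a b).eval O h ρ = a.eval O h ρ * b.eval O h ρ := rfl
@[simp] theorem eval_eAdd : (eAdd a b).eval O h ρ = a.eval O h ρ + b.eval O h ρ := rfl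
@[simp] theorem eval_eSub : (eSub a b).eval O h ρ = a.eval O h ρ - b.eval O h ρ := rfl
@[simp] theorem eval_eDiv : (eDiv a b).eval O h ρ = a.eval O h ρ / b.eval O h ρ := rfl
@[simp] theorem eval_eSum (i : ℕ) (j : Fin 8) : (eSum i j a).eval O h ρ =
    ∑ l ∈ range (h.sz j), a.eval O h (update ρ i l) := rfl

@[simp] theorem eval_eLt : (eLt a b).eval O h ρ = bi (a.eval O h ρ < b.eval O h ρ) := by
  by_cases hab : a.eval O h ρ < b.eval O h ρ <;> simp [eLt, eval, BinOp.eval, bi, hab]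

theorem eval_eNot (ha : a.eval O h ρ = bi P) : (eNot a).eval O h ρ = bi (¬ P) := by
  rw [← one_sub_bi, ← ha]; rfl

/-- If `P` fails, the product is `0` whatever `b` is. So `b` has to be meaningful only under `P`;
this is needed for keys, which make sense only for the elements to be inserted. -/
theorem eval_eAnd (ha : a.eval O h ρ = bi P) (hb : P → b.eval O h ρ = bi Q) :
    (eMul a b).eval O h ρ = bi (P ∧ Q) := by
  rw [eval_eMul, ha]
  by_cases hP : P
  · rw [hb hP, bi_mul]
  · rw [bi_neg hP, zero_mul, bi_neg fun h => hP h.1]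

theorem eval_eOr (ha : a.eval O h ρ = bi P) (hb : b.eval O h ρ = bi Q) :
    (eOr a b).eval O h ρ = bi (P ∨ Q) := by
  rw [eOr, eval_eLt, eval_eAdd, ha, hb]
  apply bi_congr
  by_cases hP : P <;> by_cases hQ : Q <;> simp [bi, hP, hQ]

theorem eval_eEx {i : ℕ} {j : Fin 8} {P : ℕ → Prop}
    (ha : ∀ l < h.sz j, a.eval O h (update ρ i (l : ℤ)) = bi (P l)) :
    (eEx i j a).eval O h ρ = bi (∃ l < h.sz j, P l) := by
  rw [eEx, eval_eLt, eval_eSum, sum_congr rfl fun l hl => ha l (mem_range.1 hl)]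
  apply bi_congr
  rw [eval_const]
  constructor
  · intro hpos
    obtain ⟨l, hl, hne⟩ := exists_ne_zero_of_sum_ne_zero hpos.ne'
    exact ⟨l, mem_range.1 hl, by_contra fun hP => hne (bi_neg hP)⟩
  · rintro ⟨l, hl, hP⟩
    exact sum_pos' (fun _ _ => bi_nonneg _) ⟨l, mem_range.2 hl, by rw [bi_pos hP]; exact one_pos⟩

theorem eval_eEq : (eEq a b).eval O h ρ = bi (a.eval O h ρ = b.eval O h ρ) := by
  rw [eEq, eval_eAnd (eval_eNot eval_eLt) fun _ => eval_eNot eval_eLt]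
  exact bi_congr (by constructor <;> intro h <;> omega)

theorem eval_eIf_pos (hc : c.eval O h ρ = bi P) (hP : P) :
    (eIf c a b).eval O h ρ = a.eval O h ρ := by
  rw [eIf, eval_eAdd, eval_eMul, eval_eMul, eval_eNot hc, hc, bi_pos hP, bi_neg (not_not.2 hP)]
  ring

theorem eval_eIf_neg (hc : c.eval O h ρ = bi P) (hP : ¬ P) :
    (eIf c a b).eval O h ρ = b.eval O h ρ := by
  rw [eIf, eval_eAdd, eval_eMul, eval_eMul, eval_eNot hc, hc, bi_neg hP, bi_pos hP]
  ring

/-- The expression does not read the variable or the array `s`. -/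
def Avoids (s : Fin 8 ⊕ Fin 8) : AExpr → Prop
  | .const _ => True
  | .sz _ => True
  | .var x => s ≠ .inl x
  | .ix _ => True
  | .arr b e => s ≠ .inr b ∧ e.Avoids s
  | .bin _ e e' => e.Avoids s ∧ e'.Avoids s
  | .fold _ _ _ e => e.Avoids s
  | .query _ _ e e' => e.Avoids s ∧ e'.Avoids s

/-- A frame rule for expressions: changes to a variable or an array that is not read are invisible.
-/
theorem eval_congr_of_avoids {s : Fin 8 ⊕ Fin 8} {h h' : AState} (hsz : h.sz = h'.sz)
    (hvar : ∀ x, s ≠ .inl x → h.var x = h'.var x) (harr : ∀ x, s ≠ .inr x → h.arr x = h'.arr x) :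
    ∀ (e : AExpr) (ρ : ℕ → ℤ), e.Avoids s → e.eval O h ρ = e.eval O h' ρ := by
  intro e
  induction e with
  | const | ix => intros; rfl
  | sz j => intros; simp [hsz]
  | var j => intro ρ he; exact hvar j he
  | arr y e ih => intro ρ he; rw [eval_arr, eval_arr, ih ρ he.2, harr y he.1]
  | bin o e e' ih ih' => intro ρ he; simp only [eval]; rw [ih ρ he.1, ih' ρ he.2]
  | fold o i j e ih =>
    intro ρ he
    rw [eval_fold, eval_fold, hsz]
    simp only [fun ρ => ih ρ he]
  | query d t e e' ih ih' => intro ρ he; simp only [eval]; rw [ih ρ he.1, ih' ρ he.2]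

end AExpr

open AExpr

/-! ### The preorder, the order of insertion, and the greedy vector -/

/-- Implication between `p` and `q`. -/
def relE (p q : AExpr) : AExpr := .arr 0 (eAdd (eMul p (.sz 3)) q)

/-- Being alive. -/
def aliveE (p : AExpr) : AExpr := eNot (relE p (eAdd (.sz 2) (.const 1)))

/-- Being alive and not implied by the pivot. -/
def innE (p : ℕ) : AExpr := eMul (aliveE (.ix p)) (eNot (relE (.var 2) (.ix p)))

/-- The values of the descent, made distinct. -/
def xkE (p : ℕ) : AExpr := eAdd (eMul (.arr 1 (.ix p)) (.sz 3)) (.ix p)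

/-- Having the largest value among the elements that imply `w`. -/
def domE (w p l : ℕ) : AExpr :=
  eMul (eMul (innE p) (relE (.ix p) (.ix w)))
    (eNot (eEx l 3 (eMul (eMul (innE l) (relE (.ix l) (.ix w))) (eLt (xkE p) (xkE l)))))

/-- The largest value of the elements that imply `w`. -/
def xbE (w l : ℕ) : AExpr := eSum l 3 (eMul (domE w l (l + 1)) (xkE l))

/-- The key of `w`. -/
def keyE (w l : ℕ) : AExpr :=
  eAdd (eMul (eAdd (eMul (xbE w l) (.sz 3)) (eSub (.sz 3) (eSum l 3 (relE (.ix w) (.ix l)))))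
    (.sz 3)) (.ix w)

/-- Membership in the set in front of `w`. -/
def preE (w e l : ℕ) : AExpr :=
  eOr (relE (.var 2) (.ix e)) (eEx l 3 (eMul (innE l)
    (eMul (eLt (keyE w (l + 1)) (keyE l (l + 1))) (relE (.ix l) (.ix e)))))

/-- Membership in the set behind `w`. -/
def preqE (w e l : ℕ) : AExpr := eOr (preE w e l) (relE (.ix w) (.ix e))

/-- Membership in the set of the elements implied by `p`. -/
def rowE (p e : ℕ) : AExpr := relE (.ix p) (.ix e)

/-- Membership in the set of the elements implied by `p` that do not imply `p`. -/
def lowerRowE (p e : ℕ) : AExpr := eMul (relE (.ix p) (.ix e)) (eNot (relE (.ix e) (.ix p)))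

/-- Numerator of the reduced function; `Fn` and `Fd` give the function itself. -/
def gnE (Fn Fd : (ℕ → ℕ → AExpr) → ℕ → AExpr) (A : ℕ → ℕ → AExpr) (l : ℕ) : AExpr :=
  eSub (eMul (Fn A l) (.var 0)) (eMul (eSum l 2 (eMul (A l (l + 1)) (.arr 3 (.ix l)))) (Fd A l))

/-- Denominator of the reduced function. -/
def gdE (Fd : (ℕ → ℕ → AExpr) → ℕ → AExpr) (A : ℕ → ℕ → AExpr) (l : ℕ) : AExpr :=
  eMul (Fd A l) (.var 0)

/-- Numerator of a difference of values of the reduced function. -/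
def diffN (Fn Fd : (ℕ → ℕ → AExpr) → ℕ → AExpr) (A B : ℕ → ℕ → AExpr) (l : ℕ) : AExpr :=
  eSub (eMul (gnE Fn Fd A l) (gdE Fd B l)) (eMul (gnE Fn Fd B l) (gdE Fd A l))

/-- Denominator of a difference of values of the reduced function. -/
def diffD (Fd : (ℕ → ℕ → AExpr) → ℕ → AExpr) (A B : ℕ → ℕ → AExpr) (l : ℕ) : AExpr :=
  eMul (gdE Fd A l) (gdE Fd B l)

/-- The rounded greedy vector. -/
def betaE (Fn Fd : (ℕ → ℕ → AExpr) → ℕ → AExpr) (w l : ℕ) : AExpr :=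
  eDiv (eMul (eMul (eMul (.const 16) (eMul (.sz 3) (.sz 3))) (diffN Fn Fd (preqE w) (preE w) l))
    (.var 5)) (eMul (diffD Fd (preqE w) (preE w) l) (.var 4))

/-- The loss vector. -/
def lossE (Fn Fd : (ℕ → ℕ → AExpr) → ℕ → AExpr) (p l : ℕ) : AExpr :=
  eMul (innE p) (eAdd
    (eSum l 3 (eMul (eMul (innE l) (domE l p (l + 1)))
      (eMul (eLt (.const 0) (betaE Fn Fd l (l + 1))) (betaE Fn Fd l (l + 1)))))
    (eMul (eLt (betaE Fn Fd p l) (.const 0)) (betaE Fn Fd p l)))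

/-- The relation stored in array `0`. -/
structure HasRel (N : ℕ) (R : ℕ → ℕ → Prop) (h : AState) : Prop where
  sz2 : h.sz 2 = N
  sz3 : h.sz 3 = N + 2
  rel : ∀ p < N + 2, ∀ q < N + 2, h.arr 0 ((p : ℤ) * ((N + 2 : ℕ) : ℤ) + q) = bi (R p q)

/-- The elements to be inserted. -/
noncomputable def free (N : ℕ) (R : ℕ → ℕ → Prop) (c : ℕ) : Finset ℕ :=
  alive N R \ row (N + 2) R c

/-- The values of the descent, made distinct. -/
def distinctVal (W : ℕ) (x : ℕ → ℤ) (p : ℕ) : ℤ := x p * W + p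

/-- `p` has the largest value among the elements of `J` that imply `w`. -/
def IsDom (W : ℕ) (R : ℕ → ℕ → Prop) (J : Finset ℕ) (x : ℕ → ℤ) (w p : ℕ) : Prop :=
  (p ∈ J ∧ R p w) ∧ ¬ ∃ l < W, (l ∈ J ∧ R l w) ∧ distinctVal W x p < distinctVal W x l

open Classical in
/-- The element with the largest value among the elements of `J` that imply `w`. -/
noncomputable def pull (W : ℕ) (R : ℕ → ℕ → Prop) (J : Finset ℕ) (x : ℕ → ℤ) (w : ℕ) : ℕ :=
  if h : ∃ p, IsDom W R J x w p then h.choose else w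

/-- The key of an element. -/
noncomputable def keyVal (W : ℕ) (R : ℕ → ℕ → Prop) (J : Finset ℕ) (x : ℕ → ℤ) (w : ℕ) : ℤ :=
  (distinctVal W x (pull W R J x w) * W + (W - (row W R w).card)) * W + w

/-- The index is the last digit in base `W`. -/
theorem distinctVal_inj {W : ℕ} {x : ℕ → ℤ} {p q : ℕ} (hp : p < W) (hq : q < W)
    (h : distinctVal W x p = distinctVal W x q) : p = q := by
  unfold distinctVal at h
  have h1 := congrArg (· % (W : ℤ)) h
  simp only [Int.mul_add_emod_self_right] at h1
  rw [Int.emod_eq_of_lt (by omega) (by omega), Int.emod_eq_of_lt (by omega) (by omega)] at h1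
  omega

section keys

variable {W : ℕ} {R : ℕ → ℕ → Prop} {J : Finset ℕ} {x : ℕ → ℤ}

/-- A maximum exists because `w` implies itself, and it is unique because the values have been made
distinct. -/
theorem isDom_iff (hR : IsPre W R) (hJ : J ⊆ range W) {w p : ℕ} (hw : w ∈ J) :
    IsDom W R J x w p ↔ p = pull W R J x w := by
  classical
  have hex : ∃ p, IsDom W R J x w p := by
    obtain ⟨p, hp, hmax⟩ := exists_max_image (J.filter fun p => R p w) (distinctVal W x)
      ⟨w, mem_filter.2 ⟨hw, hR.refl w (mem_range.1 (hJ hw))⟩⟩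
    refine ⟨p, (mem_filter.1 hp), ?_⟩
    rintro ⟨l, _, hl, hlt⟩
    have := hmax l (mem_filter.2 hl)
    omega
  have hspec : IsDom W R J x w (pull W R J x w) := by
    rw [pull, dif_pos hex]; exact hex.choose_spec
  constructor
  · intro hp
    have hpW := mem_range.1 (hJ hp.1.1)
    have hqW := mem_range.1 (hJ hspec.1.1)
    refine distinctVal_inj (x := x) hpW hqW (le_antisymm ?_ ?_)
    · by_contra hlt
      exact hspec.2 ⟨p, hpW, hp.1, not_le.1 hlt⟩
    · by_contra hlt
      exact hp.2 ⟨_, hqW, hspec.1, not_le.1 hlt⟩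
  · rintro rfl; exact hspec

theorem pull_spec (hR : IsPre W R) (hJ : J ⊆ range W) {w : ℕ} (hw : w ∈ J) :
    IsDom W R J x w (pull W R J x w) := (isDom_iff hR hJ hw).2 rfl

theorem le_pull (hR : IsPre W R) (hJ : J ⊆ range W) {w p : ℕ} (hw : w ∈ J) (hp : p ∈ J)
    (hpw : R p w) : distinctVal W x p ≤ distinctVal W x (pull W R J x w) := by
  by_contra h
  exact (pull_spec hR hJ hw).2 ⟨p, mem_range.1 (hJ hp), ⟨hp, hpw⟩, not_le.1 h⟩

theorem le_of_distinctVal_le {p q : ℕ} (hq : q < W)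
    (h : distinctVal W x p ≤ distinctVal W x q) : x p ≤ x q := by
  unfold distinctVal at h
  by_contra hlt
  have h1 : x q + 1 ≤ x p := by omega
  have : (x q + 1) * (W : ℤ) ≤ x p * W := mul_le_mul_of_nonneg_right h1 (by positivity)
  nlinarith

theorem card_row_pos (hR : IsPre W R) {w : ℕ} (hw : w < W) : 0 < (row W R w).card :=
  card_pos.2 ⟨w, mem_row.2 ⟨hw, hR.refl w hw⟩⟩

theorem card_row_le (w : ℕ) : (row W R w).card ≤ W := by
  have : row W R w ⊆ range W := fun q hq => mem_range.2 (mem_row.1 hq).1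
  simpa using card_le_card this

/-- Keys are compared lexicographically: the pulled value first, then the negated size of the row,
then the index as last digit. -/
theorem keyVal_lt_of_lt {p q : ℕ} (hp : p < W)
    (h : distinctVal W x (pull W R J x p) * W + (W - (row W R p).card) <
      distinctVal W x (pull W R J x q) * W + (W - (row W R q).card)) :
    keyVal W R J x p < keyVal W R J x q := by
  unfold keyVal
  have := mul_le_mul_of_nonneg_right (Int.add_one_le_iff.2 h) (show (0 : ℤ) ≤ W by positivity)
  nlinarith

theorem keyVal_inj {p q : ℕ} (hp : p < W) (hq : q < W)
    (h : keyVal W R J x p = keyVal W R J x q) : p = q := by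
  unfold keyVal at h
  have h1 := congrArg (· % (W : ℤ)) h
  simp only [Int.mul_add_emod_self_right] at h1
  rw [Int.emod_eq_of_lt (by omega) (by omega), Int.emod_eq_of_lt (by omega) (by omega)] at h1
  omega

/-- Whatever implies `p` also implies `q`, so the pulled value of `q` is not smaller than that of
`p`. A tie is broken by the second digit, because the row of `q` is a proper subset of that of `p`.
-/
theorem keyVal_lt (hR : IsPre W R) (hJ : J ⊆ range W) {p q : ℕ} (hp : p ∈ J) (hq : q ∈ J)
    (hpq : R p q) (hqp : ¬ R q p) : keyVal W R J x p < keyVal W R J x q := by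
  have hpW := mem_range.1 (hJ hp)
  have hqW := mem_range.1 (hJ hq)
  apply keyVal_lt_of_lt hpW
  have hs := pull_spec (x := x) hR hJ hp
  have h1 := le_pull (x := x) hR hJ hq hs.1.1
    (hR.trans _ (mem_range.1 (hJ hs.1.1)) p hpW q hqW hs.1.2 hpq)
  have h2 : (row W R q).card < (row W R p).card := by
    apply card_lt_card
    refine ⟨fun r hr => ?_, fun hsub => ?_⟩
    · obtain ⟨hrW, hqr⟩ := mem_row.1 hr
      exact mem_row.2 ⟨hrW, hR.trans p hpW q hqW r hrW hpq hqr⟩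
    · exact hqp (mem_row.1 (hsub (mem_row.2 ⟨hpW, hR.refl p hpW⟩))).2
  have h3 := mul_le_mul_of_nonneg_right h1 (show (0 : ℤ) ≤ W by positivity)
  omega

/-- The pulled value is the leading digit of the key, so the order of the keys refines it. -/
theorem isPull_keyVal (hR : IsPre W R) (hJ : J ⊆ range W) :
    IsPull R J (keyVal W R J x) (pull W R J x) x where
  mem w hw := (pull_spec hR hJ hw).1.1
  rel w hw := (pull_spec hR hJ hw).1.2
  le w hw := by
    have hwW := mem_range.1 (hJ hw)
    exact le_of_distinctVal_le (mem_range.1 (hJ (pull_spec hR hJ hw).1.1))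
      (le_pull hR hJ hw hw (hR.refl w hwW))
  mono w hw w' hw' hlt := by
    have h2 := mem_range.1 (hJ (pull_spec (x := x) hR hJ hw').1.1)
    refine le_of_distinctVal_le h2 ?_
    by_contra hcon
    have h3 := Int.add_one_le_iff.2 (not_le.1 hcon)
    have h4 := mul_le_mul_of_nonneg_right h3 (show (0 : ℤ) ≤ W by positivity)
    -- Rows have between `1` and `W` elements, so the second digits cannot compensate a difference
    -- of the leading ones.
    have h5 := card_row_pos hR (mem_range.1 (hJ hw'))
    have h6 := card_row_le (W := W) (R := R) w
    have h7 : keyVal W R J x w' < keyVal W R J x w := by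
      apply keyVal_lt_of_lt (mem_range.1 (hJ hw'))
      rw [add_mul] at h4
      omega
    omega

end keys

end SubmodAlloc

namespace SubmodAlloc
open Finset Function AExpr

/-! ### Values of the derived expressions -/

theorem update_index_ne {ρ : ℕ → ℤ} {w l : ℕ} {a z : ℤ} (hwl : w < l) (hw : ρ w = a) :
    update ρ l z w = a := by
  rw [update_of_ne hwl.ne, hw]

variable {O : Oracle} {h : AState} {N : ℕ} {R : ℕ → ℕ → Prop} {ρ : ℕ → ℤ}

theorem eval_relE (hR : HasRel N R h) {p q : AExpr} {a b : ℕ} (ha : a < N + 2) (hb : b < N + 2)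
    (hp : p.eval O h ρ = a) (hq : q.eval O h ρ = b) : (relE p q).eval O h ρ = bi (R a b) := by
  simp only [relE, eval_arr, eval_eAdd, eval_eMul, eval_sz, hp, hq, hR.sz3]
  exact hR.rel a ha b hb

theorem eval_aliveE (hR : HasRel N R h) {p : AExpr} {a : ℕ} (ha : a < N + 2)
    (hp : p.eval O h ρ = a) : (aliveE p).eval O h ρ = bi (a ∈ alive N R) := by
  have := eval_eNot (eval_relE (O := O) hR (q := eAdd (.sz 2) (.const 1)) ha
    (by omega : N + 1 < N + 2) hp (by simp [hR.sz2]))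
  rw [aliveE, this]
  exact bi_congr (by simp [mem_alive, ha])

variable {c : ℕ}

theorem eval_innE (hR : HasRel N R h) (hc : c < N + 2) (hv : h.var 2 = c) {p a : ℕ}
    (ha : a < N + 2) (hp : ρ p = a) : (innE p).eval O h ρ = bi (a ∈ free N R c) := by
  have h1 := eval_aliveE (O := O) hR (p := .ix p) ha hp
  have h2 := eval_eNot (eval_relE (O := O) (ρ := ρ) hR (p := .var 2) (q := .ix p) hc ha hv hp)
  rw [innE, eval_eAnd h1 fun _ => h2]
  exact bi_congr (by simp [free, mem_row, ha])

theorem eval_xkE (hR : HasRel N R h) {p a : ℕ} (hp : ρ p = a) :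
    (xkE p).eval O h ρ = distinctVal (N + 2) (fun i => h.arr 1 i) a := by
  simp [xkE, hp, hR.sz3, distinctVal]

theorem eval_domE (hR : HasRel N R h) (hc : c < N + 2) (hv : h.var 2 = c) {w p l a b : ℕ}
    (hwl : w < l) (hpl : p < l) (ha : a < N + 2) (hb : b < N + 2) (hw : ρ w = b) (hp : ρ p = a) :
    (domE w p l).eval O h ρ =
      bi (IsDom (N + 2) R (free N R c) (fun i => h.arr 1 i) b a) := by
  refine eval_eAnd (eval_eAnd (eval_innE hR hc hv ha hp) fun _ => eval_relE hR ha hb hp hw)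
    fun _ => eval_eNot ?_
  rw [← hR.sz3]
  refine eval_eEx fun i hi => ?_
  rw [hR.sz3] at hi
  have hl : update ρ l (i : ℤ) l = i := update_self _ _ _
  refine eval_eAnd (eval_eAnd (eval_innE hR hc hv hi hl) fun _ =>
    eval_relE hR hi hb hl (update_index_ne hwl hw)) fun _ => ?_
  rw [eval_eLt, eval_xkE hR hl, eval_xkE hR (update_index_ne hpl hp), hR.sz3]

theorem free_subset (N : ℕ) (R : ℕ → ℕ → Prop) (c : ℕ) : free N R c ⊆ range (N + 2) :=
  fun _ hp => mem_range.2 (mem_alive.1 (mem_sdiff.1 hp).1).1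

theorem eval_xbE (hR : HasRel N R h) (hpre : IsPre (N + 2) R) (hc : c < N + 2) (hv : h.var 2 = c)
    {w l b : ℕ} (hwl : w < l) (hb : b ∈ free N R c) (hw : ρ w = b) :
    (xbE w l).eval O h ρ = distinctVal (N + 2) (fun i => h.arr 1 i)
      (pull (N + 2) R (free N R c) (fun i => h.arr 1 i) b) := by
  have hbW := mem_range.1 (free_subset N R c hb)
  have hJ := free_subset N R c
  rw [xbE, eval_eSum, hR.sz3]
  have : ∀ i ∈ range (N + 2), (eMul (domE w l (l + 1)) (xkE l)).eval O h (update ρ l (i : ℤ)) =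
      bi (IsDom (N + 2) R (free N R c) (fun i => h.arr 1 i) b i) *
        distinctVal (N + 2) (fun i => h.arr 1 i) i := by
    intro i hi
    have hl : update ρ l (i : ℤ) l = i := update_self _ _ _
    rw [eval_eMul, eval_domE hR hc hv (by omega) (by omega) (mem_range.1 hi) hbW
      (update_index_ne hwl hw) hl, eval_xkE hR hl]
  rw [sum_congr rfl this]
  exact sum_bi_mul_of_unique (mem_range.1 (hJ (pull_spec hpre hJ hb).1.1))
    fun i _ => isDom_iff hpre hJ hb

theorem sum_bi_eq_card {M : ℕ} (P : ℕ → Prop) [DecidablePred P] :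
    ∑ l ∈ range M, bi (P l) = ((range M).filter P).card := by
  rw [card_filter]
  push_cast
  exact sum_congr rfl fun i _ => by by_cases hP : P i <;> simp [bi, hP]

theorem eval_keyE (hR : HasRel N R h) (hpre : IsPre (N + 2) R) (hc : c < N + 2) (hv : h.var 2 = c)
    {w l b : ℕ} (hwl : w < l) (hb : b ∈ free N R c) (hw : ρ w = b) :
    (keyE w l).eval O h ρ = keyVal (N + 2) R (free N R c) (fun i => h.arr 1 i) b := by
  classical
  have hbW := mem_range.1 (free_subset N R c hb)
  have hsum : (eSum l 3 (relE (.ix w) (.ix l))).eval O h ρ = (row (N + 2) R b).card := by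
    have : ∀ i ∈ range (N + 2), (relE (.ix w) (.ix l)).eval O h (update ρ l (i : ℤ)) =
        bi (R b i) := fun i hi => eval_relE hR hbW (mem_range.1 hi)
          (update_index_ne hwl hw) (by simp)
    rw [eval_eSum, hR.sz3, sum_congr rfl this, sum_bi_eq_card]
    congr!
  simp only [keyE, eval_eAdd, eval_eMul, eval_eSub, eval_sz, eval_ix, hsum,
    eval_xbE hR hpre hc hv hwl hb hw, hR.sz3, hw, keyVal]

theorem eval_preE (hR : HasRel N R h) (hpre : IsPre (N + 2) R) (hc : c < N + 2) (hv : h.var 2 = c)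
    {w e l a b : ℕ} (hwl : w < l) (hel : e < l) (hb : b ∈ free N R c) (ha : a < N + 2)
    (hw : ρ w = b) (he : ρ e = a) : (preE w e l).eval O h ρ =
      bi (a ∈ prefixSet (N + 2) R (row (N + 2) R c) (free N R c)
        (keyVal (N + 2) R (free N R c) (fun i => h.arr 1 i)) b) := by
  have h1 : (eEx l 3 (eMul (innE l) (eMul (eLt (keyE w (l + 1)) (keyE l (l + 1)))
      (relE (.ix l) (.ix e))))).eval O h ρ = bi (∃ i < h.sz 3, i ∈ free N R c ∧
        (keyVal (N + 2) R (free N R c) (fun i => h.arr 1 i) b <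
          keyVal (N + 2) R (free N R c) (fun i => h.arr 1 i) i ∧ R i a)) := by
    refine eval_eEx fun i hi => ?_
    rw [hR.sz3] at hi
    have hl : update ρ l (i : ℤ) l = i := update_self _ _ _
    refine eval_eAnd (eval_innE hR hc hv hi hl) fun hiJ => eval_eAnd ?_ fun _ =>
      eval_relE hR hi ha hl (update_index_ne hel he)
    rw [eval_eLt, eval_keyE hR hpre hc hv (by omega) hb (update_index_ne hwl hw),
      eval_keyE hR hpre hc hv (by omega) hiJ hl]
  rw [preE, eval_eOr (eval_relE (p := .var 2) (q := .ix e) hR hc ha hv he) h1]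
  apply bi_congr
  rw [prefixSet, mem_union, mem_row, mem_rows]
  simp only [ha, true_and, mem_filter, hR.sz3]
  refine or_congr_right ⟨?_, ?_⟩
  · rintro ⟨i, _, hi, hlt, hRi⟩; exact ⟨i, ⟨hi, hlt⟩, hRi⟩
  · rintro ⟨i, ⟨hi, hlt⟩, hRi⟩
    exact ⟨i, mem_range.1 (free_subset N R c hi), hi, hlt, hRi⟩

theorem eval_preqE (hR : HasRel N R h) (hpre : IsPre (N + 2) R) (hc : c < N + 2) (hv : h.var 2 = c)
    {w e l a b : ℕ} (hwl : w < l) (hel : e < l) (hb : b ∈ free N R c) (ha : a < N + 2)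
    (hw : ρ w = b) (he : ρ e = a) : (preqE w e l).eval O h ρ =
      bi (a ∈ prefixSet (N + 2) R (row (N + 2) R c) (free N R c)
        (keyVal (N + 2) R (free N R c) (fun i => h.arr 1 i)) b ∪ row (N + 2) R b) := by
  have hbW := mem_range.1 (free_subset N R c hb)
  rw [preqE, eval_eOr (eval_preE hR hpre hc hv hwl hel hb ha hw he)
    (eval_relE (p := .ix w) (q := .ix e) hR hbW ha hw he)]
  exact bi_congr (by rw [mem_union, mem_row (p := b)]; simp [ha])

/-! ### Evaluation of the set function -/

/-- In the presence of indices below `l`, the expression `A e l'` describes the membership of index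
`e` in the set `S`. -/
def Memb (O : Oracle) (h : AState) (N : ℕ) (ρ : ℕ → ℤ) (l : ℕ) (A : ℕ → ℕ → AExpr)
    (S : Finset ℕ) : Prop :=
  ∀ (ρ' : ℕ → ℤ) (e l' a : ℕ), (∀ i < l, ρ' i = ρ i) → l ≤ e → e < l' → a < N → ρ' e = a →
    (A e l').eval O h ρ' = bi (a ∈ S)

theorem memb_preE (hR : HasRel N R h) (hpre : IsPre (N + 2) R) (hc : c < N + 2) (hv : h.var 2 = c)
    {w l b : ℕ} (hwl : w < l) (hb : b ∈ free N R c) (hw : ρ w = b) :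
    Memb O h N ρ l (preE w) (prefixSet (N + 2) R (row (N + 2) R c) (free N R c)
        (keyVal (N + 2) R (free N R c) (fun i => h.arr 1 i)) b) := by
  intro ρ' e l' a hρ hle hel ha he
  exact eval_preE hR hpre hc hv (by omega) hel hb (by omega) ((hρ w hwl).trans hw) he

theorem memb_preqE (hR : HasRel N R h) (hpre : IsPre (N + 2) R) (hc : c < N + 2) (hv : h.var 2 = c)
    {w l b : ℕ} (hwl : w < l) (hb : b ∈ free N R c) (hw : ρ w = b) :
    Memb O h N ρ l (preqE w) (prefixSet (N + 2) R (row (N + 2) R c) (free N R c)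
        (keyVal (N + 2) R (free N R c) (fun i => h.arr 1 i)) b ∪ row (N + 2) R b) := by
  intro ρ' e l' a hρ hle hel ha he
  exact eval_preqE hR hpre hc hv (by omega) hel hb (by omega) ((hρ w hwl).trans hw) he

theorem memb_rowE (hR : HasRel N R h) {p l b : ℕ} (hpl : p < l) (hb : b < N + 2) (hp : ρ p = b) :
    Memb O h N ρ l (fun e _ => rowE p e) (row (N + 2) R b) := by
  intro ρ' e l' a hρ hle hel ha he
  change (relE (.ix p) (.ix e)).eval O h ρ' = _
  rw [eval_relE (p := .ix p) (q := .ix e) hR hb (by omega : a < N + 2) ((hρ p hpl).trans hp) he]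
  exact bi_congr (by rw [mem_row]; simp; omega)

theorem memb_lowerRowE (hR : HasRel N R h) {p l b : ℕ} (hpl : p < l) (hb : b < N + 2)
    (hp : ρ p = b) : Memb O h N ρ l (fun e _ => lowerRowE p e) (lowerRow (N + 2) R b) := by
  intro ρ' e l' a hρ hle hel ha he
  change (lowerRowE p e).eval O h ρ' = _
  rw [lowerRowE, eval_eAnd (eval_relE (p := .ix p) (q := .ix e) hR hb (by omega : a < N + 2)
    ((hρ p hpl).trans hp) he)
    fun _ => eval_eNot (eval_relE (p := .ix e) (q := .ix p) hR (by omega : a < N + 2) hb he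
      ((hρ p hpl).trans hp))]
  exact bi_congr (by rw [mem_lowerRow]; simp; omega)

/-- The sizes. -/
structure HasSizes (n k : ℕ) (h : AState) : Prop where
  sz0 : h.sz 0 = k
  sz1 : h.sz 1 = n
  sz2 : h.sz 2 = n * k
  sz3 : h.sz 3 = n * k + 2
  sz4 : h.sz 4 = descentSteps (n * k + 2)
  sz5 : h.sz 5 = (n * k + 2) ^ 2

/-- With the oracle `O`, the expressions `Fn` and `Fd` give numerator and denominator of the set
function `F`, and these have at most `B` bits. -/
structure Evaluates (n k : ℕ) (F : Finset ℕ → ℚ) (B : ℕ) (O : Oracle)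
    (Fn Fd : (ℕ → ℕ → AExpr) → ℕ → AExpr) : Prop where
  pos : ∀ h ρ l A S, HasSizes n k h → Memb O h (n * k) ρ l A S → 0 < (Fd A l).eval O h ρ
  eq : ∀ h ρ l A S, HasSizes n k h → Memb O h (n * k) ρ l A S →
    ((Fn A l).eval O h ρ : ℚ) = F S * ((Fd A l).eval O h ρ : ℚ)
  num_le : ∀ h ρ l A S, HasSizes n k h → Memb O h (n * k) ρ l A S → |(Fn A l).eval O h ρ| ≤ 2 ^ B
  den_le : ∀ h ρ l A S, HasSizes n k h → Memb O h (n * k) ρ l A S → |(Fd A l).eval O h ρ| ≤ 2 ^ B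

/-- The dual solution stored in array `3`, with the common denominator in variable `0`. -/
structure HasDual (N : ℕ) (y : ℕ → ℚ) (h : AState) : Prop where
  pos : 0 < h.var 0
  eq : ∀ e < N, (h.arr 3 e : ℚ) = y e * h.var 0

variable {n k B : ℕ} {F : Finset ℕ → ℚ} {Fn Fd : (ℕ → ℕ → AExpr) → ℕ → AExpr} {y : ℕ → ℚ}
  {l : ℕ} {A A' : ℕ → ℕ → AExpr} {S S' : Finset ℕ}

theorem gdE_pos (hE : Evaluates n k F B O Fn Fd) (hs : HasSizes n k h) (hy : HasDual (n * k) y h)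
    (hA : Memb O h (n * k) ρ l A S) : 0 < (gdE Fd A l).eval O h ρ :=
  mul_pos (hE.pos h ρ l A S hs hA) hy.pos

theorem sum_bi_mem_mul (M : ℕ) (S : Finset ℕ) (f : ℕ → ℚ) :
    ∑ a ∈ range M, ((bi (a ∈ S) : ℤ) : ℚ) * f a = ∑ a ∈ S ∩ range M, f a := by
  rw [inter_comm, ← filter_mem_eq_inter, sum_filter]
  exact sum_congr rfl fun a _ => by by_cases ha : a ∈ S <;> simp [bi, ha]

/-- Rational values are handled as pairs of integers with positive denominators that are never
reduced; "numerator equals value times denominator" is the form in which this is passed on. -/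
theorem gnE_eq (hE : Evaluates n k F B O Fn Fd) (hs : HasSizes n k h) (hy : HasDual (n * k) y h)
    (hA : Memb O h (n * k) ρ l A S) : ((gnE Fn Fd A l).eval O h ρ : ℚ) =
      reduced (n * k) F y S * ((gdE Fd A l).eval O h ρ : ℚ) := by
  have h1 : (((eSum l 2 (eMul (A l (l + 1)) (.arr 3 (.ix l)))).eval O h ρ : ℤ) : ℚ) =
      (∑ a ∈ S ∩ range (n * k), y a) * h.var 0 := by
    rw [eval_eSum, hs.sz2, ← sum_bi_mem_mul, sum_mul, Int.cast_sum]
    refine sum_congr rfl fun a ha => ?_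
    have ha := mem_range.1 ha
    rw [eval_eMul, hA (update ρ l (a : ℤ)) l (l + 1) a
      (fun i hi => update_of_ne hi.ne _ _) le_rfl (by omega) ha (update_self _ _ _), eval_arr,
      eval_ix, update_self, Int.cast_mul, hy.eq a ha, mul_assoc]
  have h2 := hE.eq h ρ l A S hs hA
  simp only [gnE, gdE, eval_eSub, eval_eMul, eval_var] at h1 ⊢
  push_cast
  rw [h1, h2, reduced]
  ring

theorem diffD_pos (hE : Evaluates n k F B O Fn Fd) (hs : HasSizes n k h)
    (hy : HasDual (n * k) y h) (hA : Memb O h (n * k) ρ l A S) (hA' : Memb O h (n * k) ρ l A' S') :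
    0 < (diffD Fd A A' l).eval O h ρ :=
  mul_pos (gdE_pos hE hs hy hA) (gdE_pos hE hs hy hA')

theorem diffN_eq (hE : Evaluates n k F B O Fn Fd) (hs : HasSizes n k h)
    (hy : HasDual (n * k) y h) (hA : Memb O h (n * k) ρ l A S) (hA' : Memb O h (n * k) ρ l A' S') :
    ((diffN Fn Fd A A' l).eval O h ρ : ℚ) = (reduced (n * k) F y S - reduced (n * k) F y S') *
      ((diffD Fd A A' l).eval O h ρ : ℚ) := by
  have h1 := gnE_eq hE hs hy hA
  have h2 := gnE_eq hE hs hy hA'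
  simp only [diffN, diffD, eval_eSub, eval_eMul]
  push_cast
  rw [h1, h2]
  ring

theorem floor_eq_ediv {a b : ℤ} (hb : 0 < b) : ⌊(a : ℚ) / b⌋ = a / b := by
  lift b to ℕ using hb.le
  exact_mod_cast Rat.floor_intCast_div_natCast a b

/-- The scale `η` is the quotient of variables `4` and `5`. All denominators are positive, so the
floor of the rational number is a single integer division. -/
theorem eval_betaE (hE : Evaluates n k F B O Fn Fd) (hs : HasSizes n k h)
    (hy : HasDual (n * k) y h) (hR : HasRel (n * k) R h) (hpre : IsPre (n * k + 2) R)
    (hc : c < n * k + 2) (hv : h.var 2 = c) {η : ℚ} (hη : 0 < η) (hd : 0 < h.var 5)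
    (hn : (h.var 4 : ℚ) = η * h.var 5)
    {w b : ℕ} (hwl : w < l) (hb : b ∈ free (n * k) R c) (hw : ρ w = b) :
    (betaE Fn Fd w l).eval O h ρ = ⌊((16 * (n * k + 2) ^ 2 : ℕ) : ℚ) / η *
      greedy (n * k + 2) R (reduced (n * k) F y) (row (n * k + 2) R c) (free (n * k) R c)
        (keyVal (n * k + 2) R (free (n * k) R c) (fun i => h.arr 1 i)) b⌋ := by
  have h1 := memb_preqE (O := O) (ρ := ρ) hR hpre hc hv hwl hb hw
  have h2 := memb_preE (O := O) (ρ := ρ) hR hpre hc hv hwl hb hw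
  have hN := diffN_eq hE hs hy h1 h2
  have hD := diffD_pos hE hs hy h1 h2
  have hd' : (0 : ℚ) < h.var 5 := by exact_mod_cast hd
  have hn' : 0 < h.var 4 := by
    have : (0 : ℚ) < h.var 4 := by rw [hn]; positivity
    exact_mod_cast this
  have hDq : (0 : ℚ) < ((diffD Fd (preqE w) (preE w) l).eval O h ρ : ℚ) := by exact_mod_cast hD
  rw [betaE, eval_eDiv, ← floor_eq_ediv (by rw [eval_eMul]; exact mul_pos hD hn')]
  congr 1
  simp only [eval_eMul, eval_const, eval_sz, eval_var, hs.sz3]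
  push_cast
  rw [hN, hn, greedy]
  field_simp

/-- The factors `innE` suppress the elements that are not to be inserted, for which keys and greedy
values have not been computed correctly. -/
theorem eval_lossE (hE : Evaluates n k F B O Fn Fd) (hs : HasSizes n k h)
    (hy : HasDual (n * k) y h) (hR : HasRel (n * k) R h) (hpre : IsPre (n * k + 2) R)
    (hc : c < n * k + 2) (hv : h.var 2 = c) {η : ℚ} (hη : 0 < η) (hd : 0 < h.var 5)
    (hn : (h.var 4 : ℚ) = η * h.var 5)
    {p a : ℕ} (hpl : p < l) (ha : a ∈ free (n * k) R c) (hp : ρ p = a) :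
    (lossE Fn Fd p l).eval O h ρ = loss (free (n * k) R c)
      (pull (n * k + 2) R (free (n * k) R c) (fun i => h.arr 1 i))
      (fun w => ⌊((16 * (n * k + 2) ^ 2 : ℕ) : ℚ) / η *
        greedy (n * k + 2) R (reduced (n * k) F y) (row (n * k + 2) R c) (free (n * k) R c)
          (keyVal (n * k + 2) R (free (n * k) R c) (fun i => h.arr 1 i)) w⌋) a := by
  have hJ := free_subset (n * k) R c
  have haW := mem_range.1 (hJ ha)
  have hmax : ∀ z : ℤ, bi (0 < z) * z = max z 0 := by
    intro z
    rcases lt_or_ge 0 z with hz | hz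
    · rw [bi_pos hz, one_mul, max_eq_left hz.le]
    · rw [bi_neg (not_lt.2 hz), zero_mul, max_eq_right hz]
  have hmin : ∀ z : ℤ, bi (z < 0) * z = min z 0 := by
    intro z
    rcases lt_or_ge z 0 with hz | hz
    · rw [bi_pos hz, one_mul, min_eq_left hz.le]
    · rw [bi_neg (not_lt.2 hz), zero_mul, min_eq_right hz]
  rw [lossE, eval_eMul, eval_innE hR hc hv haW hp, bi_pos ha, one_mul, eval_eAdd, loss]
  congr 1
  · have hterm : ∀ i ∈ range (n * k + 2), (eMul (eMul (innE l) (domE l p (l + 1)))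
        (eMul (eLt (.const 0) (betaE Fn Fd l (l + 1))) (betaE Fn Fd l (l + 1)))).eval O h
          (update ρ l (i : ℤ)) =
        if i ∈ (free (n * k) R c).filter fun w =>
          pull (n * k + 2) R (free (n * k) R c) (fun i => h.arr 1 i) w = a
        then max ⌊((16 * (n * k + 2) ^ 2 : ℕ) : ℚ) / η *
          greedy (n * k + 2) R (reduced (n * k) F y) (row (n * k + 2) R c) (free (n * k) R c)
          (keyVal (n * k + 2) R (free (n * k) R c) (fun i => h.arr 1 i)) i⌋ 0 else 0 := by
      intro i hi
      have hi := mem_range.1 hi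
      have hl : update ρ l (i : ℤ) l = i := update_self _ _ _
      have hp' : update ρ l (i : ℤ) p = a := update_index_ne hpl hp
      rw [eval_eMul, eval_eMul, eval_innE hR hc hv hi hl]
      by_cases hiJ : i ∈ free (n * k) R c
      · rw [bi_pos hiJ, one_mul, eval_domE hR hc hv (by omega) (by omega) haW hi hl hp',
          eval_eMul, eval_eLt, eval_const,
          eval_betaE hE hs hy hR hpre hc hv hη hd hn (by omega) hiJ hl, hmax]
        by_cases hpull : pull (n * k + 2) R (free (n * k) R c) (fun i => h.arr 1 i) i = a
        · rw [bi_pos ((isDom_iff hpre hJ hiJ).2 hpull.symm), one_mul,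
            if_pos (mem_filter.2 ⟨hiJ, hpull⟩)]
        · rw [bi_neg fun hd => hpull ((isDom_iff hpre hJ hiJ).1 hd).symm, zero_mul]
          simp [hpull]
      · rw [bi_neg hiJ, zero_mul, zero_mul]
        simp [hiJ]
    rw [eval_eSum, hs.sz3, sum_congr rfl hterm, ← sum_filter]
    refine sum_congr ?_ fun _ _ => rfl
    ext i
    simp only [mem_filter, mem_range]
    constructor
    · rintro ⟨_, h⟩; exact h
    · rintro h; exact ⟨mem_range.1 (hJ h.1), h⟩
  · rw [eval_eMul, eval_eLt, eval_const, eval_betaE hE hs hy hR hpre hc hv hη hd hn hpl ha hp, hmin]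

end SubmodAlloc

namespace SubmodAlloc
open Finset Function AExpr

/-! ### Frames of commands -/

@[simp] theorem AState.setArr_var (h : AState) (a : Fin 8) (m : ℕ) (f : ℤ → ℤ) :
    (h.setArr a m f).var = h.var := rfl

theorem AState.setArr_lt (h : AState) (a : Fin 8) {m i : ℕ} (hi : i < m) (f : ℤ → ℤ) :
    (h.setArr a m f).arr a i = f i := by
  simp [AState.setArr, hi]

theorem AState.setArr_ne (h : AState) {a b : Fin 8} (hab : b ≠ a) (m : ℕ) (f : ℤ → ℤ) :
    (h.setArr a m f).arr b = h.arr b := update_of_ne hab _ _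

/-- A property of all new entries and of all old entries holds for all entries. -/
theorem AState.setArr_forall (h : AState) (a : Fin 8) {m : ℕ} {f : ℤ → ℤ} {p : ℤ → Prop}
    (hf : ∀ i : ℕ, i < m → p (f i)) (i : ℤ) (hh : p (h.arr a i)) : p ((h.setArr a m f).arr a i) := by
  simp only [AState.setArr, update_self]
  split_ifs with hi
  · obtain ⟨j, rfl⟩ := Int.eq_ofNat_of_zero_le hi.1
    exact hf j (by omega)
  · exact hh

/-- The command does not change the variable `x`. -/
def ACmd.KeepsVar (x : Fin 8) : ACmd → Prop
  | .assign y _ => x ≠ y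
  | .tab _ _ _ => True
  | .seq c c' => c.KeepsVar x ∧ c'.KeepsVar x
  | .loop _ c => c.KeepsVar x

/-- The command does not change the array `a`. -/
def ACmd.KeepsArr (a : Fin 8) : ACmd → Prop
  | .assign _ _ => True
  | .tab b _ _ => a ≠ b
  | .seq c c' => c.KeepsArr a ∧ c'.KeepsArr a
  | .loop _ c => c.KeepsArr a

variable {O : Oracle}

theorem ACmd.den_var {x : Fin 8} : ∀ {c : ACmd} (h : AState), c.KeepsVar x →
    (c.den O h).var x = h.var x := by
  intro c
  induction c with
  | assign y e => intro h hc; exact update_of_ne hc _ _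
  | tab => intros; rfl
  | seq c c' ih ih' => intro h hc; exact (ih' _ hc.2).trans (ih _ hc.1)
  | loop j c ih =>
    intro h hc
    simp only [ACmd.den]
    generalize h.sz j = r
    induction r with
    | zero => rfl
    | succ r ihr => rw [iterate_succ_apply', ih _ hc, ihr]

theorem ACmd.den_arr {a : Fin 8} : ∀ {c : ACmd} (h : AState), c.KeepsArr a →
    (c.den O h).arr a = h.arr a := by
  intro c
  induction c with
  | assign => intros; rfl
  | tab b j e => intro h hc; exact update_of_ne hc _ _
  | seq c c' ih ih' => intro h hc; exact (ih' _ hc.2).trans (ih _ hc.1)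
  | loop j c ih =>
    intro h hc
    simp only [ACmd.den]
    generalize h.sz j = r
    induction r with
    | zero => rfl
    | succ r ihr => rw [iterate_succ_apply', ih _ hc, ihr]

theorem ACmd.iterate_den_var {x : Fin 8} {c : ACmd} (hc : c.KeepsVar x) (h : AState) (r : ℕ) :
    ((c.den O)^[r] h).var x = h.var x := by
  induction r with
  | zero => rfl
  | succ r ih => rw [iterate_succ_apply', den_var _ hc, ih]

theorem ACmd.iterate_den_arr {a : Fin 8} {c : ACmd} (hc : c.KeepsArr a) (h : AState) (r : ℕ) :
    ((c.den O)^[r] h).arr a = h.arr a := by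
  induction r with
  | zero => rfl
  | succ r ih => rw [iterate_succ_apply', den_arr _ hc, ih]

theorem ACmd.den_tab_ne {a b j : Fin 8} (hab : a ≠ b) (e : AExpr) (h : AState) :
    ((ACmd.tab b j e).den O h).arr a = h.arr a := update_of_ne hab _ _

theorem ACmd.den_tab_lt {a j : Fin 8} (e : AExpr) (h : AState) {i : ℕ} (hi : i < h.sz j) :
    ((ACmd.tab a j e).den O h).arr a i = e.eval O h (update noIndex 0 i) :=
  h.setArr_lt a hi _

/-! ### The subgradient descent -/

/-- Projection to the interval between `0` and the number of steps. -/
def clipE (a : AExpr) : AExpr :=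
  eMul (eLt (.const 0) a) (eIf (eLt a (.sz 4)) a (.sz 4))

variable (Fn Fd : (ℕ → ℕ → AExpr) → ℕ → AExpr)

/-- One step of the descent. -/
def stepCmd : ACmd :=
  .seq (.tab 2 3 (eAdd (.arr 2 (.ix 0)) (lossE Fn Fd 0 1)))
    (.tab 1 3 (clipE (eSub (.arr 1 (.ix 0)) (lossE Fn Fd 0 1))))

/-- The descent. -/
def descentCmd : ACmd :=
  .seq (.tab 1 3 (.const 0)) (.seq (.tab 2 3 (.const 0)) (.loop 4 (stepCmd Fn Fd)))

/-- The sums of the losses, made distinct. -/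
def skE (p : ℕ) : AExpr := eAdd (eMul (.arr 2 (.ix p)) (.sz 3)) (.ix p)

/-- The outcome of the descent. -/
def outcomeE : AExpr :=
  eSum 0 3 (eMul (eMul (eMul (innE 0) (eNot (eEx 1 3 (eMul (innE 1) (eLt (skE 1) (skE 0))))))
    (eLt (.arr 2 (.ix 0)) (eSub (.const 0) (eMul (eMul (.const 4) (.sz 3)) (.sz 4)))))
    (eAdd (.ix 0) (.const 1)))

variable {Fn Fd}

theorem eval_clipE {h : AState} {ρ : ℕ → ℤ} {a : AExpr} :
    (clipE a).eval O h ρ = max 0 (min (h.sz 4 : ℤ) (a.eval O h ρ)) := by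
  have h1 : (eLt a (.sz 4)).eval O h ρ = bi (a.eval O h ρ < h.sz 4) := eval_eLt
  rw [clipE, eval_eMul, eval_eLt, eval_const]
  rcases lt_or_ge 0 (a.eval O h ρ) with h0 | h0
  · rw [bi_pos h0, one_mul]
    rcases lt_or_ge (a.eval O h ρ) (h.sz 4) with h2 | h2
    · rw [eval_eIf_pos h1 h2]; omega
    · rw [eval_eIf_neg h1 (not_lt.2 h2), eval_sz]; omega
  · rw [bi_neg (not_lt.2 h0), zero_mul]; omega

/-- The expressions for the set function depend only on the sizes and on the given set. -/
structure Transparent (Fn Fd : (ℕ → ℕ → AExpr) → ℕ → AExpr) : Prop where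
  num : ∀ s A l, (∀ e l, (A e l).Avoids s) → (Fn A l).Avoids s
  den : ∀ s A l, (∀ e l, (A e l).Avoids s) → (Fd A l).Avoids s

/-- A step computes the losses twice, the second time after the sums in array `2` have been changed.
Both computations agree because nothing in the losses reads this array. -/
theorem avoids_innE (p : ℕ) : (innE p).Avoids (.inr 2) := by
  simp [innE, aliveE, eNot, Avoids, eAdd, eMul, relE]

theorem avoids_domE (w p l : ℕ) : (domE w p l).Avoids (.inr 2) := by
  simp [domE, xkE, avoids_innE, eNot, eEx, eSum, eLt, Avoids, eAdd, eMul, relE]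

theorem avoids_keyE (w l : ℕ) : (keyE w l).Avoids (.inr 2) := by
  simp [keyE, xbE, xkE, avoids_domE, eSum, eSub, Avoids, eAdd, eMul, relE]

theorem avoids_preE (w e l : ℕ) : (preE w e l).Avoids (.inr 2) := by
  simp [preE, eOr, eEx, eLt, avoids_keyE, avoids_innE, eSum, Avoids, eAdd, eMul, relE]

theorem avoids_betaE (hF : Transparent Fn Fd) (w l : ℕ) : (betaE Fn Fd w l).Avoids (.inr 2) := by
  have h1 := avoids_preE w
  have h2 : ∀ e l, (preqE w e l).Avoids (.inr 2) := fun e l => by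
    simp [preqE, eOr, eLt, h1, Avoids, eAdd, relE, eMul]
  simp [betaE, diffN, diffD, gnE, gdE, hF.num _ _ _ h1, hF.num _ _ _ h2, hF.den _ _ _ h1, hF.den _ _ _ h2,
    Avoids, eDiv, eMul, eSub, eSum, h1, h2]

theorem avoids_lossE (hF : Transparent Fn Fd) (p l : ℕ) : (lossE Fn Fd p l).Avoids (.inr 2) := by
  simp [lossE, avoids_innE, avoids_domE, avoids_betaE hF, eLt, eSum, Avoids, eAdd, eMul]

/-- The state of the descent after `t` steps. -/
def descentState (O : Oracle) (Fn Fd : (ℕ → ℕ → AExpr) → ℕ → AExpr) (h : AState) (t : ℕ) : AState :=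
  ((stepCmd Fn Fd).den O)^[t] ((ACmd.tab 2 3 (.const 0)).den O ((ACmd.tab 1 3 (.const 0)).den O h))

theorem descentState_zero (h : AState) : descentState O Fn Fd h 0 =
    (ACmd.tab 2 3 (.const 0)).den O ((ACmd.tab 1 3 (.const 0)).den O h) := rfl

theorem descentState_succ (h : AState) (t : ℕ) : descentState O Fn Fd h (t + 1) =
    (stepCmd Fn Fd).den O (descentState O Fn Fd h t) := iterate_succ_apply' _ _ _

theorem den_descentCmd (h : AState) :
    (descentCmd Fn Fd).den O h = descentState O Fn Fd h (h.sz 4) := rfl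

section frame

variable (h : AState) (t : ℕ)

theorem descentState_sz : (descentState O Fn Fd h t).sz = h.sz := by
  rw [descentState, ACmd.iterate_den_sz]; rfl

theorem descentState_var : (descentState O Fn Fd h t).var = h.var := by
  funext x
  rw [descentState, ACmd.iterate_den_var (by simp [stepCmd, ACmd.KeepsVar])]
  rfl

theorem descentState_arr {a : Fin 8} (h1 : a ≠ 1) (h2 : a ≠ 2) :
    (descentState O Fn Fd h t).arr a = h.arr a := by
  rw [descentState, ACmd.iterate_den_arr (by simp [stepCmd, ACmd.KeepsArr, h1, h2]),
    ACmd.den_tab_ne h2, ACmd.den_tab_ne h1]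

/-- The loss vector does not change while the sums are updated. -/
theorem descentState_succ_sums (i : ℕ) (hi : i < h.sz 3) :
    (descentState O Fn Fd h (t + 1)).arr 2 i = (descentState O Fn Fd h t).arr 2 i +
      (lossE Fn Fd 0 1).eval O (descentState O Fn Fd h t) (update noIndex 0 i) := by
  rw [descentState_succ, stepCmd, ACmd.den, ACmd.den_tab_ne (by decide),
    ACmd.den_tab_lt _ _ (by rwa [descentState_sz])]
  simp

theorem descentState_succ_vals (hF : Transparent Fn Fd) (i : ℕ) (hi : i < h.sz 3) :
    (descentState O Fn Fd h (t + 1)).arr 1 i =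
      max 0 (min (h.sz 4 : ℤ) ((descentState O Fn Fd h t).arr 1 i -
        (lossE Fn Fd 0 1).eval O (descentState O Fn Fd h t) (update noIndex 0 i))) := by
  rw [descentState_succ, stepCmd, ACmd.den]
  set g := (ACmd.tab 2 3 (eAdd (.arr 2 (.ix 0)) (lossE Fn Fd 0 1))).den O
    (descentState O Fn Fd h t) with hg
  have h1 : g.sz = h.sz := by rw [hg, ACmd.den_sz, descentState_sz]
  rw [ACmd.den_tab_lt _ _ (by rwa [h1]), eval_clipE, h1, eval_eSub]
  have h2 : (lossE Fn Fd 0 1).eval O g (update noIndex 0 i) =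
      (lossE Fn Fd 0 1).eval O (descentState O Fn Fd h t) (update noIndex 0 i) :=
    eval_congr_of_avoids (s := .inr 2) (h1.trans (descentState_sz h t).symm) (fun _ _ => rfl)
      (fun y hy => ACmd.den_tab_ne (fun h => hy (congrArg _ h.symm)) _ _) _ _ (avoids_lossE hF 0 1)
  have h3 : g.arr 1 = (descentState O Fn Fd h t).arr 1 :=
    ACmd.den_tab_ne (by decide) _ _
  rw [h2, eval_arr, h3]
  simp

end frame

variable {n k B c : ℕ} {F : Finset ℕ → ℚ} {y : ℕ → ℚ} {R : ℕ → ℕ → Prop} {h : AState} {η : ℚ}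

theorem HasSizes.congr {h h' : AState} (hs : HasSizes n k h) (hsz : h'.sz = h.sz) :
    HasSizes n k h' := by
  obtain ⟨h0, h1, h2, h3, h4, h5⟩ := hs
  exact ⟨hsz ▸ h0, hsz ▸ h1, hsz ▸ h2, hsz ▸ h3, hsz ▸ h4, hsz ▸ h5⟩

theorem HasRel.congr {N : ℕ} {h h' : AState} (hR : HasRel N R h) (hsz : h'.sz = h.sz)
    (harr : h'.arr 0 = h.arr 0) : HasRel N R h' := by
  obtain ⟨h2, h3, hr⟩ := hR
  exact ⟨hsz ▸ h2, hsz ▸ h3, harr ▸ hr⟩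

theorem HasDual.congr {N : ℕ} {h h' : AState} (hy : HasDual N y h) (hvar : h'.var 0 = h.var 0)
    (harr : h'.arr 3 = h.arr 3) : HasDual N y h' := by
  obtain ⟨h1, h2⟩ := hy
  exact ⟨hvar ▸ h1, by rw [hvar, harr]; exact h2⟩

/-- The situation in which the descent is started: the preorder `R` consists of implications for
the reduced function, `c` is the pivot and `η` is the scale. -/
structure DescentStart (n k B : ℕ) (F : Finset ℕ → ℚ) (y : ℕ → ℚ) (R : ℕ → ℕ → Prop) (c : ℕ)
    (η : ℚ) (O : Oracle) (Fn Fd : (ℕ → ℕ → AExpr) → ℕ → AExpr) (h : AState) : Prop where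
  evaluates : Evaluates n k F B O Fn Fd
  avoids : Transparent Fn Fd
  sizes : HasSizes n k h
  dual : HasDual (n * k) y h
  rel : HasRel (n * k) R h
  implications : Implications (n * k) (reduced (n * k) F y) R
  pivot : h.var 2 = c
  mem : c ∈ alive (n * k) R
  pos : 0 < η
  den_pos : 0 < h.var 5
  num_eq : (h.var 4 : ℚ) = η * h.var 5

theorem DescentStart.isDescent (hd : DescentStart n k B F y R c η O Fn Fd h) :
    IsDescent (n * k + 2) R (reduced (n * k) F y) (row (n * k + 2) R c) (free (n * k) R c) η
      (fun t => keyVal (n * k + 2) R (free (n * k) R c)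
        fun i => (descentState O Fn Fd h t).arr 1 i)
      (fun t => pull (n * k + 2) R (free (n * k) R c)
        fun i => (descentState O Fn Fd h t).arr 1 i)
      (fun t i => (descentState O Fn Fd h t).arr 1 i)
      (fun t i => (descentState O Fn Fd h t).arr 2 i) := by
  have hJ := free_subset (n * k) R c
  have hcW := (mem_alive.1 hd.mem).1
  have hlt : ∀ p ∈ free (n * k) R c, p < h.sz 3 := fun p hp => by
    rw [hd.sizes.sz3]; exact mem_range.1 (hJ hp)
  have hloss : ∀ t, ∀ p ∈ free (n * k) R c,
      (lossE Fn Fd 0 1).eval O (descentState O Fn Fd h t) (update noIndex 0 (p : ℤ)) = _ :=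
    fun t p hp => eval_lossE hd.evaluates (hd.sizes.congr (descentState_sz h t))
      (hd.dual.congr (by rw [descentState_var]) (descentState_arr h t (by decide) (by decide)))
      (hd.rel.congr (descentState_sz h t) (descentState_arr h t (by decide) (by decide)))
      hd.implications.pre hcW (by rw [descentState_var]; exact hd.pivot) hd.pos
      (by rw [descentState_var]; exact hd.den_pos) (by rw [descentState_var]; exact hd.num_eq)
      (by omega) hp (update_self _ _ _)
  refine ⟨?_, ?_, ?_, ?_, ?_, ?_⟩
  · intro t _
    refine hd.implications.isConsistent hd.mem (fun p hp q hq => ?_) fun p hp q hq => ?_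
    · exact keyVal_inj (mem_range.1 (hJ hp)) (mem_range.1 (hJ hq))
    · exact keyVal_lt hd.implications.pre hJ hp hq
  · intro t _
    exact isPull_keyVal hd.implications.pre hJ
  · intro p hp
    rw [descentState_zero, ACmd.den_tab_ne (by decide), ACmd.den_tab_lt _ _ (hlt p hp), eval_const]
  · intro p hp
    rw [descentState_zero, ACmd.den_tab_lt _ _ (by rw [ACmd.den_sz]; exact hlt p hp), eval_const]
  · intro t _ p hp
    rw [← hloss t p hp]
    exact descentState_succ_sums h t p (hlt p hp)
  · intro t _ p hp
    rw [← hloss t p hp, ← hd.sizes.sz4]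
    exact descentState_succ_vals h t hd.avoids p (hlt p hp)

/-- An element with minimal sum of losses decides: either it is below the threshold and belongs to
all minimizers, or no element is below the threshold and the closure of the pivot is almost optimal.
-/
theorem DescentStart.isOutcome (hd : DescentStart n k B F y R c η O Fn Fd h)
    (hF : IsPolymatroid (n * k) F)
    (hη : ∀ p ∈ alive (n * k) R, ¬ R (n * k) p → gain (n * k) (reduced (n * k) F y) R p ≤ η) :
    ∃ r : ℕ, outcomeE.eval O ((descentCmd Fn Fd).den O h) noIndex = r ∧
      IsOutcome (n * k) (reduced (n * k) F y) R η c r := by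
  have hI := hd.implications
  have hJ := free_subset (n * k) R c
  have hcW := (mem_alive.1 hd.mem).1
  have hD := hd.isDescent
  have hsub := hF.isSub_reduced y
  have hKJ : ∀ X ⊆ alive (n * k) R, X ⊆ row (n * k + 2) R c ∪ free (n * k) R c := by
    intro X hX p hp
    by_cases hpK : p ∈ row (n * k + 2) R c
    · exact mem_union_left _ hpK
    · exact mem_union_right _ (mem_sdiff.2 ⟨hX hp, hpK⟩)
  have hJK : row (n * k + 2) R c ∪ free (n * k) R c ⊆ alive (n * k) R :=
    union_subset (hI.row_subset_alive hd.mem) sdiff_subset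
  have hS : IsScale (n * k + 2) R (reduced (n * k) F y) (free (n * k) R c) η := by
    refine ⟨hsub.submodular, by omega, hd.pos, fun p hp => ?_⟩
    obtain ⟨hpa, hpr⟩ := mem_sdiff.1 hp
    have hpW := (mem_alive.1 hpa).1
    -- Every element implies the bottom element. So whatever the bottom implies is implied by the
    -- pivot, hence is not free, and the bound on the gains covers all free elements.
    exact hη p hpa fun hbp => hpr (mem_row.2 ⟨hpW,
      hI.pre.trans c hcW (n * k) (by omega) p hpW (hI.bot c hcW) hbp⟩)
  rw [den_descentCmd, hd.sizes.sz4]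
  set g := descentState O Fn Fd h (descentSteps (n * k + 2)) with hg
  have hgs : HasSizes n k g := hd.sizes.congr (descentState_sz h _)
  have hgR : HasRel (n * k) R g := hd.rel.congr (descentState_sz h _)
    (descentState_arr h _ (by decide) (by decide))
  have hgv : g.var 2 = c := by rw [hg, descentState_var]; exact hd.pivot
  have hsk : ∀ (ρ : ℕ → ℤ) (p a : ℕ), ρ p = a → (skE p).eval O g ρ =
      distinctVal (n * k + 2) (fun i => g.arr 2 i) a := by
    intro ρ p a hp
    simp [skE, hp, hgs.sz3, distinctVal]
  have hterm : ∀ i < n * k + 2, (eMul (eMul (eMul (innE 0) (eNot (eEx 1 3 (eMul (innE 1)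
      (eLt (skE 1) (skE 0)))))) (eLt (.arr 2 (.ix 0)) (eSub (.const 0) (eMul (eMul (.const 4)
      (.sz 3)) (.sz 4))))) (eAdd (.ix 0) (.const 1))).eval O g (update noIndex 0 (i : ℤ)) =
      bi ((i ∈ free (n * k) R c ∧ ¬ ∃ l < n * k + 2, l ∈ free (n * k) R c ∧
        distinctVal (n * k + 2) (fun i => g.arr 2 i) l <
          distinctVal (n * k + 2) (fun i => g.arr 2 i) i) ∧
        g.arr 2 i < -(4 * ((n * k + 2 : ℕ) : ℤ) * descentSteps (n * k + 2))) * (i + 1) := by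
    intro i hi
    rw [eval_eMul, eval_eAnd (eval_eAnd (eval_innE hgR hcW hgv hi (update_self _ _ _)) fun _ =>
      eval_eNot (eval_eEx fun l hl => eval_eAnd (eval_innE hgR hcW hgv (by rwa [hgs.sz3] at hl)
        (update_self _ _ _)) fun _ => eval_eLt)) fun _ => eval_eLt]
    have h0 : ∀ l : ℕ, (skE 0).eval O g (update (update noIndex 0 (i : ℤ)) 1 (l : ℤ)) = _ :=
      fun l => hsk _ 0 i (by simp)
    have h1 : ∀ l : ℕ, (skE 1).eval O g (update (update noIndex 0 (i : ℤ)) 1 (l : ℤ)) = _ :=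
      fun l => hsk _ 1 l (by simp)
    simp only [hgs.sz3, h0, h1]
    simp [hgs.sz3, hgs.sz4]
  rw [outcomeE, eval_eSum, hgs.sz3, sum_congr rfl fun i hi => hterm i (mem_range.1 hi)]
  -- Ties are broken by the index, so at most one term of the sum is nonzero. Its value is the
  -- successor of the element, which leaves `0` for failure.
  by_cases hex : ∃ i ∈ free (n * k) R c,
      (∀ l ∈ free (n * k) R c, distinctVal (n * k + 2) (fun i => g.arr 2 i) i ≤
        distinctVal (n * k + 2) (fun i => g.arr 2 i) l) ∧
      g.arr 2 i < -(4 * ((n * k + 2 : ℕ) : ℤ) * descentSteps (n * k + 2))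
  · obtain ⟨w, hw, hmin, hlt⟩ := hex
    have hwW := mem_range.1 (hJ hw)
    refine ⟨w + 1, ?_, Or.inr ⟨w, rfl, (mem_sdiff.1 hw).1, (mem_sdiff.1 hw).2, fun X hX hKX hXa hXmin =>
      hD.mem_of_lt hS hw (fun p hp => le_of_distinctVal_le (x := fun i => g.arr 2 i)
        (mem_range.1 (hJ hp)) (hmin p hp)) hlt hX hKX (hKJ X hXa) fun Y hY hKY hYJ =>
        hXmin Y hY hKY (hYJ.trans hJK)⟩⟩
    rw [sum_bi_mul_of_unique hwW (f := fun i => (i : ℤ) + 1)]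
    · push_cast; rfl
    · intro l hl
      constructor
      · rintro ⟨⟨hlJ, hno⟩, _⟩
        refine distinctVal_inj (x := fun i => g.arr 2 i) hl hwW (le_antisymm ?_ (hmin l hlJ))
        by_contra hcon
        exact hno ⟨w, hwW, hw, not_le.1 hcon⟩
      · rintro rfl
        exact ⟨⟨hw, fun ⟨l', _, hl', hlt'⟩ => absurd (hmin l' hl') (not_le.2 hlt')⟩, hlt⟩
  · refine ⟨0, ?_, Or.inl ⟨rfl, fun X hX hKX hXa =>
      hD.lt_of_forall_le hS (fun w hw => ?_) hX hKX (hKJ X hXa)⟩⟩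
    · rw [Nat.cast_zero]
      refine sum_eq_zero fun i hi => ?_
      rw [bi_neg, zero_mul]
      rintro ⟨⟨hiJ, hno⟩, hlt⟩
      exact hex ⟨i, hiJ, fun l hl => by
        by_contra hcon
        exact hno ⟨l, mem_range.1 (hJ hl), hl, not_le.1 hcon⟩, hlt⟩
    · by_contra hcon
      obtain ⟨i, hi, hmin⟩ := exists_min_image (free (n * k) R c)
        (distinctVal (n * k + 2) (fun i => g.arr 2 i)) ⟨w, hw⟩
      refine hex ⟨i, hi, hmin, lt_of_le_of_lt ?_ (not_le.1 hcon)⟩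
      exact le_of_distinctVal_le (x := fun i => g.arr 2 i) (mem_range.1 (hJ hw)) (hmin w hw)

end SubmodAlloc

namespace SubmodAlloc
open Finset Function AExpr

/-! ### Deduction of an implication -/

section commands

variable (Fn Fd : (ℕ → ℕ → AExpr) → ℕ → AExpr)

/-- The element `p` is alive and not implied by the bottom element. -/
def eligibleE (p : ℕ) : AExpr := eMul (aliveE (.ix p)) (eNot (relE (.sz 2) (.ix p)))

/-- Numerator of the gain of `p`. -/
def gainN (p l : ℕ) : AExpr := diffN Fn Fd (fun e _ => rowE p e) (fun e _ => lowerRowE p e) l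

/-- Denominator of the gain of `p`. -/
def gainD (p l : ℕ) : AExpr := diffD Fd (fun e _ => rowE p e) (fun e _ => lowerRowE p e) l

/-- The gain of `q` is larger than that of `p`, or equal to it, and then `q` is smaller. -/
def betterE (p q l : ℕ) : AExpr :=
  eOr (eLt (eMul (gainN Fn Fd p l) (gainD Fd q l)) (eMul (gainN Fn Fd q l) (gainD Fd p l)))
    (eMul (eNot (eLt (eMul (gainN Fn Fd q l) (gainD Fd p l))
      (eMul (gainN Fn Fd p l) (gainD Fd q l)))) (eLt (.ix q) (.ix p)))

/-- The successor of the eligible element with the largest gain, or `0`. -/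
def bestE : AExpr :=
  eSum 0 3 (eMul (eMul (eligibleE 0) (eNot (eEx 1 3 (eMul (eligibleE 1) (betterE Fn Fd 0 1 2)))))
    (eAdd (.ix 0) (.const 1)))

/-- The value of `a` at the chosen element. -/
def atBestE (a : AExpr) : AExpr := eSum 0 3 (eMul (eEq (eAdd (.ix 0) (.const 1)) (.var 3)) a)

/-- The preparation of the first descent. -/
def prepareCmd : ACmd :=
  .seq (.assign 3 (bestE Fn Fd)) (.seq (.assign 4 (atBestE (gainN Fn Fd 0 1)))
    (.seq (.assign 5 (atBestE (gainD Fd 0 1))) (.assign 2 (.sz 2))))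

/-- The preparation of the second descent. -/
def middleCmd : ACmd := .seq (.assign 6 outcomeE) (.assign 2 (eSub (.var 3) (.const 1)))

/-- The source of the new implication. -/
def sourceE : AExpr := eIf (eLt (.const 0) (.var 6)) (.sz 2) (eSub (.var 3) (.const 1))

/-- The target of the new implication. -/
def targetE : AExpr := eIf (eLt (.const 0) (.var 6)) (eSub (.var 6) (.const 1))
  (eIf (eLt (.const 0) (.var 7)) (eSub (.var 7) (.const 1)) (eAdd (.sz 2) (.const 1)))

/-- The new preorder. -/
def newRelE : AExpr :=
  eOr (.arr 0 (.ix 0)) (eMul (eLt (.const 0) (.var 4))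
    (eMul (relE (eDiv (.ix 0) (.sz 3)) (.var 2))
      (relE (.var 7) (eSub (.ix 0) (eMul (eDiv (.ix 0) (.sz 3)) (.sz 3))))))

/-- The addition of the new implication. -/
def extendCmd : ACmd :=
  .seq (.assign 7 outcomeE) (.seq (.assign 7 targetE) (.seq (.assign 2 sourceE)
    (.tab 0 5 newRelE)))

/-- Deleting all intermediate results. -/
def resetCmd : ACmd :=
  .seq (.assign 2 (.const 0)) (.seq (.assign 3 (.const 0)) (.seq (.assign 4 (.const 0))
    (.seq (.assign 5 (.const 0)) (.seq (.assign 6 (.const 0)) (.seq (.assign 7 (.const 0))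
      (.seq (.tab 1 3 (.const 0)) (.tab 2 3 (.const 0))))))))

/-- One deduction. -/
def deduceCmd : ACmd :=
  .seq (prepareCmd Fn Fd) (.seq (descentCmd Fn Fd) (.seq middleCmd (.seq (descentCmd Fn Fd)
    (.seq extendCmd resetCmd))))

end commands

variable {n k B : ℕ} {F : Finset ℕ → ℚ} {y : ℕ → ℚ} {R : ℕ → ℕ → Prop} {h : AState} {O : Oracle}
  {Fn Fd : (ℕ → ℕ → AExpr) → ℕ → AExpr} {ρ : ℕ → ℤ}

/-- The situation in which the reduced function is minimized. -/
structure MinStart (n k B : ℕ) (F : Finset ℕ → ℚ) (y : ℕ → ℚ) (O : Oracle)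
    (Fn Fd : (ℕ → ℕ → AExpr) → ℕ → AExpr) (h : AState) : Prop where
  evaluates : Evaluates n k F B O Fn Fd
  avoids : Transparent Fn Fd
  polymatroid : IsPolymatroid (n * k) F
  sizes : HasSizes n k h
  dual : HasDual (n * k) y h

theorem MinStart.congr {h h' : AState} (hm : MinStart n k B F y O Fn Fd h) (hsz : h'.sz = h.sz)
    (hvar : h'.var 0 = h.var 0) (harr : h'.arr 3 = h.arr 3) : MinStart n k B F y O Fn Fd h' :=
  ⟨hm.1, hm.2, hm.3, hm.4.congr hsz, hm.5.congr hvar harr⟩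

theorem gainD_pos (hm : MinStart n k B F y O Fn Fd h) (hR : HasRel (n * k) R h) {p l a : ℕ}
    (hpl : p < l) (ha : a < n * k + 2) (hp : ρ p = a) : 0 < (gainD Fd p l).eval O h ρ :=
  diffD_pos hm.evaluates hm.sizes hm.dual (memb_rowE hR hpl ha hp) (memb_lowerRowE hR hpl ha hp)

theorem gainN_eq (hm : MinStart n k B F y O Fn Fd h) (hR : HasRel (n * k) R h) {p l a : ℕ}
    (hpl : p < l) (ha : a < n * k + 2) (hp : ρ p = a) : ((gainN Fn Fd p l).eval O h ρ : ℚ) =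
      gain (n * k) (reduced (n * k) F y) R a * ((gainD Fd p l).eval O h ρ : ℚ) :=
  diffN_eq hm.evaluates hm.sizes hm.dual (memb_rowE hR hpl ha hp) (memb_lowerRowE hR hpl ha hp)

theorem eval_eligibleE (hR : HasRel (n * k) R h) {p a : ℕ} (ha : a < n * k + 2) (hp : ρ p = a) :
    (eligibleE p).eval O h ρ = bi (a ∈ alive (n * k) R ∧ ¬ R (n * k) a) :=
  eval_eAnd (eval_aliveE hR ha hp) fun _ =>
    eval_eNot (eval_relE hR (by omega) ha (by simp [hR.sz2]) hp)

/-- The gain and the negated index of an element, ordered lexicographically. -/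
noncomputable def rank (N : ℕ) (g : Finset ℕ → ℚ) (R : ℕ → ℕ → Prop) (p : ℕ) : ℚ ×ₗ ℤ :=
  toLex (gain N g R p, -(p : ℤ))

theorem rank_lt {N : ℕ} {g : Finset ℕ → ℚ} {p q : ℕ} : rank N g R p < rank N g R q ↔
    gain N g R p < gain N g R q ∨ (¬ gain N g R q < gain N g R p ∧ q < p) := by
  simp only [rank, Prod.Lex.toLex_lt_toLex]
  constructor
  · rintro (h | ⟨h, h'⟩)
    · exact Or.inl h
    · exact Or.inr ⟨by rw [h]; exact lt_irrefl _, by omega⟩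
  · rintro (h | ⟨h, h'⟩)
    · exact Or.inl h
    · rcases (not_lt.1 h).lt_or_eq with h | h
      · exact Or.inl h
      · exact Or.inr ⟨h, by omega⟩

theorem eval_gain_lt (hm : MinStart n k B F y O Fn Fd h) (hR : HasRel (n * k) R h) {p q l a b : ℕ}
    (hpl : p < l) (hql : q < l) (ha : a < n * k + 2) (hb : b < n * k + 2) (hp : ρ p = a)
    (hq : ρ q = b) :
    (eLt (eMul (gainN Fn Fd p l) (gainD Fd q l)) (eMul (gainN Fn Fd q l) (gainD Fd p l))).eval O h ρ =
      bi (gain (n * k) (reduced (n * k) F y) R a < gain (n * k) (reduced (n * k) F y) R b) := by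
  rw [eval_eLt]
  apply bi_congr
  have h1 : (0 : ℚ) < ((gainD Fd p l).eval O h ρ : ℚ) := by exact_mod_cast gainD_pos hm hR hpl ha hp
  have h2 : (0 : ℚ) < ((gainD Fd q l).eval O h ρ : ℚ) := by exact_mod_cast gainD_pos hm hR hql hb hq
  rw [← Int.cast_lt (R := ℚ), eval_eMul, eval_eMul, Int.cast_mul, Int.cast_mul,
    gainN_eq hm hR hpl ha hp, gainN_eq hm hR hql hb hq,
    mul_right_comm (gain (n * k) _ R b), mul_assoc (gain _ _ R a), mul_assoc (gain _ _ R b),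
    mul_lt_mul_iff_left₀ (mul_pos h1 h2)]

theorem eval_betterE (hm : MinStart n k B F y O Fn Fd h) (hR : HasRel (n * k) R h) {p q l a b : ℕ}
    (hpl : p < l) (hql : q < l) (ha : a < n * k + 2) (hb : b < n * k + 2) (hp : ρ p = a)
    (hq : ρ q = b) : (betterE Fn Fd p q l).eval O h ρ =
      bi (rank (n * k) (reduced (n * k) F y) R a < rank (n * k) (reduced (n * k) F y) R b) := by
  rw [betterE, eval_eOr (eval_gain_lt hm hR hpl hql ha hb hp hq) (eval_eAnd
    (eval_eNot (eval_gain_lt hm hR hql hpl hb ha hq hp)) fun _ => eval_eLt)]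
  apply bi_congr
  rw [rank_lt, eval_ix, eval_ix, hp, hq, Nat.cast_lt]

/-- Ranks of different elements differ, so exactly one eligible element has no better one; the sum
is its successor, or `0` if nothing is eligible. -/
theorem eval_bestE (hm : MinStart n k B F y O Fn Fd h) (hR : HasRel (n * k) R h) :
    ∃ r : ℕ, (bestE Fn Fd).eval O h noIndex = r ∧
      ((r = 0 ∧ IsFinal (n * k) (reduced (n * k) F y) R) ∨
        ∃ p, r = p + 1 ∧ p ∈ alive (n * k) R ∧ ¬ R (n * k) p ∧ ∀ q ∈ alive (n * k) R,
          ¬ R (n * k) q → gain (n * k) (reduced (n * k) F y) R q ≤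
            gain (n * k) (reduced (n * k) F y) R p) := by
  classical
  set rk := rank (n * k) (reduced (n * k) F y) R with hrk
  have hterm : ∀ i ∈ range (n * k + 2), (eMul (eMul (eligibleE 0) (eNot (eEx 1 3
      (eMul (eligibleE 1) (betterE Fn Fd 0 1 2))))) (eAdd (.ix 0) (.const 1))).eval O h
        (update noIndex 0 (i : ℤ)) =
      bi ((i ∈ alive (n * k) R ∧ ¬ R (n * k) i) ∧ ¬ ∃ l < n * k + 2,
        (l ∈ alive (n * k) R ∧ ¬ R (n * k) l) ∧ rk i < rk l) * (i + 1) := by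
    intro i hi
    have hi := mem_range.1 hi
    rw [eval_eMul, eval_eAnd (eval_eligibleE hR hi (update_self _ _ _)) fun _ =>
      eval_eNot (eval_eEx (P := fun l => (l ∈ alive (n * k) R ∧ ¬ R (n * k) l) ∧ rk i < rk l)
        fun l hl => ?_)]
    · simp [hm.sizes.sz3]
    · have hl : l < n * k + 2 := by rwa [hm.sizes.sz3] at hl
      exact eval_eAnd (eval_eligibleE hR hl (update_self _ _ _)) fun _ =>
        eval_betterE hm hR (by omega) (by omega) hi hl (by simp) (by simp)
  rw [bestE, eval_eSum, hm.sizes.sz3, sum_congr rfl hterm]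
  rcases ((alive (n * k) R).filter fun p => ¬ R (n * k) p).eq_empty_or_nonempty with hem | hne
  · refine ⟨0, ?_, Or.inl ⟨rfl, fun p hp hbp => ?_⟩⟩
    · rw [Nat.cast_zero]
      refine sum_eq_zero fun i _ => ?_
      rw [bi_neg, zero_mul]
      rintro ⟨hi, -⟩
      exact notMem_empty i (hem ▸ mem_filter.2 hi)
    · exact absurd (hem ▸ mem_filter.2 ⟨hp, hbp⟩) (notMem_empty p)
  · obtain ⟨p, hp, hmax⟩ := exists_max_image _ rk hne
    obtain ⟨hpa, hbp⟩ := mem_filter.1 hp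
    refine ⟨p + 1, ?_, Or.inr ⟨p, rfl, hpa, hbp, fun q hq hbq => ?_⟩⟩
    · rw [sum_bi_mul_of_unique (mem_alive.1 hpa).1 (f := fun i => (i : ℤ) + 1)]
      · push_cast; rfl
      · intro l hl
        constructor
        · rintro ⟨hl', hno⟩
          have h1 := hmax l (mem_filter.2 hl')
          rcases h1.lt_or_eq with h1 | h1
          · exact absurd ⟨p, (mem_alive.1 hpa).1, ⟨hpa, hbp⟩, h1⟩ hno
          · have := congrArg (fun z : ℚ ×ₗ ℤ => (ofLex z).2) h1
            simp [hrk, rank] at this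
            exact this
        · rintro rfl
          exact ⟨⟨hpa, hbp⟩, fun ⟨l', _, hl', hlt⟩ =>
            absurd (hmax l' (mem_filter.2 hl')) (not_le.2 hlt)⟩
    · have := hmax q (mem_filter.2 ⟨hq, hbq⟩)
      by_contra hcon
      exact absurd this (not_le.2 (rank_lt.2 (Or.inl (not_le.1 hcon))))

theorem eval_atBestE {a : AExpr} {p : ℕ} (hs : HasSizes n k h) (hp : p < n * k + 2)
    (hv : h.var 3 = p + 1) :
    (atBestE a).eval O h noIndex = a.eval O h (update noIndex 0 (p : ℤ)) := by
  rw [atBestE, eval_eSum, hs.sz3]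
  rw [← sum_bi_mul_of_unique (P := fun i => (i : ℤ) + 1 = p + 1)
    (f := fun i => a.eval O h (update noIndex 0 (i : ℤ))) hp fun l _ => by omega]
  refine sum_congr rfl fun i _ => ?_
  rw [eval_eMul, eval_eEq]
  simp [hv]

/-- If nothing is eligible, the stored gain has numerator `0`, and this will suppress the extension
of the preorder. -/
theorem eval_atBestE_zero {a : AExpr} (hv : h.var 3 = 0) :
    (atBestE a).eval O h noIndex = 0 := by
  rw [atBestE, eval_eSum]
  refine sum_eq_zero fun i _ => ?_
  rw [eval_eMul, eval_eEq, bi_neg, zero_mul]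
  simp [hv]
  omega

end SubmodAlloc

/-! ### The effect of one deduction on the stored preorder. -/

namespace SubmodAlloc
open Finset Function AExpr

variable {n k B : ℕ} {F : Finset ℕ → ℚ} {y : ℕ → ℚ} {R : ℕ → ℕ → Prop} {h : AState} {O : Oracle}
  {Fn Fd : (ℕ → ℕ → AExpr) → ℕ → AExpr}

theorem ACmd.den_seq (c c' : ACmd) (h : AState) : (ACmd.seq c c').den O h = c'.den O (c.den O h) :=
  rfl

theorem ACmd.den_assign_self (x : Fin 8) (e : AExpr) (h : AState) :
    ((ACmd.assign x e).den O h).var x = e.eval O h noIndex := update_self _ _ _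

theorem ACmd.den_assign_ne {x z : Fin 8} (hz : z ≠ x) (e : AExpr) (h : AState) :
    ((ACmd.assign x e).den O h).var z = h.var z := update_of_ne hz _ _

theorem ACmd.den_assign_arr (x : Fin 8) (e : AExpr) (h : AState) :
    ((ACmd.assign x e).den O h).arr = h.arr := rfl

theorem keeps_descentCmd :
    (∀ x, (descentCmd Fn Fd).KeepsVar x) ∧
      ∀ a, a ≠ 1 → a ≠ 2 → (descentCmd Fn Fd).KeepsArr a := by
  constructor
  · intro x; simp [descentCmd, stepCmd, ACmd.KeepsVar]
  · intro a h1 h2; simp [descentCmd, stepCmd, ACmd.KeepsArr, h1, h2]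

theorem den_descentCmd_var (x : Fin 8) : ((descentCmd Fn Fd).den O h).var x = h.var x :=
  ACmd.den_var h (keeps_descentCmd.1 x)

theorem den_descentCmd_arr {a : Fin 8} (h1 : a ≠ 1) (h2 : a ≠ 2) :
    ((descentCmd Fn Fd).den O h).arr a = h.arr a :=
  ACmd.den_arr h (keeps_descentCmd.2 a h1 h2)

/-- The denominator of the gain is computed after the numerator has been put into variable `4`,
which therefore must not be read. -/
theorem gainD_congr (hF : Transparent Fn Fd) {h h' : AState} (hsz : h.sz = h'.sz)
    (hvar : ∀ x, x ≠ 4 → h.var x = h'.var x) (harr : h.arr = h'.arr) (ρ : ℕ → ℤ) (p l : ℕ) :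
    (gainD Fd p l).eval O h ρ = (gainD Fd p l).eval O h' ρ := by
  refine eval_congr_of_avoids (s := .inl 4) hsz
    (fun x hx => hvar x fun h4 => hx (congrArg _ h4.symm)) (fun x _ => by rw [harr]) _ _ ?_
  have h1 : ∀ e l : ℕ, ((fun e _ => rowE p e : ℕ → ℕ → AExpr) e l).Avoids (.inl 4) :=
    fun e l => by simp [rowE, relE, eAdd, eMul, Avoids]
  have h2 : ∀ e l : ℕ, ((fun e _ => lowerRowE p e : ℕ → ℕ → AExpr) e l).Avoids (.inl 4) :=
    fun e l => by simp [lowerRowE, relE, eAdd, eMul, eNot, Avoids]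
  simp [gainD, diffD, gdE, eMul, Avoids, hF.den _ _ _ h1, hF.den _ _ _ h2]

/-- The state after the preparation: the chosen element, its gain, and the first pivot. -/
theorem den_prepareCmd (hm : MinStart n k B F y O Fn Fd h) (hR : HasRel (n * k) R h) :
    ((prepareCmd Fn Fd).den O h).var 2 = (n * k : ℕ) ∧
    ((IsFinal (n * k) (reduced (n * k) F y) R ∧ ((prepareCmd Fn Fd).den O h).var 4 ≤ 0) ∨
      ∃ p ∈ alive (n * k) R, ¬ R (n * k) p ∧
        (∀ q ∈ alive (n * k) R, ¬ R (n * k) q → gain (n * k) (reduced (n * k) F y) R q ≤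
            gain (n * k) (reduced (n * k) F y) R p) ∧
        0 < gain (n * k) (reduced (n * k) F y) R p ∧
        ((prepareCmd Fn Fd).den O h).var 3 = p + 1 ∧
        0 < ((prepareCmd Fn Fd).den O h).var 4 ∧
        0 < ((prepareCmd Fn Fd).den O h).var 5 ∧
        (((prepareCmd Fn Fd).den O h).var 4 : ℚ) =
          gain (n * k) (reduced (n * k) F y) R p * ((prepareCmd Fn Fd).den O h).var 5) := by
  obtain ⟨r, hr, hcase⟩ := eval_bestE hm hR
  simp only [prepareCmd, ACmd.den_seq]
  obtain ⟨h1, e1⟩ : ∃ h1, h1 = (ACmd.assign 3 (bestE Fn Fd)).den O h := ⟨_, rfl⟩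
  rw [← e1]
  have s1 : h1.sz = h.sz := by rw [e1, ACmd.den_sz]
  have hm1 : MinStart n k B F y O Fn Fd h1 :=
    hm.congr s1 (by rw [e1, ACmd.den_assign_ne (by decide)]) (by rw [e1, ACmd.den_assign_arr])
  have hR1 : HasRel (n * k) R h1 := hR.congr s1 (by rw [e1, ACmd.den_assign_arr])
  have h13 : h1.var 3 = r := by rw [e1, ACmd.den_assign_self, hr]
  obtain ⟨h2, e2⟩ : ∃ h2, h2 = (ACmd.assign 4 (atBestE (gainN Fn Fd 0 1))).den O h1 := ⟨_, rfl⟩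
  rw [← e2]
  have s2 : h2.sz = h1.sz := by rw [e2, ACmd.den_sz]
  have v2 : ∀ x : Fin 8, x ≠ 4 → h2.var x = h1.var x := fun x hx => by
    rw [e2, ACmd.den_assign_ne hx]
  have h24 : h2.var 4 = (atBestE (gainN Fn Fd 0 1)).eval O h1 noIndex := by
    rw [e2, ACmd.den_assign_self]
  have a2 : h2.arr = h1.arr := by rw [e2, ACmd.den_assign_arr]
  rw [ACmd.den_assign_self, ACmd.den_assign_ne (show (4 : Fin 8) ≠ 2 by decide),
    ACmd.den_assign_ne (show (4 : Fin 8) ≠ 5 by decide),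
    ACmd.den_assign_ne (show (3 : Fin 8) ≠ 2 by decide),
    ACmd.den_assign_ne (show (3 : Fin 8) ≠ 5 by decide),
    ACmd.den_assign_ne (show (5 : Fin 8) ≠ 2 by decide), ACmd.den_assign_self, eval_sz, ACmd.den_sz,
    s2, hm1.sizes.sz2, v2 3 (by decide), h13, h24]
  refine ⟨rfl, ?_⟩
  rcases hcase with ⟨h0, hf⟩ | ⟨p, hp, hpa, hbp, hmax⟩
  · exact Or.inl ⟨hf, by rw [eval_atBestE_zero (by rw [h13, h0]; rfl)]⟩
  · have hpW := (mem_alive.1 hpa).1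
    have h13' : h1.var 3 = p + 1 := by rw [h13, hp]; push_cast; rfl
    have hp0 : (update noIndex 0 (p : ℤ)) 0 = p := update_self _ _ _
    have hN := gainN_eq hm1 hR1 (show 0 < 1 by omega) hpW hp0
    have hD := gainD_pos hm1 hR1 (show 0 < 1 by omega) hpW hp0
    have hD' : (0 : ℚ) < ((gainD Fd 0 1).eval O h1 (update noIndex 0 (p : ℤ)) : ℚ) := by
      exact_mod_cast hD
    rw [eval_atBestE hm1.sizes hpW h13', eval_atBestE (hm1.sizes.congr s2) hpW
      (by rw [v2 3 (by decide), h13']), gainD_congr hm.avoids s2 v2 a2]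
    by_cases hη : 0 < gain (n * k) (reduced (n * k) F y) R p
    · refine Or.inr ⟨p, hpa, hbp, hmax, hη, by rw [hp]; push_cast; rfl, ?_, hD, hN⟩
      have : (0 : ℚ) < ((gainN Fn Fd 0 1).eval O h1 (update noIndex 0 (p : ℤ)) : ℚ) := by
        rw [hN]; exact mul_pos hη hD'
      exact_mod_cast this
    · refine Or.inl ⟨fun q hq hbq => (hmax q hq hbq).trans (not_lt.1 hη), ?_⟩
      have : ((gainN Fn Fd 0 1).eval O h1 (update noIndex 0 (p : ℤ)) : ℚ) ≤ 0 := by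
        rw [hN]; exact mul_nonpos_of_nonpos_of_nonneg (not_lt.1 hη) hD'.le
      exact_mod_cast this

/-- The preorder after the addition of the new implication. -/
theorem hasRel_extend {h : AState} {R' : ℕ → ℕ → Prop} (hs : HasSizes n k h)
    (hR : HasRel (n * k) R h)
    (hnew : ∀ p < n * k + 2, ∀ q < n * k + 2, (eMul (eLt (.const 0) (.var 4))
      (eMul (relE (eDiv (.ix 0) (.sz 3)) (.var 2)) (relE (.var 7)
        (eSub (.ix 0) (eMul (eDiv (.ix 0) (.sz 3)) (.sz 3)))))).eval O h
          (update noIndex 0 ((p * (n * k + 2) + q : ℕ) : ℤ)) = bi (R' p q)) :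
    HasRel (n * k) (fun p q => R p q ∨ R' p q) ((ACmd.tab 0 5 newRelE).den O h) where
  sz2 := hs.sz2
  sz3 := hs.sz3
  rel p hp q hq := by
    have hlt : p * (n * k + 2) + q < h.sz 5 := by
      rw [hs.sz5]
      have : (p + 1) * (n * k + 2) ≤ (n * k + 2) * (n * k + 2) := Nat.mul_le_mul_right _ hp
      nlinarith
    have h1 := ACmd.den_tab_lt (O := O) (a := 0) newRelE h hlt
    have h2 : (AExpr.arr 0 (.ix 0)).eval O h (update noIndex 0
        ((p * (n * k + 2) + q : ℕ) : ℤ)) = bi (R p q) := by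
      rw [← hR.rel p hp q hq]
      simp
    rw [newRelE, eval_eOr h2 (hnew p hp q hq)] at h1
    rw [← h1]
    push_cast
    rfl

theorem eval_div_index {h : AState} (hs : HasSizes n k h) (p : ℕ) {q : ℕ} (hq : q < n * k + 2) :
    (eDiv (.ix 0) (.sz 3)).eval O h (update noIndex 0 ((p * (n * k + 2) + q : ℕ) : ℤ)) = p := by
  rw [eval_eDiv, eval_ix, eval_sz, update_self, hs.sz3, ← Int.natCast_div]
  congr 1
  rw [Nat.add_comm, Nat.add_mul_div_right _ _ (by omega), Nat.div_eq_of_lt hq, Nat.zero_add]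

theorem eval_mod_index {h : AState} (hs : HasSizes n k h) (p : ℕ) {q : ℕ} (hq : q < n * k + 2) :
    (eSub (.ix 0) (eMul (eDiv (.ix 0) (.sz 3)) (.sz 3))).eval O h
      (update noIndex 0 ((p * (n * k + 2) + q : ℕ) : ℤ)) = q := by
  rw [eval_eSub, eval_eMul, eval_div_index hs p hq, eval_ix, update_self, eval_sz, hs.sz3]
  push_cast
  ring

theorem eval_newImp {h : AState} {v w : ℕ} (hs : HasSizes n k h) (hR : HasRel (n * k) R h)
    (hpos : 0 < h.var 4) (hv : v < n * k + 2) (hw : w < n * k + 2) (h2 : h.var 2 = v)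
    (h7 : h.var 7 = w) {p q : ℕ} (hp : p < n * k + 2) (hq : q < n * k + 2) :
    (eMul (eLt (.const 0) (.var 4)) (eMul (relE (eDiv (.ix 0) (.sz 3)) (.var 2)) (relE (.var 7)
        (eSub (.ix 0) (eMul (eDiv (.ix 0) (.sz 3)) (.sz 3)))))).eval O h
          (update noIndex 0 ((p * (n * k + 2) + q : ℕ) : ℤ)) = bi (R p v ∧ R w q) := by
  rw [eval_eMul, eval_eLt, eval_const, eval_var, bi_pos hpos, one_mul]
  exact eval_eAnd (eval_relE hR hp hv (eval_div_index hs p hq) h2)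
    fun _ => eval_relE hR hw hq h7 (eval_mod_index hs p hq)

/-- Loops have fixed lengths, so deductions continue after the preorder is final. The descents then
run on meaningless data, but the condition that variable `4` be positive keeps the preorder as it
is. -/
theorem hasRel_extendCmd_of_not_pos {h : AState} (hs : HasSizes n k h) (hR : HasRel (n * k) R h)
    (hpos : h.var 4 ≤ 0) : HasRel (n * k) R (extendCmd.den O h) := by
  simp only [extendCmd, ACmd.den_seq]
  obtain ⟨h', e'⟩ : ∃ h', h' = (ACmd.assign 2 sourceE).den O ((ACmd.assign 7 targetE).den O
    ((ACmd.assign 7 outcomeE).den O h)) := ⟨_, rfl⟩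
  rw [← e']
  have hsz : h'.sz = h.sz := by simp only [e', ACmd.den_sz]
  have h4 : h'.var 4 = h.var 4 := by
    rw [e', ACmd.den_assign_ne (by decide), ACmd.den_assign_ne (by decide),
      ACmd.den_assign_ne (by decide)]
  have hR' : HasRel (n * k) R h' := hR.congr hsz (by simp only [e', ACmd.den_assign_arr])
  have := hasRel_extend (O := O) (R' := fun _ _ => False) (hs.congr hsz) hR' fun p hp q hq => by
    rw [eval_eMul, eval_eLt, eval_const, eval_var, h4, bi_neg (not_lt.2 hpos), zero_mul,
      bi_neg not_false]
  simpa using this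

theorem hasRel_extendCmd {h : AState} {v r r' : ℕ} (hs : HasSizes n k h) (hR : HasRel (n * k) R h)
    (hpos : 0 < h.var 4) (hv : v < n * k + 2) (h3 : h.var 3 = v + 1) (h6 : h.var 6 = r)
    (h7 : outcomeE.eval O h noIndex = r') (hr : r ≤ n * k + 2) (hr' : r' ≤ n * k + 2) :
    HasRel (n * k) (addImp R (deduced (n * k) v r r').1 (deduced (n * k) v r r').2)
      (extendCmd.den O h) := by
  simp only [extendCmd, ACmd.den_seq]
  obtain ⟨h1, e1⟩ : ∃ h1, h1 = (ACmd.assign 7 outcomeE).den O h := ⟨_, rfl⟩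
  rw [← e1]
  have s1 : h1.sz = h.sz := by rw [e1, ACmd.den_sz]
  have v1 : ∀ x : Fin 8, x ≠ 7 → h1.var x = h.var x := fun x hx => by rw [e1, ACmd.den_assign_ne hx]
  have v17 : h1.var 7 = r' := by rw [e1, ACmd.den_assign_self, h7]
  obtain ⟨h2, e2⟩ : ∃ h2, h2 = (ACmd.assign 7 targetE).den O h1 := ⟨_, rfl⟩
  rw [← e2]
  have s2 : h2.sz = h.sz := by rw [e2, ACmd.den_sz, s1]
  have v2 : ∀ x : Fin 8, x ≠ 7 → h2.var x = h.var x := fun x hx => by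
    rw [e2, ACmd.den_assign_ne hx, v1 x hx]
  have v27 : h2.var 7 = targetE.eval O h1 noIndex := by rw [e2, ACmd.den_assign_self]
  obtain ⟨h3', e3⟩ : ∃ h3, h3 = (ACmd.assign 2 sourceE).den O h2 := ⟨_, rfl⟩
  rw [← e3]
  have s3 : h3'.sz = h.sz := by rw [e3, ACmd.den_sz, s2]
  have c6 : ∀ h' : AState, h'.var 6 = h.var 6 →
      (eLt (.const 0) (.var 6)).eval O h' noIndex = bi (0 < r) := fun h' hv' => by
    rw [eval_eLt, eval_const, eval_var, hv', h6]; exact bi_congr (by omega)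
  have c7 : (eLt (.const 0) (.var 7)).eval O h1 noIndex = bi (0 < r') := by
    rw [eval_eLt, eval_const, eval_var, v17]; exact bi_congr (by omega)
  have c61 := c6 h1 (v1 6 (by decide))
  have c62 := c6 h2 (v2 6 (by decide))
  have target : h3'.var 7 = ((deduced (n * k) v r r').2 : ℕ) := by
    rw [e3, ACmd.den_assign_ne (by decide), v27, targetE, deduced]
    by_cases h0 : 0 < r
    · rw [eval_eIf_pos c61 h0, if_pos h0, eval_eSub, eval_var, v1 6 (by decide), h6]
      push_cast [Nat.cast_sub h0]; rfl
    · rw [eval_eIf_neg c61 h0, if_neg h0]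
      by_cases h0' : 0 < r'
      · rw [eval_eIf_pos c7 h0', if_pos h0', eval_eSub, eval_var, v17]
        push_cast [Nat.cast_sub h0']; rfl
      · rw [eval_eIf_neg c7 h0', if_neg h0', eval_eAdd, eval_sz, s1, hs.sz2]
        push_cast; rfl
  have source : h3'.var 2 = ((deduced (n * k) v r r').1 : ℕ) := by
    rw [e3, ACmd.den_assign_self, sourceE, deduced]
    by_cases h0 : 0 < r
    · rw [eval_eIf_pos c62 h0, if_pos h0, eval_sz, s2, hs.sz2]
    · rw [eval_eIf_neg c62 h0, if_neg h0, eval_eSub, eval_var, v2 3 (by decide), h3]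
      by_cases h0' : 0 < r' <;> simp [h0']
  have hlt : (deduced (n * k) v r r').1 < n * k + 2 ∧ (deduced (n * k) v r r').2 < n * k + 2 := by
    unfold deduced
    split_ifs <;> constructor <;> dsimp only <;> omega
  have h34 : h3'.var 4 = h.var 4 := by rw [e3, ACmd.den_assign_ne (by decide), v2 4 (by decide)]
  have hR3 : HasRel (n * k) R h3' := hR.congr s3 (by simp only [e3, e2, e1, ACmd.den_assign_arr])
  exact hasRel_extend (hs.congr s3) hR3 fun p hp q hq =>
    eval_newImp (hs.congr s3) hR3 (by rwa [h34]) hlt.1 hlt.2 source target hp hq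

/-- The effect of a deduction. -/
theorem den_deduceCmd (hm : MinStart n k B F y O Fn Fd h) (hR : HasRel (n * k) R h)
    (hI : Implications (n * k) (reduced (n * k) F y) R) :
    ∃ R', HasRel (n * k) R' ((deduceCmd Fn Fd).den O h) ∧
      Implications (n * k) (reduced (n * k) F y) R' ∧
      (IsFinal (n * k) (reduced (n * k) F y) R' ∨
        (¬ IsFinal (n * k) (reduced (n * k) F y) R ∧ relCard (n * k) R < relCard (n * k) R')) := by
  have hprep := den_prepareCmd hm hR
  simp only [deduceCmd, ACmd.den_seq]
  have hreset : ∀ {R' : ℕ → ℕ → Prop} {g : AState}, HasRel (n * k) R' g →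
      HasRel (n * k) R' (resetCmd.den O g) := fun hR' => hR'.congr (ACmd.den_sz _ _ _)
    (ACmd.den_arr _ (by simp [resetCmd, ACmd.KeepsArr]))
  have p0 : ((prepareCmd Fn Fd).den O h).var 0 = h.var 0 :=
    ACmd.den_var _ (by simp [prepareCmd, ACmd.KeepsVar])
  have pa : ∀ a, ((prepareCmd Fn Fd).den O h).arr a = h.arr a := fun a =>
    ACmd.den_arr _ (by simp [prepareCmd, ACmd.KeepsArr])
  have ps : ((prepareCmd Fn Fd).den O h).sz = h.sz := ACmd.den_sz _ _ _
  obtain ⟨h1, e1⟩ : ∃ h1, h1 = (prepareCmd Fn Fd).den O h := ⟨_, rfl⟩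
  rw [← e1] at hprep p0 pa ps ⊢
  have s2 : ((descentCmd Fn Fd).den O h1).sz = h.sz := (ACmd.den_sz _ _ _).trans ps
  have v2 : ∀ x, ((descentCmd Fn Fd).den O h1).var x = h1.var x := fun x => den_descentCmd_var x
  have a2 : ∀ a : Fin 8, a ≠ 1 → a ≠ 2 → ((descentCmd Fn Fd).den O h1).arr a = h.arr a :=
    fun a ha ha' => (den_descentCmd_arr ha ha').trans (pa a)
  have start1 : ∀ {c : ℕ} {η : ℚ}, h1.var 2 = c → c ∈ alive (n * k) R → 0 < η → 0 < h1.var 5 →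
      (h1.var 4 : ℚ) = η * h1.var 5 → DescentStart n k B F y R c η O Fn Fd h1 :=
    fun h2 hc hη h5 h4 => ⟨hm.evaluates, hm.avoids, hm.sizes.congr ps, hm.dual.congr p0 (pa 3),
      hR.congr ps (pa 0), hI, h2, hc, hη, h5, h4⟩
  have out1 := fun c η h2 hc hη h5 h4 hmax =>
    (start1 (c := c) (η := η) h2 hc hη h5 h4).isOutcome hm.polymatroid hmax
  obtain ⟨h2, e2⟩ : ∃ h2, h2 = (descentCmd Fn Fd).den O h1 := ⟨_, rfl⟩
  rw [← e2] at s2 v2 a2 out1 ⊢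
  have s3 : (middleCmd.den O h2).sz = h.sz := (ACmd.den_sz _ _ _).trans s2
  have v3 : ∀ x : Fin 8, x ≠ 2 → x ≠ 6 → (middleCmd.den O h2).var x = h1.var x :=
    fun x hx hx' => (ACmd.den_var _ (by simp [middleCmd, ACmd.KeepsVar, hx, hx'])).trans (v2 x)
  have v36 : (middleCmd.den O h2).var 6 = outcomeE.eval O h2 noIndex := by
    rw [middleCmd, ACmd.den_seq, ACmd.den_assign_ne (by decide), ACmd.den_assign_self]
  have v32 : (middleCmd.den O h2).var 2 = h1.var 3 - 1 := by
    rw [middleCmd, ACmd.den_seq, ACmd.den_assign_self, eval_eSub, eval_var,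
      ACmd.den_assign_ne (by decide), v2]
    rfl
  have a3 : ∀ a : Fin 8, a ≠ 1 → a ≠ 2 → (middleCmd.den O h2).arr a = h.arr a :=
    fun a ha ha' => (ACmd.den_arr _ (by simp [middleCmd, ACmd.KeepsArr])).trans (a2 a ha ha')
  obtain ⟨h3, e3⟩ : ∃ h3, h3 = middleCmd.den O h2 := ⟨_, rfl⟩
  rw [← e3] at s3 v3 v36 v32 a3 ⊢
  have start3 : ∀ {c : ℕ} {η : ℚ}, h3.var 2 = c → c ∈ alive (n * k) R → 0 < η → 0 < h3.var 5 →
      (h3.var 4 : ℚ) = η * h3.var 5 → DescentStart n k B F y R c η O Fn Fd h3 :=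
    fun h2 hc hη h5 h4 => ⟨hm.evaluates, hm.avoids, hm.sizes.congr s3,
      hm.dual.congr ((v3 0 (by decide) (by decide)).trans p0) (a3 3 (by decide) (by decide)),
      hR.congr s3 (a3 0 (by decide) (by decide)), hI, h2, hc, hη, h5, h4⟩
  have out3 := fun c η h2 hc hη h5 h4 hmax =>
    (start3 (c := c) (η := η) h2 hc hη h5 h4).isOutcome hm.polymatroid hmax
  have s4 : ((descentCmd Fn Fd).den O h3).sz = h.sz := (ACmd.den_sz _ _ _).trans s3
  have v4 : ∀ x, ((descentCmd Fn Fd).den O h3).var x = h3.var x := fun x => den_descentCmd_var x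
  have a4 : ((descentCmd Fn Fd).den O h3).arr 0 = h.arr 0 :=
    (den_descentCmd_arr (by decide) (by decide)).trans (a3 0 (by decide) (by decide))
  obtain ⟨h4, e4⟩ : ∃ h4, h4 = (descentCmd Fn Fd).den O h3 := ⟨_, rfl⟩
  rw [← e4] at s4 v4 a4 out3 ⊢
  have hs4 := hm.sizes.congr s4
  have hR4 := hR.congr s4 a4
  have v44 : h4.var 4 = h1.var 4 := (v4 4).trans (v3 4 (by decide) (by decide))
  have v43 : h4.var 3 = h1.var 3 := (v4 3).trans (v3 3 (by decide) (by decide))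
  have v35 := v3 5 (by decide) (by decide)
  have v34 := v3 4 (by decide) (by decide)
  -- The facts about the descents have been stated conditionally, because their hypotheses hold only
  -- if the largest gain is positive.
  obtain ⟨h12, ⟨hf, hle⟩ | ⟨p, hpa, hbp, hmax, hη, h13, h14, h15, heq⟩⟩ := hprep
  · exact ⟨R, hreset (hasRel_extendCmd_of_not_pos hs4 hR4 (by rwa [v44])), hI, Or.inl hf⟩
  · have hN : n * k ∈ alive (n * k) R := mem_alive.2 ⟨by omega, hI.not_bot_top⟩
    have hpW := (mem_alive.1 hpa).1
    -- The first descent has the bottom element as pivot, the second one the element of largest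
    -- gain; both use this gain as scale.
    obtain ⟨r, hr, hor⟩ := out1 (n * k) _ h12 hN hη h15 heq hmax
    obtain ⟨r', hr', hor'⟩ := out3 p _ (by rw [v32, h13]; ring) hpa hη (by rwa [v35])
      (by rw [v34, v35]; exact heq) hmax
    have hle : ∀ {v r : ℕ}, IsOutcome (n * k) (reduced (n * k) F y) R
        (gain (n * k) (reduced (n * k) F y) R p) v r → r ≤ n * k + 2 := by
      rintro v r (⟨rfl, _⟩ | ⟨w, rfl, hw, _⟩)
      · omega
      · exact (mem_alive.1 hw).1
    have hd := hI.deduce (hm.polymatroid.isSub_reduced y) hpa hbp hor hor'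
    refine ⟨_, hreset (hasRel_extendCmd hs4 hR4 (by rwa [v44]) hpW (by rw [v43, h13])
      (by rw [v4, v36, hr]) hr' (hle hor) (hle hor')), hd.1, Or.inr ⟨?_, hd.2⟩⟩
    exact fun hf => absurd (hf p hpa hbp) (not_le.2 hη)

end SubmodAlloc

namespace SubmodAlloc
open Finset Function AExpr

/-! ### Minimization, Newton iteration, and the main loop -/

section commands

variable (Fn Fd : (ℕ → ℕ → AExpr) → ℕ → AExpr)

/-- The trivial implications. -/
def trivialRelE : AExpr :=
  eOr (eEq (eDiv (.ix 0) (.sz 3)) (eSub (.ix 0) (eMul (eDiv (.ix 0) (.sz 3)) (.sz 3))))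
    (eOr (eEq (eSub (.ix 0) (eMul (eDiv (.ix 0) (.sz 3)) (.sz 3))) (.sz 2))
      (eEq (eDiv (.ix 0) (.sz 3)) (eAdd (.sz 2) (.const 1))))

/-- Minimization of the reduced function. -/
def minimizeCmd : ACmd := .seq (.tab 0 5 trivialRelE) (.loop 5 (deduceCmd Fn Fd))

/-- Membership in the set of the elements that are alive. -/
def aliveSetE (e _ : ℕ) : AExpr := aliveE (.ix e)

/-- Membership in the current set of the Newton iteration. -/
def currentE (e _ : ℕ) : AExpr := .arr 5 (.ix e)

/-- Replacing the current set by the minimizer if this is negative. -/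
def improveCmd : ACmd :=
  .tab 5 2 (eIf (eLt (gnE Fn Fd aliveSetE 1) (.const 0)) (aliveSetE 0 1) (currentE 0 1))

/-- Remainder modulo `n`. -/
def modE (e : ℕ) : AExpr := eSub (.ix e) (eMul (.sz 1) (eDiv (.ix e) (.sz 1)))

/-- The number of elements of the current set that belong to the current customer. -/
def multiplicityE : AExpr := eSum 0 2 (eMul (.arr 5 (.ix 0)) (eEq (modE 0) (.var 1)))

/-- Sum of the dual variables over the elements of the current set that do not belong to the
current customer. -/
def otherSumE : AExpr :=
  eSum 0 2 (eMul (eMul (.arr 5 (.ix 0)) (eNot (eEq (modE 0) (.var 1)))) (.arr 3 (.ix 0)))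

/-- The new entries of the dual solution. -/
def newDualE : AExpr :=
  eIf (eEq (modE 0) (.var 1)) (.var 5) (eMul (.arr 3 (.ix 0)) (eMul (.var 2) (.var 4)))

/-- Changing the dual variable of the current customer such that the current set is tight. -/
def updateCmd : ACmd :=
  .seq (.assign 2 (Fd currentE 0)) (.seq (.assign 3 (Fn currentE 0)) (.seq (.assign 4 multiplicityE)
    (.seq (.assign 5 (eSub (eMul (.var 3) (.var 0)) (eMul (.var 2) otherSumE)))
      (.seq (.tab 3 2 newDualE) (.seq (.assign 0 (eMul (.var 0) (eMul (.var 2) (.var 4))))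
        (.seq (.assign 2 (.const 0)) (.seq (.assign 3 (.const 0)) (.seq (.assign 4 (.const 0))
          (.assign 5 (.const 0))))))))))

/-- One Newton step. -/
def newtonCmd : ACmd := .seq (minimizeCmd Fn Fd) (.seq (improveCmd Fn Fd) (updateCmd Fn Fd))

/-- The treatment of one customer. -/
def customerCmd : ACmd :=
  .seq (.tab 5 2 (.const 1)) (.seq (updateCmd Fn Fd) (.seq (.loop 0 (newtonCmd Fn Fd))
    (.seq (.tab 4 2 (eOr (.arr 4 (.ix 0)) (.arr 5 (.ix 0)))) (.assign 1 (eAdd (.var 1) (.const 1))))))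

/-- The binary encoding of the assignment. -/
def outputE : AExpr :=
  eSum 0 2 (eMul (eMul (.arr 4 (.ix 0)) (eNot (eEx 1 2 (eMul (eLt (.ix 1) (.ix 0))
    (eMul (.arr 4 (.ix 1)) (eEq (modE 1) (modE 0)))))))
    (.fold true 1 2 (eAdd (.const 1) (eLt (.ix 1) (.ix 0)))))

/-- The approximation algorithm. -/
def mainCmd : ACmd :=
  .seq (.assign 0 (.const 1)) (.seq (.loop 1 (customerCmd Fn Fd)) (.assign 0 outputE))

end commands

variable {n k B : ℕ} {F : Finset ℕ → ℚ} {y : ℕ → ℚ} {R : ℕ → ℕ → Prop} {h : AState} {O : Oracle}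
  {Fn Fd : (ℕ → ℕ → AExpr) → ℕ → AExpr} {ρ : ℕ → ℤ}

theorem keeps_deduceCmd : (∀ x : Fin 8, x < 2 → (deduceCmd Fn Fd).KeepsVar x) ∧
    ∀ a : Fin 8, 3 ≤ a → (deduceCmd Fn Fd).KeepsArr a := by
  constructor
  · intro x hx
    have h2 : ∀ z : Fin 8, 2 ≤ z → x ≠ z := fun z hz => (hx.trans_le hz).ne
    simp [deduceCmd, prepareCmd, descentCmd, stepCmd, middleCmd, extendCmd, resetCmd, ACmd.KeepsVar,
      h2]
  · intro a ha
    have h2 : ∀ z : Fin 8, z < 3 → a ≠ z := fun z hz => (hz.trans_le ha).ne'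
    simp [deduceCmd, prepareCmd, descentCmd, stepCmd, middleCmd, extendCmd, resetCmd, ACmd.KeepsArr,
      h2]

theorem keeps_minimizeCmd : (∀ x : Fin 8, x < 2 → (minimizeCmd Fn Fd).KeepsVar x) ∧
    ∀ a : Fin 8, 3 ≤ a → (minimizeCmd Fn Fd).KeepsArr a :=
  ⟨fun x hx => ⟨trivial, keeps_deduceCmd.1 x hx⟩,
    fun a ha => ⟨fun h => by subst h; exact absurd ha (by decide), keeps_deduceCmd.2 a ha⟩⟩

theorem hasRel_trivialRelE (hs : HasSizes n k h) :
    HasRel (n * k) (trivialImp (n * k)) ((ACmd.tab 0 5 trivialRelE).den O h) where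
  sz2 := hs.sz2
  sz3 := hs.sz3
  rel p hp q hq := by
    have hlt : p * (n * k + 2) + q < h.sz 5 := by
      rw [hs.sz5]
      have : (p + 1) * (n * k + 2) ≤ (n * k + 2) * (n * k + 2) := Nat.mul_le_mul_right _ hp
      nlinarith
    have h1 := ACmd.den_tab_lt (O := O) (a := 0) trivialRelE h hlt
    have hdiv := eval_div_index (O := O) hs p hq
    have hmod := eval_mod_index (O := O) hs p hq
    have h2 : trivialRelE.eval O h (update noIndex 0 ((p * (n * k + 2) + q : ℕ) : ℤ)) =
        bi (trivialImp (n * k) p q) := by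
      rw [trivialRelE, eval_eOr eval_eEq (eval_eOr eval_eEq eval_eEq), hdiv, hmod, eval_sz,
        eval_eAdd, eval_sz, eval_const, hs.sz2]
      exact bi_congr (by unfold trivialImp; omega)
    have h3 := h1.trans h2
    push_cast at h3 ⊢
    exact h3

/-- Each round leaves a final preorder or enlarges a preorder that was not final, and there are as
many rounds as pairs. Once final, the preorder stays final. -/
theorem den_minimizeCmd (hm : MinStart n k B F y O Fn Fd h) :
    ∃ R, HasRel (n * k) R ((minimizeCmd Fn Fd).den O h) ∧
      Implications (n * k) (reduced (n * k) F y) R ∧ IsFinal (n * k) (reduced (n * k) F y) R := by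
  simp only [minimizeCmd, ACmd.den]
  obtain ⟨h0, e0⟩ : ∃ h0, h0 = (h.setArr 0 (h.sz 5) fun i =>
    trivialRelE.eval O h (update noIndex 0 i)) := ⟨_, rfl⟩
  have hR0 : HasRel (n * k) (trivialImp (n * k)) h0 := e0 ▸ hasRel_trivialRelE hm.sizes
  have hm0 : MinStart n k B F y O Fn Fd h0 := by
    rw [e0]
    exact hm.congr rfl rfl (AState.setArr_ne _ (by decide) _ _)
  rw [← e0, hm0.sizes.sz5]
  have key : ∀ j, ∃ R, HasRel (n * k) R (((deduceCmd Fn Fd).den O)^[j] h0) ∧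
      Implications (n * k) (reduced (n * k) F y) R ∧
      (IsFinal (n * k) (reduced (n * k) F y) R ∨ j ≤ relCard (n * k) R) := by
    intro j
    induction j with
    | zero => exact ⟨_, hR0, implications_trivialImp _ _, Or.inr (Nat.zero_le _)⟩
    | succ j ih =>
      obtain ⟨R, hR, hI, hj⟩ := ih
      have hmj : MinStart n k B F y O Fn Fd (((deduceCmd Fn Fd).den O)^[j] h0) :=
        hm0.congr (ACmd.iterate_den_sz _ _ _ _)
          (ACmd.iterate_den_var (keeps_deduceCmd.1 0 (by decide)) _ _)
          (ACmd.iterate_den_arr (keeps_deduceCmd.2 3 (by decide)) _ _)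
      obtain ⟨R', hR', hI', hj'⟩ := den_deduceCmd hmj hR hI
      refine ⟨R', by rwa [iterate_succ_apply'], hI', ?_⟩
      rcases hj' with hf | ⟨hf, hlt⟩
      · exact Or.inl hf
      · have := hj.resolve_left hf
        exact Or.inr (by omega)
  obtain ⟨R, hR, hI, hj⟩ := key ((n * k + 2) ^ 2)
  refine ⟨R, hR, hI, ?_⟩
  rcases hj with hf | hj
  · exact hf
  -- With all pairs in the preorder no element could be alive.
  · intro p hp
    have := relCard_lt hp
    omega

/-- The set `A` is stored in the array `a`. -/
def HasSet (a : Fin 8) (N : ℕ) (A : Finset ℕ) (h : AState) : Prop :=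
  ∀ e < N, h.arr a e = bi (e ∈ A)

theorem memb_currentE {A : Finset ℕ} {l : ℕ} (hA : HasSet 5 (n * k) A h) :
    Memb O h (n * k) ρ l currentE A := by
  intro ρ' e l' a _ _ _ ha he
  rw [currentE, eval_arr, eval_ix, he, hA a ha]

theorem memb_aliveSetE {N l : ℕ} (hR : HasRel N R h) :
    Memb O h N ρ l aliveSetE (alive N R ∩ range N) := by
  intro ρ' e l' a _ _ _ ha he
  rw [aliveSetE, eval_aliveE (p := .ix e) hR (by omega : a < N + 2) he]
  exact bi_congr (by simp [ha])

theorem eval_modE (hs : HasSizes n k h) {e a : ℕ} (he : ρ e = a) :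
    (modE e).eval O h ρ = (a % n : ℕ) := by
  rw [modE, eval_eSub, eval_eMul, eval_eDiv, eval_ix, eval_sz, he, hs.sz1, Int.natCast_mod,
    Int.emod_def]

theorem hasSet_improveCmd (hm : MinStart n k B F y O Fn Fd h) (hR : HasRel (n * k) R h)
    {A : Finset ℕ} (hA : HasSet 5 (n * k) A h) :
    HasSet 5 (n * k) (if reduced (n * k) F y (alive (n * k) R ∩ range (n * k)) < 0
      then alive (n * k) R ∩ range (n * k) else A) ((improveCmd Fn Fd).den O h) := by
  intro e he
  rw [improveCmd, ACmd.den_tab_lt _ _ (by rwa [hm.sizes.sz2])]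
  have hmem := memb_aliveSetE (O := O) (ρ := update noIndex 0 (e : ℤ)) (l := 1) hR
  have hg := gnE_eq hm.evaluates hm.sizes hm.dual hmem
  have hd := gdE_pos hm.evaluates hm.sizes hm.dual hmem
  have hd' : (0 : ℚ) < ((gdE Fd aliveSetE 1).eval O h (update noIndex 0 (e : ℤ)) : ℚ) := by
    exact_mod_cast hd
  have hc : (eLt (gnE Fn Fd aliveSetE 1) (.const 0)).eval O h (update noIndex 0 (e : ℤ)) =
      bi (reduced (n * k) F y (alive (n * k) R ∩ range (n * k)) < 0) := by
    rw [eval_eLt, eval_const]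
    apply bi_congr
    rw [← Int.cast_lt (R := ℚ), hg, Int.cast_zero]
    constructor
    · intro hneg
      by_contra hcon
      exact absurd hneg (not_lt.2 (mul_nonneg (not_lt.1 hcon) hd'.le))
    · intro hneg; exact mul_neg_of_neg_of_pos hneg hd'
  split_ifs with hneg
  · rw [eval_eIf_pos hc hneg]
    exact memb_aliveSetE (O := O) (ρ := noIndex) (l := 0) hR _ 0 1 e (fun i hi => by omega)
      (by omega) (by omega) he (update_self _ _ _)
  · rw [eval_eIf_neg hc hneg]
    exact memb_currentE (O := O) (ρ := noIndex) (l := 0) hA _ 0 1 e (fun i hi => by omega)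
      (by omega) (by omega) he (update_self _ _ _)

theorem sum_bi_mul_cast (M : ℕ) (P : ℕ → Prop) [DecidablePred P] (S : Finset ℕ) (hS : S ⊆ range M)
    (f : ℕ → ℚ) : ∑ a ∈ range M, ((bi (a ∈ S ∧ P a) : ℤ) : ℚ) * f a = ∑ a ∈ S.filter P, f a := by
  have : ∀ a ∈ range M, ((bi (a ∈ S ∧ P a) : ℤ) : ℚ) * f a = if a ∈ S.filter P then f a else 0 := by
    intro a _
    by_cases ha : a ∈ S ∧ P a
    · rw [bi_pos ha, if_pos (mem_filter.2 ha)]; simp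
    · rw [bi_neg ha, if_neg fun h => ha (mem_filter.1 h)]; simp
  rw [sum_congr rfl this, ← sum_filter]
  refine sum_congr ?_ fun _ _ => rfl
  ext a
  simp only [mem_filter, mem_range]
  exact ⟨fun h => h.2, fun h => ⟨mem_range.1 (hS h.1), h⟩⟩

theorem eval_multiplicityE (hs : HasSizes n k h) {A : Finset ℕ} (hAN : A ⊆ range (n * k))
    (hA : HasSet 5 (n * k) A h) {v : ℕ} (hv : h.var 1 = v) :
    multiplicityE.eval O h ρ = (multiplicity n v A : ℕ) := by
  have h1 : (multiplicityE.eval O h ρ : ℚ) = ((multiplicity n v A : ℕ) : ℚ) := by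
    rw [multiplicityE, eval_eSum, hs.sz2, multiplicity, card_eq_sum_ones, Nat.cast_sum,
      Int.cast_sum]
    rw [← sum_bi_mul_cast (n * k) _ A hAN]
    refine sum_congr rfl fun e he => ?_
    rw [Nat.cast_one, mul_one, eval_eAnd (P := e ∈ A) (Q := e % n = v)]
    · rw [eval_arr, eval_ix, update_self, hA e (mem_range.1 he)]
    · intro _
      rw [eval_eEq, eval_modE hs (update_self _ _ _), eval_var, hv]
      exact bi_congr Nat.cast_inj
  exact_mod_cast h1

theorem eval_otherSumE (hs : HasSizes n k h) (hy : HasDual (n * k) y h) {A : Finset ℕ}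
    (hAN : A ⊆ range (n * k)) (hA : HasSet 5 (n * k) A h) {v : ℕ} (hv : h.var 1 = v) :
    (otherSumE.eval O h ρ : ℚ) = (∑ e ∈ A.filter (fun e => ¬ e % n = v), y e) * h.var 0 := by
  rw [otherSumE, eval_eSum, hs.sz2, Int.cast_sum, ← sum_bi_mul_cast (n * k) _ A hAN, sum_mul]
  refine sum_congr rfl fun e he => ?_
  rw [eval_eMul, eval_eAnd (P := e ∈ A) (Q := ¬ e % n = v), eval_arr, eval_ix, update_self,
    Int.cast_mul, hy.eq e (mem_range.1 he), mul_assoc]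
  · rw [eval_arr, eval_ix, update_self, hA e (mem_range.1 he)]
  · intro _
    refine eval_eNot ?_
    rw [eval_eEq, eval_modE hs (update_self _ _ _), eval_var, hv]
    exact bi_congr Nat.cast_inj

theorem eval_assign_of_avoids {x : Fin 8} {e e' : AExpr} (he : e.Avoids (.inl x)) :
    e.eval O ((ACmd.assign x e').den O h) ρ = e.eval O h ρ :=
  eval_congr_of_avoids (h := (ACmd.assign x e').den O h) (h' := h) rfl
    (fun _ hz => ACmd.den_assign_ne (fun h => hz (congrArg _ h.symm)) _ _) (fun _ _ => rfl) _ _ he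

theorem avoids_currentE (x : Fin 8) (e l : ℕ) : (currentE e l).Avoids (.inl x) := by
  simp [currentE, Avoids]

theorem avoids_otherSumE {x : Fin 8} (hx : x ≠ 1) : otherSumE.Avoids (.inl x) := by
  simp [otherSumE, modE, eSum, eMul, eNot, eEq, eLt, eSub, eDiv, Avoids, hx]

/-- The effect of the update on the numbers that are stored. -/
theorem den_updateCmd (hF : Transparent Fn Fd) (hs : HasSizes n k h) {A : Finset ℕ}
    (hAN : A ⊆ range (n * k)) (hA : HasSet 5 (n * k) A h) {v : ℕ} (hv : h.var 1 = v) :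
    ((updateCmd Fn Fd).den O h).var 0 =
      h.var 0 * ((Fd currentE 0).eval O h noIndex * (multiplicity n v A : ℕ)) ∧
    ∀ e < n * k, ((updateCmd Fn Fd).den O h).arr 3 e = if e % n = v
      then (Fn currentE 0).eval O h noIndex * h.var 0 -
        (Fd currentE 0).eval O h noIndex * otherSumE.eval O h noIndex
      else h.arr 3 e * ((Fd currentE 0).eval O h noIndex * (multiplicity n v A : ℕ)) := by
  simp only [updateCmd, ACmd.den_seq]
  obtain ⟨h2, e2⟩ : ∃ h2, h2 = (ACmd.assign 2 (Fd currentE 0)).den O h := ⟨_, rfl⟩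
  rw [← e2]
  have s2 : h2.sz = h.sz := by rw [e2, ACmd.den_sz]
  have a2 : h2.arr = h.arr := by rw [e2, ACmd.den_assign_arr]
  have v2 : ∀ x : Fin 8, x ≠ 2 → h2.var x = h.var x := fun x hx => by rw [e2, ACmd.den_assign_ne hx]
  have v22 : h2.var 2 = (Fd currentE 0).eval O h noIndex := by rw [e2, ACmd.den_assign_self]
  have n2 : (Fn currentE 0).eval O h2 noIndex = (Fn currentE 0).eval O h noIndex := by
    rw [e2, eval_assign_of_avoids (hF.num _ _ _ (avoids_currentE 2))]
  have o2 : otherSumE.eval O h2 noIndex = otherSumE.eval O h noIndex := by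
    rw [e2, eval_assign_of_avoids (avoids_otherSumE (by decide))]
  obtain ⟨h3, e3⟩ : ∃ h3, h3 = (ACmd.assign 3 (Fn currentE 0)).den O h2 := ⟨_, rfl⟩
  rw [← e3]
  have s3 : h3.sz = h.sz := by rw [e3, ACmd.den_sz, s2]
  have a3 : h3.arr = h.arr := by rw [e3, ACmd.den_assign_arr, a2]
  have v3 : ∀ x : Fin 8, x ≠ 3 → h3.var x = h2.var x := fun x hx => by
    rw [e3, ACmd.den_assign_ne hx]
  have v33 : h3.var 3 = (Fn currentE 0).eval O h noIndex := by rw [e3, ACmd.den_assign_self, n2]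
  have o3 : otherSumE.eval O h3 noIndex = otherSumE.eval O h noIndex := by
    rw [e3, eval_assign_of_avoids (avoids_otherSumE (by decide)), o2]
  have m3 : multiplicityE.eval O h3 noIndex = (multiplicity n v A : ℕ) :=
    eval_multiplicityE (hs.congr s3) hAN (fun e he => by rw [a3, hA e he])
      (by rw [v3 1 (by decide), v2 1 (by decide), hv])
  obtain ⟨h4, e4⟩ : ∃ h4, h4 = (ACmd.assign 4 multiplicityE).den O h3 := ⟨_, rfl⟩
  rw [← e4]
  have s4 : h4.sz = h.sz := by rw [e4, ACmd.den_sz, s3]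
  have a4 : h4.arr = h.arr := by rw [e4, ACmd.den_assign_arr, a3]
  have v4 : ∀ x : Fin 8, x ≠ 4 → h4.var x = h3.var x := fun x hx => by
    rw [e4, ACmd.den_assign_ne hx]
  have v44 : h4.var 4 = (multiplicity n v A : ℕ) := by rw [e4, ACmd.den_assign_self, m3]
  have o4 : otherSumE.eval O h4 noIndex = otherSumE.eval O h noIndex := by
    rw [e4, eval_assign_of_avoids (avoids_otherSumE (by decide)), o3]
  obtain ⟨h5, e5⟩ : ∃ h5, h5 = (ACmd.assign 5 (eSub (eMul (.var 3) (.var 0))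
    (eMul (.var 2) otherSumE))).den O h4 := ⟨_, rfl⟩
  rw [← e5]
  have s5 : h5.sz = h.sz := by rw [e5, ACmd.den_sz, s4]
  have a5 : h5.arr = h.arr := by rw [e5, ACmd.den_assign_arr, a4]
  have v5 : ∀ x : Fin 8, x ≠ 5 → h5.var x = h4.var x := fun x hx => by
    rw [e5, ACmd.den_assign_ne hx]
  have v55 : h5.var 5 = (Fn currentE 0).eval O h noIndex * h.var 0 -
        (Fd currentE 0).eval O h noIndex * otherSumE.eval O h noIndex := by
    rw [e5, ACmd.den_assign_self, eval_eSub, eval_eMul, eval_eMul, o4]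
    simp only [eval_var]
    rw [v4 3 (by decide), v33, v4 0 (by decide), v3 0 (by decide), v2 0 (by decide),
      v4 2 (by decide), v3 2 (by decide), v22]
  have v50 : h5.var 0 = h.var 0 := by
    rw [v5 0 (by decide), v4 0 (by decide), v3 0 (by decide), v2 0 (by decide)]
  have v51 : h5.var 1 = v := by
    rw [v5 1 (by decide), v4 1 (by decide), v3 1 (by decide), v2 1 (by decide), hv]
  have v52 : h5.var 2 = (Fd currentE 0).eval O h noIndex := by
    rw [v5 2 (by decide), v4 2 (by decide), v3 2 (by decide), v22]
  have v54 : h5.var 4 = (multiplicity n v A : ℕ) := by rw [v5 4 (by decide), v44]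
  obtain ⟨h6, e6⟩ : ∃ h6, h6 = (ACmd.tab 3 2 newDualE).den O h5 := ⟨_, rfl⟩
  rw [← e6]
  have v6 : h6.var = h5.var := by rw [e6]; rfl
  constructor
  · simp only [ACmd.den_assign_ne (show (0 : Fin 8) ≠ 2 by decide),
      ACmd.den_assign_ne (show (0 : Fin 8) ≠ 3 by decide),
      ACmd.den_assign_ne (show (0 : Fin 8) ≠ 4 by decide),
      ACmd.den_assign_ne (show (0 : Fin 8) ≠ 5 by decide), ACmd.den_assign_self, eval_eMul, eval_var,
      v6, v50, v52, v54]
  · intro e he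
    simp only [ACmd.den_assign_arr]
    rw [e6, ACmd.den_tab_lt _ _ (by rw [s5, hs.sz2]; exact he), newDualE]
    have hc : (eEq (modE 0) (.var 1)).eval O h5 (update noIndex 0 (e : ℤ)) = bi (e % n = v) := by
      rw [eval_eEq, eval_modE (hs.congr s5) (update_self _ _ _), eval_var, v51]
      exact bi_congr Nat.cast_inj
    split_ifs with hev
    · rw [eval_eIf_pos hc hev, eval_var, v55]
    · rw [eval_eIf_neg hc hev]
      simp only [eval_eMul, eval_arr, eval_ix, eval_var, update_self, a5, v52, v54]

/-- The new dual value is the ratio `(Fn / Fd - otherSum / D) / m`, where `D` is the old common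
denominator and `m` the multiplicity. With the new common denominator `D * (Fd * m)` its numerator
is `Fn * D - Fd * otherSum`, and the old numerators are multiplied by `Fd * m`. -/
theorem hasDual_updateCmd (hm : MinStart n k B F y O Fn Fd h) {A : Finset ℕ}
    (hAN : A ⊆ range (n * k)) (hA : HasSet 5 (n * k) A h) {v : ℕ} (hv : h.var 1 = v)
    (hpos : 0 < multiplicity n v A) :
    HasDual (n * k) (raise n v (reducedWithout n F y v A / multiplicity n v A) y)
      ((updateCmd Fn Fd).den O h) := by
  obtain ⟨h0, h3⟩ := den_updateCmd (O := O) hm.avoids hm.sizes hAN hA hv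
  have hmem := memb_currentE (O := O) (ρ := noIndex) (l := 0) hA
  have hd := hm.evaluates.pos _ _ _ _ _ hm.sizes hmem
  have hN := hm.evaluates.eq _ _ _ _ _ hm.sizes hmem
  have hS := eval_otherSumE (O := O) (ρ := noIndex) hm.sizes hm.dual hAN hA hv
  have hpos' : (0 : ℚ) < multiplicity n v A := by exact_mod_cast hpos
  constructor
  · rw [h0]
    exact mul_pos hm.dual.pos (mul_pos hd (by exact_mod_cast hpos))
  · intro e he
    rw [h3 e he, h0, raise]
    split_ifs with hev
    · push_cast
      rw [hN, hS, reducedWithout]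
      field_simp
    · push_cast
      rw [hm.dual.eq e he]
      ring

/-- The function in the ratio ignores the dual variable of `v`. So all Newton steps for this
customer concern the same ratio problem, although the stored dual solution changes. -/
theorem reducedWithout_raise (v : ℕ) (a : ℚ) (A : Finset ℕ) :
    reducedWithout n F (raise n v a y) v A = reducedWithout n F y v A := by
  unfold reducedWithout
  congr 1
  exact sum_congr rfl fun e he => if_neg (mem_filter.1 he).2

theorem raise_raise (v : ℕ) (a b : ℚ) : raise n v a (raise n v b y) = raise n v a y := by
  funext e
  unfold raise
  split_ifs <;> rfl

/-- The state of the Newton iteration after `j` steps. -/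
structure NewtonStart (n k B : ℕ) (F : Finset ℕ → ℚ) (y : ℕ → ℚ) (v j : ℕ) (A : Finset ℕ)
    (O : Oracle) (Fn Fd : (ℕ → ℕ → AExpr) → ℕ → AExpr) (h : AState) : Prop where
  start : MinStart n k B F (raise n v (reducedWithout n F y v A / multiplicity n v A) y) O Fn Fd h
  newton : NewtonState (n * k) (reducedWithout n F y v) (multiplicity n v) k j A
  set : HasSet 5 (n * k) A h
  var : h.var 1 = v

theorem keeps_updateCmd : (∀ x : Fin 8, x = 1 → (updateCmd Fn Fd).KeepsVar x) ∧
    ∀ a : Fin 8, a ≠ 3 → (updateCmd Fn Fd).KeepsArr a := by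
  constructor
  · rintro x rfl; simp [updateCmd, ACmd.KeepsVar]
  · intro a ha; simp [updateCmd, ACmd.KeepsArr, ha]

/-- The state before the update in a Newton step. -/
theorem den_improveCmd {v j : ℕ} {A : Finset ℕ}
    (hN : NewtonStart n k B F y v j A O Fn Fd h)
    (h0 : ∀ Z ⊆ range (n * k), 0 ≤ reducedWithout n F y v Z) :
    ∃ A', NewtonState (n * k) (reducedWithout n F y v) (multiplicity n v) k (j + 1) A' ∧
      MinStart n k B F (raise n v (reducedWithout n F y v A / multiplicity n v A) y) O Fn Fd
        ((improveCmd Fn Fd).den O ((minimizeCmd Fn Fd).den O h)) ∧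
      HasSet 5 (n * k) A' ((improveCmd Fn Fd).den O ((minimizeCmd Fn Fd).den O h)) ∧
      ((improveCmd Fn Fd).den O ((minimizeCmd Fn Fd).den O h)).var 1 = v := by
  obtain ⟨hm, hnew, hA, hv⟩ := hN
  obtain ⟨R, hR, hI, hf⟩ := den_minimizeCmd hm
  have s1 : ((minimizeCmd Fn Fd).den O h).sz = h.sz := ACmd.den_sz _ _ _
  have v1 : ∀ x : Fin 8, x < 2 → ((minimizeCmd Fn Fd).den O h).var x = h.var x := fun x hx =>
    ACmd.den_var _ (keeps_minimizeCmd.1 x hx)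
  have a1 : ∀ a : Fin 8, 3 ≤ a → ((minimizeCmd Fn Fd).den O h).arr a = h.arr a := fun a ha =>
    ACmd.den_arr _ (keeps_minimizeCmd.2 a ha)
  obtain ⟨h1, e1⟩ : ∃ h1, h1 = (minimizeCmd Fn Fd).den O h := ⟨_, rfl⟩
  rw [← e1] at hR s1 v1 a1 ⊢
  set a := reducedWithout n F y v A / multiplicity n v A with ha
  have hm1 : MinStart n k B F (raise n v a y) O Fn Fd h1 :=
    hm.congr s1 (v1 0 (by decide)) (a1 3 (by decide))
  have hA1 : HasSet 5 (n * k) A h1 := fun e he => by rw [a1 5 (by decide), hA e he]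
  have hA2 := hasSet_improveCmd hm1 hR hA1
  have s2 : ((improveCmd Fn Fd).den O h1).sz = h1.sz := ACmd.den_sz _ _ _
  have v2 : ∀ x, ((improveCmd Fn Fd).den O h1).var x = h1.var x := fun x => rfl
  have a2 : ((improveCmd Fn Fd).den O h1).arr 3 = h1.arr 3 := ACmd.den_tab_ne (by decide) _ _
  obtain ⟨h2, e2⟩ : ∃ h2, h2 = (improveCmd Fn Fd).den O h1 := ⟨_, rfl⟩
  rw [← e2] at hA2 s2 v2 a2 ⊢
  have hm2 : MinStart n k B F (raise n v a y) O Fn Fd h2 := hm1.congr s2 (v2 0) a2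
  set C := alive (n * k) R ∩ range (n * k) with hC
  have hCN : C ⊆ range (n * k) := inter_subset_right
  have hsub := hm.polymatroid.isSub_reduced (raise n v a y)
  have hred : ∀ Z ⊆ range (n * k), reduced (n * k) F (raise n v a y) Z =
      reducedWithout n F y v Z - a * multiplicity n v Z := fun Z hZ => reduced_raise hZ
  have hmin : IsMin (n * k) (fun Z => reducedWithout n F y v Z - a * multiplicity n v Z) C := by
    refine ⟨hCN, fun Z hZ => ?_⟩
    change reducedWithout n F y v C - a * multiplicity n v C ≤
      reducedWithout n F y v Z - a * multiplicity n v Z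
    rw [← hred C hCN, ← hred Z hZ, hsub.inter]
    exact hI.alive_min hsub hf Z
  have hstep := hnew.step h0 hmin
  rw [hred C hCN] at hA2
  generalize (if reducedWithout n F y v C - a * multiplicity n v C < 0 then C else A) = A' at *
  have hv2 : h2.var 1 = v := by rw [v2, v1 1 (by decide), hv]
  exact ⟨A', hstep, hm2, hA2, hv2⟩

theorem newtonStart_newtonCmd {v j : ℕ} {A : Finset ℕ}
    (hN : NewtonStart n k B F y v j A O Fn Fd h)
    (h0 : ∀ Z ⊆ range (n * k), 0 ≤ reducedWithout n F y v Z) :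
    ∃ A', NewtonStart n k B F y v (j + 1) A' O Fn Fd ((newtonCmd Fn Fd).den O h) := by
  obtain ⟨A', hstep, hm, hA, hv⟩ := den_improveCmd hN h0
  have hdual := hasDual_updateCmd hm hstep.subset hA hv hstep.pos
  rw [reducedWithout_raise, raise_raise] at hdual
  refine ⟨A', ⟨hm.evaluates, hm.avoids, hm.polymatroid, ?_, hdual⟩, hstep, ?_, ?_⟩
  · rw [newtonCmd, ACmd.den_seq, ACmd.den_seq]
    exact hm.sizes.congr (ACmd.den_sz _ _ _)
  · intro e he
    rw [newtonCmd, ACmd.den_seq, ACmd.den_seq, ACmd.den_arr _ (keeps_updateCmd.2 5 (by decide)),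
      hA e he]
  · rw [newtonCmd, ACmd.den_seq, ACmd.den_seq, ACmd.den_var _ (keeps_updateCmd.1 1 rfl), hv]

/-- The state of the main loop after the treatment of `v` customers. -/
structure MainState (n k B : ℕ) (F : Finset ℕ → ℚ) (y : ℕ → ℚ) (v : ℕ) (A : Finset ℕ)
    (O : Oracle) (Fn Fd : (ℕ → ℕ → AExpr) → ℕ → AExpr) (h : AState) : Prop where
  start : MinStart n k B F y O Fn Fd h
  dual : DualState n (n * k) F v y A
  set : HasSet 4 (n * k) A h
  var : h.var 1 = v

/-- The state before the Newton iteration. -/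
theorem newtonStart_zero {v : ℕ} {A : Finset ℕ} (hM : MainState n k B F y v A O Fn Fd h)
    (hk : 1 ≤ k) (hv : v < n) : NewtonStart n k B F y v 0 (range (n * k)) O Fn Fd
      ((updateCmd Fn Fd).den O ((ACmd.tab 5 2 (.const 1)).den O h)) := by
  have s1 : ((ACmd.tab 5 2 (.const 1)).den O h).sz = h.sz := ACmd.den_sz _ _ _
  have hA1 : HasSet 5 (n * k) (range (n * k)) ((ACmd.tab 5 2 (.const 1)).den O h) := by
    intro e he
    rw [ACmd.den_tab_lt _ _ (by rwa [hM.start.sizes.sz2]), eval_const, bi_pos (mem_range.2 he)]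
  have v1 : ((ACmd.tab 5 2 (.const 1)).den O h).var = h.var := rfl
  have a1 : ((ACmd.tab 5 2 (.const 1)).den O h).arr 3 = h.arr 3 := ACmd.den_tab_ne (by decide) _ _
  obtain ⟨h1, e1⟩ : ∃ h1, h1 = (ACmd.tab 5 2 (.const 1)).den O h := ⟨_, rfl⟩
  rw [← e1] at s1 hA1 v1 a1 ⊢
  have hm1 : MinStart n k B F y O Fn Fd h1 := hM.start.congr s1 (by rw [v1]) a1
  have hN := newtonState_zero (reducedWithout n F y v) hk hv
  have hv1 : h1.var 1 = v := by rw [v1, hM.var]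
  refine ⟨⟨hm1.evaluates, hm1.avoids, hm1.polymatroid, hm1.sizes.congr (ACmd.den_sz _ _ _),
    hasDual_updateCmd hm1 hN.subset hA1 hv1 hN.pos⟩, hN, ?_, ?_⟩
  · intro e he
    rw [ACmd.den_arr _ (keeps_updateCmd.2 5 (by decide)), hA1 e he]
  · rw [ACmd.den_var _ (keeps_updateCmd.1 1 rfl), hv1]

theorem newtonStart_iterate {v : ℕ} {A : Finset ℕ} (hN : NewtonStart n k B F y v 0 A O Fn Fd h)
    (h0 : ∀ Z ⊆ range (n * k), 0 ≤ reducedWithout n F y v Z) (j : ℕ) :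
    ∃ A', NewtonStart n k B F y v j A' O Fn Fd (((newtonCmd Fn Fd).den O)^[j] h) := by
  induction j with
  | zero => exact ⟨A, hN⟩
  | succ j ih =>
    obtain ⟨A', hA'⟩ := ih
    rw [iterate_succ_apply']
    exact newtonStart_newtonCmd hA' h0

theorem keepsArr_newtonCmd : (newtonCmd Fn Fd).KeepsArr 4 :=
  ⟨keeps_minimizeCmd.2 4 (by decide), by simp [improveCmd, ACmd.KeepsArr],
    keeps_updateCmd.2 4 (by decide)⟩

theorem mainState_customerCmd {v : ℕ} {A : Finset ℕ} (hM : MainState n k B F y v A O Fn Fd h)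
    (hk : 1 ≤ k) (hv : v < n) :
    ∃ y' A', MainState n k B F y' (v + 1) A' O Fn Fd ((customerCmd Fn Fd).den O h) := by
  have h0 := newtonStart_zero hM hk hv
  have hnn := fun Z hZ => hM.dual.reducedWithout_nonneg (Z := Z) hZ
  simp only [customerCmd, ACmd.den_seq]
  have a4 : ((updateCmd Fn Fd).den O ((ACmd.tab 5 2 (.const 1)).den O h)).arr 4 = h.arr 4 := by
    rw [ACmd.den_arr _ (keeps_updateCmd.2 4 (by decide)), ACmd.den_tab_ne (by decide)]
  obtain ⟨h1, e1⟩ : ∃ h1, h1 = (updateCmd Fn Fd).den O ((ACmd.tab 5 2 (.const 1)).den O h) :=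
    ⟨_, rfl⟩
  rw [← e1] at h0 a4 ⊢
  obtain ⟨A', hN⟩ := newtonStart_iterate h0 hnn (h1.sz 0)
  have b4 : ((ACmd.loop 0 (newtonCmd Fn Fd)).den O h1).arr 4 = h.arr 4 := by
    rw [ACmd.den_arr (c := ACmd.loop 0 (newtonCmd Fn Fd)) _ keepsArr_newtonCmd, a4]
  change NewtonStart n k B F y v (h1.sz 0) A' O Fn Fd ((ACmd.loop 0 (newtonCmd Fn Fd)).den O h1) at hN
  obtain ⟨h2, e2⟩ : ∃ h2, h2 = (ACmd.loop 0 (newtonCmd Fn Fd)).den O h1 := ⟨_, rfl⟩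
  rw [← e2] at hN b4 ⊢
  rw [h0.start.sizes.sz0] at hN
  obtain ⟨hm, hnew, hA, hv2⟩ := hN
  refine ⟨_, A ∪ A', ⟨hm.congr rfl rfl ?_, hM.dual.step hm.polymatroid hnew, ?_, ?_⟩⟩
  · rw [ACmd.den_assign_arr, ACmd.den_tab_ne (by decide)]
  · intro e he
    rw [ACmd.den_assign_arr, ACmd.den_tab_lt _ _ (by rwa [hm.sizes.sz2]),
      eval_eOr (P := e ∈ A) (Q := e ∈ A')]
    · exact bi_congr mem_union.symm
    · rw [eval_arr, eval_ix, update_self, b4, hM.set e he]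
    · rw [eval_arr, eval_ix, update_self, hA e he]
  · rw [ACmd.den_assign_self, eval_eAdd, eval_var]
    change h2.var 1 + 1 = _
    rw [hv2]
    push_cast
    rfl

theorem mainState_iterate {A : Finset ℕ} (hM : MainState n k B F y 0 A O Fn Fd h) (hk : 1 ≤ k) :
    ∀ i ≤ n, ∃ y' A', MainState n k B F y' i A' O Fn Fd (((customerCmd Fn Fd).den O)^[i] h) := by
  intro i
  induction i with
  | zero => intro _; exact ⟨y, A, hM⟩
  | succ i ih =>
    intro hi
    obtain ⟨y', A', hA'⟩ := ih (by omega)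
    rw [iterate_succ_apply']
    exact mainState_customerCmd hA' hk (by omega)

theorem eval_outputE (hs : HasSizes n k h) {A : Finset ℕ} (hA : HasSet 4 (n * k) A h) :
    outputE.eval O h noIndex = ∑ e ∈ range (n * k), bi (e ∈ leastReps n A) * 2 ^ e := by
  rw [outputE, eval_eSum, hs.sz2]
  refine sum_congr rfl fun e he => ?_
  have he := mem_range.1 he
  rw [eval_eMul, eval_eAnd (P := e ∈ A)
    (Q := ¬ ∃ e' < h.sz 2, e' < e ∧ (e' ∈ A ∧ e' % n = e % n))]
  · congr 1
    · apply bi_congr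
      rw [leastReps, mem_filter, hs.sz2]
      refine and_congr_right fun _ => ⟨fun hno e' hlt hA' hmod => ?_, ?_⟩
      · exact hno ⟨e', by omega, hlt, hA', hmod⟩
      · rintro hall ⟨e', _, hlt, hA', hmod⟩
        exact hall e' hlt hA' hmod
    -- The power `2 ^ e` is a product over all positions, with a factor `2` at each position below
    -- `e` and `1` elsewhere.
    · rw [eval_fold, if_pos rfl, hs.sz2]
      have : ∀ j ∈ range (n * k), (eAdd (.const 1) (eLt (.ix 1) (.ix 0))).eval O h
          (update (update noIndex 0 (e : ℤ)) 1 (j : ℤ)) = if j < e then 2 else 1 := by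
        intro j _
        rw [eval_eAdd, eval_eLt, eval_const, eval_ix, eval_ix, update_self,
          update_of_ne (by decide), update_self, Nat.cast_lt]
        by_cases hj : j < e <;> simp [bi, hj]
      rw [prod_congr rfl this, prod_ite, prod_const, prod_const_one, mul_one]
      congr 1
      have : (range (n * k)).filter (· < e) = range e := by
        ext j; simp only [mem_filter, mem_range]; omega
      rw [this, card_range]
  · rw [eval_arr, eval_ix, update_self, hA e he]
  · intro _
    refine eval_eNot (eval_eEx fun e' he' => ?_)
    have he' : e' < n * k := by rwa [hs.sz2] at he'
    refine eval_eAnd ?_ fun _ => eval_eAnd ?_ fun _ => ?_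
    · rw [eval_eLt, eval_ix, eval_ix, update_self, update_of_ne (by decide), update_self]
      exact bi_congr Nat.cast_lt
    · rw [eval_arr, eval_ix, update_self, hA e' he']
    · rw [eval_eEq, eval_modE hs (a := e') (update_self _ _ _), eval_modE hs (a := e) (by simp)]
      exact bi_congr Nat.cast_inj

/-- The state before the main loop. -/
theorem mainState_zero (hE : Evaluates n k F B O Fn Fd) (hF : Transparent Fn Fd)
    (hP : IsPolymatroid (n * k) F) (hs : HasSizes n k h) (hv : h.var 1 = 0)
    (h0 : ∀ a i, h.arr a i = 0) :
    MainState n k B F (fun _ => 0) 0 ∅ O Fn Fd ((ACmd.assign 0 (.const 1)).den O h) where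
  start := ⟨hE, hF, hP, hs.congr rfl, by
    constructor
    · rw [ACmd.den_assign_self, eval_const]; exact one_pos
    · intro e _; rw [ACmd.den_assign_arr, h0]; simp⟩
  dual := dualState_zero hP
  set e _ := by rw [ACmd.den_assign_arr, h0, bi_neg (notMem_empty e)]
  var := by rw [ACmd.den_assign_ne (by decide), hv]; rfl

/-- The algorithm computes an encoding of an approximate solution. -/
theorem den_mainCmd (hE : Evaluates n k F B O Fn Fd) (hF : Transparent Fn Fd)
    (hP : IsPolymatroid (n * k) F) (hk : 1 ≤ k) (hs : HasSizes n k h) (hv : h.var 1 = 0)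
    (h0 : ∀ a i, h.arr a i = 0) :
    ∃ y A, DualState n (n * k) F n y A ∧ ((mainCmd Fn Fd).den O h).var 0 =
      ∑ e ∈ range (n * k), bi (e ∈ leastReps n A) * 2 ^ e := by
  have hM := mainState_zero hE hF hP hs hv h0
  simp only [mainCmd, ACmd.den_seq]
  obtain ⟨h1, e1⟩ : ∃ h1, h1 = (ACmd.assign 0 (.const 1)).den O h := ⟨_, rfl⟩
  rw [← e1] at hM ⊢
  obtain ⟨y, A, hA⟩ := mainState_iterate hM hk n le_rfl
  refine ⟨y, A, hA.dual, ?_⟩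
  rw [ACmd.den_assign_self, ← eval_outputE hA.start.sizes hA.set, ACmd.den,
    hM.start.sizes.sz1]

end SubmodAlloc

namespace SubmodAlloc
open Finset Function AExpr

/-! ### Bounds on the numbers -/

/-- All changes of the array `a` are made at the first `sz j` positions. -/
def ACmd.TabsWith (a j : Fin 8) : ACmd → Prop
  | .assign _ _ => True
  | .tab b j' _ => a = b → j' = j
  | .seq c c' => c.TabsWith a j ∧ c'.TabsWith a j
  | .loop _ c => c.TabsWith a j

variable {n k B : ℕ} {F : Finset ℕ → ℚ} {y : ℕ → ℚ} {R : ℕ → ℕ → Prop} {h : AState} {O : Oracle}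
  {Fn Fd : (ℕ → ℕ → AExpr) → ℕ → AExpr} {ρ : ℕ → ℤ} {m : ℕ}

theorem ACmd.den_arr_out {a j : Fin 8} {i : ℤ} : ∀ {c : ACmd} (h : AState), c.TabsWith a j →
    ¬ (0 ≤ i ∧ i < h.sz j) → (c.den O h).arr a i = h.arr a i := by
  intro c
  induction c with
  | assign => intros; rfl
  | tab b j' e =>
    intro h hc hi
    by_cases hab : a = b
    · subst hab
      obtain rfl := hc rfl
      simp only [ACmd.den, AState.setArr, update_self, if_neg hi]
    · rw [ACmd.den_tab_ne hab]
  | seq c c' ih ih' =>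
    intro h hc hi
    exact (ih' _ hc.2 (by rwa [ACmd.den_sz])).trans (ih _ hc.1 hi)
  | loop j' c ih =>
    intro h hc hi
    simp only [ACmd.den]
    generalize h.sz j' = r
    induction r with
    | zero => rfl
    | succ r ihr => rw [iterate_succ_apply', ih _ hc (by rwa [ACmd.iterate_den_sz]), ihr]

theorem abs_bi_le (P : Prop) (m : ℕ) : |bi P| ≤ 2 ^ m := by
  rw [abs_of_nonneg (bi_nonneg P)]
  exact (bi_le_one P).trans (one_le_pow₀ (by norm_num))

/-- A state stays bounded if an array is changed to bounded values. -/
theorem Bdd.tab (hb : Bdd m h) {a j : Fin 8} {e : AExpr}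
    (he : ∀ i < h.sz j, |e.eval O h (update noIndex 0 (i : ℤ))| ≤ 2 ^ m) :
    Bdd m ((ACmd.tab a j e).den O h) where
  sz := hb.sz
  var := hb.var
  arr b i := by
    by_cases hba : b = a
    · subst hba
      exact h.setArr_forall b (p := fun z => |z| ≤ 2 ^ m) he i (hb.arr b i)
    · rw [ACmd.den_tab_ne hba]; exact hb.arr b i

theorem Bdd.assign (hb : Bdd m h) {x : Fin 8} {e : AExpr} (he : |e.eval O h noIndex| ≤ 2 ^ m) :
    Bdd m ((ACmd.assign x e).den O h) where
  sz := hb.sz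
  var z := by
    by_cases hzx : z = x
    · subst hzx; rwa [ACmd.den_assign_self]
    · rw [ACmd.den_assign_ne hzx]; exact hb.var z
  arr := hb.arr

section descent

variable (Fn Fd) in
/-- Bound on the bit lengths after a descent. -/
def descentBits (m : ℕ) : ℕ := m + (lossE Fn Fd 0 1).bits m + 1

/-- Iterating the bound for one step would give exponential growth. But the iterates are clipped to
the box, and the losses do not depend on the accumulated sums; so the losses have a uniform bound
and the sums grow only linearly with the number of steps. -/
theorem bdd_descentState (hF : Transparent Fn Fd) (hO : ∀ q, encLen (O q) ≤ m) (hb : Bdd m h)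
    {t : ℕ} (ht : t ≤ h.sz 4) : Bdd (descentBits Fn Fd m) (descentState O Fn Fd h t) := by
  set b := (lossE Fn Fd 0 1).bits m with hbdef
  have key : ∀ t : ℕ, (∀ i, |(descentState O Fn Fd h t).arr 1 i| ≤ 2 ^ m) ∧
      ∀ i, |(descentState O Fn Fd h t).arr 2 i| ≤ 2 ^ m + t * 2 ^ b := by
    have hout : ∀ (t : ℕ) (a : Fin 8) (i : ℤ), ¬ (0 ≤ i ∧ i < h.sz 3) →
        (descentState O Fn Fd h t).arr a i = h.arr a i := by
      intro t a i hi
      induction t with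
      | zero =>
        rw [descentState_zero, ACmd.den_arr_out (j := 3) _ (by simp [ACmd.TabsWith])
          (by rwa [ACmd.den_sz]), ACmd.den_arr_out (j := 3) _ (by simp [ACmd.TabsWith]) hi]
      | succ t ih =>
        rw [descentState_succ, ACmd.den_arr_out (j := 3) _
          (by simp [stepCmd, ACmd.TabsWith]) (by rwa [descentState_sz]), ih]
    intro t
    induction t with
    | zero =>
      constructor
      · intro i
        by_cases hi : 0 ≤ i ∧ i < h.sz 3
        · obtain ⟨i, rfl⟩ := Int.eq_ofNat_of_zero_le hi.1
          rw [descentState_zero, ACmd.den_tab_ne (by decide), ACmd.den_tab_lt _ _ (by omega)]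
          simp
        · rw [hout 0 1 i hi]; exact hb.arr 1 i
      · intro i
        by_cases hi : 0 ≤ i ∧ i < h.sz 3
        · obtain ⟨i, rfl⟩ := Int.eq_ofNat_of_zero_le hi.1
          rw [descentState_zero, ACmd.den_tab_lt _ _ (by rw [ACmd.den_sz]; omega)]
          simp
        · rw [hout 0 2 i hi]; simpa using hb.arr 2 i
    | succ t ih =>
      have hloss : ∀ i < h.sz 3, |(lossE Fn Fd 0 1).eval O (descentState O Fn Fd h t)
          (update noIndex 0 (i : ℤ))| ≤ 2 ^ b := by
        intro i hi
        set g := descentState O Fn Fd h t with hg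
        -- To estimate the losses, array `2` with its possibly large entries may be replaced by
        -- zeros, since they do not read it.
        have hbg : Bdd m { g with arr := update g.arr 2 fun _ => 0 } := by
          refine ⟨fun j => ?_, fun x => ?_, fun a i => ?_⟩
          · change g.sz j ≤ m
            rw [hg, descentState_sz]; exact hb.sz j
          · change |g.var x| ≤ 2 ^ m
            rw [hg, descentState_var]; exact hb.var x
          · by_cases ha2 : a = 2
            · subst ha2; simp
            · simp only [update_of_ne ha2]
              by_cases ha1 : a = 1
              · subst ha1; exact ih.1 i
              · rw [hg, descentState_arr _ _ ha1 ha2]; exact hb.arr a i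
        have hcongr : (lossE Fn Fd 0 1).eval O g (update noIndex 0 (i : ℤ)) =
            (lossE Fn Fd 0 1).eval O { g with arr := update g.arr 2 fun _ => 0 }
              (update noIndex 0 (i : ℤ)) :=
          eval_congr_of_avoids (s := .inr 2) (h := g)
            (h' := { g with arr := update g.arr 2 fun _ => 0 }) rfl (fun _ _ => rfl)
            (fun z hz => (update_of_ne (fun h => hz (congrArg _ h.symm)) _ _).symm) _ _
            (avoids_lossE hF 0 1)
        rw [hcongr]
        exact AExpr.abs_eval_le hO hbg _ _ (update_abs_le (abs_noIndex_le m) (hb.sz 3) hi)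
      constructor
      · intro i
        by_cases hi : 0 ≤ i ∧ i < h.sz 3
        · obtain ⟨i, rfl⟩ := Int.eq_ofNat_of_zero_le hi.1
          rw [descentState_succ_vals h t hF i (by omega)]
          have h4 := abs_natCast_le_two_pow (hb.sz 4)
          rw [abs_of_nonneg (by positivity)] at h4
          rw [abs_of_nonneg (le_max_left _ _)]
          exact max_le (by positivity) ((min_le_left _ _).trans h4)
        · rw [hout _ 1 i hi]; exact hb.arr 1 i
      · intro i
        by_cases hi : 0 ≤ i ∧ i < h.sz 3
        · obtain ⟨i, rfl⟩ := Int.eq_ofNat_of_zero_le hi.1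
          rw [descentState_succ_sums h t i (by omega)]
          have h1 := ih.2 i
          have h2 := hloss i (by omega)
          have h3 := abs_add_le ((descentState O Fn Fd h t).arr 2 i)
            ((lossE Fn Fd 0 1).eval O (descentState O Fn Fd h t) (update noIndex 0 (i : ℤ)))
          push_cast
          linarith
        · rw [hout _ 2 i hi]
          exact (hb.arr 2 i).trans (by have : (0 : ℤ) ≤ (t + 1 : ℕ) * 2 ^ b := by positivity
                                       linarith)
  have hb' := hb.mono (show m ≤ descentBits Fn Fd m by unfold descentBits; omega)
  refine ⟨fun j => ?_, fun x => ?_, fun a i => ?_⟩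
  · rw [descentState_sz]; exact hb'.sz j
  · rw [descentState_var]; exact hb'.var x
  · by_cases ha1 : a = 1
    · subst ha1
      exact abs_le_two_pow_of_le ((key t).1 i) (by unfold descentBits; omega)
    · by_cases ha2 : a = 2
      · subst ha2
        refine ((key t).2 i).trans ?_
        -- The number of steps is a size, hence at most `m`, so that all sums together cost `m` plus
        -- one further bit.
        have h1 : (t : ℤ) ≤ 2 ^ m := by
          exact_mod_cast (ht.trans (hb.sz 4)).trans Nat.lt_two_pow_self.le
        have h2 : (1 : ℤ) ≤ 2 ^ b := one_le_pow₀ (by norm_num)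
        have h3 : (1 : ℤ) ≤ 2 ^ m := one_le_pow₀ (by norm_num)
        have h4 : (2 : ℤ) ^ descentBits Fn Fd m = 2 * (2 ^ m * 2 ^ b) := by
          unfold descentBits; rw [← hbdef]; ring
        rw [h4]
        nlinarith
      · rw [descentState_arr _ _ ha1 ha2]; exact hb'.arr a i

theorem good_descentCmd (hF : Transparent Fn Fd) (hO : ∀ q, encLen (O q) ≤ m) (hb : Bdd m h) :
    (descentCmd Fn Fd).Good O (descentBits Fn Fd m) h :=
  ⟨trivial, trivial, fun _ hi => ⟨bdd_descentState hF hO hb hi, fun _ => ⟨trivial, trivial⟩⟩⟩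

theorem bdd_descentCmd (hF : Transparent Fn Fd) (hO : ∀ q, encLen (O q) ≤ m) (hb : Bdd m h) :
    Bdd (descentBits Fn Fd m) ((descentCmd Fn Fd).den O h) := by
  rw [den_descentCmd]; exact bdd_descentState hF hO hb le_rfl

end descent

variable (Fn Fd) in
/-- Bound on the bit lengths during a deduction. -/
def deduceBits (m : ℕ) : ℕ :=
  descentBits Fn Fd (middleCmd.growth (descentBits Fn Fd ((prepareCmd Fn Fd).growth m)))

theorem le_descentBits (m : ℕ) : m ≤ descentBits Fn Fd m := by unfold descentBits; omega

theorem le_deduceBits (m : ℕ) : m ≤ deduceBits Fn Fd m :=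
  ((ACmd.le_growth _ m).trans (le_descentBits _)).trans
    ((ACmd.le_growth _ _).trans (le_descentBits _))

theorem good_deduceCmd (hF : Transparent Fn Fd) (hO : ∀ q, encLen (O q) ≤ m) (hb : Bdd m h) :
    (deduceCmd Fn Fd).Good O (deduceBits Fn Fd m) h := by
  have hle := ACmd.le_growth (prepareCmd Fn Fd) m
  have h1 := (prepareCmd Fn Fd).bdd_den m h hO hb (by simp [prepareCmd, ACmd.Good])
  have hO1 := fun q => (hO q).trans hle
  have h2 := bdd_descentCmd hF hO1 h1
  have hO2 := fun q => (hO1 q).trans (le_descentBits (Fn := Fn) (Fd := Fd) _)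
  have h3 := middleCmd.bdd_den _ _ hO2 h2 (by simp [middleCmd, ACmd.Good])
  have hO3 := fun q => (hO2 q).trans (middleCmd.le_growth _)
  refine ⟨by simp [prepareCmd, ACmd.Good], ?_, by simp [middleCmd, ACmd.Good],
    good_descentCmd hF hO3 h3, by simp [extendCmd, ACmd.Good], by simp [resetCmd, ACmd.Good]⟩
  exact (good_descentCmd hF hO1 h1).mono ((ACmd.le_growth _ _).trans (le_descentBits _))

/-- The bound after a deduction is the one before it, so nothing accumulates over the rounds: the
preorder consists of truth values, and all intermediate results are reset to `0`. -/
theorem bdd_deduceCmd (hb : Bdd m h) : Bdd m ((deduceCmd Fn Fd).den O h) := by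
  refine ⟨fun j => ?_, fun x => ?_, fun a i => ?_⟩
  · rw [ACmd.den_sz]; exact hb.sz j
  · by_cases hx : x < 2
    · rw [ACmd.den_var _ (keeps_deduceCmd.1 x hx)]; exact hb.var x
    · have : ((deduceCmd Fn Fd).den O h).var x = 0 := by
        simp only [deduceCmd, ACmd.den_seq]
        generalize extendCmd.den O _ = g
        simp only [resetCmd, ACmd.den, AState.setArr_var, AState.setVar, eval_const]
        fin_cases x <;> simp_all
      rw [this]; simp
  · by_cases ha : 3 ≤ a
    · rw [ACmd.den_arr _ (keeps_deduceCmd.2 a ha)]; exact hb.arr a i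
    · by_cases ha0 : a = 0
      · subst ha0
        have h0 : ∃ g : AState, g.arr 0 = h.arr 0 ∧ ((deduceCmd Fn Fd).den O h).arr 0 =
            ((ACmd.tab 0 5 newRelE).den O g).arr 0 := by
          refine ⟨_, ?_, ACmd.den_arr (c := resetCmd) _ (by simp [resetCmd, ACmd.KeepsArr])⟩
          rw [ACmd.den_assign_arr, ACmd.den_assign_arr, ACmd.den_assign_arr,
            den_descentCmd_arr (by decide) (by decide),
            ACmd.den_arr _ (by simp [middleCmd, ACmd.KeepsArr]),
            den_descentCmd_arr (by decide) (by decide),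
            ACmd.den_arr _ (by simp [prepareCmd, ACmd.KeepsArr])]
        obtain ⟨g, hg, he⟩ := h0
        rw [he]
        refine g.setArr_forall 0 (p := fun z => |z| ≤ 2 ^ m) (fun j _ => ?_) i
          (by rw [hg]; exact hb.arr 0 i)
        rw [newRelE, eOr, eval_eLt]
        exact abs_bi_le _ _
      · have ha12 : a = 1 ∨ a = 2 := by
          fin_cases a <;> simp_all
        by_cases hi : 0 ≤ i ∧ i < h.sz 3
        · have : ((deduceCmd Fn Fd).den O h).arr a i = 0 := by
            have hsz : (extendCmd.den O ((descentCmd Fn Fd).den O (middleCmd.den O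
                ((descentCmd Fn Fd).den O ((prepareCmd Fn Fd).den O h))))).sz = h.sz := by
              simp only [ACmd.den_sz]
            simp only [deduceCmd, ACmd.den_seq]
            generalize extendCmd.den O _ = g at hsz ⊢
            obtain ⟨i, rfl⟩ := Int.eq_ofNat_of_zero_le hi.1
            have hi3 : i < g.sz 3 := by rw [hsz]; omega
            simp only [resetCmd, ACmd.den_seq]
            rcases ha12 with rfl | rfl
            · rw [ACmd.den_tab_ne (by decide), ACmd.den_tab_lt _ _ (by simpa only [ACmd.den_sz]),
                eval_const]
            · rw [ACmd.den_tab_lt _ _ (by simpa only [ACmd.den_sz]), eval_const]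
          rw [this]; simp
        · rw [ACmd.den_arr_out (j := 3) _ ?_ hi]
          · exact hb.arr a i
          · have h10 : a ≠ 0 := ha0
            simp [deduceCmd, prepareCmd, descentCmd, stepCmd, middleCmd, extendCmd, resetCmd,
              ACmd.TabsWith, h10]

end SubmodAlloc

/-! ### Bit lengths during minimization, Newton iteration and the main loop. -/

namespace SubmodAlloc
open Finset Function AExpr

variable {n k B : ℕ} {F : Finset ℕ → ℚ} {y : ℕ → ℚ} {R : ℕ → ℕ → Prop} {h : AState} {O : Oracle}
  {Fn Fd : (ℕ → ℕ → AExpr) → ℕ → AExpr} {ρ : ℕ → ℤ} {m : ℕ}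

theorem bdd_iterate_deduceCmd (hb : Bdd m h) (j : ℕ) :
    Bdd m (((deduceCmd Fn Fd).den O)^[j] h) := by
  induction j with
  | zero => exact hb
  | succ j ih => rw [iterate_succ_apply']; exact bdd_deduceCmd ih

theorem bdd_trivialRel (hb : Bdd m h) : Bdd m ((ACmd.tab 0 5 trivialRelE).den O h) :=
  hb.tab fun _ _ => by rw [trivialRelE, eOr, eval_eLt]; exact abs_bi_le _ _

theorem bdd_minimizeCmd (hb : Bdd m h) : Bdd m ((minimizeCmd Fn Fd).den O h) :=
  bdd_iterate_deduceCmd (bdd_trivialRel hb) _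

theorem good_minimizeCmd (hF : Transparent Fn Fd) (hO : ∀ q, encLen (O q) ≤ m) (hb : Bdd m h) :
    (minimizeCmd Fn Fd).Good O (deduceBits Fn Fd m) h := by
  refine ⟨trivial, fun j _ => ?_⟩
  have hj := bdd_iterate_deduceCmd (O := O) (Fn := Fn) (Fd := Fd) (bdd_trivialRel (O := O) hb) j
  exact ⟨hj.mono (le_deduceBits m), fun _ => good_deduceCmd hF hO hj⟩

theorem abs_otherSumE_le (hs : HasSizes n k h) {A : Finset ℕ} (hA : HasSet 5 (n * k) A h)
    (hb : Bdd m h) : |otherSumE.eval O h ρ| ≤ (n * k : ℕ) * 2 ^ m := by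
  rw [otherSumE, eval_eSum, hs.sz2]
  refine (abs_sum_le_sum_abs _ _).trans ((sum_le_sum (g := fun _ => (2 : ℤ) ^ m) fun e he => ?_).trans
    (by simp))
  rw [eval_eMul, eval_eAnd (P := e ∈ A) (by rw [eval_arr, eval_ix, update_self,
    hA e (mem_range.1 he)]) fun _ => eval_eNot eval_eEq, abs_mul]
  have h1 := abs_bi_le (e ∈ A ∧ ¬ (modE 0).eval O h (update ρ 0 (e : ℤ)) =
    (AExpr.var 1).eval O h (update ρ 0 (e : ℤ))) 0
  have h2 : |(AExpr.arr 3 (.ix 0)).eval O h (update ρ 0 (e : ℤ))| ≤ 2 ^ m := hb.arr 3 _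
  rw [pow_zero] at h1
  calc _ ≤ 1 * (2 : ℤ) ^ m := mul_le_mul h1 h2 (abs_nonneg _) (by norm_num)
    _ = _ := one_mul _

theorem multiplicity_le_card {v : ℕ} {A : Finset ℕ} (hAN : A ⊆ range (n * k)) :
    multiplicity n v A ≤ n * k := by
  have := (card_filter_le A fun e => e % n = v).trans (card_le_card hAN)
  rwa [card_range] at this

/-- An update multiplies the common denominator by an oracle denominator with at most `B` bits and
by a multiplicity with at most `n * k` bits. This additive growth of the length is affordable even
without reducing fractions, because the number of updates is polynomial. -/
theorem bdd_updateCmd (hm : MinStart n k B F y O Fn Fd h) {A : Finset ℕ}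
    (hAN : A ⊆ range (n * k)) (hA : HasSet 5 (n * k) A h) {v : ℕ} (hv : h.var 1 = v)
    (hb : Bdd m h) : Bdd (m + (B + n * k)) ((updateCmd Fn Fd).den O h) := by
  obtain ⟨h0, h3⟩ := den_updateCmd (O := O) hm.avoids hm.sizes hAN hA hv
  have hmem := memb_currentE (O := O) (ρ := noIndex) (l := 0) hA
  have hd := hm.evaluates.den_le _ _ _ _ _ hm.sizes hmem
  have hN := hm.evaluates.num_le _ _ _ _ _ hm.sizes hmem
  have hS := abs_otherSumE_le (O := O) (ρ := noIndex) hm.sizes hA hb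
  generalize (Fd currentE 0).eval O h noIndex = d at *
  generalize (Fn currentE 0).eval O h noIndex = a at *
  generalize otherSumE.eval O h noIndex = s at *
  have hk : ((n * k : ℕ) : ℤ) + 1 ≤ 2 ^ (n * k) := by exact_mod_cast Nat.lt_two_pow_self
  have hmul : |((multiplicity n v A : ℕ) : ℤ)| ≤ 2 ^ (n * k) :=
    abs_natCast_le_two_pow (multiplicity_le_card hAN)
  have hprod : ∀ z : ℤ, |z| ≤ 2 ^ m →
      |z * (d * ((multiplicity n v A : ℕ) : ℤ))| ≤ 2 ^ (m + (B + n * k)) := by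
    intro z hz
    rw [abs_mul, abs_mul, pow_add, pow_add]
    exact mul_le_mul hz (mul_le_mul hd hmul (abs_nonneg _) (by positivity)) (by positivity)
      (by positivity)
  have hb' := hb.mono (show m ≤ m + (B + n * k) by omega)
  refine ⟨fun j => ?_, fun x => ?_, fun b i => ?_⟩
  · rw [ACmd.den_sz]; exact hb'.sz j
  · by_cases hx0 : x = 0
    · subst hx0
      rw [h0]
      exact hprod _ (hb.var 0)
    · by_cases hx5 : 2 ≤ x ∧ x ≤ 5
      · have : ((updateCmd Fn Fd).den O h).var x = 0 := by
          simp only [updateCmd, ACmd.den_seq]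
          generalize (ACmd.assign 0 (eMul (.var 0) (eMul (.var 2) (.var 4)))).den O _ = g
          simp only [ACmd.den, AState.setVar, eval_const]
          fin_cases x <;> simp_all
        rw [this]; simp
      · rw [ACmd.den_var]
        · exact hb'.var x
        · have h2 : x ≠ 2 := by rintro rfl; exact hx5 (by decide)
          have h3 : x ≠ 3 := by rintro rfl; exact hx5 (by decide)
          have h4 : x ≠ 4 := by rintro rfl; exact hx5 (by decide)
          have h5 : x ≠ 5 := by rintro rfl; exact hx5 (by decide)
          simp [updateCmd, ACmd.KeepsVar, hx0, h2, h3, h4, h5]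
  · by_cases hb3 : b = 3
    · subst hb3
      by_cases hi : 0 ≤ i ∧ i < h.sz 2
      · obtain ⟨e, rfl⟩ := Int.eq_ofNat_of_zero_le hi.1
        have he : e < n * k := by rw [hm.sizes.sz2] at hi; omega
        rw [h3 e he]
        split_ifs
        · have h1 : |a * h.var 0| ≤ 2 ^ B * 2 ^ m := by
            rw [abs_mul]; exact mul_le_mul hN (hb.var 0) (abs_nonneg _) (by positivity)
          have h2 : |d * s| ≤ 2 ^ B * ((n * k : ℕ) * 2 ^ m) := by
            rw [abs_mul]; exact mul_le_mul hd hS (abs_nonneg _) (by positivity)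
          have h4 : (0 : ℤ) ≤ 2 ^ B * 2 ^ m := by positivity
          calc _ ≤ |a * h.var 0| + |d * s| := abs_sub _ _
            _ ≤ 2 ^ B * 2 ^ m * (((n * k : ℕ) : ℤ) + 1) := by linarith
            _ ≤ 2 ^ B * 2 ^ m * 2 ^ (n * k) := mul_le_mul_of_nonneg_left hk h4
            _ = _ := by ring
        · exact hprod _ (hb.arr 3 _)
      · rw [ACmd.den_arr_out (j := 2) _ (by simp [updateCmd, ACmd.TabsWith]) hi]
        exact hb'.arr 3 i
    · rw [ACmd.den_arr _ (keeps_updateCmd.2 b hb3)]; exact hb'.arr b i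

/-- A state stays bounded if a set is stored in an array. -/
theorem Bdd.of_hasSet {h' : AState} (hb : Bdd m h) {a : Fin 8} {N : ℕ} {A : Finset ℕ}
    (hsz : h'.sz = h.sz) (hvar : h'.var = h.var) (harr : ∀ b, b ≠ a → h'.arr b = h.arr b)
    (hout : ∀ i, ¬ (0 ≤ i ∧ i < (N : ℤ)) → h'.arr a i = h.arr a i) (hA : HasSet a N A h') :
    Bdd m h' where
  sz j := by rw [hsz]; exact hb.sz j
  var x := by rw [hvar]; exact hb.var x
  arr b i := by
    by_cases hba : b = a
    · subst hba
      by_cases hi : 0 ≤ i ∧ i < (N : ℤ)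
      · obtain ⟨e, rfl⟩ := Int.eq_ofNat_of_zero_le hi.1
        rw [hA e (by omega)]; exact abs_bi_le _ _
      · rw [hout i hi]; exact hb.arr b i
    · rw [harr b hba]; exact hb.arr b i

theorem bdd_newtonCmd {v j : ℕ} {A : Finset ℕ} (hN : NewtonStart n k B F y v j A O Fn Fd h)
    (h0 : ∀ Z ⊆ range (n * k), 0 ≤ reducedWithout n F y v Z) (hb : Bdd m h) :
    Bdd (m + (B + n * k)) ((newtonCmd Fn Fd).den O h) := by
  obtain ⟨A', hstep, hm, hA, hv⟩ := den_improveCmd hN h0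
  refine bdd_updateCmd hm hstep.subset hA hv ?_
  have hb1 := bdd_minimizeCmd (O := O) (Fn := Fn) (Fd := Fd) hb
  refine hb1.of_hasSet (ACmd.den_sz _ _ _) rfl (fun b hb => ACmd.den_tab_ne hb _ _)
    (fun i hi => ACmd.den_arr_out (j := 2) _ (by simp [improveCmd, ACmd.TabsWith]) ?_) hA
  rwa [ACmd.den_sz, hN.start.sizes.sz2]

/-- The bounds during the Newton iteration. -/
theorem bdd_iterate_newtonCmd {v : ℕ} {A : Finset ℕ} (hN : NewtonStart n k B F y v 0 A O Fn Fd h)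
    (h0 : ∀ Z ⊆ range (n * k), 0 ≤ reducedWithout n F y v Z) (hb : Bdd m h) (j : ℕ) :
    Bdd (m + j * (B + n * k)) (((newtonCmd Fn Fd).den O)^[j] h) := by
  induction j with
  | zero => simpa using hb
  | succ j ih =>
    obtain ⟨A', hA'⟩ := newtonStart_iterate hN h0 j
    rw [iterate_succ_apply', Nat.succ_mul, ← Nat.add_assoc]
    exact bdd_newtonCmd hA' h0 ih

theorem bdd_start {v : ℕ} {A : Finset ℕ} (hM : MainState n k B F y v A O Fn Fd h)
    (hb : Bdd m h) : Bdd (m + (B + n * k))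
      ((updateCmd Fn Fd).den O ((ACmd.tab 5 2 (.const 1)).den O h)) := by
  have hb1 : Bdd m ((ACmd.tab 5 2 (.const 1)).den O h) := hb.tab fun i _ => by
    rw [eval_const, abs_one]; exact one_le_pow₀ (by norm_num)
  have hA : HasSet 5 (n * k) (range (n * k)) ((ACmd.tab 5 2 (.const 1)).den O h) := by
    intro e he
    rw [ACmd.den_tab_lt _ _ (by rwa [hM.start.sizes.sz2]), eval_const, bi_pos (mem_range.2 he)]
  exact bdd_updateCmd (hM.start.congr rfl rfl (ACmd.den_tab_ne (by decide) _ _)) Subset.rfl hA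
    hM.var hb1

/-- There are `k + 1` updates for each customer: one for the initial set and one in each of the `k`
Newton steps. -/
theorem bdd_customerCmd {v : ℕ} {A : Finset ℕ} (hM : MainState n k B F y v A O Fn Fd h)
    (hk : 1 ≤ k) (hv : v < n) (hb : Bdd m h) :
    Bdd (m + (k + 1) * (B + n * k)) ((customerCmd Fn Fd).den O h) := by
  have hN := newtonStart_zero hM hk hv
  have hb1 := bdd_iterate_newtonCmd hN (fun Z hZ => hM.dual.reducedWithout_nonneg (Z := Z) hZ)
    (bdd_start hM hb) k
  have hle : m + (B + n * k) + k * (B + n * k) = m + (k + 1) * (B + n * k) := by ring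
  rw [hle] at hb1
  simp only [customerCmd, ACmd.den_seq]
  have hloop : (ACmd.loop 0 (newtonCmd Fn Fd)).den O ((updateCmd Fn Fd).den O
      ((ACmd.tab 5 2 (.const 1)).den O h)) = ((newtonCmd Fn Fd).den O)^[k] ((updateCmd Fn Fd).den O
      ((ACmd.tab 5 2 (.const 1)).den O h)) :=
    congrArg (fun r => ((newtonCmd Fn Fd).den O)^[r] ((updateCmd Fn Fd).den O
      ((ACmd.tab 5 2 (.const 1)).den O h))) hN.start.sizes.sz0
  obtain ⟨A', hN'⟩ := newtonStart_iterate hN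
    (fun Z hZ => hM.dual.reducedWithout_nonneg (Z := Z) hZ) k
  rw [hloop]
  generalize ((newtonCmd Fn Fd).den O)^[k] ((updateCmd Fn Fd).den O
      ((ACmd.tab 5 2 (.const 1)).den O h)) = g at *
  refine (hb1.tab fun i _ => ?_).assign ?_
  · rw [eOr, eval_eLt]; exact abs_bi_le _ _
  · rw [eval_eAdd, eval_var]
    change |g.var 1 + 1| ≤ _
    rw [hN'.var]
    have h1 := hb.sz 1
    rw [hM.start.sizes.sz1] at h1
    exact_mod_cast abs_natCast_le_two_pow (n := v + 1) (m := m + (k + 1) * (B + n * k)) (by omega)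

theorem good_newtonCmd (hF : Transparent Fn Fd) (hO : ∀ q, encLen (O q) ≤ m) (hb : Bdd m h) :
    (newtonCmd Fn Fd).Good O (deduceBits Fn Fd m) h :=
  ⟨good_minimizeCmd hF hO hb, trivial, by simp [updateCmd, ACmd.Good]⟩

theorem good_customerCmd {v : ℕ} {A : Finset ℕ} (hM : MainState n k B F y v A O Fn Fd h)
    (hk : 1 ≤ k) (hv : v < n) {m' : ℕ} (hb : Bdd m h) (hm : m + (k + 1) * (B + n * k) ≤ m')
    (hO : ∀ q, encLen (O q) ≤ m') : (customerCmd Fn Fd).Good O (deduceBits Fn Fd m') h := by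
  have hN := newtonStart_zero hM hk hv
  refine ⟨trivial, by simp [updateCmd, ACmd.Good], fun j hj => ?_, trivial, trivial⟩
  rw [hN.start.sizes.sz0] at hj
  have hb1 := bdd_iterate_newtonCmd hN (fun Z hZ => hM.dual.reducedWithout_nonneg (Z := Z) hZ)
    (bdd_start hM hb) j
  have hle : m + (B + n * k) + j * (B + n * k) ≤ m' := by
    have := Nat.mul_le_mul_right (B + n * k) hj
    have : (k + 1) * (B + n * k) = k * (B + n * k) + (B + n * k) := by ring
    omega
  have hb2 := hb1.mono hle
  exact ⟨hb2.mono (le_deduceBits _), fun _ => good_newtonCmd hM.start.avoids hO hb2⟩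

theorem bdd_iterate_customerCmd {A : Finset ℕ} (hM : MainState n k B F y 0 A O Fn Fd h)
    (hk : 1 ≤ k) (hb : Bdd m h) : ∀ i ≤ n,
      Bdd (m + i * ((k + 1) * (B + n * k))) (((customerCmd Fn Fd).den O)^[i] h) := by
  intro i
  induction i with
  | zero => intro _; simpa using hb
  | succ i ih =>
    intro hi
    obtain ⟨y', A', hM'⟩ := mainState_iterate hM hk i (by omega)
    rw [iterate_succ_apply', Nat.succ_mul, ← Nat.add_assoc]
    exact bdd_customerCmd hM' hk hi (ih (by omega))

variable (Fn Fd) in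
/-- Bound on all bit lengths. -/
def mainBits (n k B m : ℕ) : ℕ :=
  deduceBits Fn Fd (m + (n + 1) * ((k + 1) * (B + n * k)))

theorem good_mainCmd (hE : Evaluates n k F B O Fn Fd) (hF : Transparent Fn Fd)
    (hP : IsPolymatroid (n * k) F) (hk : 1 ≤ k) (hs : HasSizes n k h) (hv : h.var 1 = 0)
    (h0 : ∀ a i, h.arr a i = 0) (hO : ∀ q, encLen (O q) ≤ m) (hb : Bdd m h) :
    (mainCmd Fn Fd).Good O (mainBits Fn Fd n k B m) h := by
  have hM := mainState_zero hE hF hP hs hv h0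
  have hb1 : Bdd m ((ACmd.assign 0 (.const 1)).den O h) := hb.assign (by
    rw [eval_const, abs_one]; exact one_le_pow₀ (by norm_num))
  refine ⟨trivial, fun i hi => ?_, trivial⟩
  rw [hM.start.sizes.sz1] at hi
  have hbi := bdd_iterate_customerCmd hM hk hb1 i hi
  have hle : m + i * ((k + 1) * (B + n * k)) + (k + 1) * (B + n * k) ≤
      m + (n + 1) * ((k + 1) * (B + n * k)) := by
    have := Nat.mul_le_mul_right ((k + 1) * (B + n * k)) (Nat.add_le_add_right hi 1)
    rw [Nat.succ_mul] at this
    omega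
  refine ⟨hbi.mono ((Nat.le_add_right _ _).trans (hle.trans (le_deduceBits _))), fun hi' => ?_⟩
  rw [hM.start.sizes.sz1] at hi'
  obtain ⟨y', A', hM'⟩ := mainState_iterate hM hk i hi
  exact good_customerCmd hM' hk hi' hbi hle fun q => (hO q).trans (by omega)

end SubmodAlloc

namespace SubmodAlloc
open Finset Function AExpr

/-! ## The program -/

/-- The expression `48 W ^ 5`, computed from `W` and `W ^ 2`. -/
def sqrtStepsExpr : Expr := .mul (.const 48) (.mul (.mul (.var 6) (.var 6)) (.var 4))

/-- Computes the sizes for the array language. -/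
def preludeProg : Prog :=
  .seq (.assign 2 (.var 0)) (.seq (.assign 3 (.mul (.var 0) (.var 1)))
    (.seq (.assign 4 (.add (.var 3) (.const 2))) (.seq (.assign 6 (.mul (.var 4) (.var 4)))
      (.assign 5 (.mul sqrtStepsExpr sqrtStepsExpr)))))

/-- The state of the array language at the beginning. -/
def startState (n k : ℕ) : AState where
  sz := ![k, n, n * k, n * k + 2, descentSteps (n * k + 2), (n * k + 2) ^ 2, 0, 0]
  var _ := 0
  arr _ _ := 0

theorem hasSizes_startState (n k : ℕ) : HasSizes n k (startState n k) := by
  constructor <;> rfl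

theorem bdd_startState {n k m : ℕ} (hm : n + k + descentSteps (n * k + 2) ≤ m) :
    Bdd m (startState n k) := by
  have h1 : (n * k + 2) ^ 2 ≤ descentSteps (n * k + 2) := by
    unfold descentSteps
    have h2 : n * k + 2 ≤ (n * k + 2) ^ 5 := Nat.le_self_pow (by norm_num) _
    exact Nat.pow_le_pow_left (by omega) 2
  have h2 : n * k + 2 ≤ (n * k + 2) ^ 2 := Nat.le_self_pow (by norm_num) _
  refine ⟨fun j => ?_, fun x => by simp [startState], fun a i => by simp [startState]⟩
  fin_cases j <;> simp [startState] <;> omega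

theorem run_preludeProg (O : Oracle) {n k m : ℕ} (hm : n + k + descentSteps (n * k + 2) ≤ m) :
    ∃ s t, Run O preludeProg (initState n k) s t ∧ t ≤ 31 * (m + 2) + 5 ∧
      Rep (startState n k) s := by
  obtain ⟨W, hW⟩ : ∃ W, W = n * k + 2 := ⟨_, rfl⟩
  have hWm : descentSteps W ≤ m := by rw [hW]; omega
  have h5 : W ^ 5 ≤ descentSteps W := by
    unfold descentSteps
    have := Nat.le_self_pow (n := 2) (by norm_num) (48 * W ^ 5)
    omega
  have h48 : 48 * W ^ 5 ≤ descentSteps W := Nat.le_self_pow (n := 2) (by norm_num) (48 * W ^ 5)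
  -- Sizes are numbers of passes, so `m` has to bound the numbers themselves and not only their
  -- lengths; the number of descent steps dominates all powers that occur.
  have hpow : ∀ i ≤ 5, W ^ i ≤ m := fun i hi =>
    ((Nat.pow_le_pow_right (by omega) hi).trans h5).trans hWm
  have hpos : 1 ≤ W ^ 5 := Nat.one_le_pow _ _ (by omega)
  have b0 : bitLen (n : ℤ) ≤ m + 2 := bitLen_natCast_le (by omega)
  have b1 : bitLen (k : ℤ) ≤ m + 2 := bitLen_natCast_le (by omega)
  have hW1 := hpow 1 (by norm_num)
  rw [pow_one] at hW1
  have b2 : bitLen ((n : ℤ) * k) ≤ m + 2 := by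
    exact_mod_cast bitLen_natCast_le (n := n * k) (m := m) (by omega)
  have b3 : bitLen ((n : ℤ) * k + 2) ≤ m + 2 := by
    exact_mod_cast bitLen_natCast_le (n := n * k + 2) (m := m) (by omega)
  have b4 : bitLen (((n : ℤ) * k + 2) * ((n : ℤ) * k + 2)) ≤ m + 2 := by
    have := bitLen_natCast_le (hpow 2 (by norm_num))
    rw [hW] at this; push_cast at this; rwa [sq] at this
  have b5 : bitLen (((n : ℤ) * k + 2) * ((n : ℤ) * k + 2) * (((n : ℤ) * k + 2) *
      ((n : ℤ) * k + 2))) ≤ m + 2 := by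
    have := bitLen_natCast_le (hpow 4 (by norm_num))
    rw [hW] at this; push_cast at this; convert this using 2; ring
  have b6 : bitLen (((n : ℤ) * k + 2) * ((n : ℤ) * k + 2) * (((n : ℤ) * k + 2) *
      ((n : ℤ) * k + 2)) * ((n : ℤ) * k + 2)) ≤ m + 2 := by
    have := bitLen_natCast_le (hpow 5 (by norm_num))
    rw [hW] at this; push_cast at this; convert this using 2; ring
  have b7 : bitLen (48 * (((n : ℤ) * k + 2) * ((n : ℤ) * k + 2) * (((n : ℤ) * k + 2) *
      ((n : ℤ) * k + 2)) * ((n : ℤ) * k + 2))) ≤ m + 2 := by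
    have := bitLen_natCast_le (h48.trans hWm)
    rw [hW] at this; push_cast at this; convert this using 2; ring
  have e8 : (descentSteps (n * k + 2) : ℤ) = (48 * (((n : ℤ) * k + 2) * ((n : ℤ) * k + 2) *
      (((n : ℤ) * k + 2) * ((n : ℤ) * k + 2)) * ((n : ℤ) * k + 2))) *
      (48 * (((n : ℤ) * k + 2) * ((n : ℤ) * k + 2) * (((n : ℤ) * k + 2) *
      ((n : ℤ) * k + 2)) * ((n : ℤ) * k + 2))) := by
    unfold descentSteps; push_cast; ring
  have b8 := bitLen_natCast_le hWm
  rw [hW, e8] at b8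
  have b9 : bitLen 2 ≤ m + 2 := bitLen_natCast_le (n := 2) (by omega)
  have b10 : bitLen 48 ≤ m + 2 := bitLen_natCast_le (n := 48) (by omega)
  refine ⟨_, _, Run.seq (Run.assign _ _ _) (Run.seq (Run.assign _ _ _) (Run.seq (Run.assign _ _ _)
    (Run.seq (Run.assign _ _ _) (Run.assign _ _ _)))), ?_, ⟨?_, ?_, ?_, ?_⟩⟩
  · simp [Expr.cost, Expr.eval, State.setVar, initState, sqrtStepsExpr]
    omega
  · intro j
    fin_cases j <;> simp [Expr.eval, State.setVar, initState, sqrtStepsExpr, startState, sq, e8]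
  · intro j
    fin_cases j <;> simp [State.setVar, initState, startState]
  · intro a i
    simp [State.setVar, initState, startState]
  · simp [State.setVar, initState]

/-- The complete program. -/
def allocProg (Fn Fd : (ℕ → ℕ → AExpr) → ℕ → AExpr) : Prog :=
  .seq preludeProg (.seq ((mainCmd Fn Fd).comp 18) (.assign 0 (.var 9)))

/-! ### Sets of numbers as binary numbers -/

/-- The number whose binary expansion is the characteristic vector of `A ∩ {0, …, N - 1}`. -/
noncomputable def mask (N : ℕ) (A : Finset ℕ) : ℤ := ∑ e ∈ range N, bi (e ∈ A) * 2 ^ e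

theorem mask_eq (N : ℕ) (A : Finset ℕ) :
    ∃ q : ℕ, mask N A = q ∧ q < 2 ^ N ∧ ∀ e, q.testBit e = true ↔ e < N ∧ e ∈ A := by
  induction N with
  | zero => exact ⟨0, by simp [mask], by simp, by simp⟩
  | succ N ih =>
    obtain ⟨q, h1, h2, h3⟩ := ih
    have hs : mask (N + 1) A = mask N A + bi (N ∈ A) * 2 ^ N := sum_range_succ _ _
    have hp : 2 ^ (N + 1) = 2 ^ N * 2 := pow_succ _ _
    by_cases hN : N ∈ A
    · refine ⟨2 ^ N * 1 + q, by rw [hs, h1, bi_pos hN]; push_cast; ring, by omega, fun e => ?_⟩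
      rw [Nat.testBit_two_pow_mul_add _ h2]
      split_ifs with he
      · rw [h3]; simp [he, Nat.lt_succ_of_lt he]
      · rw [Nat.testBit_one_eq_true_iff_self_eq_zero]
        constructor
        · intro h; have : e = N := by omega
          subst this; simp [hN]
        · rintro ⟨h, _⟩; omega
    · refine ⟨q, by rw [hs, h1, bi_neg hN]; ring, by omega, fun e => ?_⟩
      rw [h3]
      refine ⟨fun h => ⟨by omega, h.2⟩, fun h => ⟨?_, h.2⟩⟩
      have : e ≠ N := fun h' => hN (h' ▸ h.2)
      omega

theorem decodeTuple_mask (n k : ℕ) (A : Finset ℕ) :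
    decodeTuple n k (mask (n * k) A) = tupleOf n k A := by
  obtain ⟨q, h1, _, h3⟩ := mask_eq (n * k) A
  ext i v
  rw [h1, mem_tupleOf, decodeTuple, mem_filter, Int.toNat_natCast, h3]
  simp [index_lt i v]

theorem decodeTuple_zero (n k : ℕ) : decodeTuple n k 0 = fun _ => ∅ := by
  ext i v; simp [decodeTuple]

theorem decodeSet_mask (n : ℕ) (A : Finset ℕ) :
    decodeSet n (mask n A) = univ.filter fun v : Fin n => (v : ℕ) ∈ A := by
  obtain ⟨q, h1, _, h3⟩ := mask_eq n A
  ext v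
  rw [h1, decodeSet, mem_filter, Int.toNat_natCast, h3]
  simp

theorem decodeSet_zero (n : ℕ) : decodeSet n 0 = ∅ := by
  ext v; simp [decodeSet]

/-! ### The running time -/

theorem polyBounded_descentBits (Fn Fd : (ℕ → ℕ → AExpr) → ℕ → AExpr) :
    PolyBounded (descentBits Fn Fd) :=
  (PolyBounded.id.add (AExpr.polyBounded_bits _)).add (.const 1)

theorem polyBounded_deduceBits (Fn Fd : (ℕ → ℕ → AExpr) → ℕ → AExpr) :
    PolyBounded (deduceBits Fn Fd) :=
  (polyBounded_descentBits Fn Fd).comp ((ACmd.polyBounded_growth _).comp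
    ((polyBounded_descentBits Fn Fd).comp (ACmd.polyBounded_growth _)))

theorem descentSteps_mono {a b : ℕ} (hab : a ≤ b) : descentSteps a ≤ descentSteps b := by
  unfold descentSteps; gcongr

/-- The program works for all functions that can be evaluated by the given expressions. -/
theorem exists_computes {Fn Fd : (ℕ → ℕ → AExpr) → ℕ → AExpr} (hF : Transparent Fn Fd) {β : ℕ → ℕ}
    (hβ : PolyBounded β) : ∃ p : Polynomial ℕ,
      ∀ (n k L : ℕ) (f : (Fin k → Finset (Fin n)) → ℚ) (O : Oracle), 1 ≤ k → (∀ S, 0 ≤ f S) →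
        IsMultiMonotone f → IsMultiSubmodular f → (∀ q, encLen (O q) ≤ L + 4) →
        Evaluates n k (normalized f) (β (n + k + L)) O Fn Fd →
        Computes (allocProg Fn Fd) O n k (p.eval (n + k + L)) (IsApproxMin (k : ℚ) f) := by
  have hx := PolyBounded.id
  have hm : PolyBounded fun x => x + descentSteps (x * x + 2) + 4 :=
    (hx.add (((PolyBounded.const 48).mul (((hx.mul hx).add (.const 2)).pow 5)).pow 2)).add (.const 4)
  have hM : PolyBounded fun x => x + descentSteps (x * x + 2) + 4 +
      (x + 1) * ((x + 1) * (β x + x * x)) :=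
    hm.add ((hx.add (.const 1)).mul ((hx.add (.const 1)).mul (hβ.add (hx.mul hx))))
  obtain ⟨p, hp⟩ := hM
  obtain ⟨q, hq⟩ := ((ACmd.polyBounded_time (mainCmd Fn Fd)).add
    (ACmd.polyBounded_growth (mainCmd Fn Fd))).comp (polyBounded_deduceBits Fn Fd)
  obtain ⟨r, hr⟩ := hm
  -- The prelude takes `31 * (m + 2) + 5 = 31 * m + 67`, and the last assignment adds `3` and the
  -- bits of the result, which `q` covers together with the time of the main command.
  refine ⟨31 * r + q.comp p + 70, ?_⟩
  intro n k L f O hk h0 hmono hsub hO hE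
  obtain ⟨x, hxdef⟩ : ∃ x, x = n + k + L := ⟨_, rfl⟩
  rw [← hxdef] at hE ⊢
  obtain ⟨m, hmdef⟩ : ∃ m, m = x + descentSteps (x * x + 2) + 4 := ⟨_, rfl⟩
  have hnx : n ≤ x := by omega
  have hkx : k ≤ x := by omega
  have hnk : n * k ≤ x * x := Nat.mul_le_mul hnx hkx
  have hle : n + k + descentSteps (n * k + 2) ≤ m := by
    have := descentSteps_mono (Nat.add_le_add_right hnk 2)
    omega
  obtain ⟨s1, t1, hr1, ht1, hrep1⟩ := run_preludeProg O hle
  have hO' : ∀ q, encLen (O q) ≤ m := fun q => (hO q).trans (by omega)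
  have hP := isPolymatroid_normalized hmono hsub
  have hs := hasSizes_startState n k
  have hb := bdd_startState hle
  have hgood := good_mainCmd hE hF hP hk hs rfl (fun _ _ => rfl) hO' hb
  obtain ⟨y, A, hd, hout⟩ := den_mainCmd (O := O) hE hF hP hk hs rfl fun _ _ => rfl
  obtain ⟨M, hMdef⟩ : ∃ M, M = m + (n + 1) * ((k + 1) * (β x + n * k)) := ⟨_, rfl⟩
  rw [mainBits, ← hMdef] at hgood
  have hmM : m ≤ deduceBits Fn Fd M := (by omega : m ≤ M).trans (le_deduceBits M)
  have hO2 : ∀ q, encLen (O q) ≤ deduceBits Fn Fd M := fun q => (hO' q).trans hmM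
  obtain ⟨s2, t2, hr2, ht2, hrep2, -⟩ := ACmd.run_comp (mainCmd Fn Fd) 18 _ _ s1 le_rfl hO2
    (hb.mono hmM) hgood hrep1
  have hb2 := (mainCmd Fn Fd).bdd_den _ _ hO2 (hb.mono hmM) hgood
  refine ⟨_, _, Run.seq hr1 (Run.seq hr2 (Run.assign _ _ _)), ?_, ?_⟩
  · have h9 := bitLen_le_of_abs_le (hb2.var 0)
    rw [← hrep2.var] at h9
    have h1 := hq M
    have h2 : M ≤ p.eval x := by
      refine le_trans ?_ (hp x)
      rw [hMdef, hmdef]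
      simp only
      gcongr
    have h3 := eval_mono q h2
    have h4 : m ≤ r.eval x := hmdef ▸ hr x
    simp only [Expr.cost, Polynomial.eval_add, Polynomial.eval_mul, Polynomial.eval_comp,
      Polynomial.eval_ofNat]
    simp only [Fin.val_zero, zero_add] at h9
    simp only at h1 h3
    omega
  · have h9 : s2.var 9 = mask (n * k) (leastReps n A) := by
      rw [mask, ← hout, ← hrep2.var]; rfl
    have : (s2.setVar 0 ((Expr.var 9).eval s2)).var 0 = s2.var 9 := by
      simp [State.setVar, Expr.eval]
    rw [this, h9, decodeTuple_mask]
    exact isApproxMin_of_dualState hk h0 hmono hd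

end SubmodAlloc

namespace SubmodAlloc
open Finset Function AExpr

/-! ## Evaluation of functions given by value oracles -/

namespace AExpr

/-- Numerator of the difference of the oracle's answers for the sets `b` and `0`. -/
def diffNumE (two : Bool) (a b : AExpr) : AExpr :=
  eSub (eMul (.query false two a b) (.query true two a (.const 0)))
    (eMul (.query false two a (.const 0)) (.query true two a b))

/-- Denominator of the difference of the oracle's answers for the sets `b` and `0`. -/
def diffDenE (two : Bool) (a b : AExpr) : AExpr :=
  eMul (.query true two a b) (.query true two a (.const 0))

/-- Power of `2` with exponent `w - b`. -/
def powE (w l : ℕ) (j : Fin 8) (b : AExpr) : AExpr :=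
  .fold true l j (eAdd (.const 1) (eLt (eAdd b (.ix l)) (.ix w)))

end AExpr

section

variable {O : Oracle} {h : AState} {ρ : ℕ → ℤ} {n k c : ℕ} {F : Finset ℕ → ℚ} {two : Bool}
  {a b : AExpr} {S : Finset ℕ}

/-- The oracle's answer for the set `b`. -/
def answer (O : Oracle) (two : Bool) (a b : ℤ) : ℚ := O (if two then [a, b] else [b])

theorem eval_query_num : (AExpr.query false two a b).eval O h ρ =
    (answer O two (a.eval O h ρ) (b.eval O h ρ)).num := rfl

theorem eval_query_den : (AExpr.query true two a b).eval O h ρ =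
    (answer O two (a.eval O h ρ) (b.eval O h ρ)).den := rfl

theorem diffDenE_pos : 0 < (diffDenE two a b).eval O h ρ := by
  rw [diffDenE, eval_eMul, eval_query_den, eval_query_den]
  exact mul_pos (by exact_mod_cast Rat.den_pos _) (by exact_mod_cast Rat.den_pos _)

theorem diffNumE_eq : ((diffNumE two a b).eval O h ρ : ℚ) =
    (answer O two (a.eval O h ρ) (b.eval O h ρ) - answer O two (a.eval O h ρ) 0) *
      ((diffDenE two a b).eval O h ρ : ℚ) := by
  rw [diffNumE, diffDenE, eval_eMul, eval_eSub, eval_eMul, eval_eMul]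
  simp only [eval_query_den, eval_query_num, eval_const]
  generalize answer O two (a.eval O h ρ) (b.eval O h ρ) = r
  generalize answer O two (a.eval O h ρ) 0 = r'
  push_cast
  rw [← Rat.mul_den_eq_num r, ← Rat.mul_den_eq_num r']
  ring

theorem abs_num_le {r : ℚ} (hr : encLen r ≤ c) : |r.num| ≤ 2 ^ c :=
  abs_le_two_pow_of_bitLen_le (by unfold encLen at hr; omega)

theorem abs_den_le {r : ℚ} (hr : encLen r ≤ c) : |(r.den : ℤ)| ≤ 2 ^ c :=
  abs_le_two_pow_of_bitLen_le (by unfold encLen at hr; omega)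

theorem diffDenE_le (hO : ∀ q, encLen (O q) ≤ c) :
    |(diffDenE two a b).eval O h ρ| ≤ 2 ^ (c + c + 1) :=
  BinOp.abs_eval_le .mul (abs_den_le (hO _)) (abs_den_le (hO _))

theorem diffNumE_le (hO : ∀ q, encLen (O q) ≤ c) :
    |(diffNumE two a b).eval O h ρ| ≤ 2 ^ (c + c + 1 + (c + c + 1) + 1) :=
  BinOp.abs_eval_le .sub (BinOp.abs_eval_le .mul (abs_num_le (hO _)) (abs_den_le (hO _)))
    (BinOp.abs_eval_le .mul (abs_num_le (hO _)) (abs_den_le (hO _)))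

/-- The exponent is a truncated difference: exactly `e - d` positions contribute a factor `2`,
provided that the range is long enough. -/
theorem eval_powE {w l : ℕ} (hwl : w < l) {j : Fin 8} {e d : ℕ} (hw : ρ w = e)
    (hb : ∀ z : ℤ, b.eval O h (update ρ l z) = d) (hj : e - d ≤ h.sz j) :
    (powE w l j b).eval O h ρ = 2 ^ (e - d) := by
  rw [powE, eval_fold, if_pos rfl]
  have : ∀ i ∈ range (h.sz j), (eAdd (.const 1) (eLt (eAdd b (.ix l)) (.ix w))).eval O h
      (update ρ l (i : ℤ)) = if i < e - d then 2 else 1 := by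
    intro i _
    rw [eval_eAdd, eval_eLt, eval_const, eval_eAdd, eval_ix, eval_ix, update_self,
      update_index_ne hwl hw, hb]
    by_cases hi : i < e - d
    · rw [if_pos hi, bi_pos (by omega)]; rfl
    · rw [if_neg hi, bi_neg (by omega)]; rfl
  rw [prod_congr rfl this, prod_ite, prod_const, prod_const_one, mul_one]
  congr 1
  have : (range (h.sz j)).filter (· < e - d) = range (e - d) := by
    ext i; simp only [mem_filter, mem_range]; omega
  rw [this, card_range]

/-! ### Functions of tuples -/

/-- The binary number of a set. -/
def maskE (A : ℕ → ℕ → AExpr) (l : ℕ) : AExpr :=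
  eSum l 2 (eMul (A l (l + 1)) (powE l (l + 1) 2 (.const 0)))

/-- Numerator of a function of tuples. -/
def tupleNumE (A : ℕ → ℕ → AExpr) (l : ℕ) : AExpr := diffNumE false (.const 0) (maskE A l)

/-- Denominator of a function of tuples. -/
def tupleDenE (A : ℕ → ℕ → AExpr) (l : ℕ) : AExpr := diffDenE false (.const 0) (maskE A l)

theorem transparent_tuple : Transparent tupleNumE tupleDenE := by
  constructor <;> intro s A l hA <;>
    simp [tupleNumE, tupleDenE, diffNumE, diffDenE, maskE, powE, Avoids, eSub, eMul, eSum, eAdd, eLt,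
      hA]

theorem eval_maskE (hs : HasSizes n k h) {l : ℕ} {A : ℕ → ℕ → AExpr}
    (hA : Memb O h (n * k) ρ l A S) : (maskE A l).eval O h ρ = mask (n * k) S := by
  rw [maskE, eval_eSum, hs.sz2, mask]
  refine sum_congr rfl fun e he => ?_
  have he := mem_range.1 he
  rw [eval_eMul, hA (update ρ l (e : ℤ)) l (l + 1) e (fun i hi => update_of_ne hi.ne _ _) le_rfl
    (by omega) he (update_self _ _ _), eval_powE (by omega) (e := e) (d := 0) (update_self _ _ _)
    (fun _ => rfl) (by rw [hs.sz2]; omega), Nat.sub_zero]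

theorem evaluates_tuple {L : ℕ} {f : (Fin k → Finset (Fin n)) → ℚ}
    (hO : ∀ q, encLen (tupleOracle f q) ≤ L) :
    Evaluates n k (normalized f) (4 * L + 3) (tupleOracle f) tupleNumE tupleDenE where
  pos h ρ l A S _ _ := diffDenE_pos
  eq h ρ l A S hs hA := by
    rw [tupleNumE, diffNumE_eq, eval_maskE hs hA]
    change (f (decodeTuple n k _) - f (decodeTuple n k 0)) * _ = _
    rw [decodeTuple_mask, decodeTuple_zero, normalized, tupleDenE]
  num_le h ρ l A S _ _ := abs_le_two_pow_of_le (diffNumE_le hO) (by omega)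
  den_le h ρ l A S _ _ := abs_le_two_pow_of_le (diffDenE_le hO) (by omega)

/-! ### Facility location -/

/-- The binary number of the set of the facility `w`. -/
def facilityMaskE (A : ℕ → ℕ → AExpr) (w l : ℕ) : AExpr :=
  eSum l 2 (eMul (eMul (A l (l + 1)) (eEq (eDiv (.ix l) (.sz 1)) (.ix w)))
    (powE l (l + 1) 2 (eMul (.ix w) (.sz 1))))

/-- Numerator for the facility `w`. -/
def facilityTermE (A : ℕ → ℕ → AExpr) (w l : ℕ) : AExpr :=
  diffNumE true (.ix w) (facilityMaskE A w l)

/-- Denominator for the facility `w`. -/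
def facilityFactorE (A : ℕ → ℕ → AExpr) (w l : ℕ) : AExpr :=
  diffDenE true (.ix w) (facilityMaskE A w l)

/-- Common denominator of all facilities. -/
def facilityDenE (A : ℕ → ℕ → AExpr) (l : ℕ) : AExpr :=
  .fold true l 0 (facilityFactorE A l (l + 1))

/-- Numerator of the sum over all facilities. -/
def facilityNumE (A : ℕ → ℕ → AExpr) (l : ℕ) : AExpr :=
  eSum l 0 (eMul (facilityTermE A l (l + 1))
    (eDiv (facilityDenE A (l + 1)) (facilityFactorE A l (l + 1))))

theorem transparent_facility : Transparent facilityNumE facilityDenE := by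
  constructor <;> intro s A l hA <;>
    simp [facilityNumE, facilityDenE, facilityFactorE, facilityTermE, facilityMaskE, diffNumE,
      diffDenE, powE, Avoids, eSub, eMul, eSum, eAdd, eLt, eDiv, eEq, eNot, hA]

theorem Memb.mono {N l l' : ℕ} {ρ' : ℕ → ℤ} {A : ℕ → ℕ → AExpr} (hA : Memb O h N ρ l A S)
    (hl : l ≤ l') (hρ : ∀ i < l, ρ' i = ρ i) : Memb O h N ρ' l' A S :=
  fun ρ'' e m a h1 h2 h3 h4 h5 =>
    hA ρ'' e m a (fun i hi => (h1 i (by omega)).trans (hρ i hi)) (by omega) h3 h4 h5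

/-- The elements of facility `i` are those with quotient `i` modulo `n`, shifted down by `i * n`.
For other elements the truncated exponent is meaningless, but they are multiplied by `0`. -/
theorem eval_facilityMaskE (hs : HasSizes n k h) {w l i : ℕ} (hwl : w < l) (hw : ρ w = i)
    (hi : i < k) {A : ℕ → ℕ → AExpr} (hA : Memb O h (n * k) ρ l A S) :
    (facilityMaskE A w l).eval O h ρ = mask n ((range n).filter (i * n + · ∈ S)) := by
  have hterm : ∀ e ∈ range (n * k), (eMul (eMul (A l (l + 1)) (eEq (eDiv (.ix l) (.sz 1)) (.ix w)))
      (powE l (l + 1) 2 (eMul (.ix w) (.sz 1)))).eval O h (update ρ l (e : ℤ)) =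
      if e / n = i then bi (e ∈ S) * 2 ^ (e - i * n) else 0 := by
    intro e he
    have he := mem_range.1 he
    have hw' : ∀ z : ℤ, update ρ l z w = i := fun z => update_index_ne hwl hw
    rw [eval_eMul, eval_eMul, hA (update ρ l (e : ℤ)) l (l + 1) e
      (fun i hi => update_of_ne hi.ne _ _) le_rfl (by omega) he (update_self _ _ _),
      eval_powE (by omega) (e := e) (d := i * n) (update_self _ _ _) (fun z => by
        rw [eval_eMul, eval_ix, eval_sz, hs.sz1, update_index_ne (by omega) (hw' e)]; push_cast; rfl)
        (by rw [hs.sz2]; omega),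
      eval_eEq, eval_eDiv, eval_ix, eval_ix, eval_sz, hs.sz1, update_self, hw']
    have : ((e : ℤ) / (n : ℤ) = i) ↔ e / n = i := by norm_cast
    split_ifs with h
    · rw [bi_pos (this.2 h), mul_one]
    · rw [bi_neg (fun h' => h (this.1 h')), mul_zero, zero_mul]
  rw [facilityMaskE, eval_eSum, hs.sz2, sum_congr rfl hterm, ← sum_filter, mask]
  refine (sum_bij (fun v _ => i * n + v) (fun v hv => ?_) (fun v _ v' _ h => by simpa using h)
    (fun e he => ?_) fun v hv => ?_).symm
  · have hv := mem_range.1 hv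
    rw [mem_filter, mem_range]
    refine ⟨by nlinarith, ?_⟩
    rw [Nat.add_comm, Nat.add_mul_div_right _ _ (by omega), Nat.div_eq_of_lt hv, zero_add]
  · obtain ⟨h1, h2⟩ := mem_filter.1 he
    have h1 := mem_range.1 h1
    have hn : 0 < n := Nat.pos_of_ne_zero fun h => by simp [h] at h1
    refine ⟨e % n, mem_range.2 (Nat.mod_lt _ hn), ?_⟩
    have := Nat.div_add_mod e n
    rw [h2] at this
    rw [← this, mul_comm]
    simp
  · rw [Nat.add_sub_cancel_left]
    congr 1
    exact bi_congr (by simp [mem_range.1 hv])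

theorem facilityOracle_of_lt {f : Fin k → Finset (Fin n) → ℚ} (i : Fin k) (q : ℤ) :
    facilityOracle f [(i : ℕ), q] = f i (decodeSet n q) := by
  have h : (0 : ℤ) ≤ ((i : ℕ) : ℤ) ∧ ((i : ℕ) : ℤ).toNat < k := by simp
  simp only [facilityOracle]
  rw [dif_pos h]
  simp

/-- The fractions of the facilities are brought to the product of all their denominators; this has
polynomial length, because there are `k` factors with at most `2 * L + 1` bits each. -/
theorem evaluates_facility {L : ℕ} {f : Fin k → Finset (Fin n) → ℚ}
    (hO : ∀ q, encLen (facilityOracle f q) ≤ L) :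
    Evaluates n k (normalized fun S => ∑ i, f i (S i))
      ((k + 1) * (4 * L + 3 + (k + 1) * (L + L + 1 + 1) + 1 + 1)) (facilityOracle f)
      facilityNumE facilityDenE := by
  have hden : ∀ (h : AState) ρ l A, HasSizes n k h →
      |(facilityDenE A l).eval (facilityOracle f) h ρ| ≤ 2 ^ ((k + 1) * (L + L + 1 + 1)) := by
    intro h ρ l A hs
    rw [facilityDenE, eval_fold, if_pos rfl]
    exact abs_prod_le_two_pow hs.sz0.le _ fun _ _ => diffDenE_le hO
  have hfac : ∀ (h : AState) ρ l A, 0 < (facilityDenE A l).eval (facilityOracle f) h ρ := by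
    intro h ρ l A
    rw [facilityDenE, eval_fold, if_pos rfl]
    exact prod_pos fun _ _ => diffDenE_pos
  refine ⟨fun h ρ l A S _ _ => hfac h ρ l A, fun h ρ l A S hs hA => ?_, fun h ρ l A S hs _ => ?_,
    fun h ρ l A S hs _ => abs_le_two_pow_of_le (hden h ρ l A hs) ?_⟩
  · have hmask : ∀ i : Fin k, ∀ (w l' : ℕ) (ρ' : ℕ → ℤ), w < l' →
        l ≤ l' → ρ' w = (i : ℕ) → (∀ j < l, ρ' j = ρ j) →
        decodeSet n ((facilityMaskE A w l').eval (facilityOracle f) h ρ') = tupleOf n k S i := by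
      intro i w l' ρ' hw hl hi hρ
      rw [eval_facilityMaskE hs hw hi i.2 (hA.mono hl hρ), decodeSet_mask]
      ext v; simp [mem_tupleOf]
    -- The same factor is evaluated under different names of the index and in different
    -- surroundings; its value depends on the facility only.
    obtain ⟨D, hD⟩ : ∃ D : ℕ → ℤ, ∀ i : Fin k, ∀ (w l' : ℕ) (ρ' : ℕ → ℤ), w < l' →
        l ≤ l' → ρ' w = (i : ℕ) →
        (∀ j < l, ρ' j = ρ j) →
        (facilityFactorE A w l').eval (facilityOracle f) h ρ' = D i := by
      refine ⟨fun i => (facilityFactorE A l (l + 1)).eval (facilityOracle f) h (update ρ l (i : ℤ)),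
        fun i w l' ρ' hw hl hi hρ => ?_⟩
      have h1 := eval_facilityMaskE hs hw hi i.2 (hA.mono hl hρ)
      have h2 := eval_facilityMaskE (ρ := update ρ l ((i : ℕ) : ℤ)) hs (Nat.lt_succ_self l)
        (update_self _ _ _) i.2 (hA.mono l.le_succ fun j hj => update_of_ne hj.ne _ _)
      simp only [facilityFactorE, diffDenE, eval_eMul, eval_query_den, eval_const, eval_ix,
        update_self, hi]
      rw [h1, h2]
    have hprod : ∀ l' ρ', l ≤ l' → (∀ j < l, ρ' j = ρ j) →
        (facilityDenE A l').eval (facilityOracle f) h ρ' = ∏ i : Fin k, D i := by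
      intro l' ρ' hl hρ
      rw [facilityDenE, eval_fold, if_pos rfl, hs.sz0, ← Fin.prod_univ_eq_prod_range
        fun i : ℕ => (facilityFactorE A l' (l' + 1)).eval (facilityOracle f) h (update ρ' l' (i : ℤ))]
      refine prod_congr rfl fun i _ => hD i _ _ _ (by omega) (by omega) (update_self _ _ _)
        fun j hj => ?_
      rw [update_of_ne (by omega), hρ j hj]
    rw [facilityNumE, eval_eSum, hs.sz0, hprod l ρ le_rfl fun _ _ => rfl, normalized,
      ← sum_sub_distrib, sum_mul, Int.cast_sum,
      ← Fin.sum_univ_eq_sum_range fun i : ℕ => (((eMul (facilityTermE A l (l + 1))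
        (eDiv (facilityDenE A (l + 1)) (facilityFactorE A l (l + 1)))).eval (facilityOracle f) h
        (update ρ l (i : ℤ)) : ℤ) : ℚ)]
    refine sum_congr rfl fun i _ => ?_
    have hρ : ∀ j < l, update ρ l ((i : ℕ) : ℤ) j = ρ j := fun j hj => update_of_ne hj.ne _ _
    have hDi := hD i l (l + 1) _ l.lt_succ_self l.le_succ (update_self l ((i : ℕ) : ℤ) ρ) hρ
    have hpos : (facilityFactorE A l (l + 1)).eval (facilityOracle f) h
      (update ρ l ((i : ℕ) : ℤ)) ≠ 0 := diffDenE_pos.ne'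
    rw [eval_eMul, eval_eDiv, hprod (l + 1) _ l.le_succ hρ, Int.cast_mul, facilityTermE, diffNumE_eq]
    change _ * (((facilityFactorE A l (l + 1)).eval (facilityOracle f) h
      (update ρ l ((i : ℕ) : ℤ)) : ℤ) : ℚ) * _ = _
    rw [hDi] at hpos ⊢
    -- The integer division is exact, since the factor is one of the factors of the product.
    rw [Int.cast_div (dvd_prod_of_mem (fun i : Fin k => D i) (mem_univ i)) (by exact_mod_cast hpos)]
    have h1 : answer (facilityOracle f) true ((AExpr.ix l).eval (facilityOracle f) h
        (update ρ l ((i : ℕ) : ℤ))) ((facilityMaskE A l (l + 1)).eval (facilityOracle f) h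
        (update ρ l ((i : ℕ) : ℤ))) = f i (tupleOf n k S i) := by
      rw [eval_ix, update_self, ← hmask i l (l + 1) _ l.lt_succ_self l.le_succ
        (update_self l ((i : ℕ) : ℤ) ρ) hρ]
      exact facilityOracle_of_lt i _
    have h2 : answer (facilityOracle f) true ((AExpr.ix l).eval (facilityOracle f) h
        (update ρ l ((i : ℕ) : ℤ))) 0 = f i ∅ := by
      rw [eval_ix, update_self, ← decodeSet_zero n]
      exact facilityOracle_of_lt i _
    rw [h1, h2]
    have hpos' : (D i : ℚ) ≠ 0 := by exact_mod_cast hpos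
    field_simp
  · rw [facilityNumE, eval_eSum]
    refine abs_sum_le_two_pow hs.sz0.le _ fun i _ => ?_
    refine BinOp.abs_eval_le .mul (abs_le_two_pow_of_le (diffNumE_le hO) (by omega)) ?_
    rw [eval_eDiv]
    refine le_trans ?_ (hden h (update ρ l (i : ℤ)) (l + 1) A hs)
    rw [← Int.natCast_natAbs, ← Int.natCast_natAbs]
    exact_mod_cast Int.natAbs_ediv_le_natAbs _ _
  · exact Nat.mul_le_mul_left _ (by nlinarith)

end

theorem encLen_zero : encLen 0 = 3 := by decide

/-- Malformed queries are answered by `0`, whose length `3` must be covered even if `L` is small. -/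
theorem encLen_tupleOracle_le {n k L : ℕ} {f : (Fin k → Finset (Fin n)) → ℚ}
    (hf : ∀ S, encLen (f S) ≤ L) (q : List ℤ) : encLen (tupleOracle f q) ≤ L + 4 := by
  unfold tupleOracle
  split
  · exact (hf _).trans (by omega)
  · rw [encLen_zero]; omega

theorem encLen_facilityOracle_le {n k L : ℕ} {f : Fin k → Finset (Fin n) → ℚ}
    (hf : ∀ i S, encLen (f i S) ≤ L) (q : List ℤ) : encLen (facilityOracle f q) ≤ L + 4 := by
  unfold facilityOracle
  split
  · split_ifs
    · exact (hf _ _).trans (by omega)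
    · rw [encLen_zero]; omega
  · rw [encLen_zero]; omega

theorem isMultiMonotone_sum {n k : ℕ} {f : Fin k → Finset (Fin n) → ℚ} (hf : ∀ i, Monotone (f i)) :
    IsMultiMonotone fun S => ∑ i, f i (S i) :=
  fun _ _ h => sum_le_sum fun i _ => hf i (h i)

theorem isMultiSubmodular_sum {n k : ℕ} {f : Fin k → Finset (Fin n) → ℚ}
    (hf : ∀ i, IsSubmodular (f i)) : IsMultiSubmodular fun S => ∑ i, f i (S i) := by
  intro S T
  simp only [← sum_add_distrib]
  exact sum_le_sum fun i _ => hf i _ _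

theorem Evaluates.mono {n k B B' : ℕ} {F : Finset ℕ → ℚ} {O : Oracle}
    {Fn Fd : (ℕ → ℕ → AExpr) → ℕ → AExpr} (hE : Evaluates n k F B O Fn Fd) (hB : B ≤ B') :
    Evaluates n k F B' O Fn Fd where
  pos := hE.pos
  eq := hE.eq
  num_le h ρ l A S hs hA := abs_le_two_pow_of_le (hE.num_le h ρ l A S hs hA) hB
  den_le h ρ l A S hs hA := abs_le_two_pow_of_le (hE.den_le h ρ l A S hs hA) hB

end SubmodAlloc

/-! ### The two approximation algorithms. -/

open SubmodAlloc

theorem mainTheorem12 :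
    (∃ (P : Prog) (p : Polynomial ℕ),
      ∀ (n k L : ℕ) (f : (Fin k → Finset (Fin n)) → ℚ),
        1 ≤ k →
        (∀ S, 0 ≤ f S) →
        IsMultiMonotone f →
        IsMultiSubmodular f →
        (∀ S, encLen (f S) ≤ L) →
        Computes P (tupleOracle f) n k (p.eval (n + k + L)) (IsApproxMin (k : ℚ) f)) ∧
    (∃ (P : Prog) (p : Polynomial ℕ),
      ∀ (n k L : ℕ) (f : Fin k → Finset (Fin n) → ℚ),
        1 ≤ k →
        (∀ i S, 0 ≤ f i S) →
        (∀ i, Monotone (f i)) →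
        (∀ i, IsSubmodular (f i)) →
        (∀ i S, encLen (f i S) ≤ L) →
        Computes P (facilityOracle f) n k (p.eval (n + k + L))
          (IsApproxMin (k : ℚ) fun S => ∑ i, f i (S i))) := by
  have hx := PolyBounded.id
  have hc : ∀ c, PolyBounded fun x => x + c := fun c => hx.add (.const c)
  constructor
  · obtain ⟨p, hp⟩ := exists_computes transparent_tuple
      (((PolyBounded.const 4).mul (hc 4)).add (.const 3))
    refine ⟨allocProg tupleNumE tupleDenE, p, fun n k L f hk h0 hm hs hL => ?_⟩
    have hO := encLen_tupleOracle_le hL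
    exact hp n k L f _ hk h0 hm hs hO ((evaluates_tuple hO).mono (by omega))
  -- Facility location is the case `f(S) = ∑ i, f i (S i)` of the first part, with another oracle.
  -- The lengths of the values of this sum need not be bounded separately: only the lengths of
  -- numerator and denominator as computed from the individual answers matter.
  · obtain ⟨p, hp⟩ := exists_computes transparent_facility
      ((hc 1).mul ((((((PolyBounded.const 4).mul (hc 4)).add (.const 3)).add
        ((hc 1).mul ((((hc 4).add (hc 4)).add (.const 1)).add (.const 1)))).add (.const 1)).add
        (.const 1)))
    refine ⟨allocProg facilityNumE facilityDenE, p, fun n k L f hk h0 hm hs hL => ?_⟩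
    have hO := encLen_facilityOracle_le hL
    refine hp n k L _ _ hk (fun S => Finset.sum_nonneg fun i _ => h0 i _) (isMultiMonotone_sum hm)
      (isMultiSubmodular_sum hs) hO ((evaluates_facility hO).mono ?_)
    gcongr <;> omega
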